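/- **Theorem 2.1 (general recurrence for genus $0$ double Hurwitz numbers).** *Notation.* For a sequence $a=(a_1,\dots,a_k)$ and $K\subseteq[1,k]$ write $a_K=\sum_{i\in K}a_i$, let $a(K)$ be the subsequence of the terms $a_i$ with $i\in K$, and let $\bar K$ be the complement of $K$. For positive integer sequences $\mu=(\mu_1,\dots,\mu_m)$, $\nu=(\nu_1,\dots,\nu_n)$ with the same sum $d$, let $h^0_{\mu;\nu}$ be the genus $0$ double Hurwitz number: the number of isomorphism classes of connected genus $0$ degree $d$ covers of $\mathbb{CP}^1$ with ramification profile $\mu$ over $\infty$ and $\nu$ over $0$ (the points over $\infty$ and $0$ being labelled) and simple branching over $m+n-2$ further fixed points, each cover being weighted by $1/|\mathrm{Aut}|$. In terms of monodromy, $h^0_{\mu;\nu}$ is $1/d!$ times the number of tuples $(\sigma,\tau_1,\dots,\tau_{m+n-2},\rho)$ in $S_d$ with $\sigma\tau_1\cdots\tau_{m+n-2}\rho=1$ that generate a transitive group, where the $\tau_i$ are transpositions and the cycles of $\sigma$ and of $\rho$ are labelled by $[1,m]$ and $[1,n]$ so that their lengths are the $\mu_i$ and the $\nu_j$. The parameter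 space consists of the real points $(x,y)\in\mathbb R^{m+n}$ with $x_1\ge\dots\ge x_m\ge0$, $y_1\ge\dots\ge y_n\ge0$, $x_1+\dots+x_m=y_1+\dots+y_n$. A resonance is a hyperplane $x_I=y_J$ with $I\subset[1,m]$, $J\subset[1,n]$ nonempty proper subsets, and a chamber is a connected component of the complement in the parameter space to the union of all resonances. For a point $(\alpha,\beta)$ of a chamber $C$, a chamber polynomial $P_{\alpha;\beta}$ is a homogeneous polynomial in $x,y$ of degree $m+n-3$ with $P_{\alpha;\beta}(\mu,\nu)=h^0_{\mu;\nu}$ for all positive integer $(\mu,\nu)$ in the closure of $C$; it matters only through its values at points with $\sum x_i=\sum y_j$. The same notions are used for all other lengths of the two sequences. *Statement.* Let $\mu=(\mu_1\ge\dots\ge\mu_m)$ and $\nu=(\nu_1\ge\dots\ge\nu_n)$ be partitions of $d$ into positive parts ($m\ge1$), and let the real numbers $\delta$ and $\varepsilon=(\varepsilon_3,\dots,\varepsilon_m)$ satisfy $0<\delta<\varepsilon_m<\dots<\varepsilon_3<1/m$ (just $0<\delta<1/m$ if $m\le2$). There is a pair of partitions $\alpha=(\alpha_1\ge\dots\ge\alpha_m)$,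 $\beta=(\beta_1\ge\dots\ge\beta_n)$ of one integer into positive parts such that $(\alpha,\beta)$ lies on no resonance and $(\mu,\nu)$ belongs to the closure of the chamber of $(\alpha,\beta)$. (One may take $(\alpha,\beta)=(\mu,\nu)$ if $(\mu,\nu)$ lies on no resonance.) For every such pair $(\alpha,\beta)$, $$ \begin{aligned} h^0_{\mu;\nu}=(m+n-2)!\,d^{m-2}\mu_1^{n-1}+\sum_{\mu_I>\nu_J}&\binom{m+n-2}{|I|+|J|-1}(\mu_I-\nu_J)\\ &\times P_{\xi_1,\alpha(\bar I_1),\varepsilon(\bar I_2),\delta;\,\beta(\bar J)}\bigl(\mu_1,\mu(\bar I_1\cup\bar I_2),\mu_I-\nu_J,\nu(\bar J)\bigr)\\ &\times P_{\alpha(I_1),\xi_2,\varepsilon(I_2);\,\beta(J),\delta}\bigl(\mu(I_1),\mu_{i_k},\mu(I_2),\nu(J),\mu_I-\nu_J\bigr). \end{aligned} $$ The sum is over all nonempty $I\subseteq[2,m]$ and nonempty proper $J\subset[1,n]$ with $\mu_I>\nu_J$. For such $I=\{i_1<\dots<i_{|I|}\}$ and $J$, $k=\min\{j:\alpha_{i_1}+\dots+\alpha_{i_j}>\beta_J\}$,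 and $$I_1=\{i\in I:i<i_k\},\quad I_2=\{i\in I:i>i_k\},\quad \bar I_1=\{i\notin I:1<i<i_k\},\quad \bar I_2=\{i\notin I:i>i_k\},$$ $$\xi_1=\beta_{\bar J}-\alpha_{\bar I_1}-\varepsilon_{\bar I_2}-\delta,\qquad \xi_2=\beta_J-\alpha_{I_1}-\varepsilon_{I_2}+\delta.$$ Moreover, for every term of the sum, both reference points lie in chambers (they are in the parameter space and on no resonance), and both chamber polynomials exist. -/

import Mathlib

open Finset

noncomputable section

universe u v

/-- `μ` is a partition: a weakly decreasing family of positive integers. -/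
def IsPartitionFamily {ι : Type u} [Preorder ι] (μ : ι → ℕ) : Prop :=
  Antitone μ ∧ ∀ i, 0 < μ i

/-- The monodromy of a connected genus `0` branched cover of the Riemann sphere of degree
`d = ∑ i, μ i`, with its `d` sheets over a base point numbered, with ramification profile `μ` over
`∞` and `ν` over `0`, the points over `∞` and `0` labelled by `ι` and `κ`, and with simple
branching over `|ι| + |κ| - 2` further fixed points.

The sheets are permuted by the loops around the branch points, whose product is trivial; the cover
is connected iff the generated group is transitive; the points over a branch point are the cycles of
the corresponding permutation, their multiplicities being the lengths of the cycles. A label of the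
points over `∞` is therefore a labelling of the sheets whose fibres are exactly the cycles. By the
Riemann--Hurwitz formula, the genus is `0` because there are `|ι| + |κ| - 2` simple branch points. -/
structure MonodromySystem {ι : Type u} {κ : Type v} [Fintype ι] [Fintype κ]
    (μ : ι → ℕ) (ν : κ → ℕ) where
  /-- monodromy around `∞` -/
  atInfty : Equiv.Perm (Fin (∑ i, μ i))
  /-- monodromy around `0` -/
  atZero : Equiv.Perm (Fin (∑ i, μ i))
  /-- monodromy around the simple branch points -/
  simple : Fin (Fintype.card ι + Fintype.card κ - 2) → Equiv.Perm (Fin (∑ i, μ i))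
  /-- labelling of the points over `∞` -/
  poleLabel : Fin (∑ i, μ i) → ι
  /-- labelling of the points over `0` -/
  zeroLabel : Fin (∑ i, μ i) → κ
  simple_isSwap : ∀ s, (simple s).IsSwap
  prod_eq_one : atInfty * (List.ofFn simple).prod * atZero = 1
  transitive : MulAction.IsPretransitive
    (Subgroup.closure ({atInfty, atZero} ∪ Set.range simple)) (Fin (∑ i, μ i))
  poleLabel_eq_iff : ∀ s t, poleLabel s = poleLabel t ↔ atInfty.SameCycle s t
  zeroLabel_eq_iff : ∀ s t, zeroLabel s = zeroLabel t ↔ atZero.SameCycle s t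
  card_poleLabel : ∀ i, Nat.card {s // poleLabel s = i} = μ i
  card_zeroLabel : ∀ j, Nat.card {s // zeroLabel s = j} = ν j

/-- The genus `0` double Hurwitz number, with labelled preimages of `∞` and `0`: the number of
isomorphism classes of covers, each weighted by the inverse of the number of its automorphisms.
Forgetting the numbering of the `d` sheets amounts to dividing by `d!`. -/
def hurwitz {ι : Type u} {κ : Type v} [Fintype ι] [Fintype κ] (μ : ι → ℕ) (ν : κ → ℕ) : ℚ :=
  (Nat.card (MonodromySystem μ ν) : ℚ) / ((∑ i, μ i).factorial : ℚ)

/-- A pair of integer vectors as a point with real coordinates. -/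
def realPoint {ι : Type u} {κ : Type v} (μ : ι → ℕ) (ν : κ → ℕ) : (ι → ℝ) × (κ → ℝ) :=
  (fun i => (μ i : ℝ), fun j => (ν j : ℝ))

/-- The parameter space: weakly decreasing nonnegative `x` and `y` with equal sums. -/
def parameterSpace (ι : Type u) (κ : Type v) [Fintype ι] [LinearOrder ι] [Fintype κ]
    [LinearOrder κ] : Set ((ι → ℝ) × (κ → ℝ)) :=
  {p | Antitone p.1 ∧ (∀ i, 0 ≤ p.1 i) ∧ Antitone p.2 ∧ (∀ j, 0 ≤ p.2 j) ∧
    ∑ i, p.1 i = ∑ j, p.2 j}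

/-- The union of all resonances `x_I = y_J`, where `I` and `J` are nonempty proper subsets. -/
def resonances (ι : Type u) (κ : Type v) [Fintype ι] [Fintype κ] :
    Set ((ι → ℝ) × (κ → ℝ)) :=
  {p | ∃ (I : Finset ι) (J : Finset κ), I.Nonempty ∧ I ≠ univ ∧ J.Nonempty ∧ J ≠ univ ∧
    ∑ i ∈ I, p.1 i = ∑ j ∈ J, p.2 j}

/-- The points of the parameter space that lie on no resonance. -/
def regularPoints (ι : Type u) (κ : Type v) [Fintype ι] [LinearOrder ι] [Fintype κ]
    [LinearOrder κ] : Set ((ι → ℝ) × (κ → ℝ)) :=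
  parameterSpace ι κ \ resonances ι κ

/-- The chamber with reference point `q`: the connected component of `q` in the complement to the
union of all resonances. -/
def chamber {ι : Type u} {κ : Type v} [Fintype ι] [LinearOrder ι] [Fintype κ] [LinearOrder κ]
    (q : (ι → ℝ) × (κ → ℝ)) : Set ((ι → ℝ) × (κ → ℝ)) :=
  connectedComponentIn (regularPoints ι κ) q

/-- `q` is the reference point of a chamber, and `P` is a homogeneous polynomial of degree
`|ι| + |κ| - 3` in the variables `x_i`, `y_j` that gives the double Hurwitz numbers on the closure
of this chamber. -/
def IsChamberPolynomial {ι : Type u} {κ : Type v} [Fintype ι] [LinearOrder ι] [Fintype κ]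
    [LinearOrder κ] (q : (ι → ℝ) × (κ → ℝ)) (P : MvPolynomial (ι ⊕ κ) ℚ) : Prop :=
  q ∈ regularPoints ι κ ∧
  P.IsHomogeneous (Fintype.card ι + Fintype.card κ - 3) ∧
  ∀ (μ : ι → ℕ) (ν : κ → ℕ), (∀ i, 0 < μ i) → (∀ j, 0 < ν j) →
    realPoint μ ν ∈ closure (chamber q) →
    MvPolynomial.eval (Sum.elim (fun i => (μ i : ℚ)) (fun j => (ν j : ℚ))) P = hurwitz μ ν

open Classical in
/-- The polynomial `P_q` of the chamber with reference point `q` (and `0` if there is none). Its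
values at points with `∑ x_i = ∑ y_j` do not depend on the choice. -/
def chamberPolynomial {ι : Type u} {κ : Type v} [Fintype ι] [LinearOrder ι] [Fintype κ]
    [LinearOrder κ] (q : (ι → ℝ) × (κ → ℝ)) : MvPolynomial (ι ⊕ κ) ℚ :=
  if h : ∃ P, IsChamberPolynomial q P then h.choose else 0

/-- The value `P_q(x, y)`. -/
def chamberValue {ι : Type u} {κ : Type v} [Fintype ι] [LinearOrder ι] [Fintype κ]
    [LinearOrder κ] (q : (ι → ℝ) × (κ → ℝ)) (x : ι → ℚ) (y : κ → ℚ) : ℚ :=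
  MvPolynomial.eval (Sum.elim x y) (chamberPolynomial q)

/-- The sequence `f, c`: one more term `c`, with the new index `⊤`, is put after the terms of `f`. -/
def appendLast {ι : Type u} {R : Type v} (f : ι → R) (c : R) : WithTop ι → R :=
  WithTop.recTopCoe c f

/-- The pair of partitions `(α, β)` is the reference point of a chamber whose closure contains
`(μ, ν)`. If `(μ, ν)` lies on no resonance, this is just the chamber of `(μ, ν)`, and
`(α, β) = (μ, ν)` is a possible choice; otherwise it is any of the chambers adjacent to `(μ, ν)`. -/
def IsAdjacentReference {m n : ℕ} (μ : Fin m → ℕ) (ν : Fin n → ℕ)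
    (α : Fin m → ℕ) (β : Fin n → ℕ) : Prop :=
  IsPartitionFamily α ∧ IsPartitionFamily β ∧
  realPoint α β ∈ regularPoints (Fin m) (Fin n) ∧
  realPoint μ ν ∈ closure (chamber (realPoint α β))

/-- The resonances `x_I = y_J`, with the first index not in `I`, for which `μ_I > ν_J`. -/
def crossedResonances {m n : ℕ} [NeZero m] (μ : Fin m → ℕ) (ν : Fin n → ℕ) :
    Finset (Finset (Fin m) × Finset (Fin n)) :=
  {r | (0 : Fin m) ∉ r.1 ∧ r.1.Nonempty ∧ r.2.Nonempty ∧ r.2 ≠ univ ∧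
    ∑ j ∈ r.2, ν j < ∑ i ∈ r.1, μ i}

/-- The index `i_k`, where `I = {i_1 < i_2 < ⋯}` and `k` is the least number with
`α_{i_1} + ⋯ + α_{i_k} > β_J` (and `⊤` if there is none). -/
def crossingIndex {m n : ℕ} (α : Fin m → ℕ) (β : Fin n → ℕ)
    (I : Finset (Fin m)) (J : Finset (Fin n)) : WithTop (Fin m) :=
  Finset.min {i ∈ I | ∑ j ∈ J, β j < ∑ i' ∈ I with i' ≤ i, α i'}

/-- `ξ₁ = β_{J̄} - α_{Ī₁} - ε_{Ī₂} - δ`. -/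
def xiOne {m n : ℕ} [NeZero m] (α : Fin m → ℕ) (β : Fin n → ℕ) (ε : Fin m → ℝ) (δ : ℝ)
    (I : Finset (Fin m)) (J : Finset (Fin n)) : ℝ :=
  ∑ j ∈ Jᶜ, (β j : ℝ)
    - ∑ i ∈ Iᶜ with i ≠ 0 ∧ WithTop.some i < crossingIndex α β I J, (α i : ℝ)
    - ∑ i ∈ Iᶜ with i ≠ 0 ∧ crossingIndex α β I J < WithTop.some i, ε i
    - δ

/-- `ξ₂ = β_J - α_{I₁} - ε_{I₂} + δ`. -/
def xiTwo {m n : ℕ} (α : Fin m → ℕ) (β : Fin n → ℕ) (ε : Fin m → ℝ) (δ : ℝ)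
    (I : Finset (Fin m)) (J : Finset (Fin n)) : ℝ :=
  ∑ j ∈ J, (β j : ℝ)
    - ∑ i ∈ I with WithTop.some i < crossingIndex α β I J, (α i : ℝ)
    - ∑ i ∈ I with crossingIndex α β I J < WithTop.some i, ε i
    + δ

/-- The reference point `(ξ₁, α(Ī₁), ε(Ī₂), δ; β(J̄))`. -/
def refOne {m n : ℕ} [NeZero m] (α : Fin m → ℕ) (β : Fin n → ℕ) (ε : Fin m → ℝ) (δ : ℝ)
    (I : Finset (Fin m)) (J : Finset (Fin n)) :
    (WithTop {i // i ∉ I} → ℝ) × ({j // j ∉ J} → ℝ) :=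
  (appendLast (fun i : {i // i ∉ I} =>
      if i.1 = 0 then xiOne α β ε δ I J
      else if (i.1 : WithTop (Fin m)) < crossingIndex α β I J then (α i.1 : ℝ)
      else ε i.1) δ,
    fun j => (β j.1 : ℝ))

/-- The reference point `(α(I₁), ξ₂, ε(I₂); β(J), δ)`. -/
def refTwo {m n : ℕ} (α : Fin m → ℕ) (β : Fin n → ℕ) (ε : Fin m → ℝ) (δ : ℝ)
    (I : Finset (Fin m)) (J : Finset (Fin n)) :
    ({i // i ∈ I} → ℝ) × (WithTop {j // j ∈ J} → ℝ) :=
  (fun i =>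
      if (i.1 : WithTop (Fin m)) < crossingIndex α β I J then (α i.1 : ℝ)
      else if (i.1 : WithTop (Fin m)) = crossingIndex α β I J then xiTwo α β ε δ I J
      else ε i.1,
    appendLast (fun j : {j // j ∈ J} => (β j.1 : ℝ)) δ)

/-- `μ_I - ν_J`. -/
def gap {m n : ℕ} (μ : Fin m → ℕ) (ν : Fin n → ℕ)
    (I : Finset (Fin m)) (J : Finset (Fin n)) : ℚ :=
  ∑ i ∈ I, (μ i : ℚ) - ∑ j ∈ J, (ν j : ℚ)

end

/-! Covers of genus `0` are counted by trees. Take trivalent trees whose leaves carry the weights `μ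
i` and `-ν j`. Conservation fixes the flow through each inner edge; the flows orient the tree, and a
tree is weighted by the product of the absolute flows times the number of orderings of its vertices
compatible with the orientation. `treeSum` is this sum divided by the factorial of the number of
vertices, defined recursively through the last vertex. The double Hurwitz number is `(m + n - 2)!`
times it (`hurwitz_eq_intTreeSum`). The reason is the cut-and-join recursion: multiplying by a
transposition cuts or joins cycles, and `countFormula` shows by induction on the number of
transpositions that the monodromy count satisfies the recursion `mul_treeSum`.

The orientations and the weights can be separated. `refTreeSum q x y` takes orientations from a
reference point `q` and weights from `x, y`, so it is polynomial in `x, y`. For `(μ, ν)` in the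
closure of the chamber of `q` it still gives the Hurwitz number, since an edge whose direction is in
doubt has weight `0` (`hurwitz_eq_refTreeSum`). Hence it yields a chamber polynomial. All chamber
polynomials agree at balanced points (`chamberValue_eq`), because the cone of a chamber contains
sufficiently many integer points.

Now keep the weights `μ, ν` and move only the reference point from `(α, β)`. The coordinates are
shrunk one at a time, from the last to the second, to the small values `ε i` (to `δ` for the second
one), and the first coordinate compensates. When an edge reverses, the tree sum changes by the flow
of that edge times the tree sums of the two sides (`treeSum_sub`, `treeSum_sub_of_path`). Since only
two coordinates move at a time, three parts of a tree cannot have zero flow simultaneously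
(`not_vanish_of_split`), so the reversals do not interfere. The resonance `x_I = y_J` is crossed if
`α_I > β_J`, and exactly when the coordinate `i_k` of the statement shrinks
(`PathData.isCrossedAt_iff`); its weight is `μ_I - ν_J`.

At the moment of crossing the cut edge has flow `0`. Giving it flow `δ` instead changes no other
direction, because every other relevant flow exceeds `δ` in absolute value
(`IsCrossedAt.delta_lt_abs_stage`); this produces the reference points with `ξ₁` and `ξ₂`. The
factorial `(m + n - 2)!` splits into the binomial coefficient and the factorials of the two sides.

At the end of the path one positive leaf dominates: the other positive ones have total flow below
`1`, while each `β j` is at least `1`. There the tree sum is `d ^ (m - 2) * μ 0 ^ (n - 1)`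
(`BaseLeaves.treeSum_eq`), by induction and identities of Hurwitz-Abel type (`abel_and_jensen`). -/

/-! ### Sums over the splittings of a multiset. -/

section AntidiagonalSums

variable {M : Type*} {M' : Type*} {R : Type*} {R' : Type*}

/-- The sum of `Φ A B` over all ways of splitting a multiset as `A + B`. -/
def splitSum [AddCommMonoid R] (Φ : Multiset M → Multiset M → R) (S : Multiset M) : R :=
  ((Multiset.antidiagonal S).map fun p => Φ p.1 p.2).sum

section
variable [AddCommMonoid R] (Φ Ψ : Multiset M → Multiset M → R) (S T : Multiset M)

@[simp] theorem splitSum_zero : splitSum Φ 0 = Φ 0 0 := by simp [splitSum]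

theorem splitSum_cons (a : M) :
    splitSum Φ (a ::ₘ S) =
      splitSum (fun A B => Φ A (a ::ₘ B)) S + splitSum (fun A B => Φ (a ::ₘ A) B) S := by
  simp [splitSum, Multiset.antidiagonal_cons, Multiset.map_map]

variable {Φ Ψ S} in
theorem splitSum_congr (h : ∀ A B, A + B = S → Φ A B = Ψ A B) : splitSum Φ S = splitSum Ψ S := by
  unfold splitSum
  congr 1
  exact Multiset.map_congr rfl fun p hp => h _ _ (Multiset.mem_antidiagonal.1 hp)

variable {Φ S} in
theorem splitSum_eq_zero (h : ∀ A B, A + B = S → Φ A B = 0) : splitSum Φ S = 0 := by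
  rw [splitSum_congr (Ψ := fun _ _ => 0) h]
  simp [splitSum]

theorem splitSum_add_fun :
    splitSum (fun A B => Φ A B + Ψ A B) S = splitSum Φ S + splitSum Ψ S := by
  simp [splitSum]

theorem splitSum_swap : splitSum (fun A B => Φ B A) S = splitSum Φ S := by
  induction S using Multiset.induction generalizing Φ with
  | empty => simp
  | cons a S ih =>
    rw [splitSum_cons, splitSum_cons, add_comm]
    congr 1
    · exact ih fun A B => Φ A (a ::ₘ B)
    · exact ih fun A B => Φ (a ::ₘ A) B

/-- Both sides run over splittings into three parts. The reassociation later moves a piece of a tree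
across an edge. -/
theorem splitSum_assoc (Θ : Multiset M → Multiset M → Multiset M → R) :
    splitSum (fun X C => splitSum (fun A B => Θ A B C) X) S =
      splitSum (fun A Y => splitSum (fun B C => Θ A B C) Y) S := by
  induction S using Multiset.induction generalizing Θ with
  | empty => simp
  | cons a S ih =>
    simp only [splitSum_cons, splitSum_add_fun]
    rw [ih fun A B C => Θ A B (a ::ₘ C), ih fun A B C => Θ A (a ::ₘ B) C,
      ih fun A B C => Θ (a ::ₘ A) B C]
    abel

theorem splitSum_map (e : M' → M) (S : Multiset M') :
    splitSum Φ (S.map e) = splitSum (fun A B => Φ (A.map e) (B.map e)) S := by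
  induction S using Multiset.induction generalizing Φ with
  | empty => simp
  | cons a S ih => simp [splitSum_cons, ih]

theorem splitSum_add :
    splitSum Φ (S + T) =
      splitSum (fun A B => splitSum (fun A' B' => Φ (A + A') (B + B')) T) S := by
  induction S using Multiset.induction generalizing Φ with
  | empty => simp
  | cons a S ih => simp [splitSum_cons, ih]

theorem map_splitSum [AddCommMonoid R'] {F : Type*} [FunLike F R R'] [AddMonoidHomClass F R R']
    (g : F) : g (splitSum Φ S) = splitSum (fun A B => g (Φ A B)) S := by
  simp [splitSum, map_multiset_sum, Multiset.map_map]

/-- Splittings are counted with multiplicity, so for indexed leaves they are subsets of the index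
set, even if some leaves coincide. -/
theorem splitSum_map_val {ι : Type*} [DecidableEq ι] (e : ι → M) (s : Finset ι) :
    splitSum Φ (s.val.map e) = ∑ t ∈ s.powerset, Φ (t.val.map e) ((s \ t).val.map e) := by
  induction s using Finset.induction_on generalizing Φ with
  | empty => simp
  | insert a s ha ih =>
    rw [Finset.insert_val_of_notMem ha, Multiset.map_cons, splitSum_cons, ih, ih,
      Finset.sum_powerset_insert ha]
    congr 1
    · refine Finset.sum_congr rfl fun t ht => ?_
      have hat : a ∉ t := fun h => ha (Finset.mem_powerset.1 ht h)
      rw [Finset.insert_sdiff_of_notMem _ hat, Finset.insert_val_of_notMem (by simp [ha]),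
        Multiset.map_cons]
    · refine Finset.sum_congr rfl fun t ht => ?_
      have hat : a ∉ t := fun h => ha (Finset.mem_powerset.1 ht h)
      rw [Finset.insert_val_of_notMem hat, Multiset.map_cons, Finset.insert_sdiff_insert,
        Finset.sdiff_insert_of_notMem ha]

end

section
variable [CommRing R] (Φ Ψ : Multiset M → Multiset M → R) (S : Multiset M)

theorem splitSum_sub_fun :
    splitSum (fun A B => Φ A B - Ψ A B) S = splitSum Φ S - splitSum Ψ S := by
  simp [splitSum]

theorem mul_splitSum (r : R) : r * splitSum Φ S = splitSum (fun A B => r * Φ A B) S := by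
  simp [splitSum, Multiset.sum_map_mul_left]

theorem splitSum_mul (r : R) : splitSum Φ S * r = splitSum (fun A B => Φ A B * r) S := by
  simp [splitSum, Multiset.sum_map_mul_right]

end

/-- The sum of `Φ A B C` over all ways of splitting a multiset as `A + B + C`. -/
def splitSum₃ [AddCommMonoid R] (Φ : Multiset M → Multiset M → Multiset M → R)
    (S : Multiset M) : R :=
  splitSum (fun A T => splitSum (fun B C => Φ A B C) T) S

section
variable [AddCommMonoid R] (Φ Ψ : Multiset M → Multiset M → Multiset M → R) (S : Multiset M)

theorem splitSum₃_cons (a : M) :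
    splitSum₃ Φ (a ::ₘ S) = splitSum₃ (fun A B C => Φ (a ::ₘ A) B C) S +
      splitSum₃ (fun A B C => Φ A (a ::ₘ B) C) S + splitSum₃ (fun A B C => Φ A B (a ::ₘ C)) S := by
  simp only [splitSum₃, splitSum_cons, splitSum_add_fun]
  abel

variable {Φ Ψ S} in
theorem splitSum₃_congr (h : ∀ A B C, A + B + C = S → Φ A B C = Ψ A B C) :
    splitSum₃ Φ S = splitSum₃ Ψ S :=
  splitSum_congr fun A T hT => splitSum_congr fun B C hB => h A B C (by rw [add_assoc, hB, hT])

variable {Φ S} in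
theorem splitSum₃_eq_zero (h : ∀ A B C, A + B + C = S → Φ A B C = 0) :
    splitSum₃ Φ S = 0 :=
  splitSum_eq_zero fun A T hT => splitSum_eq_zero fun B C hB => h A B C (by rw [add_assoc, hB, hT])

theorem splitSum₃_add_fun :
    splitSum₃ (fun A B C => Φ A B C + Ψ A B C) S = splitSum₃ Φ S + splitSum₃ Ψ S := by
  simp only [splitSum₃, splitSum_add_fun]

theorem splitSum₃_swap_right : splitSum₃ (fun A B C => Φ A C B) S = splitSum₃ Φ S :=
  splitSum_congr fun A _ _ => splitSum_swap (fun B C => Φ A B C) _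

theorem splitSum₃_swap_left : splitSum₃ (fun A B C => Φ B A C) S = splitSum₃ Φ S := by
  unfold splitSum₃
  rw [← splitSum_assoc, ← splitSum_assoc]
  exact splitSum_congr fun T C _ => splitSum_swap (fun A B => Φ A B C) _

theorem splitSum₃_map {M' : Type*} (e : M' → M) (S : Multiset M') :
    splitSum₃ Φ (S.map e) = splitSum₃ (fun A B C => Φ (A.map e) (B.map e) (C.map e)) S := by
  simp only [splitSum₃, splitSum_map]

theorem map_splitSum₃ [AddCommMonoid R'] {F : Type*} [FunLike F R R'] [AddMonoidHomClass F R R']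
    (g : F) : g (splitSum₃ Φ S) = splitSum₃ (fun A B C => g (Φ A B C)) S := by
  simp only [splitSum₃, map_splitSum]

end

theorem splitSum₃_sub_fun [CommRing R] (Φ Ψ : Multiset M → Multiset M → Multiset M → R)
    (S : Multiset M) :
    splitSum₃ (fun A B C => Φ A B C - Ψ A B C) S = splitSum₃ Φ S - splitSum₃ Ψ S := by
  simp only [splitSum₃, splitSum_sub_fun]

end AntidiagonalSums

/-! ### The weighted sum over oriented trivalent trees. -/

section TreeSum

variable {M : Type*} {R : Type*} [AddCommGroup M] [CommRing R] [Algebra ℚ R]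

open Classical in
/-- The normalised sum over trivalent trees with leaves labelled by `S`, of the product of the
weights of the inner edges, the number of admissible orderings of the vertices being divided by
`(card S - 2)!`. It is defined by the choice of the last vertex. -/
noncomputable def treeSum (pos : M → Prop) (z : M →+ R) (S : Multiset M) : R :=
  -- The `6` removes the order of the three branches. Branches with `a`, `b`, `c` leaves have `a -
  -- 1`, `b - 1`, `c - 1` vertices, in total `card S - 3`; shuffling their orderings gives a
  -- multinomial coefficient, which after normalisation leaves only the factor `1 / (card S - 2)`.
  (6 * ((Multiset.card S : ℚ) - 2))⁻¹ •
    splitSum₃ (fun A B C =>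
      (if Multiset.card A = 1 then 1
        else if _h : 2 ≤ Multiset.card A ∧ Multiset.card A + 1 < Multiset.card S ∧ pos A.sum then
          z A.sum * treeSum pos z ((-A.sum) ::ₘ A) else 0) *
      (if Multiset.card B = 1 then 1
        else if _h : 2 ≤ Multiset.card B ∧ Multiset.card B + 1 < Multiset.card S ∧ pos B.sum then
          z B.sum * treeSum pos z ((-B.sum) ::ₘ B) else 0) *
      (if Multiset.card C = 1 then 1
        else if _h : 2 ≤ Multiset.card C ∧ Multiset.card C + 1 < Multiset.card S ∧ pos C.sum then
          z C.sum * treeSum pos z ((-C.sum) ::ₘ C) else 0)) S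
termination_by Multiset.card S
decreasing_by all_goals simp; omega

open Classical in
/-- The contribution of a branch with set of leaves `A` at a vertex: `1` for a leaf. -/
noncomputable def branchSum (pos : M → Prop) (z : M →+ R) (A : Multiset M) : R :=
  if Multiset.card A = 1 then 1
  else if 2 ≤ Multiset.card A ∧ pos A.sum then z A.sum * treeSum pos z ((-A.sum) ::ₘ A) else 0

variable (pos : M → Prop) (z : M →+ R)

@[simp] theorem branchSum_zero : branchSum pos z 0 = 0 := by simp [branchSum]

@[simp] theorem branchSum_singleton (a : M) : branchSum pos z {a} = 1 := by simp [branchSum]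

variable {pos} in
theorem branchSum_of_pos {A : Multiset M} (h : 2 ≤ Multiset.card A) (hp : pos A.sum) :
    branchSum pos z A = z A.sum * treeSum pos z ((-A.sum) ::ₘ A) := by
  rw [branchSum, if_neg (by omega), if_pos ⟨h, hp⟩]

variable {pos} in
theorem branchSum_of_not_pos {A : Multiset M} (h : Multiset.card A ≠ 1) (hp : ¬ pos A.sum) :
    branchSum pos z A = 0 := by
  rw [branchSum, if_neg h, if_neg fun h => hp h.2]

theorem branchSum_mul_eq_zero {A B C : Multiset M} (h : A = 0 ∨ B = 0 ∨ C = 0) :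
    branchSum pos z A * branchSum pos z B * branchSum pos z C = 0 := by
  rcases h with rfl | rfl | rfl <;> simp

/-- The size bounds in the recursion serve termination only: in a nonzero term all three parts are
nonempty, so each part misses at least two leaves of `S`. -/
theorem treeSum_def (S : Multiset M) :
    treeSum pos z S = (6 * ((Multiset.card S : ℚ) - 2))⁻¹ •
      splitSum₃ (fun A B C => branchSum pos z A * branchSum pos z B * branchSum pos z C) S := by
  classical
  rw [treeSum]
  congr 1
  refine splitSum₃_congr fun A B C hS => ?_
  have hc : Multiset.card A + Multiset.card B + Multiset.card C = Multiset.card S := by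
    rw [← hS]; simp
  by_cases h0 : A = 0 ∨ B = 0 ∨ C = 0
  · rw [branchSum_mul_eq_zero _ _ h0]
    rcases h0 with rfl | rfl | rfl <;> simp
  · push Not at h0
    have hA := Multiset.card_pos.2 h0.1
    have hB := Multiset.card_pos.2 h0.2.1
    have hC := Multiset.card_pos.2 h0.2.2
    have key : ∀ X : Multiset M, Multiset.card X + 1 < Multiset.card S →
        (if Multiset.card X = 1 then 1
          else if _h : 2 ≤ Multiset.card X ∧ Multiset.card X + 1 < Multiset.card S ∧ pos X.sum then
          z X.sum * treeSum pos z ((-X.sum) ::ₘ X) else 0) = branchSum pos z X := by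
      intro X hX
      simp only [branchSum, hX, true_and, dite_eq_ite]
    rw [key A (by omega), key B (by omega), key C (by omega)]

theorem splitSum₃_branchSum_eq_zero {S : Multiset M} (hS : Multiset.card S ≤ 2) :
    splitSum₃ (fun A B C => branchSum pos z A * branchSum pos z B * branchSum pos z C) S = 0 := by
  refine splitSum₃_eq_zero fun A B C h => branchSum_mul_eq_zero _ _ ?_
  by_contra! h0
  have hA := Multiset.card_pos.2 h0.1
  have hB := Multiset.card_pos.2 h0.2.1
  have hC := Multiset.card_pos.2 h0.2.2
  have := congrArg Multiset.card h
  simp at this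
  omega

theorem treeSum_eq_zero {S : Multiset M} (hS : Multiset.card S ≤ 2) : treeSum pos z S = 0 := by
  rw [treeSum_def, splitSum₃_branchSum_eq_zero _ _ hS, smul_zero]

/-- With at most two leaves both sides vanish, so the recursion can be used in this form without a
lower bound on the number of leaves. -/
theorem smul_treeSum (S : Multiset M) :
    (6 * ((Multiset.card S : ℚ) - 2)) • treeSum pos z S =
      splitSum₃ (fun A B C => branchSum pos z A * branchSum pos z B * branchSum pos z C) S := by
  by_cases hS : Multiset.card S ≤ 2
  · rw [treeSum_eq_zero _ _ hS, splitSum₃_branchSum_eq_zero _ _ hS, smul_zero]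
  · rw [treeSum_def, smul_inv_smul₀]
    have : (2 : ℚ) < Multiset.card S := by exact_mod_cast (by omega : 2 < Multiset.card S)
    have : (0 : ℚ) < (Multiset.card S : ℚ) - 2 := by linarith
    positivity

theorem card_pos_of_branchSum_mul_ne_zero {A B C : Multiset M}
    (h : branchSum pos z A * branchSum pos z B * branchSum pos z C ≠ 0) :
    A ≠ 0 ∧ B ≠ 0 ∧ C ≠ 0 := by
  by_contra! h0
  refine h (branchSum_mul_eq_zero _ _ ?_)
  tauto

/-- Naturality of `treeSum` in both the labels and the coefficients. -/
theorem map_treeSum {M' : Type*} [AddCommGroup M'] {R' : Type*} [CommRing R'] [Algebra ℚ R']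
    (pos' : M' → Prop) (z' : M' →+ R') (g : M →+ M') (ψ : R →ₐ[ℚ] R')
    (hpos : ∀ v, pos v ↔ pos' (g v)) (hz : ∀ v, ψ (z v) = z' (g v)) (S : Multiset M) :
    ψ (treeSum pos z S) = treeSum pos' z' (S.map g) := by
  induction hn : Multiset.card S using Nat.strong_induction_on generalizing S with
  | _ n ih =>
  subst hn
  rw [treeSum_def, treeSum_def, map_smul, map_splitSum₃, splitSum₃_map, Multiset.card_map]
  congr 1
  refine splitSum₃_congr fun A B C hS => ?_
  have hc : Multiset.card A + Multiset.card B + Multiset.card C = Multiset.card S := by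
    rw [← hS]; simp
  by_cases h0 : A = 0 ∨ B = 0 ∨ C = 0
  · rw [branchSum_mul_eq_zero _ _ h0, branchSum_mul_eq_zero, map_zero]
    rcases h0 with rfl | rfl | rfl <;> simp
  · push Not at h0
    have hA := Multiset.card_pos.2 h0.1
    have hB := Multiset.card_pos.2 h0.2.1
    have hC := Multiset.card_pos.2 h0.2.2
    have key : ∀ X : Multiset M, Multiset.card X + 1 < Multiset.card S →
        ψ (branchSum pos z X) = branchSum pos' z' (X.map g) := by
      intro X hX
      have hs : (X.map g).sum = g X.sum := (map_multiset_sum g X).symm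
      unfold branchSum
      rw [Multiset.card_map, hs, ← hpos, ← hz, apply_ite ψ, apply_ite ψ, map_one, map_zero, map_mul,
        ih _ (by simpa using hX) _ rfl, Multiset.map_cons, map_neg]
    rw [map_mul, map_mul, key A (by omega), key B (by omega), key C (by omega)]

/-- `treeSum` depends on the sign function only through its values at the flows through the inner
edges. -/
theorem treeSum_congr {pos pos' : M → Prop} {S : Multiset M} (h0 : S.sum = 0)
    (h : ∀ A B, A + B = S → 2 ≤ Multiset.card A → 2 ≤ Multiset.card B → z A.sum ≠ 0 →
      (pos A.sum ↔ pos' A.sum)) :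
    treeSum pos z S = treeSum pos' z S := by
  classical
  induction hn : Multiset.card S using Nat.strong_induction_on generalizing S with
  | _ n ih =>
  subst hn
  rw [treeSum_def, treeSum_def]
  congr 1
  refine splitSum₃_congr fun A B C hS => ?_
  have hc : Multiset.card A + Multiset.card B + Multiset.card C = Multiset.card S := by
    rw [← hS]; simp
  by_cases hz : A = 0 ∨ B = 0 ∨ C = 0
  · rw [branchSum_mul_eq_zero _ _ hz, branchSum_mul_eq_zero _ _ hz]
  · push Not at hz
    have hA := Multiset.card_pos.2 hz.1
    have hB := Multiset.card_pos.2 hz.2.1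
    have hC := Multiset.card_pos.2 hz.2.2
    have key : ∀ X Y : Multiset M, X + Y = S → 2 ≤ Multiset.card Y →
        branchSum pos z X = branchSum pos' z X := by
      intro X Y hXY hY
      have hcX : Multiset.card X + Multiset.card Y = Multiset.card S := by rw [← hXY]; simp
      rcases Nat.lt_or_ge (Multiset.card X) 2 with hX | hX
      · interval_cases hX' : Multiset.card X <;> simp [branchSum, hX']
      by_cases hzX : z X.sum = 0
      · simp [branchSum, hzX]
      have hp := h X Y hXY hX hY hzX
      unfold branchSum
      refine if_congr Iff.rfl rfl (if_congr (and_congr_right' hp) ?_ rfl)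
      rw [ih _ (by rw [Multiset.card_cons]; omega) (by simp) _ rfl]
      intro P Q hPQ hP hQ hzP
      -- The new leaf `-X.sum` carries the flow of the whole complement `Y`. Replacing it by `Y`
      -- turns a splitting of the branch into a splitting of `S` with the same sums, to which `h`
      -- applies.
      have hsum : X.sum + Y.sum = 0 := by rw [← Multiset.sum_add, hXY, h0]
      have hneg : -X.sum = Y.sum := (eq_neg_of_add_eq_zero_right hsum).symm
      have hmem : -X.sum ∈ P + Q := by rw [hPQ]; exact Multiset.mem_cons_self _ _
      rcases Multiset.mem_add.1 hmem with hm | hm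
      · obtain ⟨P', rfl⟩ := Multiset.exists_cons_of_mem hm
        rw [Multiset.cons_add, Multiset.cons_inj_right] at hPQ
        have hs : (-X.sum ::ₘ P').sum = (P' + Y).sum := by
          rw [Multiset.sum_cons, Multiset.sum_add, hneg, add_comm]
        rw [hs] at hzP ⊢
        refine h _ Q ?_ ?_ hQ hzP
        · rw [← hXY, ← hPQ]; abel
        · rw [Multiset.card_add]; omega
      · obtain ⟨Q', rfl⟩ := Multiset.exists_cons_of_mem hm
        rw [Multiset.add_cons, Multiset.cons_inj_right] at hPQ
        refine h P (Q' + Y) ?_ hP ?_ hzP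
        · rw [← hXY, ← hPQ]; abel
        · rw [Multiset.card_add]; omega
    rw [key A (B + C) (by rw [← hS]; abel) (by rw [Multiset.card_add]; omega),
      key B (A + C) (by rw [← hS]; abel) (by rw [Multiset.card_add]; omega),
      key C (A + B) (by rw [← hS]; abel) (by rw [Multiset.card_add]; omega)]

end TreeSum

/-- Values of `treeSum` on linear forms are homogeneous polynomials. -/
theorem treeSum_isHomogeneous {M σ : Type*} [AddCommGroup M] (pos : M → Prop)
    (z : M →+ MvPolynomial σ ℚ) (S : Multiset M) (hz : ∀ v ∈ S, (z v).IsHomogeneous 1) :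
    (treeSum pos z S).IsHomogeneous (Multiset.card S - 3) := by
  induction hn : Multiset.card S using Nat.strong_induction_on generalizing S with
  | _ n ih =>
  subst hn
  have hsum : ∀ X : Multiset M, X ≤ S → (z X.sum).IsHomogeneous 1 := by
    intro X
    induction X using Multiset.induction with
    | empty => intro _; simpa using MvPolynomial.isHomogeneous_zero σ ℚ 1
    | cons a X ihX =>
      intro h
      rw [Multiset.sum_cons, map_add]
      exact (hz a (Multiset.mem_of_le h (Multiset.mem_cons_self _ _))).add
        (ihX ((Multiset.le_cons_self X a).trans h))
  have hbr : ∀ X : Multiset M, X ≤ S → Multiset.card X + 1 < Multiset.card S →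
      (branchSum pos z X).IsHomogeneous (Multiset.card X - 1) := by
    intro X hX hc
    by_cases h1 : Multiset.card X = 1
    · rw [branchSum, if_pos h1, h1]
      exact MvPolynomial.isHomogeneous_one σ ℚ
    by_cases h2 : 2 ≤ Multiset.card X ∧ pos X.sum
    · rw [branchSum_of_pos z h2.1 h2.2]
      have := (hsum X hX).mul (ih _ (by simpa using hc) (-X.sum ::ₘ X) (by
        intro v hv
        rcases Multiset.mem_cons.1 hv with rfl | hv
        · rw [map_neg]; exact (hsum X hX).neg
        · exact hz v (Multiset.mem_of_le hX hv)) rfl)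
      convert this using 1
      rw [Multiset.card_cons]
      omega
    · rw [branchSum, if_neg h1, if_neg h2]
      exact MvPolynomial.isHomogeneous_zero σ ℚ _
  have hmem : ∀ {κ : Type _} (s : Multiset κ) (φ : κ → MvPolynomial σ ℚ) (k : ℕ),
      (∀ a ∈ s, (φ a).IsHomogeneous k) → ((s.map φ).sum).IsHomogeneous k := by
    intro κ s φ k
    induction s using Multiset.induction with
    | empty => intro _; simpa using MvPolynomial.isHomogeneous_zero σ ℚ k
    | cons a s ihs =>
      intro h
      rw [Multiset.map_cons, Multiset.sum_cons]
      exact (h a (Multiset.mem_cons_self _ _)).add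
        (ihs fun b hb => h b (Multiset.mem_cons_of_mem hb))
  rw [treeSum_def, MvPolynomial.smul_eq_C_mul]
  rw [← zero_add (Multiset.card S - 3)]
  refine (MvPolynomial.isHomogeneous_C σ _).mul ?_
  refine hmem _ _ _ fun p hp => hmem _ _ _ fun q hq => ?_
  have h1 := Multiset.mem_antidiagonal.1 hp
  have h2 := Multiset.mem_antidiagonal.1 hq
  beta_reduce
  by_cases hne : branchSum pos z p.1 * branchSum pos z q.1 * branchSum pos z q.2 = 0
  · rw [hne]; exact MvPolynomial.isHomogeneous_zero σ ℚ _
  obtain ⟨a, b, c⟩ := card_pos_of_branchSum_mul_ne_zero _ _ hne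
  have hA := Multiset.card_pos.2 a
  have hB := Multiset.card_pos.2 b
  have hC := Multiset.card_pos.2 c
  have hS : p.1 + (q.1 + q.2) = S := by rw [h2, h1]
  have hc : Multiset.card p.1 + (Multiset.card q.1 + Multiset.card q.2) = Multiset.card S := by
    rw [← hS]; simp
  -- A branch with `a` leaves has degree `a - 1`: one for its root edge and `a - 2` for its tree.
  -- The three degrees add up to `card S - 3`.
  have := ((hbr p.1 (by rw [← hS]; exact Multiset.le_add_right _ _) (by omega)).mul
    (hbr q.1 (by rw [← hS]; exact (Multiset.le_add_right _ _).trans (Multiset.le_add_left _ _))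
      (by omega))).mul
    (hbr q.2 (by rw [← hS]; exact (Multiset.le_add_left _ _).trans (Multiset.le_add_left _ _))
      (by omega))
  convert this using 1
  omega

/-! ### The change of the tree sum when edges are reversed. -/

section WallCrossing

variable {M : Type*} {R : Type*} [AddCommGroup M] [CommRing R] [Algebra ℚ R]

theorem splitSum_eq_of_left_zero {M R : Type*} [AddCommMonoid R] {Φ : Multiset M → Multiset M → R}
    {S : Multiset M} (h : ∀ A B, A + B = S → A ≠ 0 → Φ A B = 0) : splitSum Φ S = Φ 0 S := by
  induction S using Multiset.induction generalizing Φ with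
  | empty => simp
  | cons a S ih =>
    rw [splitSum_cons, ih (Φ := fun A B => Φ A (a ::ₘ B)), splitSum_eq_zero, add_zero]
    · exact fun A B hAB => h _ _ (by rw [Multiset.cons_add, hAB]) (Multiset.cons_ne_zero)
    · exact fun A B hAB hA => h _ _ (by rw [Multiset.add_cons, hAB]) hA

open Classical in
/-- The jump of the weight of an edge with flow `w`, when the sign function changes from `pos'` to
`pos`. -/
noncomputable def edgeJump (pos pos' : M → Prop) (z : M →+ R) (w : M) : R :=
  if pos w ∧ ¬ pos' w then z w else if pos' w ∧ ¬ pos w then -z w else 0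

variable (pos pos' : M → Prop) (z : M →+ R)

/-- The tree sum of the part of the tree on one side of an edge, with set of leaves `A`. -/
noncomputable def cutSum (pos : M → Prop) (z : M →+ R) (A : Multiset M) : R :=
  treeSum pos z ((-A.sum) ::ₘ A)

theorem cutSum_eq_zero {A : Multiset M} (h : Multiset.card A ≤ 1) : cutSum pos z A = 0 :=
  treeSum_eq_zero _ _ (by rw [Multiset.card_cons]; omega)

theorem splitSum₃_mul_left_swap {M R : Type*} [CommRing R] (φ ψ : Multiset M → R)
    (S : Multiset M) :
    splitSum₃ (fun A B C => φ A * ψ B * φ C) S = splitSum₃ (fun A B C => ψ A * φ B * φ C) S := by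
  rw [← splitSum₃_swap_left]
  exact splitSum₃_congr fun _ _ _ _ => by ring

theorem splitSum₃_mul_right_swap {M R : Type*} [CommRing R] (φ ψ : Multiset M → R)
    (S : Multiset M) :
    splitSum₃ (fun A B C => φ A * φ B * ψ C) S = splitSum₃ (fun A B C => ψ A * φ B * φ C) S := by
  rw [← splitSum₃_swap_right, ← splitSum₃_mul_left_swap]
  exact splitSum₃_congr fun _ _ _ _ => by ring

/-- By symmetry the distinguished element may be assumed to lie in the first of the three parts. -/
theorem splitSum₃_mul_cons {M R : Type*} [CommRing R] (φ : Multiset M → R) (a : M)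
    (S : Multiset M) :
    splitSum₃ (fun A B C => φ A * φ B * φ C) (a ::ₘ S) =
      3 * splitSum₃ (fun A B C => φ (a ::ₘ A) * φ B * φ C) S := by
  rw [splitSum₃_cons, splitSum₃_mul_left_swap φ (fun X => φ (a ::ₘ X)),
    splitSum₃_mul_right_swap φ (fun X => φ (a ::ₘ X))]
  ring

/-- The recursion through the last vertex, with the branch containing the cut edge `-A.sum` listed
first: this uses up a factor `3` of the `6`. There are `card A - 1` vertices on this side of the
edge. -/
theorem smul_cutSum (A : Multiset M) :
    (2 * ((Multiset.card A : ℚ) - 1)) • cutSum pos z A =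
      splitSum (fun X T => branchSum pos z (-A.sum ::ₘ X) *
        splitSum (fun B C => branchSum pos z B * branchSum pos z C) T) A := by
  have h := smul_treeSum pos z (-A.sum ::ₘ A)
  rw [splitSum₃_mul_cons, Multiset.card_cons] at h
  simp only [splitSum₃, mul_assoc, ← mul_splitSum] at h
  refine smul_right_injective R (by norm_num : (3 : ℚ) ≠ 0) ?_
  beta_reduce
  rw [smul_smul, Algebra.smul_def (3 : ℚ) (splitSum _ _), map_ofNat, ← h, cutSum]
  push_cast
  congr 1
  ring

variable {pos pos' z}

/-- Reversing the orientation changes the sign of the weight and exchanges the two cases, so the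
jump belongs to the edge and not to one of its sides. -/
theorem edgeJump_neg {w : M} (h : pos (-w) ↔ ¬ pos w) (h' : pos' (-w) ↔ ¬ pos' w) :
    edgeJump pos pos' z (-w) = edgeJump pos pos' z w := by
  unfold edgeJump
  rw [h, h', map_neg]
  by_cases hp : pos w <;> by_cases hp' : pos' w <;> simp [hp, hp']

theorem edgeJump_zero : edgeJump pos pos' z 0 = 0 := by simp [edgeJump]

theorem ne_zero_of_card_le {M : Type*} {A B : Multiset M} (hA : A ≠ 0)
    (h : Multiset.card A ≤ Multiset.card B) : B ≠ 0 :=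
  Multiset.card_pos.1 ((Multiset.card_pos.2 hA).trans_le h)

/-- The leaves of a part of a tree can be split off without splitting the rest of the tree. -/
theorem exists_sum_eq_of_mem {C E S P : Multiset M} (hS : S.sum = 0) (hCE : C + E = S)
    (hE : E ≠ 0) (h : -C.sum ∈ P) :
    ∃ P' : Multiset M, P = -C.sum ::ₘ P' ∧ (P' + E).sum = P.sum ∧
      Multiset.card P ≤ Multiset.card (P' + E) := by
  have hneg : -C.sum = E.sum := by
    rw [← hCE, Multiset.sum_add] at hS
    exact (eq_neg_of_add_eq_zero_right hS).symm
  obtain ⟨P', rfl⟩ := Multiset.exists_cons_of_mem h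
  refine ⟨P', rfl, by rw [Multiset.sum_add, Multiset.sum_cons, hneg, add_comm], ?_⟩
  rw [Multiset.card_cons, Multiset.card_add]
  have := Multiset.card_pos.2 hE
  omega

/-- Lets the hypotheses on splittings of the full set of leaves descend to a cut-off part in the
inductions: the edge leaf is replaced by the complement `E`, which has the same sum. -/
theorem exists_split_of_cons {C E S P Q : Multiset M} (hS : S.sum = 0) (hCE : C + E = S)
    (hE : E ≠ 0) (h : P + Q = -C.sum ::ₘ C) :
    ∃ P' Q' : Multiset M, P' + Q' = S ∧ P'.sum = P.sum ∧ Q'.sum = Q.sum ∧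
      Multiset.card P ≤ Multiset.card P' ∧ Multiset.card Q ≤ Multiset.card Q' := by
  have hmem : -C.sum ∈ P + Q := by rw [h]; exact Multiset.mem_cons_self _ _
  rcases Multiset.mem_add.1 hmem with hm | hm
  · obtain ⟨P', rfl, h1, h2⟩ := exists_sum_eq_of_mem hS hCE hE hm
    rw [Multiset.cons_add, Multiset.cons_inj_right] at h
    exact ⟨P' + E, Q, by rw [← hCE, ← h]; abel, h1, rfl, h2, le_rfl⟩
  · obtain ⟨Q', rfl, h1, h2⟩ := exists_sum_eq_of_mem hS hCE hE hm
    rw [Multiset.add_cons, Multiset.cons_inj_right] at h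
    exact ⟨P, Q' + E, by rw [← hCE, ← h]; abel, rfl, h1, le_rfl, h2⟩

theorem exists_split₃_of_cons {C E S P Q T : Multiset M} (hS : S.sum = 0) (hCE : C + E = S)
    (hE : E ≠ 0) (h : P + Q + T = -C.sum ::ₘ C) :
    ∃ P' Q' T' : Multiset M, P' + Q' + T' = S ∧ P'.sum = P.sum ∧ T'.sum = T.sum ∧
      Multiset.card P ≤ Multiset.card P' ∧ Multiset.card Q ≤ Multiset.card Q' ∧
      Multiset.card T ≤ Multiset.card T' := by
  have hmem : -C.sum ∈ P + Q + T := by rw [h]; exact Multiset.mem_cons_self _ _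
  rcases Multiset.mem_add.1 hmem with hm | hm
  · rcases Multiset.mem_add.1 hm with hm | hm
    · obtain ⟨P', rfl, h1, h2⟩ := exists_sum_eq_of_mem hS hCE hE hm
      rw [Multiset.cons_add, Multiset.cons_add, Multiset.cons_inj_right] at h
      exact ⟨P' + E, Q, T, by rw [← hCE, ← h]; abel, h1, rfl, h2, le_rfl, le_rfl⟩
    · obtain ⟨Q', rfl, h1, h2⟩ := exists_sum_eq_of_mem hS hCE hE hm
      rw [Multiset.add_cons, Multiset.cons_add, Multiset.cons_inj_right] at h
      exact ⟨P, Q' + E, T, by rw [← hCE, ← h]; abel, rfl, rfl, le_rfl, h2, le_rfl⟩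
  · obtain ⟨T', rfl, h1, h2⟩ := exists_sum_eq_of_mem hS hCE hE hm
    rw [Multiset.add_cons, Multiset.cons_inj_right] at h
    exact ⟨P, Q, T' + E, by rw [← hCE, ← h]; abel, rfl, h1, le_rfl, le_rfl, h2⟩

/-- The root leaf lies on one of the two sides of the reversed edge. The two halves agree since the
jump is even, and in each only the side away from the root is kept as a cut-off part. -/
theorem splitSum_edgeJump_cons {C : Multiset M}
    (hsymm : ∀ P Q, P + Q = -C.sum ::ₘ C →
      edgeJump pos pos' z (-P.sum) = edgeJump pos pos' z P.sum ∨ P = 0 ∨ Q = 0) :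
    splitSum (fun Y Y' => edgeJump pos pos' z Y.sum * cutSum pos' z Y * cutSum pos' z Y')
      (-C.sum ::ₘ C) =
    2 * splitSum (fun X Y => edgeJump pos pos' z Y.sum * cutSum pos' z Y *
      treeSum pos' z (Y.sum ::ₘ -C.sum ::ₘ X)) C := by
  have key : ∀ P Q, P + Q = C →
      cutSum pos' z (-C.sum ::ₘ P) = treeSum pos' z (Q.sum ::ₘ -C.sum ::ₘ P) := by
    intro P Q h
    rw [cutSum, Multiset.sum_cons, ← h, Multiset.sum_add]
    congr 2
    abel
  rw [splitSum_cons, ← splitSum_swap, two_mul]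
  congr 1
  · refine splitSum_congr fun P Q h => ?_
    rw [key P Q h]
  · refine splitSum_congr fun P Q h => ?_
    rw [key P Q h]
    rcases Multiset.empty_or_exists_mem Q with rfl | ⟨q, hq⟩
    · simp [cutSum_eq_zero pos' z (A := (0 : Multiset M)) (by simp)]
    · have hQ : Q ≠ 0 := fun h0 => by simp [h0] at hq
      have : edgeJump pos pos' z (-C.sum ::ₘ P).sum = edgeJump pos pos' z Q.sum := by
        have h1 : (-C.sum ::ₘ P).sum = -Q.sum := by
          rw [Multiset.sum_cons, ← h, Multiset.sum_add]; abel
        rw [h1]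
        rcases hsymm Q (-C.sum ::ₘ P) (by rw [Multiset.add_cons, add_comm, h]) with h2 | h2 | h2
        · exact h2
        · exact absurd h2 hQ
        · exact absurd h2 Multiset.cons_ne_zero
      rw [this]
      ring

/-- The change of the contribution of a branch, when the sign function changes from `pos'` to
`pos`. -/
theorem branchSum_sub {C E S : Multiset M} (hS : S.sum = 0) (hCE : C + E = S) (hE : E ≠ 0)
    (hneg : ∀ A B, A + B = S → A ≠ 0 → B ≠ 0 →
      (pos (-A.sum) ↔ ¬ pos A.sum) ∧ (pos' (-A.sum) ↔ ¬ pos' A.sum))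
    (hsep : ∀ A B C, A + B + C = S → A ≠ 0 → B ≠ 0 → C ≠ 0 →
      edgeJump pos pos' z A.sum = 0 ∨ edgeJump pos pos' z C.sum = 0)
    (ih : 2 ≤ Multiset.card C → 2 * (cutSum pos z C - cutSum pos' z C) =
      splitSum (fun Y Y' => edgeJump pos pos' z Y.sum * cutSum pos' z Y * cutSum pos' z Y')
        (-C.sum ::ₘ C)) :
    branchSum pos z C - branchSum pos' z C =
      splitSum (fun X Y => edgeJump pos pos' z Y.sum * cutSum pos' z Y *
        branchSum pos' z (Y.sum ::ₘ X)) C := by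
  rcases Nat.lt_or_ge (Multiset.card C) 2 with hC | hC
  · rw [splitSum_eq_zero]
    · interval_cases h : Multiset.card C <;> simp [branchSum, h]
    · intro X Y h
      have : Multiset.card X + Multiset.card Y = Multiset.card C := by rw [← h]; simp
      rw [cutSum_eq_zero _ _ (by omega)]
      simp
  have hC0 : C ≠ 0 := by rintro rfl; simp at hC
  have hsymm : ∀ P Q, P + Q = S → P ≠ 0 → Q ≠ 0 →
      edgeJump pos pos' z (-P.sum) = edgeJump pos pos' z P.sum := fun P Q h hP hQ =>
    edgeJump_neg (hneg P Q h hP hQ).1 (hneg P Q h hP hQ).2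
  -- The change inside the branch, with each reversed edge seen only from the side away from the
  -- root.
  have hcut : cutSum pos z C - cutSum pos' z C =
      splitSum (fun X Y => edgeJump pos pos' z Y.sum * cutSum pos' z Y *
      treeSum pos' z (Y.sum ::ₘ -C.sum ::ₘ X)) C := by
    have h2 := ih hC
    rw [splitSum_edgeJump_cons] at h2
    · refine smul_right_injective R (by norm_num : (2 : ℚ) ≠ 0) ?_
      simpa only [Algebra.smul_def, map_ofNat] using h2
    · intro P Q h
      by_cases hP : P = 0
      · exact Or.inr (Or.inl hP)
      by_cases hQ : Q = 0
      · exact Or.inr (Or.inr hQ)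
      obtain ⟨P', Q', h1, h2, h3, h4, h5⟩ := exists_split_of_cons hS hCE hE h
      left
      rw [← h2]
      exact hsymm P' Q' h1 (ne_zero_of_card_le hP h4) (ne_zero_of_card_le hQ h5)
  -- Either the root edge does not jump, and the change comes from inside the branch; or it jumps,
  -- and then `hsep` forbids any jump inside. The term with `X = 0` on the right accounts for the
  -- root edge.
  by_cases hj : edgeJump pos pos' z C.sum = 0
  · have hX : ∀ X Y, X + Y = C → ∀ v, edgeJump pos pos' z Y.sum * v ≠ 0 → X ≠ 0 := by
      rintro X Y h v hv rfl
      rw [zero_add] at h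
      rw [h, hj, zero_mul] at hv
      exact hv rfl
    by_cases hz : z C.sum = 0
    · rw [splitSum_eq_zero]
      · simp [branchSum, hz]
      · intro X Y h
        by_contra hne
        have := hX X Y h _ (by rw [mul_assoc] at hne; exact hne)
        have h1 := Multiset.card_pos.2 this
        refine hne ?_
        have hs : (Y.sum ::ₘ X).sum = C.sum := by
          rw [Multiset.sum_cons, ← h, Multiset.sum_add, add_comm]
        rw [branchSum, hs, if_neg (by rw [Multiset.card_cons]; omega), hz]
        simp
    · have hiff : pos C.sum ↔ pos' C.sum := by
        unfold edgeJump at hj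
        by_cases hp : pos C.sum <;> by_cases hp' : pos' C.sum <;> simp [hp, hp', hz] at hj ⊢
      by_cases hp' : pos' C.sum
      · rw [branchSum_of_pos z hC (hiff.2 hp'), branchSum_of_pos z hC hp', ← mul_sub]
        change z C.sum * (cutSum pos z C - cutSum pos' z C) = _
        rw [hcut, mul_splitSum]
        refine splitSum_congr fun X Y h => ?_
        have hs : (Y.sum ::ₘ X).sum = C.sum := by
          rw [Multiset.sum_cons, ← h, Multiset.sum_add, add_comm]
        by_cases h0 : X = 0
        · rw [h0, zero_add] at h
          rw [h, hj]
          simp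
        · have := Multiset.card_pos.2 h0
          rw [branchSum_of_pos z (by rw [Multiset.card_cons]; omega) (by rwa [hs]), hs,
            Multiset.cons_swap]
          ring
      · rw [branchSum_of_not_pos z (by omega) hp', branchSum_of_not_pos z (by omega)
          (by rwa [hiff]), sub_zero, splitSum_eq_zero]
        intro X Y h
        by_contra hne
        have := hX X Y h _ (by rw [mul_assoc] at hne; exact hne)
        have h1 := Multiset.card_pos.2 this
        refine hne ?_
        have hs : (Y.sum ::ₘ X).sum = C.sum := by
          rw [Multiset.sum_cons, ← h, Multiset.sum_add, add_comm]
        rw [branchSum_of_not_pos z (by rw [Multiset.card_cons]; omega) (by rwa [hs]), mul_zero]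
  -- The root edge has the same jump seen from `C` and from `E`, so `hsep` for `Y`, `X`, `E` kills
  -- every inner jump.
  · have hj0 : ∀ X Y, X + Y = C → X ≠ 0 → edgeJump pos pos' z Y.sum * cutSum pos' z Y = 0 := by
      intro X Y h hX
      by_cases hY : Y = 0
      · rw [hY, cutSum_eq_zero _ _ (by simp), mul_zero]
      rcases hsep Y X E (by rw [add_comm Y, h, hCE]) hY hX hE with h1 | h1
      · rw [h1, zero_mul]
      · refine absurd ?_ hj
        rw [← h1, ← hsymm C E hCE hC0 hE]
        congr 1
        rw [← hCE, Multiset.sum_add] at hS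
        exact (eq_neg_of_add_eq_zero_right hS).symm
    rw [splitSum_eq_of_left_zero fun X Y h hX => by rw [hj0 X Y h hX, zero_mul]]
    rw [splitSum_eq_of_left_zero fun X Y h hX => by rw [hj0 X Y h hX, zero_mul],
      treeSum_eq_zero _ _ (by simp), mul_zero, sub_eq_zero] at hcut
    rw [Multiset.cons_zero, branchSum_singleton, mul_one]
    unfold edgeJump at hj ⊢
    by_cases hp : pos C.sum <;> by_cases hp' : pos' C.sum <;> simp [hp, hp'] at hj ⊢
    · rw [branchSum_of_pos z hC hp, branchSum_of_not_pos z (by omega) hp', ← hcut, cutSum, sub_zero]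
    · rw [branchSum_of_not_pos z (by omega) hp, branchSum_of_pos z hC hp', cutSum, zero_sub]

/-- The wall-crossing formula. -/
theorem treeSum_sub {S : Multiset M} (hS : S.sum = 0)
    (hneg : ∀ A B, A + B = S → A ≠ 0 → B ≠ 0 →
      (pos (-A.sum) ↔ ¬ pos A.sum) ∧ (pos' (-A.sum) ↔ ¬ pos' A.sum))
    (hsep : ∀ A B C, A + B + C = S → A ≠ 0 → B ≠ 0 → C ≠ 0 →
      edgeJump pos pos' z A.sum = 0 ∨ edgeJump pos pos' z C.sum = 0) :
    2 * (treeSum pos z S - treeSum pos' z S) =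
      splitSum (fun Y Y' => edgeJump pos pos' z Y.sum * cutSum pos' z Y * cutSum pos' z Y') S := by
  induction hn : Multiset.card S using Nat.strong_induction_on generalizing S with
  | _ n ih =>
  subst hn
  rcases Nat.lt_or_ge 2 (Multiset.card S) with hN | hN
  swap
  · rw [treeSum_eq_zero _ _ hN, treeSum_eq_zero _ _ hN, splitSum_eq_zero]
    · simp
    · intro A B h
      have : Multiset.card A + Multiset.card B = Multiset.card S := by rw [← h]; simp
      rcases Nat.lt_or_ge (Multiset.card A) 2 with hA | hA
      · rw [cutSum_eq_zero _ _ (A := A) (by omega)]; simp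
      · rw [cutSum_eq_zero _ _ (A := B) (by omega)]; simp
  have hbr : ∀ C E, C + E = S → 2 ≤ Multiset.card E → branchSum pos z C - branchSum pos' z C =
      splitSum (fun X Y => edgeJump pos pos' z Y.sum * cutSum pos' z Y *
        branchSum pos' z (Y.sum ::ₘ X)) C := by
    intro C E hCE hE
    have hE0 : E ≠ 0 := by rintro rfl; simp at hE
    have hc : Multiset.card C + Multiset.card E = Multiset.card S := by rw [← hCE]; simp
    refine branchSum_sub hS hCE hE0 hneg hsep fun _ => ?_
    refine ih _ (by rw [Multiset.card_cons]; omega) (by simp) ?_ ?_ rfl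
    · intro P Q h hP hQ
      obtain ⟨P', Q', h1, h2, h3, h4, h5⟩ := exists_split_of_cons hS hCE hE0 h
      rw [← h2]
      exact hneg P' Q' h1 (ne_zero_of_card_le hP h4) (ne_zero_of_card_le hQ h5)
    · intro P Q T h hP hQ hT
      obtain ⟨P', Q', T', h1, h2, h3, h4, h5, h6⟩ := exists_split₃_of_cons hS hCE hE0 h
      rw [← h2, ← h3]
      exact hsep P' Q' T' h1 (ne_zero_of_card_le hP h4) (ne_zero_of_card_le hQ h5)
        (ne_zero_of_card_le hT h6)
  have hjump : ∀ A B, A + B = S → A ≠ 0 → B ≠ 0 →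
      edgeJump pos pos' z A.sum = edgeJump pos pos' z B.sum := by
    intro A B h hA hB
    rw [← edgeJump_neg (hneg A B h hA hB).1 (hneg A B h hA hB).2]
    congr 1
    rw [← h, Multiset.sum_add] at hS
    exact (eq_neg_of_add_eq_zero_right hS).symm
  set br : Multiset M → R := branchSum pos' z with hbrdef
  set Δ : Multiset M → R := fun C => branchSum pos z C - br C with hΔ
  have hΔne : ∀ C E, C + E = S → 2 ≤ Multiset.card E → Δ C ≠ 0 →
      ∃ X Y, X + Y = C ∧ Y ≠ 0 ∧ edgeJump pos pos' z Y.sum ≠ 0 := by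
    intro C E hCE hE hne
    by_contra! hcon
    refine hne ?_
    rw [hΔ]
    beta_reduce
    rw [hbr C E hCE hE]
    refine splitSum_eq_zero fun X Y h => ?_
    by_cases hY : Y = 0
    · rw [hY, cutSum_eq_zero _ _ (A := (0 : Multiset M)) (by simp)]; simp
    · rw [hcon X Y h hY]; simp
  -- Two branches at a vertex cannot both change: the jumping edges in them would cut off disjoint
  -- sets of leaves, against `hsep`.
  have hΔΔ : ∀ A B C, A + B + C = S → A ≠ 0 → B ≠ 0 → C ≠ 0 → Δ A * Δ B = 0 := by
    intro A B C h hA hB hC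
    have hA' := Multiset.card_pos.2 hA
    have hB' := Multiset.card_pos.2 hB
    have hC' := Multiset.card_pos.2 hC
    by_contra hne
    obtain ⟨X, Y, h1, h2, h3⟩ := hΔne A (B + C) (by rw [← h]; abel)
      (by rw [Multiset.card_add]; omega) (left_ne_zero_of_mul hne)
    obtain ⟨X', Y', h1', h2', h3'⟩ := hΔne B (A + C) (by rw [← h]; abel)
      (by rw [Multiset.card_add]; omega) (right_ne_zero_of_mul hne)
    rcases hsep Y (X + X' + C) Y' (by rw [← h, ← h1, ← h1']; abel) h2
      (by rw [← Multiset.card_pos]; simp; omega) h2' with h4 | h4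
    · exact h3 h4
    · exact h3' h4
  -- Hence the product rule for the three branches has no terms of higher order, and the symmetry of
  -- the branches gives the factor `3`.
  have hleft : (6 * ((Multiset.card S : ℚ) - 2)) • (treeSum pos z S - treeSum pos' z S) =
      3 * splitSum (fun X T => Δ X * splitSum (fun B C => br B * br C) T) S := by
    rw [smul_sub, smul_treeSum, smul_treeSum, ← splitSum₃_sub_fun]
    have e1 : splitSum (fun X T => Δ X * splitSum (fun B C => br B * br C) T) S =
        splitSum₃ (fun A B C => Δ A * br B * br C) S := by
      simp only [splitSum₃, mul_splitSum, mul_assoc]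
    have e2 : 3 * splitSum₃ (fun A B C => Δ A * br B * br C) S =
        splitSum₃ (fun A B C => Δ A * br B * br C + br A * Δ B * br C + br A * br B * Δ C) S := by
      rw [splitSum₃_add_fun, splitSum₃_add_fun, splitSum₃_mul_left_swap br Δ,
        splitSum₃_mul_right_swap br Δ]
      ring
    rw [e1, e2]
    refine splitSum₃_congr fun A B C h => ?_
    by_cases h0 : A = 0 ∨ B = 0 ∨ C = 0
    · rw [branchSum_mul_eq_zero _ _ h0, branchSum_mul_eq_zero _ _ h0]
      rcases h0 with rfl | rfl | rfl <;> simp [hΔ, hbrdef]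
    · push Not at h0
      have h1 := hΔΔ A B C h h0.1 h0.2.1 h0.2.2
      have h2 := hΔΔ B C A (by rw [← h]; abel) h0.2.1 h0.2.2 h0.1
      have h3 := hΔΔ A C B (by rw [← h]; abel) h0.1 h0.2.2 h0.2.1
      have e : ∀ X, branchSum pos z X = br X + Δ X := fun X => by rw [hΔ]; ring
      rw [e A, e B, e C]
      linear_combination (br C + Δ C) * h1 + br A * h2 + br B * h3
  -- The `card S - 2` vertices are divided between the two sides of the reversed edge as `(card Y -
  -- 1) + (card Y' - 1)`. Exchanging the sides shows that both parts contribute equally.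
  have hright : (6 * ((Multiset.card S : ℚ) - 2)) •
      splitSum (fun Y Y' => edgeJump pos pos' z Y.sum * cutSum pos' z Y * cutSum pos' z Y') S =
      6 * splitSum (fun Y Y' => edgeJump pos pos' z Y'.sum * cutSum pos' z Y' *
        ((2 * ((Multiset.card Y : ℚ) - 1)) • cutSum pos' z Y)) S := by
    have e : (6 * ((Multiset.card S : ℚ) - 2)) •
      splitSum (fun Y Y' => edgeJump pos pos' z Y.sum * cutSum pos' z Y * cutSum pos' z Y') S =
      3 * splitSum (fun Y Y' => edgeJump pos pos' z Y'.sum * cutSum pos' z Y' *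
        ((2 * ((Multiset.card Y : ℚ) - 1)) • cutSum pos' z Y)) S +
      3 * splitSum (fun Y Y' => edgeJump pos pos' z Y'.sum * cutSum pos' z Y' *
        ((2 * ((Multiset.card Y : ℚ) - 1)) • cutSum pos' z Y)) S := by
      nth_rewrite 2 [← splitSum_swap]
      rw [mul_splitSum, mul_splitSum, ← splitSum_add_fun, Algebra.smul_def, mul_splitSum]
      refine splitSum_congr fun A B h => ?_
      by_cases hA : A = 0
      · rw [hA, cutSum_eq_zero _ _ (A := (0 : Multiset M)) (by simp)]; simp
      by_cases hB : B = 0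
      · rw [hB, cutSum_eq_zero _ _ (A := (0 : Multiset M)) (by simp)]; simp
      have hc : Multiset.card S = Multiset.card A + Multiset.card B := by rw [← h]; simp
      rw [hjump A B h hA hB, hc]
      simp only [Algebra.smul_def]
      push_cast
      simp only [map_ofNat]
      ring
    rw [e]
    ring
  -- Expand the tree on the side `Y` at its last vertex. Gluing `Y'` back to the branch `X`
  -- containing the cut edge gives a full branch `C`, whose change is given by `hbr`.
  have hregroup : splitSum (fun Y Y' => edgeJump pos pos' z Y'.sum * cutSum pos' z Y' *
        ((2 * ((Multiset.card Y : ℚ) - 1)) • cutSum pos' z Y)) S =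
      splitSum (fun X T => Δ X * splitSum (fun B C => br B * br C) T) S := by
    have e1 : splitSum (fun Y Y' => edgeJump pos pos' z Y'.sum * cutSum pos' z Y' *
        ((2 * ((Multiset.card Y : ℚ) - 1)) • cutSum pos' z Y)) S =
        splitSum (fun Y Y' => splitSum (fun X T => edgeJump pos pos' z Y'.sum *
          cutSum pos' z Y' * br (Y'.sum ::ₘ X) * splitSum (fun B C => br B * br C) T) Y) S := by
      refine splitSum_congr fun Y Y' h => ?_
      have hs : -Y.sum = Y'.sum := by
        rw [← h, Multiset.sum_add] at hS
        exact (eq_neg_of_add_eq_zero_right hS).symm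
      rw [smul_cutSum, mul_splitSum, hs]
      simp only [mul_assoc, hbrdef]
    rw [e1, splitSum_assoc]
    have e2 : splitSum (fun A Z => splitSum (fun T Y' => edgeJump pos pos' z Y'.sum *
          cutSum pos' z Y' * br (Y'.sum ::ₘ A) * splitSum (fun B C => br B * br C) T) Z) S =
        splitSum (fun A Z => splitSum (fun Y' T => edgeJump pos pos' z Y'.sum *
          cutSum pos' z Y' * br (Y'.sum ::ₘ A) * splitSum (fun B C => br B * br C) T) Z) S :=
      splitSum_congr fun A Z _ => by rw [← splitSum_swap]
    rw [e2, ← splitSum_assoc]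
    refine splitSum_congr fun C T h => ?_
    rw [← splitSum_mul]
    rcases Nat.lt_or_ge (Multiset.card T) 2 with hT | hT
    · rw [splitSum_eq_zero (S := T), mul_zero, mul_zero]
      intro A B hAB
      have : Multiset.card A + Multiset.card B = Multiset.card T := by rw [← hAB]; simp
      rcases Nat.eq_zero_or_pos (Multiset.card A) with hA | hA
      · rw [Multiset.card_eq_zero.1 hA, hbrdef, branchSum_zero, zero_mul]
      · rw [Multiset.card_eq_zero.1 (by omega : Multiset.card B = 0), hbrdef, branchSum_zero,
          mul_zero]
    · rw [← hbr C T h hT]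
  have hq : (6 * ((Multiset.card S : ℚ) - 2)) ≠ 0 := by
    have : (2 : ℚ) < Multiset.card S := by exact_mod_cast hN
    have : (0 : ℚ) < (Multiset.card S : ℚ) - 2 := by linarith
    positivity
  refine smul_right_injective R hq ?_
  beta_reduce
  rw [hright, hregroup, ← mul_smul_comm, hleft]
  ring

end WallCrossing

/-! ### Tree sums along a linear path of reference points. -/

section Path

variable {M : Type*} {R : Type*} [AddCommGroup M] [CommRing R] [Algebra ℚ R]
  (a b : M →+ ℝ) (z : M →+ R)

/-- The flow at the time `t` on a linear path of reference points is positive. -/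
def PosAt (t : ℝ) (v : M) : Prop := 0 < a v + t * b v

/-- The time when the flow `v` vanishes on a linear path of reference points. -/
noncomputable def vanishingTime (v : M) : ℝ := -a v / b v

variable {a b z}

theorem eq_vanishingTime {v : M} {t : ℝ} (hb : b v ≠ 0) (h : a v + t * b v = 0) :
    t = vanishingTime a b v := by
  rw [vanishingTime, eq_div_iff hb]
  linarith

theorem add_vanishingTime_mul {v : M} (hb : b v ≠ 0) : a v + vanishingTime a b v * b v = 0 := by
  rw [vanishingTime, div_mul_cancel₀ _ hb]
  ring

theorem map_sum_eq_zero_of_countP {A : Multiset M} [DecidablePred fun v => b v ≠ 0]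
    (h : A.countP (fun v => b v ≠ 0) = 0) : b A.sum = 0 := by
  rw [map_multiset_sum]
  refine Multiset.sum_eq_zero fun x hx => ?_
  obtain ⟨v, hv, rfl⟩ := Multiset.mem_map.1 hx
  by_contra hne
  exact Multiset.countP_eq_zero.1 h v hv hne

/-- At most one edge of a tree can change its direction at a time. -/
theorem not_vanish_of_split {S : Multiset M} [DecidablePred fun v => b v ≠ 0] (hS : S.sum = 0)
    (hb : S.countP (fun v => b v ≠ 0) ≤ 2)
    (hgen : ∀ A B, A + B = S → A ≠ 0 → B ≠ 0 → b A.sum = 0 → a A.sum ≠ 0)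
    {A B C : Multiset M} (h : A + B + C = S) (hA : A ≠ 0) (hB : B ≠ 0) (hC : C ≠ 0) (t : ℝ)
    (h1 : a A.sum + t * b A.sum = 0) : a C.sum + t * b C.sum ≠ 0 := by
  intro h3
  have hsum : A.sum + B.sum + C.sum = 0 := by rw [← hS, ← h]; simp
  have h2 : a B.sum + t * b B.sum = 0 := by
    have e1 := congrArg a hsum
    have e2 := congrArg b hsum
    simp only [map_add, map_zero] at e1 e2
    linear_combination e1 + t * e2 - h1 - h3
  have hc : A.countP (fun v => b v ≠ 0) + B.countP (fun v => b v ≠ 0) +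
      C.countP (fun v => b v ≠ 0) ≤ 2 := by
    rw [← Multiset.countP_add, ← Multiset.countP_add, h]; exact hb
  -- A part with vanishing flow must contain a moving leaf, as otherwise its flow is constant and
  -- nonzero by `hgen`. Three disjoint such parts would need three moving leaves.
  have key : ∀ X Y, X + Y = S → X ≠ 0 → Y ≠ 0 → a X.sum + t * b X.sum = 0 →
      X.countP (fun v => b v ≠ 0) ≠ 0 := by
    intro X Y hXY hX hY hf hcount
    have hb0 := map_sum_eq_zero_of_countP hcount
    rw [hb0, mul_zero, add_zero] at hf
    exact hgen X Y hXY hX hY hb0 hf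
  have kA := key A (B + C) (by rw [← h]; abel) hA (by simp [hB]) h1
  have kB := key B (A + C) (by rw [← h]; abel) hB (by simp [hA]) h2
  have kC := key C (A + B) (by rw [← h]; abel) hC (by simp [hA]) h3
  omega

variable (a b) in
/-- The time `t` is critical if the flow through a possible edge vanishes. -/
def IsCritical (S : Multiset M) (t : ℝ) : Prop :=
  ∃ A B, A + B = S ∧ A ≠ 0 ∧ B ≠ 0 ∧ a A.sum + t * b A.sum = 0

theorem posAt_neg_iff {v : M} {t : ℝ} (h : a v + t * b v ≠ 0) :
    PosAt a b t (-v) ↔ ¬ PosAt a b t v := by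
  unfold PosAt
  rw [map_neg, map_neg, not_lt]
  constructor
  · intro h'; linarith
  · intro h'
    have := lt_of_le_of_ne h' h
    linarith

/-- A sign change of the flow takes place at the time when it vanishes. -/
theorem vanishingTime_mem {v : M} {t₀ t₁ : ℝ} (h : t₀ ≤ t₁) (h0 : a v + t₀ * b v ≠ 0)
    (hne : ¬ (PosAt a b t₀ v ↔ PosAt a b t₁ v)) :
    ∃ t, t₀ ≤ t ∧ t ≤ t₁ ∧ a v + t * b v = 0 := by
  have hc : Continuous fun t : ℝ => a v + t * b v := by fun_prop
  unfold PosAt at hne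
  rcases lt_or_gt_of_ne h0 with h0 | h0
  · have h1 : 0 ≤ a v + t₁ * b v := by
      by_contra h1
      exact hne ⟨fun h => absurd h (by linarith), fun h => absurd h (by linarith)⟩
    obtain ⟨t, ht, hv⟩ := intermediate_value_Icc h hc.continuousOn ⟨h0.le, h1⟩
    exact ⟨t, ht.1, ht.2, hv⟩
  · have h1 : a v + t₁ * b v ≤ 0 := by
      by_contra! h1
      exact hne ⟨fun _ => h1, fun _ => h0⟩
    obtain ⟨t, ht, hv⟩ := intermediate_value_Icc' h hc.continuousOn ⟨h1, h0.le⟩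
    exact ⟨t, ht.1, ht.2, hv⟩

open Classical in
variable (a b z) in
/-- The contribution of an edge that changes its direction between the times `t₀` and `t₁`. -/
noncomputable def crossingTerm (t₀ t₁ : ℝ) (A B : Multiset M) : R :=
  if 0 < a A.sum + t₀ * b A.sum ∧ a A.sum + t₁ * b A.sum < 0 then
    z A.sum * cutSum (PosAt a b (vanishingTime a b A.sum)) z A *
      cutSum (PosAt a b (vanishingTime a b A.sum)) z B
  else 0

/-- When the edge between `A` and `B` has flow zero, no flow inside `A` vanishes, since that would
give three parts vanishing together. So no direction inside `A` differs between the time `τ` and the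
later noncritical times, and the vanishing time can be used as a reference that does not depend on
the interval. -/
theorem cutSum_posAt_eq {S : Multiset M} [DecidablePred fun v => b v ≠ 0] (hS : S.sum = 0)
    (hb : S.countP (fun v => b v ≠ 0) ≤ 2)
    (hgen : ∀ A B, A + B = S → A ≠ 0 → B ≠ 0 → b A.sum = 0 → a A.sum ≠ 0)
    {τ t₁ : ℝ} (ht : τ ≤ t₁) (hcrit : ∀ t, τ ≤ t → t ≤ t₁ → IsCritical a b S t → t = τ)
    {A B : Multiset M} (h : A + B = S) (hA : A ≠ 0) (hB : B ≠ 0)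
    (hτ : a A.sum + τ * b A.sum = 0) :
    cutSum (PosAt a b t₁) z A = cutSum (PosAt a b τ) z A := by
  have hsB : B.sum = -A.sum := by
    rw [← h, Multiset.sum_add] at hS
    exact eq_neg_of_add_eq_zero_right hS
  have hτB : a B.sum + τ * b B.sum = 0 := by
    rw [hsB, map_neg, map_neg]
    linarith
  refine treeSum_congr z (by simp) fun P Q hPQ hP hQ _ => ?_
  have hP0 : P ≠ 0 := by rintro rfl; simp at hP
  have hQ0 : Q ≠ 0 := by rintro rfl; simp at hQ
  have hsum : P.sum + Q.sum = 0 := by rw [← Multiset.sum_add, hPQ]; simp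
  obtain ⟨P', Q', h1, h2, -, h4, h5⟩ := exists_split_of_cons hS h hB hPQ
  have sep : ∀ X Y, X + Y = A → X ≠ 0 → Y ≠ 0 → a X.sum + τ * b X.sum ≠ 0 := by
    intro X Y hXY hX hY h0
    exact not_vanish_of_split hS hb hgen (A := X) (B := Y) (C := B) (by rw [hXY, h]) hX hY hB τ h0
      hτB
  have hne : a P.sum + τ * b P.sum ≠ 0 := by
    have hmem : -A.sum ∈ P + Q := by rw [hPQ]; exact Multiset.mem_cons_self _ _
    rcases Multiset.mem_add.1 hmem with hm | hm
    · obtain ⟨X, rfl⟩ := Multiset.exists_cons_of_mem hm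
      rw [Multiset.cons_add, Multiset.cons_inj_right] at hPQ
      have hX : X ≠ 0 := by rintro rfl; simp at hP
      have := sep Q X (by rw [add_comm, hPQ]) hQ0 hX
      rw [← neg_eq_iff_add_eq_zero] at hsum
      rw [← hsum, map_neg, map_neg] at this
      contrapose! this
      linarith
    · obtain ⟨Y, rfl⟩ := Multiset.exists_cons_of_mem hm
      rw [Multiset.add_cons, Multiset.cons_inj_right] at hPQ
      have hY : Y ≠ 0 := by rintro rfl; simp at hQ
      exact sep P Y hPQ hP0 hY
  by_contra hiff
  obtain ⟨t, ht1, ht2, ht3⟩ := vanishingTime_mem ht hne (fun h' => hiff h'.symm)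
  have := hcrit t ht1 ht2 ⟨P', Q', h1, ne_zero_of_card_le hP0 h4, ne_zero_of_card_le hQ0 h5,
    by rw [h2]; exact ht3⟩
  rw [this] at ht3
  exact hne ht3

/-- The wall-crossing formula applies because all reversals in the interval take place at one time
`τ`, when parts with vanishing flow cannot be disjoint with a nonempty rest. -/
theorem treeSum_sub_of_critical {S : Multiset M} [DecidablePred fun v => b v ≠ 0] (hS : S.sum = 0)
    (hb : S.countP (fun v => b v ≠ 0) ≤ 2)
    (hgen : ∀ A B, A + B = S → A ≠ 0 → B ≠ 0 → b A.sum = 0 → a A.sum ≠ 0)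
    {t₀ t₁ τ : ℝ} (ht : t₀ ≤ t₁) (h₀ : ¬ IsCritical a b S t₀) (h₁ : ¬ IsCritical a b S t₁)
    (hcrit : ∀ t, t₀ ≤ t → t ≤ t₁ → IsCritical a b S t → t = τ) :
    treeSum (PosAt a b t₀) z S - treeSum (PosAt a b t₁) z S =
      splitSum (crossingTerm a b z t₀ t₁) S := by
  have hne : ∀ t, ¬ IsCritical a b S t → ∀ A B, A + B = S → A ≠ 0 → B ≠ 0 →
      a A.sum + t * b A.sum ≠ 0 := fun t ht A B h hA hB h0 => ht ⟨A, B, h, hA, hB, h0⟩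
  have hτ : ∀ A B, A + B = S → A ≠ 0 → B ≠ 0 →
      ¬ (PosAt a b t₀ A.sum ↔ PosAt a b t₁ A.sum) →
      a A.sum + τ * b A.sum = 0 ∧ t₀ ≤ τ ∧ τ ≤ t₁ := by
    intro A B h hA hB hiff
    obtain ⟨t, ht1, ht2, ht3⟩ := vanishingTime_mem ht (hne t₀ h₀ A B h hA hB) hiff
    have := hcrit t ht1 ht2 ⟨A, B, h, hA, hB, ht3⟩
    rw [← this]
    exact ⟨ht3, ht1, ht2⟩
  have hjump : ∀ v, edgeJump (PosAt a b t₀) (PosAt a b t₁) z v ≠ 0 →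
      ¬ (PosAt a b t₀ v ↔ PosAt a b t₁ v) := by
    intro v hv hiff
    simp [edgeJump, hiff] at hv
  have key := treeSum_sub (pos := PosAt a b t₀) (pos' := PosAt a b t₁) (z := z) hS
    (fun A B h hA hB => ⟨posAt_neg_iff (hne t₀ h₀ A B h hA hB),
      posAt_neg_iff (hne t₁ h₁ A B h hA hB)⟩)
    (by
      intro A B C h hA hB hC
      by_contra! hcon
      have k1 := hτ A (B + C) (by rw [← h]; abel) hA (by simp [hB]) (hjump _ hcon.1)
      have k2 := hτ C (A + B) (by rw [← h]; abel) hC (by simp [hA]) (hjump _ hcon.2)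
      exact not_vanish_of_split hS hb hgen h hA hB hC τ k1.1 k2.1)
  refine smul_right_injective R (by norm_num : (2 : ℚ) ≠ 0) ?_
  beta_reduce
  rw [Algebra.smul_def, Algebra.smul_def, map_ofNat, key, two_mul]
  -- The wall-crossing formula sees each edge from both sides. Adding the swapped sum pairs these
  -- contributions with the crossing term, which counts only the side whose flow passes from
  -- positive to negative.
  nth_rewrite 2 [← splitSum_swap]
  rw [← splitSum_add_fun]
  refine splitSum_congr fun A B h => ?_
  have hsB : B.sum = -A.sum := by
    rw [← h, Multiset.sum_add] at hS
    exact eq_neg_of_add_eq_zero_right hS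
  by_cases hA : A = 0
  · subst hA; simp [crossingTerm, edgeJump_zero, hsB]
  by_cases hB : B = 0
  · subst hB
    simp only [Multiset.sum_zero, zero_eq_neg] at hsB
    simp [crossingTerm, edgeJump_zero, hsB]
  have n0 := hne t₀ h₀ A B h hA hB
  have n1 := hne t₁ h₁ A B h hA hB
  have hcut : ¬ (PosAt a b t₀ A.sum ↔ PosAt a b t₁ A.sum) →
      cutSum (PosAt a b t₁) z A = cutSum (PosAt a b (vanishingTime a b A.sum)) z A ∧
      cutSum (PosAt a b t₁) z B = cutSum (PosAt a b (vanishingTime a b A.sum)) z B := by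
    intro hiff
    obtain ⟨k1, k2, k3⟩ := hτ A B h hA hB hiff
    have hbA : b A.sum ≠ 0 := by
      intro hb0
      rw [hb0, mul_zero, add_zero] at k1
      exact hgen A B h hA hB hb0 k1
    rw [← eq_vanishingTime hbA k1]
    have hc' : ∀ t, τ ≤ t → t ≤ t₁ → IsCritical a b S t → t = τ :=
      fun t h1 h2 h3 => hcrit t (k2.trans h1) h2 h3
    exact ⟨cutSum_posAt_eq hS hb hgen k3 hc' h hA hB k1,
      cutSum_posAt_eq hS hb hgen k3 hc' (by rw [add_comm, h]) hB hA (by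
        rw [hsB, map_neg, map_neg]; linarith)⟩
  have hvB : vanishingTime a b B.sum = vanishingTime a b A.sum := by
    rw [hsB, vanishingTime, vanishingTime, map_neg, map_neg, neg_div_neg_eq, neg_div]
  unfold edgeJump crossingTerm
  rw [hvB, hsB, map_neg, map_neg, map_neg]
  unfold PosAt at hcut ⊢
  rcases lt_or_gt_of_ne n0 with n0 | n0 <;> rcases lt_or_gt_of_ne n1 with n1 | n1
  · rw [if_neg (by intro h'; linarith [h'.1]), if_neg (by intro h'; linarith [h'.1]),
      if_neg (by intro h'; linarith [h'.2]), if_neg (by intro h'; linarith [h'.1])]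
    simp
  · obtain ⟨e1, e2⟩ := hcut (fun h' => by have := h'.2 n1; linarith)
    rw [if_neg (by intro h'; linarith [h'.1]), if_pos ⟨n1, by linarith⟩,
      if_pos ⟨by linarith, by linarith⟩, if_neg (by intro h'; linarith [h'.1])]
    rw [e1, e2]
    ring
  · obtain ⟨e1, e2⟩ := hcut (fun h' => by have := h'.1 n0; linarith)
    rw [if_pos ⟨n0, by linarith⟩, if_neg (by intro h'; linarith [h'.1]), if_pos ⟨n0, n1⟩]
    rw [e1, e2]
    ring
  · rw [if_neg (by intro h'; linarith [h'.2]), if_neg (by intro h'; linarith [h'.2]),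
      if_neg (by intro h'; linarith [h'.1]), if_neg (by intro h'; linarith [h'.2])]
    simp

/-- A flow is affine in time and does not vanish at the noncritical time `t'`, so a descent through
zero in the long interval takes place in exactly one of the two subintervals. -/
theorem splitSum_crossingTerm_add {S : Multiset M} {t₀ t' t₁ : ℝ} (h1 : t₀ < t') (h2 : t' < t₁)
    (h' : ¬ IsCritical a b S t') (hS : S.sum = 0) :
    splitSum (crossingTerm a b z t₀ t₁) S =
      splitSum (crossingTerm a b z t₀ t') S + splitSum (crossingTerm a b z t' t₁) S := by
  rw [← splitSum_add_fun]
  refine splitSum_congr fun A B h => ?_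
  by_cases hA : A = 0
  · subst hA; simp [crossingTerm]
  by_cases hB : B = 0
  · subst hB
    rw [add_zero] at h
    simp [crossingTerm, h, hS]
  have n : a A.sum + t' * b A.sum ≠ 0 := fun h0 => h' ⟨A, B, h, hA, hB, h0⟩
  have e : ∀ s t : ℝ, s < t → 0 < a A.sum + s * b A.sum → a A.sum + t * b A.sum < 0 →
      b A.sum < 0 := by
    intro s t hst hs ht
    by_contra! hb
    nlinarith
  unfold crossingTerm
  by_cases c : 0 < a A.sum + t₀ * b A.sum ∧ a A.sum + t₁ * b A.sum < 0
  · rw [if_pos c]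
    rcases lt_or_gt_of_ne n with n | n
    · rw [if_pos ⟨c.1, n⟩, if_neg (by intro h'; linarith [h'.1]), add_zero]
    · rw [if_neg (by intro h'; linarith [h'.2]), if_pos ⟨n, c.2⟩, zero_add]
  · rw [if_neg c, if_neg, if_neg, add_zero]
    · rintro ⟨c1, c2⟩
      have := e _ _ h2 c1 c2
      exact c ⟨by nlinarith, c2⟩
    · rintro ⟨c1, c2⟩
      have := e _ _ h1 c1 c2
      exact c ⟨c1, by nlinarith⟩

/-- The change of the tree sum along a linear path of reference points with only two moving
coordinates. -/
theorem treeSum_sub_of_path {S : Multiset M} [DecidablePred fun v => b v ≠ 0] (hS : S.sum = 0)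
    (hb : S.countP (fun v => b v ≠ 0) ≤ 2)
    (hgen : ∀ A B, A + B = S → A ≠ 0 → B ≠ 0 → b A.sum = 0 → a A.sum ≠ 0)
    {t₀ t₁ : ℝ} (ht : t₀ ≤ t₁) (h₀ : ¬ IsCritical a b S t₀) (h₁ : ¬ IsCritical a b S t₁) :
    treeSum (PosAt a b t₀) z S - treeSum (PosAt a b t₁) z S =
      splitSum (crossingTerm a b z t₀ t₁) S := by
  classical
  -- A finite superset of the critical times. Flows with zero velocity add the value of a division
  -- by zero, which does no harm.
  let T : Finset ℝ := ((Multiset.antidiagonal S).map fun p => vanishingTime a b p.1.sum).toFinset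
  have hT : ∀ t, IsCritical a b S t → t ∈ T := by
    rintro t ⟨A, B, h, hA, hB, h0⟩
    have hbA : b A.sum ≠ 0 := by
      intro hb0
      rw [hb0, mul_zero, add_zero] at h0
      exact hgen A B h hA hB hb0 h0
    rw [eq_vanishingTime hbA h0, Multiset.mem_toFinset]
    exact Multiset.mem_map.2 ⟨(A, B), Multiset.mem_antidiagonal.2 h, rfl⟩
  induction hn : (T.filter fun t => t₀ < t ∧ t < t₁).card using Nat.strong_induction_on
    generalizing t₁ with
  | _ n ih =>
  subst hn
  have hmem : ∀ t, t₀ ≤ t → t ≤ t₁ → IsCritical a b S t →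
      t ∈ T.filter fun t => t₀ < t ∧ t < t₁ := by
    intro t h1 h2 h3
    refine Finset.mem_filter.2 ⟨hT t h3, lt_of_le_of_ne h1 ?_, lt_of_le_of_ne h2 ?_⟩
    · rintro rfl; exact h₀ h3
    · rintro rfl; exact h₁ h3
  rcases Finset.eq_empty_or_nonempty (T.filter fun t => t₀ < t ∧ t < t₁) with hK | hK
  · refine treeSum_sub_of_critical (τ := t₀) hS hb hgen ht h₀ h₁ fun t h1 h2 h3 => ?_
    have := hmem t h1 h2 h3
    rw [hK] at this
    exact absurd this (Finset.notMem_empty _)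
  · set K := T.filter fun t => t₀ < t ∧ t < t₁ with hKdef
    set τ := K.max' hK with hτdef
    have hτ : τ ∈ K := K.max'_mem hK
    obtain ⟨hτT, hτ0, hτ1⟩ := Finset.mem_filter.1 hτ
    -- The time `t'` separates the last candidate `τ` from `t₀` and the earlier candidates. After
    -- `t'` only `τ` can be critical, and up to `t'` there are fewer candidates.
    obtain ⟨t', h1, h2⟩ : ∃ t', (∀ x ∈ insert t₀ (K.erase τ), x < t') ∧ t' < τ := by
      have hne : (insert t₀ (K.erase τ)).Nonempty := Finset.insert_nonempty _ _
      have : (insert t₀ (K.erase τ)).max' hne < τ := by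
        rw [Finset.max'_lt_iff]
        intro x hx
        rcases Finset.mem_insert.1 hx with rfl | hx
        · exact hτ0
        · exact lt_of_le_of_ne (K.le_max' x (Finset.mem_of_mem_erase hx))
            (Finset.ne_of_mem_erase hx)
      obtain ⟨t', h1, h2⟩ := exists_between this
      exact ⟨t', fun x hx => (Finset.le_max' _ x hx).trans_lt h1, h2⟩
    have h01 : t₀ < t' := h1 t₀ (Finset.mem_insert_self _ _)
    have hlt : ∀ t, t' ≤ t → t ≤ t₁ → IsCritical a b S t → t = τ := by
      intro t k1 k2 k3
      by_contra hne
      exact absurd (h1 t (Finset.mem_insert_of_mem (Finset.mem_erase.2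
        ⟨hne, hmem t (h01.le.trans k1) k2 k3⟩))) (not_lt.2 k1)
    have hcrit' : ¬ IsCritical a b S t' := fun hc =>
      absurd (hlt t' le_rfl (h2.trans hτ1).le hc) h2.ne
    rw [splitSum_crossingTerm_add h01 (h2.trans hτ1) hcrit' hS,
      ← treeSum_sub_of_critical hS hb hgen (h2.trans hτ1).le hcrit' h₁ hlt,
      ← ih _ ?_ h01.le hcrit' rfl]
    · ring
    · refine Finset.card_lt_card ⟨fun t ht => ?_, fun hsub => ?_⟩
      · obtain ⟨k1, k2, k3⟩ := Finset.mem_filter.1 ht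
        exact Finset.mem_filter.2 ⟨k1, k2, k3.trans (h2.trans hτ1)⟩
      · exact absurd (Finset.mem_filter.1 (hsub hτ)).2.2 (not_lt.2 h2.le)

end Path

/-! ### The recursion through the last vertex of a tree. -/

section LastVertex

variable {M G : Type*} [AddCommGroup M] [AddCommGroup G] [LinearOrder G] [IsOrderedAddMonoid G]
  (s : M →+ G) (z : M →+ ℚ)

/-- The contribution of a branch with a positive flow towards the last vertex. -/
noncomputable def posBranchAt (S : Multiset M) : ℚ :=
  if 0 < s S.sum then branchSum (fun v : M => 0 < s v) z S else 0

theorem posBranchAt_singleton {v : M} (h : 0 < s v) : posBranchAt s z {v} = 1 := by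
  simp [posBranchAt, h]

theorem posBranchAt_of_pos {S : Multiset M} (h : 0 < s S.sum) (hc : 2 ≤ Multiset.card S) :
    posBranchAt s z S = z S.sum * treeSum (fun v : M => 0 < s v) z (-S.sum ::ₘ S) := by
  rw [posBranchAt, if_pos h, branchSum_of_pos _ hc h]

@[simp] theorem posBranchAt_zero : posBranchAt s z 0 = 0 := by simp [posBranchAt]

variable {γ : Type*} [DecidableEq γ]

open Classical in
/-- The indicator function of the negative leaves. -/
noncomputable def negLeaf (S : Multiset M) : ℚ := if ∃ v, s v < 0 ∧ S = {v} then 1 else 0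

variable {s z}

/-- The first part must be a single negative leaf. None lies in `P`, so these parts are indexed by
`C`. -/
theorem splitSum_negLeaf_mul {P : Multiset M} (hP : ∀ v ∈ P, 0 < s v) (C : Finset γ) (n : γ → M)
    (hn : ∀ c ∈ C, s (n c) < 0) (F : Multiset M → ℚ) :
    splitSum (fun A B => negLeaf s A * F B) (P + C.val.map n) =
      ∑ c ∈ C, F (P + (C.erase c).val.map n) := by
  induction C using Finset.induction_on generalizing F with
  | empty =>
    refine splitSum_eq_zero fun A B h => ?_
    rw [negLeaf, if_neg, zero_mul]
    rintro ⟨v, hv, rfl⟩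
    have : v ∈ P := by
      have h' : v ∈ P + (∅ : Finset γ).val.map n := by rw [← h]; simp
      simpa using h'
    exact absurd (hP v this) (not_lt.2 hv.le)
  | insert a C ha ih =>
    rw [Finset.insert_val_of_notMem ha, Multiset.map_cons, Multiset.add_cons, splitSum_cons,
      ih (fun c hc => hn c (Finset.mem_insert_of_mem hc)) (fun B => F (n a ::ₘ B)),
      Finset.sum_insert ha, add_comm]
    congr 1
    · rw [splitSum_eq_of_left_zero, Finset.erase_insert ha]
      · rw [negLeaf, if_pos ⟨n a, hn a (Finset.mem_insert_self _ _), rfl⟩, one_mul]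
      · intro A B _ hA
        rw [negLeaf, if_neg, zero_mul]
        rintro ⟨v, _, h⟩
        have := congrArg Multiset.card h
        have hA := Multiset.card_pos.2 hA
        rw [Multiset.card_cons, Multiset.card_singleton] at this
        omega
    · refine Finset.sum_congr rfl fun c hc => ?_
      have hac : a ≠ c := fun h => ha (h ▸ hc)
      rw [Finset.erase_insert_of_ne hac, Finset.insert_val_of_notMem (by simp [ha]),
        Multiset.map_cons, Multiset.add_cons]

theorem splitSum₃_add_mul {M : Type*} (δ p : Multiset M → ℚ) (S : Multiset M) :
    splitSum₃ (fun A B C => (δ A + p A) * (δ B + p B) * (δ C + p C)) S =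
      splitSum₃ (fun A B C => p A * p B * p C) S + 3 * splitSum₃ (fun A B C => δ A * p B * p C) S +
      3 * splitSum₃ (fun A B C => p A * δ B * δ C) S +
      splitSum₃ (fun A B C => δ A * δ B * δ C) S := by
  have e : splitSum₃ (fun A B C => (δ A + p A) * (δ B + p B) * (δ C + p C)) S =
      splitSum₃ (fun A B C => p A * p B * p C + δ A * p B * p C + p A * δ B * p C +
        p A * p B * δ C + p A * δ B * δ C + δ A * p B * δ C + δ A * δ B * p C +
        δ A * δ B * δ C) S := splitSum₃_congr fun _ _ _ _ => by ring
  rw [e]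
  simp only [splitSum₃_add_fun]
  rw [splitSum₃_mul_left_swap p δ, splitSum₃_mul_right_swap p δ, splitSum₃_mul_left_swap δ p,
    splitSum₃_mul_right_swap δ p]
  ring

/-- The recursion for the tree sum, by the choice of the negative leaves at the last vertex. -/
theorem mul_treeSum {P : Multiset M} (hP : ∀ v ∈ P, 0 < s v) (C : Finset γ) (n : γ → M)
    (hn : ∀ c ∈ C, s (n c) < 0) (h0 : (P + C.val.map n).sum = 0) :
    2 * ((Multiset.card (P + C.val.map n) : ℚ) - 2) * treeSum (fun v : M => 0 < s v) z (P + C.val.map n) =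
      ∑ c ∈ C, splitSum (fun A B => posBranchAt s z A * posBranchAt s z B) (P + (C.erase c).val.map n) +
      ∑ c ∈ C, ∑ c' ∈ C.erase c, posBranchAt s z (P + ((C.erase c).erase c').val.map n) := by
  have h := smul_treeSum (fun v : M => 0 < s v) z (P + C.val.map n)
  have hne : ∀ v ∈ P + C.val.map n, s v ≠ 0 := by
    intro v hv
    rcases Multiset.mem_add.1 hv with hv | hv
    · exact (hP v hv).ne'
    · obtain ⟨c, hc, rfl⟩ := Multiset.mem_map.1 hv
      exact (hn c hc).ne
  -- The three edges at the last vertex are negative leaves or have positive flow towards it; the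
  -- term of a branch with at least two leaves already requires positive flow.
  have hbr : ∀ A, A ≤ P + C.val.map n →
      branchSum (fun v : M => 0 < s v) z A = negLeaf s A + posBranchAt s z A := by
    intro A hA
    by_cases h1 : Multiset.card A = 1
    · obtain ⟨v, rfl⟩ := Multiset.card_eq_one.1 h1
      have hv : s v ≠ 0 := hne v (Multiset.mem_of_le hA (Multiset.mem_singleton_self v))
      rcases lt_or_gt_of_ne hv with hv | hv
      · rw [negLeaf, if_pos ⟨v, hv, rfl⟩, posBranchAt, if_neg (by simpa using hv.le)]
        simp
      · rw [negLeaf, if_neg, posBranchAt_singleton _ _ hv]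
        · simp
        · rintro ⟨w, hw, h⟩
          rw [Multiset.singleton_inj] at h
          rw [h] at hv
          exact lt_asymm hv hw
    · rw [negLeaf, if_neg, zero_add, posBranchAt]
      · split_ifs with hp
        · rfl
        · exact branchSum_of_not_pos _ h1 hp
      · rintro ⟨w, _, rfl⟩
        simp at h1
  rw [splitSum₃_congr (Ψ := fun A B C => (negLeaf s A + posBranchAt s z A) * (negLeaf s B + posBranchAt s z B) *
    (negLeaf s C + posBranchAt s z C)), splitSum₃_add_mul] at h
  swap
  · intro A B D hABD
    rw [hbr A, hbr B, hbr D]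
    · rw [← hABD]; exact Multiset.le_add_left _ _
    · rw [← hABD, add_right_comm]; exact Multiset.le_add_left _ _
    · rw [← hABD, add_assoc]; exact Multiset.le_add_right _ _
  -- The flows at a vertex add up to zero, so they are neither all positive nor, below, all
  -- negative. One or two negative leaves remain, matching the cut and the join of cycles.
  have hppp : splitSum₃ (fun A B C => posBranchAt s z A * posBranchAt s z B * posBranchAt s z C)
      (P + C.val.map n) = 0 := by
    refine splitSum₃_eq_zero fun A B D hABD => ?_
    by_contra hne
    have k1 : 0 < s A.sum := by by_contra hc; simp [posBranchAt, hc] at hne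
    have k2 : 0 < s B.sum := by by_contra hc; simp [posBranchAt, hc] at hne
    have k3 : 0 < s D.sum := by by_contra hc; simp [posBranchAt, hc] at hne
    rw [← hABD, Multiset.sum_add, Multiset.sum_add] at h0
    have h0 := congrArg s h0
    rw [map_add, map_add, map_zero] at h0
    exact absurd h0 (add_pos (add_pos k1 k2) k3).ne'
  have hddd : splitSum₃ (fun A B C => negLeaf s A * negLeaf s B * negLeaf s C)
      (P + C.val.map n) = 0 := by
    have hn' : ∀ A : Multiset M, negLeaf s A ≠ 0 → s A.sum < 0 := by
      intro A hA
      by_contra hc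
      refine hA ?_
      rw [negLeaf, if_neg]
      rintro ⟨v, hv, rfl⟩
      rw [Multiset.sum_singleton] at hc
      exact hc hv
    refine splitSum₃_eq_zero fun A B D hABD => ?_
    by_contra hne
    have k1 := hn' A (left_ne_zero_of_mul (left_ne_zero_of_mul hne))
    have k2 := hn' B (right_ne_zero_of_mul (left_ne_zero_of_mul hne))
    have k3 := hn' D (right_ne_zero_of_mul hne)
    rw [← hABD, Multiset.sum_add, Multiset.sum_add] at h0
    have h0 := congrArg s h0
    rw [map_add, map_add, map_zero] at h0
    exact absurd h0 (add_neg (add_neg k1 k2) k3).ne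
  have hdpp : splitSum₃ (fun A B C => negLeaf s A * posBranchAt s z B * posBranchAt s z C) (P + C.val.map n) =
      ∑ c ∈ C, splitSum (fun A B => posBranchAt s z A * posBranchAt s z B) (P + (C.erase c).val.map n) := by
    rw [← splitSum_negLeaf_mul hP C n hn]
    simp only [splitSum₃, mul_splitSum, mul_assoc]
  have hpdd : splitSum₃ (fun A B C => posBranchAt s z A * negLeaf s B * negLeaf s C) (P + C.val.map n) =
      ∑ c ∈ C, ∑ c' ∈ C.erase c, posBranchAt s z (P + ((C.erase c).erase c').val.map n) := by
    rw [← splitSum₃_mul_right_swap, splitSum₃]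
    have : ∀ c ∈ C, ∑ c' ∈ C.erase c, posBranchAt s z (P + ((C.erase c).erase c').val.map n) =
        splitSum (fun A B => negLeaf s A * posBranchAt s z B) (P + (C.erase c).val.map n) :=
      fun c _ => (splitSum_negLeaf_mul hP _ n
        (fun d hd => hn d (Finset.mem_of_mem_erase hd)) _).symm
    rw [Finset.sum_congr rfl this, ← splitSum_negLeaf_mul hP C n hn
      (fun T => splitSum (fun A B => negLeaf s A * posBranchAt s z B) T)]
    simp only [mul_splitSum, mul_assoc]
  rw [hppp, hddd, hdpp, hpdd, smul_eq_mul] at h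
  linarith

end LastVertex

/-! ### Tree sums with integer weights. -/

section IntegerTreeSum

/-- The tree sum for integer weights of the leaves. -/
noncomputable def intTreeSum (S : Multiset ℤ) : ℚ :=
  treeSum (fun v : ℤ => 0 < v) (Int.castAddHom ℚ) S

/-- The contribution of a branch with a positive flow towards the last vertex. -/
noncomputable def posBranch (S : Multiset ℤ) : ℚ :=
  posBranchAt (AddMonoidHom.id ℤ) (Int.castAddHom ℚ) S

theorem posBranch_singleton {v : ℤ} (h : 0 < v) : posBranch {v} = 1 :=
  posBranchAt_singleton _ _ h

theorem posBranch_of_pos {S : Multiset ℤ} (h : 0 < S.sum) (hc : 2 ≤ Multiset.card S) :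
    posBranch S = (S.sum : ℚ) * intTreeSum (-S.sum ::ₘ S) :=
  posBranchAt_of_pos _ _ h hc

theorem mul_intTreeSum {γ : Type*} [DecidableEq γ] {P : Multiset ℤ} (hP : ∀ v ∈ P, 0 < v)
    (C : Finset γ) (n : γ → ℤ) (hn : ∀ c ∈ C, n c < 0) (h0 : (P + C.val.map n).sum = 0) :
    2 * ((Multiset.card (P + C.val.map n) : ℚ) - 2) * intTreeSum (P + C.val.map n) =
      ∑ c ∈ C, splitSum (fun A B => posBranch A * posBranch B) (P + (C.erase c).val.map n) +
      ∑ c ∈ C, ∑ c' ∈ C.erase c, posBranch (P + ((C.erase c).erase c').val.map n) :=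
  mul_treeSum (s := AddMonoidHom.id ℤ) (z := Int.castAddHom ℚ) hP C n hn h0

end IntegerTreeSum

/-! ### Sums over lists and shuffles. -/

section ListSum

variable {β : Type*}

/-- The sum of `Φ l` over all lists `l` of length `k` with entries in `A`. -/
def listSum (A : Finset β) : ℕ → (List β → ℚ) → ℚ
  | 0, Φ => Φ []
  | k + 1, Φ => ∑ a ∈ A, listSum A k fun l => Φ (a :: l)

variable {A : Finset β} {k : ℕ} {Φ Ψ : List β → ℚ}

theorem listSum_congr (h : ∀ l : List β, l.length = k → (∀ a ∈ l, a ∈ A) → Φ l = Ψ l) :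
    listSum A k Φ = listSum A k Ψ := by
  induction k generalizing Φ Ψ with
  | zero => exact h [] rfl (by simp)
  | succ k ih =>
    refine Finset.sum_congr rfl fun a ha => ih fun l hl hA => h _ (by simp [hl]) ?_
    intro b hb
    rcases List.mem_cons.1 hb with rfl | hb
    · exact ha
    · exact hA b hb

@[simp] theorem listSum_zero_fun : listSum A k (fun _ => 0) = 0 := by
  induction k with
  | zero => rfl
  | succ k ih => simp [listSum, ih]

theorem listSum_eq_zero (h : ∀ l : List β, l.length = k → (∀ a ∈ l, a ∈ A) → Φ l = 0) :
    listSum A k Φ = 0 := by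
  rw [listSum_congr (Ψ := fun _ => 0) h, listSum_zero_fun]

theorem listSum_add_fun :
    listSum A k (fun l => Φ l + Ψ l) = listSum A k Φ + listSum A k Ψ := by
  induction k generalizing Φ Ψ with
  | zero => rfl
  | succ k ih => simp only [listSum, ih, Finset.sum_add_distrib]

theorem listSum_finset_sum {ι : Type*} (s : Finset ι) (Θ : ι → List β → ℚ) :
    listSum A k (fun l => ∑ i ∈ s, Θ i l) = ∑ i ∈ s, listSum A k (Θ i) := by
  classical
  induction s using Finset.induction_on with
  | empty => simp
  | insert a s ha ih => simp only [Finset.sum_insert ha, listSum_add_fun, ih]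

theorem splitSum_finset_sum {M ι R : Type*} [AddCommMonoid R] (s : Finset ι)
    (Θ : ι → Multiset M → Multiset M → R) (x : Multiset M) :
    splitSum (fun X Y => ∑ i ∈ s, Θ i X Y) x = ∑ i ∈ s, splitSum (Θ i) x := by
  classical
  induction s using Finset.induction_on with
  | empty => exact splitSum_eq_zero fun _ _ _ => rfl
  | insert a s ha ih => simp only [Finset.sum_insert ha, splitSum_add_fun, ih]

theorem listSum_splitSum {M : Type*} (Θ : Multiset M → Multiset M → List β → ℚ) (x : Multiset M) :
    listSum A k (fun l => splitSum (fun X Y => Θ X Y l) x) =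
      splitSum (fun X Y => listSum A k (Θ X Y)) x := by
  induction k generalizing Θ with
  | zero => rfl
  | succ k ih => simp only [listSum, ih, splitSum_finset_sum]

theorem listSum_of_subset {A' : Finset β} (hA : A' ⊆ A)
    (h : ∀ l : List β, (∀ a ∈ l, a ∈ A) → (∃ a ∈ l, a ∉ A') → Φ l = 0) :
    listSum A k Φ = listSum A' k Φ := by
  induction k generalizing Φ with
  | zero => rfl
  | succ k ih =>
    rw [listSum, listSum, ← Finset.sum_subset hA]
    · refine Finset.sum_congr rfl fun a ha => ih fun l hl ⟨b, hb, hb'⟩ => h _ ?_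
        ⟨b, List.mem_cons_of_mem _ hb, hb'⟩
      intro c hc
      rcases List.mem_cons.1 hc with rfl | hc
      · exact hA ha
      · exact hl c hc
    · intro a ha ha'
      refine listSum_eq_zero fun l _ hl => h _ ?_ ⟨a, List.mem_cons_self, ha'⟩
      intro c hc
      rcases List.mem_cons.1 hc with rfl | hc
      · exact ha
      · exact hl c hc

/-- Lists with entries in a disjoint union are shuffles. -/
theorem listSum_union [DecidableEq β] {B : Finset β} (hAB : Disjoint A B) :
    listSum (A ∪ B) k (fun l => Φ (l.filter (· ∈ A)) * Ψ (l.filter (· ∈ B))) =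
      ∑ p ∈ Finset.HasAntidiagonal.antidiagonal k, (k.choose p.1 : ℚ) * (listSum A p.1 Φ * listSum B p.2 Ψ) := by
  induction k generalizing Φ Ψ with
  | zero => simp [listSum]
  | succ k ih =>
    -- Pascal's rule: the two summands correspond to a first entry in `B` or in `A`.
    have e := Finset.sum_antidiagonal_choose_succ_mul (R := ℚ)
      (fun i j => listSum A i Φ * listSum B j Ψ) k
    beta_reduce at e
    rw [e, listSum,
      Finset.sum_union hAB, add_comm]
    congr 1
    · have : ∀ b ∈ B, listSum (A ∪ B) k (fun l => Φ ((b :: l).filter (· ∈ A)) *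
          Ψ ((b :: l).filter (· ∈ B))) = ∑ p ∈ Finset.HasAntidiagonal.antidiagonal k,
          (k.choose p.1 : ℚ) * (listSum A p.1 Φ * listSum B p.2 fun l => Ψ (b :: l)) := by
        intro b hb
        have hbA : b ∉ A := fun h => Finset.disjoint_left.1 hAB h hb
        rw [← ih]
        simp [hb, hbA]
      rw [Finset.sum_congr rfl this, Finset.sum_comm]
      refine Finset.sum_congr rfl fun p _ => ?_
      simp only [listSum, Finset.mul_sum]
    · have : ∀ a ∈ A, listSum (A ∪ B) k (fun l => Φ ((a :: l).filter (· ∈ A)) *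
          Ψ ((a :: l).filter (· ∈ B))) = ∑ p ∈ Finset.HasAntidiagonal.antidiagonal k,
          (k.choose p.1 : ℚ) * (listSum A p.1 (fun l => Φ (a :: l)) * listSum B p.2 Ψ) := by
        intro a ha
        have haB : a ∉ B := fun h => Finset.disjoint_left.1 hAB ha h
        rw [← ih]
        simp [ha, haB]
      rw [Finset.sum_congr rfl this, Finset.sum_comm]
      refine Finset.sum_congr rfl fun p hp => ?_
      have hk : (k.choose p.2 : ℚ) = k.choose p.1 := by
        rw [← Finset.HasAntidiagonal.mem_antidiagonal.1 hp, Nat.choose_symm_add]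
      simp only [listSum, Finset.mul_sum, Finset.sum_mul, hk]

end ListSum

/-! ### Counting the matchings of two multisets. -/

section Matchings

variable {β : Type*} [DecidableEq β]

/-- The number of bijections between two multisets. -/
noncomputable def matchCount (c x : Multiset β) : ℚ :=
  if c = x then ((∏ v ∈ x.toFinset, (x.count v).factorial : ℕ) : ℚ) else 0

/-- Choose the partner of the new element; there are `c.count v` possibilities. -/
theorem matchCount_cons (c x : Multiset β) (v : β) :
    matchCount c (v ::ₘ x) = c.count v * matchCount (c.erase v) x := by
  unfold matchCount
  by_cases h : c = v ::ₘ x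
  · rw [if_pos h, h, Multiset.erase_cons_head, if_pos rfl]
    have e : (v ::ₘ x).toFinset = insert v (x.toFinset.erase v) := by
      ext w
      simp only [Multiset.toFinset_cons, Finset.mem_insert, Finset.mem_erase]
      tauto
    have e2 : ∏ w ∈ x.toFinset, (x.count w).factorial =
        (x.count v).factorial * ∏ w ∈ x.toFinset.erase v, (x.count w).factorial := by
      by_cases hv : v ∈ x.toFinset
      · rw [Finset.mul_prod_erase _ (fun w => (x.count w).factorial) hv]
      · rw [Multiset.mem_toFinset] at hv
        rw [Multiset.count_eq_zero_of_notMem hv, Finset.erase_eq_of_notMem (by simpa using hv)]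
        simp
    rw [e, Finset.prod_insert (Finset.notMem_erase _ _), e2, Multiset.count_cons_self,
      Nat.factorial_succ]
    rw [Finset.prod_congr rfl fun w hw => by
      rw [Multiset.count_cons_of_ne (Finset.ne_of_mem_erase hw)]]
    push_cast
    ring
  · rw [if_neg h]
    by_cases hv : v ∈ c
    · rw [if_neg, mul_zero]
      intro h'
      exact h (by rw [← h', Multiset.cons_erase hv])
    · rw [Multiset.count_eq_zero_of_notMem hv]
      simp

/-- A matching of `c₁ + c₂` with `x` is determined by which elements of `x` are matched with `c₁`,
and two matchings. This makes the labelled count multiplicative over the orbits. -/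
theorem matchCount_add (c₁ c₂ x : Multiset β) :
    matchCount (c₁ + c₂) x = splitSum (fun x₁ x₂ => matchCount c₁ x₁ * matchCount c₂ x₂) x := by
  induction x using Multiset.induction generalizing c₁ c₂ with
  | empty =>
    rw [splitSum_zero]
    unfold matchCount
    simp only [Multiset.toFinset_zero, Finset.prod_empty, Nat.cast_one, ite_mul, one_mul, zero_mul]
    by_cases h1 : c₁ = 0 <;> by_cases h2 : c₂ = 0 <;> simp [h1, h2]
  | cons v x ih =>
    rw [splitSum_cons, matchCount_cons, Multiset.count_add]
    have e1 : splitSum (fun A B => matchCount c₁ A * matchCount c₂ (v ::ₘ B)) x =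
        c₂.count v * matchCount (c₁ + c₂.erase v) x := by
      rw [ih, mul_splitSum]
      exact splitSum_congr fun A B _ => by rw [matchCount_cons]; ring
    have e2 : splitSum (fun A B => matchCount c₁ (v ::ₘ A) * matchCount c₂ B) x =
        c₁.count v * matchCount (c₁.erase v + c₂) x := by
      rw [ih, mul_splitSum]
      exact splitSum_congr fun A B _ => by rw [matchCount_cons]; ring
    rw [e1, e2]
    by_cases h1 : v ∈ c₁
    · rw [Multiset.erase_add_left_pos _ h1]
      by_cases h2 : v ∈ c₂
      · rw [← Multiset.erase_add_left_pos _ h1, ← Multiset.erase_add_right_pos _ h2]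
        push_cast; ring
      · rw [Multiset.count_eq_zero_of_notMem h2]
        simp
    · rw [Multiset.erase_add_right_neg _ h1, Multiset.count_eq_zero_of_notMem h1]
      simp

end Matchings

/-! ### Cycles, and how a transposition cuts and joins them. -/

section Cycles

open Equiv

variable {α : Type*} [Fintype α] [DecidableEq α]

/-- The set of points of the cycle of `a`. -/
def cycleSet (σ : Perm α) (a : α) : Finset α := {b | σ.SameCycle a b}

/-- The set of cycles of `σ` that meet `O`. -/
def cyclesIn (σ : Perm α) (O : Finset α) : Finset (Finset α) := O.image (cycleSet σ)

/-- `O` is invariant under `g`. -/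
def IsInv (g : Perm α) (O : Finset α) : Prop := ∀ a, g a ∈ O ↔ a ∈ O

variable {σ : Perm α} {a b c : α} {O U V : Finset α}

@[simp] theorem mem_cycleSet : b ∈ cycleSet σ a ↔ σ.SameCycle a b := by simp [cycleSet]

@[simp] theorem sameCycle_self : σ.SameCycle a a := Perm.SameCycle.refl _ _

theorem self_mem_cycleSet : a ∈ cycleSet σ a := by simp

theorem cycleSet_eq_iff : cycleSet σ a = cycleSet σ b ↔ σ.SameCycle a b := by
  constructor
  · intro h
    rw [← mem_cycleSet, h]
    exact self_mem_cycleSet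
  · intro h
    ext c
    simp only [mem_cycleSet]
    exact ⟨fun h' => h.symm.trans h', fun h' => h.trans h'⟩

theorem isInv_cycleSet : IsInv σ (cycleSet σ a) := fun b => by simp

theorem IsInv.mem_of_sameCycle (h : IsInv σ O) (ha : a ∈ O) (hab : σ.SameCycle a b) : b ∈ O := by
  obtain ⟨n, rfl⟩ := hab.exists_nat_pow_eq
  induction n with
  | zero => simpa
  | succ n ih =>
    rw [pow_succ', Perm.mul_apply, h]
    exact ih ⟨n, rfl⟩

theorem IsInv.cycleSet_subset (h : IsInv σ O) (ha : a ∈ O) : cycleSet σ a ⊆ O :=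
  fun _ hb => h.mem_of_sameCycle ha (mem_cycleSet.1 hb)

theorem IsInv.union (hU : IsInv σ U) (hV : IsInv σ V) : IsInv σ (U ∪ V) := fun a => by
  simp [hU a, hV a]

theorem IsInv.inter (hU : IsInv σ U) (hV : IsInv σ V) : IsInv σ (U ∩ V) := fun a => by
  simp [hU a, hV a]

theorem IsInv.sdiff (hU : IsInv σ U) (hV : IsInv σ V) : IsInv σ (U \ V) := fun a => by
  simp [hU a, hV a]

theorem isInv_biUnion {D : Finset (Finset α)} (h : ∀ d ∈ D, IsInv σ d) :
    IsInv σ (D.biUnion id) := fun a => by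
  simp only [Finset.mem_biUnion, id]
  exact ⟨fun ⟨d, hd, ha⟩ => ⟨d, hd, (h d hd a).1 ha⟩, fun ⟨d, hd, ha⟩ => ⟨d, hd, (h d hd a).2 ha⟩⟩

theorem isInv_swap_iff : IsInv (swap a b) O ↔ (a ∈ O ↔ b ∈ O) := by
  constructor
  · intro h
    have := h a
    rw [swap_apply_left] at this
    exact this.symm
  · intro h c
    by_cases h1 : c = a
    · subst h1; rw [swap_apply_left, h]
    by_cases h2 : c = b
    · subst h2; rw [swap_apply_right, h]
    rw [swap_apply_of_ne_of_ne h1 h2]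

theorem IsInv.mul {τ : Perm α} (h : IsInv τ O) (h' : IsInv σ O) : IsInv (τ * σ) O := fun a => by
  rw [Perm.mul_apply, h, h']

theorem isInv_of_mul {τ : Perm α} (h : IsInv τ O) (h' : IsInv (τ * σ) O) : IsInv σ O := fun a => by
  rw [← h (σ a), ← h' a, Perm.mul_apply]

theorem mem_of_mem_cyclesIn (hO : IsInv σ O) {d : Finset α} (hd : d ∈ cyclesIn σ O)
    (ha : a ∈ d) : a ∈ O := by
  obtain ⟨b, hb, rfl⟩ := Finset.mem_image.1 hd
  exact hO.cycleSet_subset hb ha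

theorem eq_cycleSet_of_mem {d : Finset α} (hd : d ∈ cyclesIn σ O) (ha : a ∈ d) :
    d = cycleSet σ a := by
  obtain ⟨b, hb, rfl⟩ := Finset.mem_image.1 hd
  exact cycleSet_eq_iff.2 (mem_cycleSet.1 ha)

theorem isInv_of_mem_cyclesIn {d : Finset α} (hd : d ∈ cyclesIn σ O) : IsInv σ d := by
  obtain ⟨b, hb, rfl⟩ := Finset.mem_image.1 hd
  exact isInv_cycleSet

theorem nonempty_of_mem_cyclesIn {d : Finset α} (hd : d ∈ cyclesIn σ O) : d.Nonempty := by
  obtain ⟨b, hb, rfl⟩ := Finset.mem_image.1 hd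
  exact ⟨b, self_mem_cycleSet⟩

theorem cycleSet_mem_cyclesIn (ha : a ∈ O) : cycleSet σ a ∈ cyclesIn σ O :=
  Finset.mem_image_of_mem _ ha

theorem pairwiseDisjoint_cyclesIn : (cyclesIn σ O : Set (Finset α)).PairwiseDisjoint id := by
  intro d hd e he hne
  refine Finset.disjoint_left.2 fun a ha ha' => hne ?_
  rw [eq_cycleSet_of_mem hd ha, eq_cycleSet_of_mem he ha']

theorem biUnion_cyclesIn (hO : IsInv σ O) : (cyclesIn σ O).biUnion id = O := by
  ext a
  simp only [Finset.mem_biUnion, id]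
  exact ⟨fun ⟨d, hd, ha⟩ => mem_of_mem_cyclesIn hO hd ha,
    fun ha => ⟨_, cycleSet_mem_cyclesIn ha, self_mem_cycleSet⟩⟩

theorem sum_cyclesIn {R : Type*} [AddCommMonoid R] (hO : IsInv σ O) (f : α → R) :
    ∑ a ∈ O, f a = ∑ d ∈ cyclesIn σ O, ∑ a ∈ d, f a := by
  conv_lhs => rw [← biUnion_cyclesIn hO]
  exact Finset.sum_biUnion pairwiseDisjoint_cyclesIn

theorem sum_card_cyclesIn (hO : IsInv σ O) : ∑ d ∈ cyclesIn σ O, d.card = O.card := by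
  rw [Finset.card_eq_sum_ones, sum_cyclesIn hO]
  simp

theorem cyclesIn_biUnion {D : Finset (Finset α)} (hD : D ⊆ cyclesIn σ O) :
    cyclesIn σ (D.biUnion id) = D := by
  ext d
  constructor
  · intro hd
    obtain ⟨a, ha, rfl⟩ := Finset.mem_image.1 hd
    obtain ⟨e, he, hae⟩ := Finset.mem_biUnion.1 ha
    rwa [← eq_cycleSet_of_mem (hD he) hae]
  · intro hd
    obtain ⟨a, ha⟩ := nonempty_of_mem_cyclesIn (hD hd)
    rw [eq_cycleSet_of_mem (hD hd) ha]
    exact cycleSet_mem_cyclesIn (Finset.mem_biUnion.2 ⟨d, hd, ha⟩)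

theorem cyclesIn_union : cyclesIn σ (U ∪ V) = cyclesIn σ U ∪ cyclesIn σ V := Finset.image_union _ _

theorem disjoint_cyclesIn (hU : IsInv σ U) (hV : IsInv σ V) (h : Disjoint U V) :
    Disjoint (cyclesIn σ U) (cyclesIn σ V) := by
  refine Finset.disjoint_left.2 fun d hd hd' => ?_
  obtain ⟨a, ha⟩ := nonempty_of_mem_cyclesIn hd
  exact Finset.disjoint_left.1 h (mem_of_mem_cyclesIn hU hd ha) (mem_of_mem_cyclesIn hV hd' ha)

theorem sameCycle_of_eqOn {σ' : Perm α} (hO : IsInv σ O) (h : ∀ a ∈ O, σ a = σ' a) (ha : a ∈ O)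
    (hab : σ.SameCycle a b) : σ'.SameCycle a b := by
  have key : ∀ n : ℕ, (σ ^ n) a = (σ' ^ n) a ∧ (σ ^ n) a ∈ O := by
    intro n
    induction n with
    | zero => simpa
    | succ n ih =>
      rw [pow_succ', pow_succ', Perm.mul_apply, Perm.mul_apply, ← ih.1, h _ ih.2, ← h _ ih.2]
      exact ⟨rfl, (hO _).2 ih.2⟩
  obtain ⟨n, rfl⟩ := hab.exists_nat_pow_eq
  rw [(key n).1]
  exact ⟨n, rfl⟩

theorem cycleSet_congr {σ' : Perm α} (hO : IsInv σ O) (h : ∀ a ∈ O, σ a = σ' a) (ha : a ∈ O) :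
    cycleSet σ a = cycleSet σ' a := by
  -- An injective map of a finite set into itself is onto, so `σ'` preserves membership in `O` in
  -- both directions.
  have hO' : IsInv σ' O := by
    have hcard : O.image σ' = O := by
      refine Finset.eq_of_subset_of_card_le ?_ ?_
      · intro x hx
        obtain ⟨y, hy, rfl⟩ := Finset.mem_image.1 hx
        rw [← h y hy]
        exact (hO y).2 hy
      · rw [Finset.card_image_of_injective _ σ'.injective]
    intro x
    constructor
    · intro hx
      rw [← hcard] at hx
      obtain ⟨y, hy, hyx⟩ := Finset.mem_image.1 hx
      rwa [← σ'.injective hyx]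
    · intro hx
      rw [← h x hx]
      exact (hO x).2 hx
  ext b
  simp only [mem_cycleSet]
  exact ⟨sameCycle_of_eqOn hO h ha, sameCycle_of_eqOn hO' (fun a ha => (h a ha).symm) ha⟩

theorem cyclesIn_congr {σ' : Perm α} (hO : IsInv σ O) (h : ∀ a ∈ O, σ a = σ' a) :
    cyclesIn σ O = cyclesIn σ' O :=
  Finset.image_congr fun _ ha => cycleSet_congr hO h ha

section SwapMul

theorem cycleSet_swap_mul_of_notMem (h1 : ¬ σ.SameCycle c a) (h2 : ¬ σ.SameCycle c b) :
    cycleSet (swap a b * σ) c = cycleSet σ c := by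
  refine (cycleSet_congr (O := cycleSet σ c) isInv_cycleSet ?_ self_mem_cycleSet).symm
  intro x hx
  rw [Perm.mul_apply, swap_apply_of_ne_of_ne]
  · rintro rfl
    exact h1 (by simpa using hx)
  · rintro rfl
    exact h2 (by simpa using hx)

/-- The right side is invariant under `swap a b * σ`, and under `swap a b` because it contains both
points; hence it is invariant under `σ`. Applying this also to `swap a b * σ` gives equality. -/
theorem cycleSet_swap_mul_union_subset :
    cycleSet σ a ∪ cycleSet σ b ⊆ cycleSet (swap a b * σ) a ∪ cycleSet (swap a b * σ) b := by
  have hi : IsInv (swap a b * σ) (cycleSet (swap a b * σ) a ∪ cycleSet (swap a b * σ) b) :=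
    isInv_cycleSet.union isInv_cycleSet
  have hi' : IsInv σ (cycleSet (swap a b * σ) a ∪ cycleSet (swap a b * σ) b) :=
    isInv_of_mul (isInv_swap_iff.2 (by simp)) hi
  exact Finset.union_subset (hi'.cycleSet_subset (by simp)) (hi'.cycleSet_subset (by simp))

theorem swap_mul_swap_mul : swap a b * (swap a b * σ) = σ := by
  rw [← mul_assoc, swap_mul_self, one_mul]

theorem cycleSet_swap_mul_union :
    cycleSet (swap a b * σ) a ∪ cycleSet (swap a b * σ) b = cycleSet σ a ∪ cycleSet σ b := by
  refine Finset.Subset.antisymm ?_ cycleSet_swap_mul_union_subset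
  have := cycleSet_swap_mul_union_subset (σ := swap a b * σ) (a := a) (b := b)
  rwa [swap_mul_swap_mul] at this

/-- The transposition is not felt as long as the orbit of `a` meets neither `a` nor `b`. -/
theorem swap_mul_pow_apply {p : ℕ} (h : ∀ i, 0 < i → i < p → (σ ^ i) a ≠ a ∧ (σ ^ i) a ≠ b) :
    ∀ i < p, ((swap a b * σ) ^ i) a = (σ ^ i) a := by
  intro i
  induction i with
  | zero => simp
  | succ i ih =>
    intro hi
    rw [pow_succ', Perm.mul_apply, ih (by omega), Perm.mul_apply, ← Perm.mul_apply σ, ← pow_succ',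
      swap_apply_of_ne_of_ne (h _ (by omega) hi).1 (h _ (by omega) hi).2]

theorem swap_mul_pow_apply_last {p : ℕ} (hp : 0 < p)
    (h : ∀ i, 0 < i → i < p → (σ ^ i) a ≠ a ∧ (σ ^ i) a ≠ b) :
    ((swap a b * σ) ^ p) a = swap a b ((σ ^ p) a) := by
  obtain ⟨q, rfl⟩ : ∃ q, p = q + 1 := ⟨p - 1, by omega⟩
  rw [pow_succ', Perm.mul_apply, swap_mul_pow_apply h q (by omega), Perm.mul_apply,
    ← Perm.mul_apply σ, ← pow_succ']

/-- The length of the cycle of `a`. -/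
noncomputable def cycleLen (σ : Perm α) (a : α) : ℕ := Function.minimalPeriod σ a

theorem cycleLen_pos : 0 < cycleLen σ a := by
  refine Function.minimalPeriod_pos_of_mem_periodicPts ?_
  refine Function.mk_mem_periodicPts (orderOf_pos σ) ?_
  rw [Function.IsPeriodicPt, Function.IsFixedPt, ← Perm.coe_pow, pow_orderOf_eq_one]
  rfl

theorem pow_cycleLen : (σ ^ cycleLen σ a) a = a := by
  rw [Perm.coe_pow]
  exact Function.iterate_minimalPeriod

theorem pow_injOn_cycleLen {i j : ℕ} (hi : i < cycleLen σ a) (hj : j < cycleLen σ a)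
    (h : (σ ^ i) a = (σ ^ j) a) : i = j := by
  rw [Perm.coe_pow, Perm.coe_pow] at h
  exact Function.iterate_injOn_Iio_minimalPeriod hi hj h

theorem SameCycle.exists_lt_cycleLen (h : σ.SameCycle a b) : ∃ i < cycleLen σ a, (σ ^ i) a = b := by
  obtain ⟨n, rfl⟩ := h.exists_nat_pow_eq
  refine ⟨n % cycleLen σ a, Nat.mod_lt _ cycleLen_pos, ?_⟩
  rw [Perm.coe_pow, Perm.coe_pow]
  exact Function.iterate_mod_minimalPeriod_eq

theorem cycleSet_eq_image : cycleSet σ a = (range (cycleLen σ a)).image fun i => (σ ^ i) a := by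
  ext b
  simp only [mem_cycleSet, Finset.mem_image, Finset.mem_range]
  exact ⟨SameCycle.exists_lt_cycleLen, fun ⟨i, _, h⟩ => ⟨i, by simpa using h⟩⟩

theorem card_cycleSet : (cycleSet σ a).card = cycleLen σ a := by
  rw [cycleSet_eq_image, Finset.card_image_of_injOn, Finset.card_range]
  intro i hi j hj h
  exact pow_injOn_cycleLen (by simpa using hi) (by simpa using hj) h

/-- The orbit of `a` under `σ` avoids `b`, so with the transposition its first return to `a` is
redirected to `b`. -/
theorem sameCycle_swap_mul (h : ¬ σ.SameCycle a b) : (swap a b * σ).SameCycle a b := by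
  have hne : ∀ i, 0 < i → i < cycleLen σ a → (σ ^ i) a ≠ a ∧ (σ ^ i) a ≠ b := by
    intro i h0 hi
    constructor
    · intro h'
      have := pow_injOn_cycleLen hi cycleLen_pos (a := a) (by simpa using h')
      omega
    · rintro rfl
      exact h ⟨i, by simp⟩
  refine ⟨cycleLen σ a, ?_⟩
  have := swap_mul_pow_apply_last cycleLen_pos hne
  rw [zpow_natCast, this, pow_cycleLen, swap_apply_left]

/-- The arrival at `(σ ^ p) a` is redirected to `a`, which closes the cycle after `p` steps. In
particular each length below the old one arises from exactly one second point. -/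
theorem cycleLen_swap_mul {p : ℕ} (hp : 0 < p) (hp' : p < cycleLen σ a) :
    cycleLen (swap a ((σ ^ p) a) * σ) a = p ∧
      ¬ (swap a ((σ ^ p) a) * σ).SameCycle a ((σ ^ p) a) := by
  set b := (σ ^ p) a with hb
  have hne : ∀ i, 0 < i → i < p → (σ ^ i) a ≠ a ∧ (σ ^ i) a ≠ b := by
    intro i h0 hi
    constructor
    · intro h'
      have := pow_injOn_cycleLen (hi.trans hp') cycleLen_pos (a := a) (by simpa using h')
      omega
    · intro h'
      have := pow_injOn_cycleLen (hi.trans hp') hp' h'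
      omega
  have hlast : ((swap a b * σ) ^ p) a = a := by
    rw [swap_mul_pow_apply_last hp hne, ← hb, swap_apply_right]
  have hle : cycleLen (swap a b * σ) a ≤ p := by
    refine Function.IsPeriodicPt.minimalPeriod_le hp ?_
    rw [Function.IsPeriodicPt, Function.IsFixedPt, ← Perm.coe_pow, hlast]
  have hge : cycleLen (swap a b * σ) a = p := by
    by_contra hcon
    have hlt := lt_of_le_of_ne hle hcon
    have := swap_mul_pow_apply hne _ hlt
    rw [pow_cycleLen] at this
    exact (hne _ cycleLen_pos hlt).1 this.symm
  refine ⟨hge, fun h => ?_⟩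
  obtain ⟨i, hi, h'⟩ := SameCycle.exists_lt_cycleLen h
  rw [hge] at hi
  rw [swap_mul_pow_apply hne i hi, hb] at h'
  have := pow_injOn_cycleLen (hi.trans hp') hp' h'
  omega

theorem not_sameCycle_swap_mul (hab : a ≠ b) (h : σ.SameCycle a b) :
    ¬ (swap a b * σ).SameCycle a b := by
  obtain ⟨p, hp, rfl⟩ := SameCycle.exists_lt_cycleLen h
  refine (cycleLen_swap_mul (Nat.pos_of_ne_zero ?_) hp).2
  rintro rfl
  simp at hab

/-- The sum over the second point of a transposition that cuts a cycle. -/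
theorem sum_cut_cycle (f : ℕ → ℚ) :
    ∑ b ∈ (cycleSet σ a).erase a, f (cycleSet (swap a b * σ) a).card =
      ∑ p ∈ Finset.Ico 1 (cycleSet σ a).card, f p := by
  symm
  refine Finset.sum_bij (fun p _ => (σ ^ p) a) ?_ ?_ ?_ ?_
  · intro p hp
    rw [card_cycleSet, Finset.mem_Ico] at hp
    refine Finset.mem_erase.2 ⟨fun h => ?_, mem_cycleSet.2 ⟨p, by simp⟩⟩
    have := pow_injOn_cycleLen hp.2 cycleLen_pos (a := a) (by simpa using h)
    omega
  · intro p hp q hq h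
    rw [card_cycleSet, Finset.mem_Ico] at hp hq
    exact pow_injOn_cycleLen hp.2 hq.2 h
  · intro b hb
    obtain ⟨hne, hb⟩ := Finset.mem_erase.1 hb
    obtain ⟨p, hp, rfl⟩ := SameCycle.exists_lt_cycleLen (mem_cycleSet.1 hb)
    refine ⟨p, ?_, rfl⟩
    rw [card_cycleSet, Finset.mem_Ico]
    refine ⟨Nat.pos_of_ne_zero ?_, hp⟩
    rintro rfl
    simp at hne
  · intro p hp
    rw [card_cycleSet, Finset.mem_Ico] at hp
    rw [card_cycleSet, (cycleLen_swap_mul hp.1 hp.2).1]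

/-- A transposition of points of different cycles joins these cycles. -/
theorem cyclesIn_join (ha : a ∈ O) (hb : b ∈ O) (h : ¬ σ.SameCycle a b) :
    cyclesIn (swap a b * σ) O = insert (cycleSet σ a ∪ cycleSet σ b)
      (((cyclesIn σ O).erase (cycleSet σ a)).erase (cycleSet σ b)) := by
  have hs := sameCycle_swap_mul h
  have hu : cycleSet (swap a b * σ) a = cycleSet σ a ∪ cycleSet σ b := by
    rw [← cycleSet_swap_mul_union, ← cycleSet_eq_iff.2 hs, Finset.union_self]
  have hout : ∀ c, ¬ σ.SameCycle c a → ¬ σ.SameCycle c b →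
      cycleSet (swap a b * σ) c = cycleSet σ c := fun c => cycleSet_swap_mul_of_notMem
  ext d
  simp only [Finset.mem_insert, Finset.mem_erase]
  constructor
  · intro hd
    obtain ⟨c, hc, rfl⟩ := Finset.mem_image.1 hd
    by_cases h1 : σ.SameCycle c a
    · left
      rw [← hu, cycleSet_eq_iff]
      have : c ∈ cycleSet (swap a b * σ) a := by
        rw [hu]; exact Finset.mem_union_left _ (mem_cycleSet.2 h1.symm)
      exact (mem_cycleSet.1 this).symm
    by_cases h2 : σ.SameCycle c b
    · left
      rw [← hu, cycleSet_eq_iff]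
      have : c ∈ cycleSet (swap a b * σ) a := by
        rw [hu]; exact Finset.mem_union_right _ (mem_cycleSet.2 h2.symm)
      exact (mem_cycleSet.1 this).symm
    right
    rw [hout c h1 h2, Ne, Ne, cycleSet_eq_iff, cycleSet_eq_iff]
    exact ⟨h2, h1, cycleSet_mem_cyclesIn hc⟩
  · rintro (rfl | ⟨h2, h1, hd⟩)
    · rw [← hu]; exact cycleSet_mem_cyclesIn ha
    · obtain ⟨c, hc, rfl⟩ := Finset.mem_image.1 hd
      rw [Ne, cycleSet_eq_iff] at h1 h2
      rw [← hout c h1 h2]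
      exact cycleSet_mem_cyclesIn hc

/-- A transposition of points of one cycle cuts this cycle. -/
theorem cyclesIn_cut (ha : a ∈ O) (hb : b ∈ O) (h : σ.SameCycle a b) :
    cyclesIn (swap a b * σ) O = insert (cycleSet (swap a b * σ) a)
      (insert (cycleSet (swap a b * σ) b) ((cyclesIn σ O).erase (cycleSet σ a))) := by
  have hu : cycleSet (swap a b * σ) a ∪ cycleSet (swap a b * σ) b = cycleSet σ a := by
    rw [cycleSet_swap_mul_union, ← cycleSet_eq_iff.2 h, Finset.union_self]
  have hout : ∀ c, ¬ σ.SameCycle c a → cycleSet (swap a b * σ) c = cycleSet σ c :=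
    fun c hc => cycleSet_swap_mul_of_notMem hc fun h' => hc (h'.trans h.symm)
  ext d
  simp only [Finset.mem_insert, Finset.mem_erase]
  constructor
  · intro hd
    obtain ⟨c, hc, rfl⟩ := Finset.mem_image.1 hd
    by_cases h1 : σ.SameCycle c a
    · have : c ∈ cycleSet σ a := mem_cycleSet.2 h1.symm
      rw [← hu, Finset.mem_union, mem_cycleSet, mem_cycleSet] at this
      rcases this with h' | h'
      · exact Or.inl (cycleSet_eq_iff.2 h'.symm)
      · exact Or.inr (Or.inl (cycleSet_eq_iff.2 h'.symm))
    · right; right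
      rw [hout c h1, Ne, cycleSet_eq_iff]
      exact ⟨h1, cycleSet_mem_cyclesIn hc⟩
  · rintro (rfl | rfl | ⟨h1, hd⟩)
    · exact cycleSet_mem_cyclesIn ha
    · exact cycleSet_mem_cyclesIn hb
    · obtain ⟨c, hc, rfl⟩ := Finset.mem_image.1 hd
      rw [Ne, cycleSet_eq_iff] at h1
      rw [← hout c h1]
      exact cycleSet_mem_cyclesIn hc

end SwapMul

end Cycles

/-! ### Orbits of the generated group. -/

section Components

open Equiv

variable {α : Type*} [Fintype α] [DecidableEq α]

/-- `O` is an orbit of the group generated by `gs`. -/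
def IsComponent (gs : List (Perm α)) (O : Finset α) : Prop :=
  O.Nonempty ∧ (∀ g ∈ gs, IsInv g O) ∧
    ∀ V ⊆ O, V.Nonempty → (∀ g ∈ gs, IsInv g V) → V = O

variable {gs : List (Perm α)} {O U V : Finset α} {ρ : Perm α} {a b : α}

theorem IsComponent.eq_of_mem (hU : IsComponent gs U) (hV : IsComponent gs V) (ha : a ∈ U)
    (ha' : a ∈ V) : U = V := by
  have hne : (U ∩ V).Nonempty := ⟨a, Finset.mem_inter.2 ⟨ha, ha'⟩⟩
  have hi : ∀ g ∈ gs, IsInv g (U ∩ V) := fun g hg => (hU.2.1 g hg).inter (hV.2.1 g hg)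
  rw [← hU.2.2 _ Finset.inter_subset_left hne hi]
  exact hV.2.2 _ Finset.inter_subset_right hne hi

/-- Take an invariant set containing `a` of least size. A smaller invariant subset, or its
complement in the set, would contain `a`. -/
theorem exists_isComponent (hO : ∀ g ∈ gs, IsInv g O) (ha : a ∈ O) :
    ∃ U ⊆ O, a ∈ U ∧ IsComponent gs U := by
  classical
  obtain ⟨U, hU, hmin⟩ := Finset.exists_min_image
    ({U ∈ O.powerset | a ∈ U ∧ ∀ g ∈ gs, IsInv g U}) Finset.card
    ⟨O, by simp only [Finset.mem_filter, Finset.mem_powerset]; exact ⟨subset_rfl, ha, hO⟩⟩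
  simp only [Finset.mem_filter, Finset.mem_powerset] at hU hmin
  refine ⟨U, hU.1, hU.2.1, ⟨a, hU.2.1⟩, hU.2.2, fun V hVU hV hi => ?_⟩
  by_cases haV : a ∈ V
  · exact Finset.eq_of_subset_of_card_le hVU (hmin V ⟨hVU.trans hU.1, haV, hi⟩)
  · exfalso
    have := hmin (U \ V) ⟨Finset.sdiff_subset.trans hU.1, Finset.mem_sdiff.2 ⟨hU.2.1, haV⟩,
      fun g hg => (hU.2.2 g hg).sdiff (hi g hg)⟩
    rw [Finset.card_sdiff_of_subset hVU] at this
    have h1 := Finset.card_pos.2 hV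
    have h2 := Finset.card_le_card hVU
    omega

theorem isInv_cons_swap_iff :
    (∀ g ∈ ρ :: swap a b :: gs, IsInv g V) ↔
      (∀ g ∈ (swap a b * ρ) :: gs, IsInv g V) ∧ (a ∈ V ↔ b ∈ V) := by
  simp only [List.forall_mem_cons]
  constructor
  · rintro ⟨h1, h2, h3⟩
    exact ⟨⟨h2.mul h1, h3⟩, isInv_swap_iff.1 h2⟩
  · rintro ⟨⟨h1, h2⟩, h3⟩
    exact ⟨isInv_of_mul (isInv_swap_iff.2 h3) h1, isInv_swap_iff.2 h3, h2⟩

/-- Sets invariant under `swap a b * ρ` contain both points or neither, so the transposition imposes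
no further condition. -/
theorem isComponent_cons_swap_of_sameCycle (h : (swap a b * ρ).SameCycle a b) :
    IsComponent (ρ :: swap a b :: gs) O ↔ IsComponent ((swap a b * ρ) :: gs) O := by
  have key : ∀ V, (∀ g ∈ ρ :: swap a b :: gs, IsInv g V) ↔
      (∀ g ∈ (swap a b * ρ) :: gs, IsInv g V) := by
    intro V
    rw [isInv_cons_swap_iff, and_iff_left_of_imp]
    intro hV
    have := hV _ List.mem_cons_self
    exact ⟨fun ha => this.mem_of_sameCycle ha h, fun hb => this.mem_of_sameCycle hb h.symm⟩
  unfold IsComponent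
  simp only [key]

/-- The two sets of cycles that arise when a cycle is cut. -/
theorem cut_cycle (ha : a ∈ O) (hb : b ∈ O) (hab : a ≠ b) (h : ρ.SameCycle a b) (hO : IsInv ρ O) :
    cycleSet (swap a b * ρ) a ∉ insert (cycleSet (swap a b * ρ) b)
      ((cyclesIn ρ O).erase (cycleSet ρ a)) ∧
    cycleSet (swap a b * ρ) b ∉ (cyclesIn ρ O).erase (cycleSet ρ a) ∧
    IsInv (swap a b * ρ) O ∧
    ∀ D ⊆ (cyclesIn ρ O).erase (cycleSet ρ a),
      insert (cycleSet (swap a b * ρ) a) D ⊆ cyclesIn (swap a b * ρ) O ∧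
      insert (cycleSet (swap a b * ρ) b) (((cyclesIn ρ O).erase (cycleSet ρ a)) \ D) ⊆
        cyclesIn (swap a b * ρ) O ∧
      (insert (cycleSet (swap a b * ρ) a) D).biUnion id ∪ (insert (cycleSet (swap a b * ρ) b)
        (((cyclesIn ρ O).erase (cycleSet ρ a)) \ D)).biUnion id = O ∧
      Disjoint ((insert (cycleSet (swap a b * ρ) a) D).biUnion id)
        ((insert (cycleSet (swap a b * ρ) b)
          (((cyclesIn ρ O).erase (cycleSet ρ a)) \ D)).biUnion id) := by
  set ρ' := swap a b * ρ with hρ'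
  set E := (cyclesIn ρ O).erase (cycleSet ρ a) with hE
  set ca := cycleSet ρ' a with hca
  set cb := cycleSet ρ' b with hcb
  have hC : cyclesIn ρ' O = insert ca (insert cb E) := cyclesIn_cut ha hb h
  have hO' : IsInv ρ' O := IsInv.mul (isInv_swap_iff.2 (by simp [ha, hb])) hO
  have hnot : ¬ ρ'.SameCycle a b := not_sameCycle_swap_mul hab h
  have hcaE : ca ∉ insert cb E := by
    rw [Finset.mem_insert, not_or]
    refine ⟨fun h' => hnot (cycleSet_eq_iff.1 h'), fun h' => ?_⟩
    have := eq_cycleSet_of_mem (Finset.mem_of_mem_erase h') (self_mem_cycleSet : a ∈ ca)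
    exact Finset.ne_of_mem_erase h' this
  have hcbE : cb ∉ E := by
    intro h'
    have := eq_cycleSet_of_mem (Finset.mem_of_mem_erase h') (self_mem_cycleSet : b ∈ cb)
    exact Finset.ne_of_mem_erase h' (this.trans (cycleSet_eq_iff.2 h.symm))
  have hsub1 : ∀ D ⊆ E, insert ca D ⊆ cyclesIn ρ' O := by
    intro D hD
    rw [hC]
    exact Finset.insert_subset_insert _ (hD.trans (Finset.subset_insert _ _))
  have hsub2 : ∀ D, insert cb (E \ D) ⊆ cyclesIn ρ' O := by
    intro D
    rw [hC]
    exact (Finset.insert_subset_insert _ Finset.sdiff_subset).trans (Finset.subset_insert _ _)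
  have hunion : ∀ D ⊆ E, (insert ca D).biUnion id ∪ (insert cb (E \ D)).biUnion id = O := by
    intro D hD
    rw [← Finset.union_biUnion, ← biUnion_cyclesIn hO', hC]
    congr 1
    ext d
    have := @hD d
    simp only [Finset.mem_union, Finset.mem_insert, Finset.mem_sdiff]
    tauto
  have hdisj : ∀ D ⊆ E, Disjoint ((insert ca D).biUnion id) ((insert cb (E \ D)).biUnion id) := by
    intro D hD
    rw [Finset.disjoint_left]
    intro v hv hv'
    obtain ⟨d, hd, hvd⟩ := Finset.mem_biUnion.1 hv
    obtain ⟨e, he, hve⟩ := Finset.mem_biUnion.1 hv'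
    have hde : d = e := by
      rw [eq_cycleSet_of_mem (hsub1 D hD hd) hvd, eq_cycleSet_of_mem (hsub2 D he) hve]
    subst hde
    rcases Finset.mem_insert.1 hd with rfl | hd
    · exact hcaE (Finset.insert_subset_insert _ Finset.sdiff_subset he)
    · rcases Finset.mem_insert.1 he with rfl | he
      · exact hcbE (hD hd)
      · exact (Finset.mem_sdiff.1 he).2 hd
  exact ⟨hcaE, hcbE, hO', fun D hD => ⟨hsub1 D hD, hsub2 D, hunion D hD, hdisj D hD⟩⟩

open Classical in
/-- Cutting a cycle either leaves an orbit connected, or cuts it into two orbits. -/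
theorem isComponent_cons_swap_cut (ha : a ∈ O) (hb : b ∈ O) (hab : a ≠ b)
    (h : ρ.SameCycle a b) (hO : IsInv ρ O) :
    (if IsComponent (ρ :: swap a b :: gs) O then (1 : ℚ) else 0) =
      (if IsComponent ((swap a b * ρ) :: gs) O then 1 else 0) +
      ∑ D ∈ ((cyclesIn ρ O).erase (cycleSet ρ a)).powerset,
        (if IsComponent ((swap a b * ρ) :: gs)
          ((insert (cycleSet (swap a b * ρ) a) D).biUnion id) then 1 else 0) *
        (if IsComponent ((swap a b * ρ) :: gs)
          ((insert (cycleSet (swap a b * ρ) b)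
            (((cyclesIn ρ O).erase (cycleSet ρ a)) \ D)).biUnion id) then 1 else 0) := by
  obtain ⟨hcaE, hcbE, hO', hfacts⟩ := cut_cycle ha hb hab h hO
  have hC := cyclesIn_cut ha hb h
  set ρ' := swap a b * ρ with hρ'
  set E := (cyclesIn ρ O).erase (cycleSet ρ a) with hE
  set ca := cycleSet ρ' a with hca
  set cb := cycleSet ρ' b with hcb
  have hcaE' : ca ∉ E := fun h' => hcaE (Finset.mem_insert_of_mem h')
  have hsub1 : ∀ D ⊆ E, insert ca D ⊆ cyclesIn ρ' O := fun D hD => (hfacts D hD).1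
  have hunion : ∀ D ⊆ E, (insert ca D).biUnion id ∪ (insert cb (E \ D)).biUnion id = O :=
    fun D hD => (hfacts D hD).2.2.1
  have hdisj : ∀ D ⊆ E, Disjoint ((insert ca D).biUnion id) ((insert cb (E \ D)).biUnion id) :=
    fun D hD => (hfacts D hD).2.2.2
  have ha1 : ∀ D : Finset (Finset α), a ∈ (insert ca D).biUnion id := fun D =>
    Finset.mem_biUnion.2 ⟨ca, Finset.mem_insert_self _ _, self_mem_cycleSet⟩
  have hb2 : ∀ D : Finset (Finset α), b ∈ (insert cb (E \ D)).biUnion id := fun D =>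
    Finset.mem_biUnion.2 ⟨cb, Finset.mem_insert_self _ _, self_mem_cycleSet⟩
  -- If `O` stays connected after the cut, all products in the sum vanish: an orbit containing `a`
  -- would be all of `O`, but the first part misses `b`.
  by_cases h1 : IsComponent (ρ' :: gs) O
  · have h2 : IsComponent (ρ :: swap a b :: gs) O := by
      refine ⟨h1.1, isInv_cons_swap_iff.2 ⟨h1.2.1, by simp [ha, hb]⟩, fun V hV hne hi => ?_⟩
      exact h1.2.2 V hV hne (isInv_cons_swap_iff.1 hi).1
    rw [if_pos h1, if_pos h2, Finset.sum_eq_zero, add_zero]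
    intro D hD
    rw [Finset.mem_powerset] at hD
    by_contra hne
    have h3 : IsComponent (ρ' :: gs) ((insert ca D).biUnion id) := by
      by_contra hc; exact hne (by rw [if_neg hc, zero_mul])
    have h4 := h3.eq_of_mem h1 (ha1 D) ha
    exact Finset.disjoint_left.1 (hdisj D hD) (h4 ▸ hb) (hb2 D)
  rw [if_neg h1, zero_add]
  by_cases h2 : IsComponent (ρ :: swap a b :: gs) O
  · rw [if_pos h2]
    have hOi := (isInv_cons_swap_iff.1 h2.2.1).1
    -- The orbits of `a` and `b` are disjoint, as otherwise the cut would have left `O` connected,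
    -- and they fill `O`. The cycles in the orbit of `a` other than its cut piece form the only `D`
    -- with a nonzero term.
    obtain ⟨U, hUO, haU, hU⟩ := exists_isComponent hOi ha
    obtain ⟨V, hVO, hbV, hV⟩ := exists_isComponent hOi hb
    have hbU : b ∉ U := by
      intro hbU
      refine h1 ?_
      rwa [h2.2.2 U hUO ⟨a, haU⟩ (isInv_cons_swap_iff.2 ⟨hU.2.1, by simp [haU, hbU]⟩)] at hU
    have hUV : Disjoint U V := by
      rw [Finset.disjoint_left]
      intro v hv hv'
      exact hbU (hU.eq_of_mem hV hv hv' ▸ hbV)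
    have haV : a ∉ V := Finset.disjoint_left.1 hUV haU
    have hUVO : U ∪ V = O := by
      refine h2.2.2 _ (Finset.union_subset hUO hVO) ⟨a, Finset.mem_union_left _ haU⟩
        (isInv_cons_swap_iff.2 ⟨fun g hg => (hU.2.1 g hg).union (hV.2.1 g hg), ?_⟩)
      simp [haU, hbV]
    have hUi : IsInv ρ' U := hU.2.1 _ List.mem_cons_self
    have hVi : IsInv ρ' V := hV.2.1 _ List.mem_cons_self
    set D₀ := (cyclesIn ρ' U).erase ca with hD₀
    have hcaU : ca ∈ cyclesIn ρ' U := cycleSet_mem_cyclesIn haU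
    have hcbV : cb ∈ cyclesIn ρ' V := cycleSet_mem_cyclesIn hbV
    have hdis := disjoint_cyclesIn hUi hVi hUV
    have hun : cyclesIn ρ' U ∪ cyclesIn ρ' V = insert ca (insert cb E) := by
      rw [← cyclesIn_union, hUVO, hC]
    have hD₀E : D₀ ⊆ E := by
      intro d hd
      have hd' := Finset.mem_of_mem_erase hd
      have hmem : d ∈ insert ca (insert cb E) := hun ▸ Finset.mem_union_left _ hd'
      rcases Finset.mem_insert.1 hmem with h' | hmem
      · exact absurd h' (Finset.ne_of_mem_erase hd)
      rcases Finset.mem_insert.1 hmem with h' | hmem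
      · subst h'
        exact absurd hcbV (Finset.disjoint_left.1 hdis hd')
      · exact hmem
    have hp1 : (insert ca D₀).biUnion id = U := by
      rw [hD₀, Finset.insert_erase hcaU, biUnion_cyclesIn hUi]
    have hp2 : (insert cb (E \ D₀)).biUnion id = V := by
      have e1 := hunion D₀ hD₀E
      have e2 := hdisj D₀ hD₀E
      rw [hp1] at e1 e2
      rw [← hUVO] at e1
      rw [← Finset.union_sdiff_cancel_left e2, e1, Finset.union_sdiff_cancel_left hUV]
    rw [Finset.sum_eq_single D₀]
    · rw [hp1, hp2, if_pos hU, if_pos hV, one_mul]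
    · intro D hD hne
      rw [Finset.mem_powerset] at hD
      by_contra hcon
      have h3 : IsComponent (ρ' :: gs) ((insert ca D).biUnion id) := by
        by_contra hc; exact hcon (by rw [if_neg hc, zero_mul])
      have h4 := h3.eq_of_mem hU (ha1 D) haU
      refine hne ?_
      have h5 := cyclesIn_biUnion (hsub1 D hD)
      rw [h4] at h5
      rw [hD₀, h5, Finset.erase_insert (fun h' => hcaE' (hD h'))]
    · intro hD
      exact absurd (Finset.mem_powerset.2 hD₀E) hD
  · rw [if_neg h2, Finset.sum_eq_zero]
    intro D hD
    rw [Finset.mem_powerset] at hD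
    by_contra hcon
    have h3 : IsComponent (ρ' :: gs) ((insert ca D).biUnion id) := by
      by_contra hc; exact hcon (by rw [if_neg hc, zero_mul])
    have h4 : IsComponent (ρ' :: gs) ((insert cb (E \ D)).biUnion id) := by
      by_contra hc; exact hcon (by rw [if_neg hc, mul_zero])
    -- Conversely, the transposition joins the two orbits: an invariant set that meets one of them
    -- contains it, together with `a` and `b`, and hence also the other.
    refine h2 ⟨⟨a, ha⟩, isInv_cons_swap_iff.2 ⟨?_, by simp [ha, hb]⟩, fun V hV hne hi => ?_⟩
    · intro g hg
      rw [← hunion D hD]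
      exact (h3.2.1 g hg).union (h4.2.1 g hg)
    · obtain ⟨hi1, hi2⟩ := isInv_cons_swap_iff.1 hi
      have k1 : ((insert ca D).biUnion id ∩ V).Nonempty → (insert ca D).biUnion id ⊆ V := by
        intro hn
        rw [← h3.2.2 _ Finset.inter_subset_left hn fun g hg => (h3.2.1 g hg).inter (hi1 g hg)]
        exact Finset.inter_subset_right
      have k2 : ((insert cb (E \ D)).biUnion id ∩ V).Nonempty →
          (insert cb (E \ D)).biUnion id ⊆ V := by
        intro hn
        rw [← h4.2.2 _ Finset.inter_subset_left hn fun g hg => (h4.2.1 g hg).inter (hi1 g hg)]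
        exact Finset.inter_subset_right
      have k3 : a ∈ V := by
        obtain ⟨v, hv⟩ := hne
        have hvO := hV hv
        rw [← hunion D hD] at hvO
        rcases Finset.mem_union.1 hvO with hv' | hv'
        · exact k1 ⟨v, Finset.mem_inter.2 ⟨hv', hv⟩⟩ (ha1 D)
        · exact hi2.2 (k2 ⟨v, Finset.mem_inter.2 ⟨hv', hv⟩⟩ (hb2 D))
      refine Finset.Subset.antisymm hV ?_
      rw [← hunion D hD]
      exact Finset.union_subset (k1 ⟨a, Finset.mem_inter.2 ⟨ha1 D, k3⟩⟩)
        (k2 ⟨b, Finset.mem_inter.2 ⟨hb2 D, hi2.1 k3⟩⟩)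

end Components

/-! ### The count of transitive sequences of transpositions. -/

section MonodromyCount

open Equiv

variable {α : Type*} [Fintype α] [DecidableEq α]

/-- The transpositions given by a list of pairs. -/
def swapList (l : List (α × α)) : List (Perm α) := l.map fun p => swap p.1 p.2

/-- The product of a list of transpositions, in the reverse order, and of `ρ`. -/
def swapProd (ρ : Perm α) (l : List (α × α)) : Perm α :=
  l.foldl (fun g p => swap p.1 p.2 * g) ρ

/-- The lengths of the cycles of `σ` that meet `O`. -/
def cycleLens (σ : Perm α) (O : Finset α) : Multiset ℕ := (cyclesIn σ O).val.map Finset.card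

open Classical in
/-- The number of sequences of `k` ordered pairs in `O`, such that the corresponding transpositions
generate together with `ρ` a group with orbit `O`; each sequence is counted with the number of
labellings of the cycles of the product such that the lengths are `x`. -/
noncomputable def monodromyCount (ρ : Perm α) (O : Finset α) (k : ℕ) (x : Multiset ℕ) : ℚ :=
  listSum O.offDiag k fun l =>
    (if IsComponent (ρ :: swapList l) O then 1 else 0) * matchCount (cycleLens (swapProd ρ l) O) x

variable {ρ : Perm α} {O U V : Finset α}

theorem isInv_swapProd {l : List (α × α)} (hρ : IsInv ρ O)
    (hl : ∀ p ∈ l, (p.1 ∈ O ↔ p.2 ∈ O)) : IsInv (swapProd ρ l) O := by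
  induction l generalizing ρ with
  | nil => exact hρ
  | cons p l ih =>
    exact ih (IsInv.mul (isInv_swap_iff.2 (hl p List.mem_cons_self)) hρ)
      fun q hq => hl q (List.mem_cons_of_mem _ hq)

theorem sum_cycleLens {σ : Perm α} (h : IsInv σ O) : (cycleLens σ O).sum = O.card :=
  sum_card_cyclesIn h

theorem monodromyCount_eq_zero {k : ℕ} {x : Multiset ℕ} (hρ : IsInv ρ O) (hx : x.sum ≠ O.card) :
    monodromyCount ρ O k x = 0 := by
  refine listSum_eq_zero fun l _ hl => ?_
  have : matchCount (cycleLens (swapProd ρ l) O) x = 0 := if_neg ?_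
  · rw [this, mul_zero]
  rintro rfl
  refine hx (sum_cycleLens (isInv_swapProd hρ fun p hp => ?_))
  have := Finset.mem_offDiag.1 (hl p hp)
  simp [this.1, this.2.1]

theorem cycleLens_congr {σ σ' : Perm α} (hO : IsInv σ O) (h : ∀ a ∈ O, σ a = σ' a) :
    cycleLens σ O = cycleLens σ' O := by
  rw [cycleLens, cyclesIn_congr hO h, cycleLens]

theorem cycleLens_union {σ : Perm α} (hU : IsInv σ U) (hV : IsInv σ V) (h : Disjoint U V) :
    cycleLens σ (U ∪ V) = cycleLens σ U + cycleLens σ V := by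
  rw [cycleLens, cyclesIn_union, ← Finset.disjUnion_eq_union _ _ (disjoint_cyclesIn hU hV h),
    Finset.disjUnion_val, Multiset.map_add]
  rfl

/-- On `U` the transpositions outside `U` act trivially, so the product restricted to `U` depends
only on the pairs inside `U`. -/
theorem swapProd_filter {ρ' : Perm α} {l : List (α × α)}
    (hl : ∀ p ∈ l, p ∈ U.offDiag ∨ (p.1 ∉ U ∧ p.2 ∉ U)) (hρ : IsInv ρ U)
    (hρ' : ∀ a ∈ U, ρ a = ρ' a) :
    ∀ a ∈ U, swapProd ρ l a = swapProd ρ' (l.filter (· ∈ U.offDiag)) a := by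
  induction l generalizing ρ ρ' with
  | nil => exact hρ'
  | cons p l ih =>
    have hl' := fun q hq => hl q (List.mem_cons_of_mem p hq)
    rcases hl p List.mem_cons_self with hp | hp
    · rw [List.filter_cons_of_pos (by simpa using hp)]
      have hp' := Finset.mem_offDiag.1 hp
      refine ih (ρ := swap p.1 p.2 * ρ) (ρ' := swap p.1 p.2 * ρ') hl'
        (IsInv.mul (isInv_swap_iff.2 (by simp [hp'.1, hp'.2.1])) hρ) ?_
      intro a ha
      rw [Perm.mul_apply, Perm.mul_apply, hρ' a ha]
    · rw [List.filter_cons_of_neg (by simp [hp.1])]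
      refine ih (ρ := swap p.1 p.2 * ρ) (ρ' := ρ') hl'
        (IsInv.mul (isInv_swap_iff.2 (by simp [hp.1, hp.2])) hρ) ?_
      intro a ha
      rw [Perm.mul_apply, ← hρ' a ha, swap_apply_of_ne_of_ne]
      · intro h; exact hp.1 (h ▸ (hρ a).2 ha)
      · intro h; exact hp.2 (h ▸ (hρ a).2 ha)

/-- A transposition of two points outside `U` preserves every subset of `U`, hence does not
influence whether `U` is an orbit. -/
theorem isComponent_filter {l : List (α × α)}
    (hl : ∀ p ∈ l, p ∈ U.offDiag ∨ (p.1 ∉ U ∧ p.2 ∉ U)) :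
    IsComponent (ρ :: swapList l) U ↔
      IsComponent (ρ :: swapList (l.filter (· ∈ U.offDiag))) U := by
  have key : ∀ V ⊆ U, (∀ g ∈ ρ :: swapList l, IsInv g V) ↔
      ∀ g ∈ ρ :: swapList (l.filter (· ∈ U.offDiag)), IsInv g V := by
    intro V hV
    simp only [List.forall_mem_cons, swapList, List.forall_mem_map]
    refine and_congr_right fun _ => ⟨fun h p hp => h p (List.mem_filter.1 hp).1, fun h p hp => ?_⟩
    rcases hl p hp with hp' | hp'
    · exact h p (List.mem_filter.2 ⟨hp, by simpa using hp'⟩)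
    · exact isInv_swap_iff.2 ⟨fun h' => absurd (hV h') hp'.1, fun h' => absurd (hV h') hp'.2⟩
  unfold IsComponent
  rw [key U subset_rfl]
  refine and_congr_right fun _ => and_congr_right fun _ => ?_
  exact forall₂_congr fun V hV => by rw [key V hV]

open Classical in
/-- The count of the sequences that generate a group with two orbits. -/
theorem listSum_two_components (hU : IsInv ρ U) (hV : IsInv ρ V) (hUV : Disjoint U V) (k : ℕ)
    (x : Multiset ℕ) :
    listSum (U ∪ V).offDiag k (fun l => (if IsComponent (ρ :: swapList l) U then 1 else 0) *
      (if IsComponent (ρ :: swapList l) V then 1 else 0) *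
      matchCount (cycleLens (swapProd ρ l) (U ∪ V)) x) =
    splitSum (fun x₁ x₂ => ∑ p ∈ Finset.HasAntidiagonal.antidiagonal k, (k.choose p.1 : ℚ) *
      (monodromyCount ρ U p.1 x₁ * monodromyCount ρ V p.2 x₂)) x := by
  have hdis : Disjoint U.offDiag V.offDiag := by
    rw [Finset.disjoint_left]
    intro p hp hp'
    exact Finset.disjoint_left.1 hUV (Finset.mem_offDiag.1 hp).1 (Finset.mem_offDiag.1 hp').1
  have hsub : U.offDiag ∪ V.offDiag ⊆ (U ∪ V).offDiag :=
    Finset.union_subset (Finset.offDiag_mono Finset.subset_union_left)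
      (Finset.offDiag_mono Finset.subset_union_right)
  rw [listSum_of_subset hsub]
  · have e : ∀ l : List (α × α), l.length = k → (∀ p ∈ l, p ∈ U.offDiag ∪ V.offDiag) →
        (if IsComponent (ρ :: swapList l) U then 1 else 0) *
        (if IsComponent (ρ :: swapList l) V then 1 else 0) *
        matchCount (cycleLens (swapProd ρ l) (U ∪ V)) x =
        splitSum (fun x₁ x₂ =>
          (fun l => (if IsComponent (ρ :: swapList l) U then 1 else 0) *
            matchCount (cycleLens (swapProd ρ l) U) x₁) (l.filter (· ∈ U.offDiag)) *
          (fun l => (if IsComponent (ρ :: swapList l) V then 1 else 0) *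
            matchCount (cycleLens (swapProd ρ l) V) x₂) (l.filter (· ∈ V.offDiag))) x := by
      intro l _ hl
      have hlU : ∀ p ∈ l, p ∈ U.offDiag ∨ (p.1 ∉ U ∧ p.2 ∉ U) := by
        intro p hp
        rcases Finset.mem_union.1 (hl p hp) with h | h
        · exact Or.inl h
        · have := Finset.mem_offDiag.1 h
          exact Or.inr ⟨Finset.disjoint_right.1 hUV this.1, Finset.disjoint_right.1 hUV this.2.1⟩
      have hlV : ∀ p ∈ l, p ∈ V.offDiag ∨ (p.1 ∉ V ∧ p.2 ∉ V) := by
        intro p hp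
        rcases Finset.mem_union.1 (hl p hp) with h | h
        · have := Finset.mem_offDiag.1 h
          exact Or.inr ⟨Finset.disjoint_left.1 hUV this.1, Finset.disjoint_left.1 hUV this.2.1⟩
        · exact Or.inl h
      have hiff : ∀ W : Finset α, (∀ p ∈ l, p ∈ W.offDiag ∨ (p.1 ∉ W ∧ p.2 ∉ W)) →
          ∀ p ∈ l, (p.1 ∈ W ↔ p.2 ∈ W) := by
        intro W hW p hp
        rcases hW p hp with h | h
        · have := Finset.mem_offDiag.1 h
          simp [this.1, this.2.1]
        · simp [h.1, h.2]
      have hiU := isInv_swapProd hU (hiff U hlU)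
      have hiV := isInv_swapProd hV (hiff V hlV)
      rw [cycleLens_union hiU hiV hUV, matchCount_add, mul_splitSum,
        cycleLens_congr hiU (swapProd_filter hlU hU fun _ _ => rfl),
        cycleLens_congr hiV (swapProd_filter hlV hV fun _ _ => rfl)]
      simp only [isComponent_filter hlU, isComponent_filter hlV]
      exact splitSum_congr fun _ _ _ => by ring
    rw [listSum_congr e, listSum_splitSum]
    exact splitSum_congr fun x₁ x₂ _ => listSum_union
      (Φ := fun l => (if IsComponent (ρ :: swapList l) U then 1 else 0) *
        matchCount (cycleLens (swapProd ρ l) U) x₁)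
      (Ψ := fun l => (if IsComponent (ρ :: swapList l) V then 1 else 0) *
        matchCount (cycleLens (swapProd ρ l) V) x₂) hdis
  -- A pair joining `U` to `V` would destroy the invariance of `U`; so only lists of pairs inside
  -- the two parts count, and these are shuffles.
  · intro l hl ⟨p, hp, hp'⟩
    have hpO := Finset.mem_offDiag.1 (hl p hp)
    rw [if_neg, zero_mul, zero_mul]
    intro hc
    have hi : IsInv (swap p.1 p.2) U :=
      hc.2.1 _ (List.mem_cons_of_mem _ (List.mem_map.2 ⟨p, hp, rfl⟩))
    rw [isInv_swap_iff] at hi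
    refine hp' ?_
    simp only [Finset.mem_union, Finset.mem_offDiag] at hpO ⊢
    have := @Finset.disjoint_left _ U V
    tauto

end MonodromyCount

/-! ### The cut-and-join recursion and the tree sum. -/

section CutJoin

open Equiv

variable {α : Type*} [Fintype α] [DecidableEq α] {ρ : Perm α} {O : Finset α} {a b : α}

/-- The branch with positive leaves `x` and with negative leaves given by the sizes of the sets in
`D`. -/
noncomputable def cycleBranch (x : Multiset ℕ) (D : Finset (Finset α)) : ℚ :=
  posBranch (Multiset.map (Nat.cast : ℕ → ℤ) x + D.val.map fun d => -(d.card : ℤ))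

/-- The sum over the sequences that begin with the transposition of `a` and `b`. -/
noncomputable def stepCount (ρ : Perm α) (O : Finset α) (k : ℕ) (x : Multiset ℕ) (a b : α) : ℚ :=
  open Classical in
  listSum O.offDiag k fun l =>
    (if IsComponent (ρ :: swap a b :: swapList l) O then 1 else 0) *
      matchCount (cycleLens (swapProd (swap a b * ρ) l) O) x

/-- The first pair is sorted by the cycle of its first point and by whether its second point lies in
the same cycle (a cut) or in another one (a join). -/
theorem monodromyCount_succ (hO : IsInv ρ O) (k : ℕ) (x : Multiset ℕ) :
    monodromyCount ρ O (k + 1) x =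
      ∑ c ∈ cyclesIn ρ O, ∑ a ∈ c, (∑ b ∈ c.erase a, stepCount ρ O k x a b +
        ∑ c' ∈ (cyclesIn ρ O).erase c, ∑ b ∈ c', stepCount ρ O k x a b) := by
  have e : monodromyCount ρ O (k + 1) x = ∑ p ∈ O.offDiag, stepCount ρ O k x p.1 p.2 := rfl
  have e2 : ∑ p ∈ O.offDiag, stepCount ρ O k x p.1 p.2 =
      ∑ a ∈ O, ∑ b ∈ O.erase a, stepCount ρ O k x a b := by
    rw [Finset.sum_sigma']
    refine Finset.sum_bij' (fun p _ => ⟨p.1, p.2⟩) (fun p _ => (p.1, p.2)) ?_ ?_ ?_ ?_ ?_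
    · intro p hp
      have := Finset.mem_offDiag.1 hp
      simp [this.1, this.2.1, Ne.symm this.2.2]
    · intro p hp
      simp only [Finset.mem_sigma, Finset.mem_erase] at hp
      exact Finset.mem_offDiag.2 ⟨hp.1, hp.2.2, Ne.symm hp.2.1⟩
    all_goals intros; rfl
  rw [e, e2, sum_cyclesIn hO]
  refine Finset.sum_congr rfl fun c hc => Finset.sum_congr rfl fun a ha => ?_
  have h1 : ∀ f : α → ℚ, ∑ b ∈ O.erase a, f b = ∑ b ∈ O, f b - f a := fun f =>
    Finset.sum_erase_eq_sub (mem_of_mem_cyclesIn hO hc ha)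
  have h2 : ∀ f : α → ℚ, ∑ b ∈ c.erase a, f b = ∑ b ∈ c, f b - f a := fun f =>
    Finset.sum_erase_eq_sub ha
  rw [h1, h2, sum_cyclesIn hO, ← Finset.add_sum_erase _ _ hc]
  ring

/-- After a join both points lie in one cycle, so the transposition can be dropped from the
generators. -/
theorem stepCount_join (h : ¬ ρ.SameCycle a b) (k : ℕ) (x : Multiset ℕ) :
    stepCount ρ O k x a b = monodromyCount (swap a b * ρ) O k x := by
  classical
  unfold stepCount monodromyCount
  refine listSum_congr fun l _ _ => ?_
  congr 1
  exact if_congr (isComponent_cons_swap_of_sameCycle (sameCycle_swap_mul h)) rfl rfl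

/-- After a cut, the remaining transpositions either keep `O` connected or act on two orbits. In the
second case `D` lists the old cycles that go with the piece of `a`. -/
theorem stepCount_cut (hO : IsInv ρ O) (ha : a ∈ O) (hb : b ∈ O) (hab : a ≠ b)
    (h : ρ.SameCycle a b) (k : ℕ) (x : Multiset ℕ) :
    stepCount ρ O k x a b = monodromyCount (swap a b * ρ) O k x +
      ∑ D ∈ ((cyclesIn ρ O).erase (cycleSet ρ a)).powerset,
        splitSum (fun x₁ x₂ => ∑ p ∈ Finset.HasAntidiagonal.antidiagonal k, (k.choose p.1 : ℚ) *
          (monodromyCount (swap a b * ρ)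
            ((insert (cycleSet (swap a b * ρ) a) D).biUnion id) p.1 x₁ *
          monodromyCount (swap a b * ρ) ((insert (cycleSet (swap a b * ρ) b)
            (((cyclesIn ρ O).erase (cycleSet ρ a)) \ D)).biUnion id) p.2 x₂)) x := by
  classical
  unfold stepCount
  simp only [isComponent_cons_swap_cut ha hb hab h hO, add_mul, Finset.sum_mul]
  rw [listSum_add_fun, listSum_finset_sum]
  congr 1
  refine Finset.sum_congr rfl fun D hD => ?_
  obtain ⟨-, -, -, hfacts⟩ := cut_cycle ha hb hab h hO
  obtain ⟨h1, h2, h3, h4⟩ := hfacts D (Finset.mem_powerset.1 hD)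
  rw [← listSum_two_components (isInv_biUnion fun d hd => isInv_of_mem_cyclesIn (h1 hd))
    (isInv_biUnion fun d hd => isInv_of_mem_cyclesIn (h2 hd)) h4, h3]

/-- The genus of a connected cover is nonnegative, and the number of the covers of genus zero
satisfies the recursion for the tree sum. -/
def CountFormula (k : ℕ) (ρ : Perm α) (O : Finset α) (x : Multiset ℕ) : Prop :=
  (k + 2 < Multiset.card x + (cyclesIn ρ O).card → monodromyCount ρ O k x = 0) ∧
  (k + 2 = Multiset.card x + (cyclesIn ρ O).card → ∀ c ∈ cyclesIn ρ O,
    monodromyCount ρ O k x = if x.sum = O.card then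
      2 ^ k * (k.factorial : ℚ) * (∏ d ∈ (cyclesIn ρ O).erase c, (d.card : ℚ)) *
        cycleBranch x ((cyclesIn ρ O).erase c) else 0)

/-- Without transpositions, an orbit of the cyclic group is a single cycle. In genus zero this
leaves one positive and one negative end, and the branch formed by one leaf contributes `1`. -/
theorem countFormula_zero (hO : IsInv ρ O) (hne : O.Nonempty) (x : Multiset ℕ)
    (hx : ∀ v ∈ x, 0 < v) : CountFormula 0 ρ O x := by
  classical
  have hW : monodromyCount ρ O 0 x =
      (if IsComponent [ρ] O then 1 else 0) * matchCount (cycleLens ρ O) x := rfl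
  have hcard : Multiset.card (cycleLens ρ O) = (cyclesIn ρ O).card := Multiset.card_map _ _
  constructor
  · intro h
    rw [hW]
    by_contra hcon
    have h1 : IsComponent [ρ] O := by
      by_contra hc; exact hcon (by rw [if_neg hc, zero_mul])
    have h2 : cycleLens ρ O = x := by
      by_contra hc; exact hcon (by rw [matchCount, if_neg hc, mul_zero])
    obtain ⟨a, ha⟩ := hne
    have h3 : cyclesIn ρ O ⊆ {O} := by
      intro c hc
      rw [Finset.mem_singleton]
      exact h1.2.2 c (fun v hv => mem_of_mem_cyclesIn hO hc hv) (nonempty_of_mem_cyclesIn hc)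
        (by simpa using isInv_of_mem_cyclesIn hc)
    have h4 := Finset.card_le_card h3
    rw [Finset.card_singleton] at h4
    rw [← h2, hcard] at h
    omega
  · intro h c hc
    have hpos := Finset.card_pos.2 ⟨c, hc⟩
    split_ifs with hsum
    swap
    · exact monodromyCount_eq_zero hO hsum
    have hx0 : x ≠ 0 := by
      rintro rfl
      have := Finset.card_pos.2 hne
      rw [← hsum] at this
      simp at this
    have hxpos := Multiset.card_pos.2 hx0
    obtain ⟨c', hc'⟩ := Finset.card_eq_one.1 (by omega : (cyclesIn ρ O).card = 1)
    obtain ⟨v, rfl⟩ := Multiset.card_eq_one.1 (by omega : Multiset.card x = 1)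
    have hcc : c = c' := by rw [hc'] at hc; exact Finset.mem_singleton.1 hc
    subst hcc
    have hcO : c = O := by
      rw [← biUnion_cyclesIn hO, hc']; simp
    rw [hW, hc', if_pos, Finset.erase_singleton]
    · have hlen : cycleLens ρ O = {v} := by
        have hv' : v = O.card := by simpa using hsum
        rw [cycleLens, hc', hcO]; simp [hv']
      have hv : 0 < v := hx v (Multiset.mem_singleton_self v)
      have : cycleBranch {v} (∅ : Finset (Finset α)) = 1 := by
        unfold cycleBranch
        rw [Multiset.map_singleton, Finset.empty_val, Multiset.map_zero, add_zero]
        exact posBranch_singleton (by exact_mod_cast hv)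
      rw [this, hlen]
      simp [matchCount]
    · refine ⟨hne, by simpa using hO, fun V hV ⟨a, ha⟩ hi => ?_⟩
      have hi' : IsInv ρ V := hi ρ List.mem_cons_self
      refine Finset.Subset.antisymm hV ?_
      have h1 : cycleSet ρ a = c := by
        have := cycleSet_mem_cyclesIn (σ := ρ) (hV ha)
        rw [hc'] at this
        exact Finset.mem_singleton.1 this
      rw [← hcO, ← h1]
      exact hi'.cycleSet_subset ha

/-- A join lowers the number of cycles by one. The recursion through a chosen cycle is applied to
the joined one, so the two old cycles disappear from the product and from the branch. -/
theorem monodromyCount_join {k : ℕ} {x : Multiset ℕ}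
    (ih : ∀ (ρ : Perm α), IsInv ρ O → CountFormula k ρ O x) (hO : IsInv ρ O) (ha : a ∈ O)
    (hb : b ∈ O) (h : ¬ ρ.SameCycle a b) :
    (k + 1 + 2 < Multiset.card x + (cyclesIn ρ O).card →
      monodromyCount (swap a b * ρ) O k x = 0) ∧
    (k + 1 + 2 = Multiset.card x + (cyclesIn ρ O).card → x.sum = O.card →
      monodromyCount (swap a b * ρ) O k x = 2 ^ k * (k.factorial : ℚ) *
        (∏ d ∈ ((cyclesIn ρ O).erase (cycleSet ρ a)).erase (cycleSet ρ b), (d.card : ℚ)) *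
        cycleBranch x (((cyclesIn ρ O).erase (cycleSet ρ a)).erase (cycleSet ρ b))) := by
  have hO' : IsInv (swap a b * ρ) O := IsInv.mul (isInv_swap_iff.2 (by simp [ha, hb])) hO
  have hC := cyclesIn_join ha hb h
  have hnot : cycleSet ρ a ∪ cycleSet ρ b ∉
      ((cyclesIn ρ O).erase (cycleSet ρ a)).erase (cycleSet ρ b) := by
    intro h'
    have h1 := Finset.mem_of_mem_erase h'
    exact Finset.ne_of_mem_erase h1 (eq_cycleSet_of_mem (Finset.mem_of_mem_erase h1)
      (Finset.mem_union_left _ self_mem_cycleSet))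
  have hb' : cycleSet ρ b ∈ (cyclesIn ρ O).erase (cycleSet ρ a) :=
    Finset.mem_erase.2 ⟨fun h' => h (cycleSet_eq_iff.1 h').symm, cycleSet_mem_cyclesIn hb⟩
  have hcard : (cyclesIn (swap a b * ρ) O).card + 1 = (cyclesIn ρ O).card := by
    rw [hC, Finset.card_insert_of_notMem hnot, Finset.card_erase_add_one hb',
      Finset.card_erase_add_one (cycleSet_mem_cyclesIn ha)]
  obtain ⟨h1, h2⟩ := ih _ hO'
  refine ⟨fun hk => h1 (by omega), fun hk hx => ?_⟩
  rw [h2 (by omega) (cycleSet ρ a ∪ cycleSet ρ b) (by rw [hC]; exact Finset.mem_insert_self _ _),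
    if_pos hx, hC, Finset.erase_insert hnot]

/-- The total flow is then not positive. -/
theorem cycleBranch_eq_zero {x : Multiset ℕ} {D : Finset (Finset α)}
    (h : x.sum ≤ ∑ d ∈ D, d.card) : cycleBranch x D = 0 := by
  rw [cycleBranch, posBranch, posBranchAt, if_neg]
  rw [AddMonoidHom.id_apply, Multiset.sum_add, not_lt, ← Nat.cast_multiset_sum, Finset.sum_map_val,
    Finset.sum_neg_distrib, ← Nat.cast_sum]
  have : (x.sum : ℤ) ≤ ((∑ d ∈ D, d.card : ℕ) : ℤ) := by exact_mod_cast h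
  linarith

/-- The product of the counts for the two parts of a cut cover. -/
theorem sum_choose_mul_monodromyCount {k : ℕ} {x₁ x₂ : Multiset ℕ} {U V : Finset α}
    {D D' : Finset (Finset α)} {c c' : Finset α}
    (ih : ∀ i ≤ k, CountFormula i ρ U x₁ ∧ CountFormula i ρ V x₂)
    (hU : cyclesIn ρ U = insert c D) (hV : cyclesIn ρ V = insert c' D') (hc : c ∉ D)
    (hc' : c' ∉ D') :
    (k + 2 < Multiset.card x₁ + Multiset.card x₂ + (D.card + D'.card) →
      ∑ p ∈ Finset.HasAntidiagonal.antidiagonal k, (k.choose p.1 : ℚ) *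
        (monodromyCount ρ U p.1 x₁ * monodromyCount ρ V p.2 x₂) = 0) ∧
    (k + 2 = Multiset.card x₁ + Multiset.card x₂ + (D.card + D'.card) →
      ∑ p ∈ Finset.HasAntidiagonal.antidiagonal k, (k.choose p.1 : ℚ) *
        (monodromyCount ρ U p.1 x₁ * monodromyCount ρ V p.2 x₂) =
      if x₁.sum = U.card ∧ x₂.sum = V.card then 2 ^ k * (k.factorial : ℚ) *
        ((∏ d ∈ D, (d.card : ℚ)) * ∏ d ∈ D', (d.card : ℚ)) *
        (cycleBranch x₁ D * cycleBranch x₂ D') else 0) := by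
  have hUc : (cyclesIn ρ U).card = D.card + 1 := by rw [hU, Finset.card_insert_of_notMem hc]
  have hVc : (cyclesIn ρ V).card = D'.card + 1 := by rw [hV, Finset.card_insert_of_notMem hc']
  have hzero : ∀ i j, i + j = k → (i + 2 < Multiset.card x₁ + (D.card + 1) ∨
      j + 2 < Multiset.card x₂ + (D'.card + 1)) →
      monodromyCount ρ U i x₁ * monodromyCount ρ V j x₂ = 0 := by
    rintro i j hij (h | h)
    · rw [(ih i (by omega)).1.1 (by rw [hUc]; exact h), zero_mul]
    · rw [(ih j (by omega)).2.1 (by rw [hVc]; exact h), mul_zero]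
  constructor
  · intro hk
    refine Finset.sum_eq_zero fun p hp => ?_
    have hp := Finset.HasAntidiagonal.mem_antidiagonal.1 hp
    rw [hzero p.1 p.2 hp (by omega), mul_zero]
  · intro hk
    by_cases h1 : Multiset.card x₁ + D.card = 0
    · have e1 : x₁ = 0 := Multiset.card_eq_zero.1 (by omega)
      have e2 : cycleBranch x₁ D = 0 := cycleBranch_eq_zero (by simp [e1])
      rw [e2, zero_mul, mul_zero, ite_self]
      refine Finset.sum_eq_zero fun p hp => ?_
      have hp := Finset.HasAntidiagonal.mem_antidiagonal.1 hp
      rw [hzero p.1 p.2 hp (by omega), mul_zero]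
    by_cases h2 : Multiset.card x₂ + D'.card = 0
    · have e1 : x₂ = 0 := Multiset.card_eq_zero.1 (by omega)
      have e2 : cycleBranch x₂ D' = 0 := cycleBranch_eq_zero (by simp [e1])
      rw [e2, mul_zero, mul_zero, ite_self]
      refine Finset.sum_eq_zero fun p hp => ?_
      have hp := Finset.HasAntidiagonal.mem_antidiagonal.1 hp
      rw [hzero p.1 p.2 hp (by omega), mul_zero]
    -- Both parts have nonnegative genus and the total is zero, which forces genus zero on each part
    -- and so fixes the number of transpositions in each of them.
    obtain ⟨i, hi⟩ : ∃ i, Multiset.card x₁ + D.card = i + 1 := ⟨_, (Nat.succ_pred h1).symm⟩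
    obtain ⟨j, hj⟩ : ∃ j, Multiset.card x₂ + D'.card = j + 1 := ⟨_, (Nat.succ_pred h2).symm⟩
    have hij : i + j = k := by omega
    rw [Finset.sum_eq_single (i, j)]
    · rw [(ih i (by omega)).1.2 (by rw [hUc]; omega) c (by rw [hU]; exact Finset.mem_insert_self _ _),
        (ih j (by omega)).2.2 (by rw [hVc]; omega) c' (by rw [hV]; exact Finset.mem_insert_self _ _),
        hU, hV, Finset.erase_insert hc, Finset.erase_insert hc']
      have hfac : (k.choose i : ℚ) * (i.factorial * j.factorial) = k.factorial := by
        have := Nat.choose_mul_factorial_mul_factorial (Nat.le_add_right i j)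
        rw [Nat.add_sub_cancel_left, hij] at this
        rw [← this]
        push_cast
        ring
      by_cases s1 : x₁.sum = U.card <;> by_cases s2 : x₂.sum = V.card
      · rw [if_pos s1, if_pos s2, if_pos ⟨s1, s2⟩, ← hfac, ← hij, pow_add]
        ring
      all_goals simp [s1, s2]
    · intro p hp hne
      have hp := Finset.HasAntidiagonal.mem_antidiagonal.1 hp
      rw [hzero p.1 p.2 hp, mul_zero]
      by_contra hcon
      exact hne (Prod.ext (by simp; omega) (by simp; omega))
    · intro hp
      exact absurd (Finset.HasAntidiagonal.mem_antidiagonal.2 hij) hp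

/-- The contribution of the transpositions that cut the cycle of `a` and disconnect the cover. -/
theorem stepCount_cut_eq {k : ℕ} {x : Multiset ℕ}
    (ih : ∀ i ≤ k, ∀ (ρ : Perm α) (O : Finset α) (x : Multiset ℕ), IsInv ρ O → O.Nonempty →
      (∀ v ∈ x, 0 < v) → CountFormula i ρ O x)
    (hO : IsInv ρ O) (hx : ∀ v ∈ x, 0 < v) (ha : a ∈ O) (hb : b ∈ O) (hab : a ≠ b)
    (h : ρ.SameCycle a b) :
    (k + 1 + 2 < Multiset.card x + (cyclesIn ρ O).card → stepCount ρ O k x a b = 0) ∧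
    (k + 1 + 2 = Multiset.card x + (cyclesIn ρ O).card → x.sum = O.card →
      stepCount ρ O k x a b = ∑ D ∈ ((cyclesIn ρ O).erase (cycleSet ρ a)).powerset,
        splitSum (fun x₁ x₂ =>
          if x₁.sum = (cycleSet (swap a b * ρ) a).card + ∑ d ∈ D, d.card then
            2 ^ k * (k.factorial : ℚ) *
              (∏ d ∈ (cyclesIn ρ O).erase (cycleSet ρ a), (d.card : ℚ)) *
              (cycleBranch x₁ D * cycleBranch x₂ (((cyclesIn ρ O).erase (cycleSet ρ a)) \ D))
          else 0) x) := by
  obtain ⟨hc1, hc2, hO', hfacts⟩ := cut_cycle ha hb hab h hO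
  have hC := cyclesIn_cut ha hb h (σ := ρ) (O := O)
  have hE : ((cyclesIn ρ O).erase (cycleSet ρ a)).card + 1 = (cyclesIn ρ O).card :=
    Finset.card_erase_add_one (cycleSet_mem_cyclesIn ha)
  have hcard : (cyclesIn (swap a b * ρ) O).card = (cyclesIn ρ O).card + 1 := by
    rw [hC, Finset.card_insert_of_notMem hc1, Finset.card_insert_of_notMem hc2, hE]
  set E := (cyclesIn ρ O).erase (cycleSet ρ a) with hEdef
  -- A cut adds a cycle. If the cover stayed connected, its genus would be one less than before,
  -- hence negative.
  have hfirst : k + 1 + 2 ≤ Multiset.card x + (cyclesIn ρ O).card →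
      monodromyCount (swap a b * ρ) O k x = 0 := fun hk =>
    (ih k le_rfl _ _ x hO' ⟨a, ha⟩ hx).1 (by omega)
  have hparts : ∀ D ⊆ E, ∀ x₁ x₂, x₁ + x₂ = x → _ := fun D hD x₁ x₂ hxx =>
    sum_choose_mul_monodromyCount (ρ := swap a b * ρ) (k := k) (x₁ := x₁) (x₂ := x₂)
      (U := (insert (cycleSet (swap a b * ρ) a) D).biUnion id)
      (V := (insert (cycleSet (swap a b * ρ) b) (E \ D)).biUnion id)
      (fun i hi => ⟨ih i hi _ _ _
          (isInv_biUnion fun d hd => isInv_of_mem_cyclesIn ((hfacts D hD).1 hd))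
          ⟨a, Finset.mem_biUnion.2 ⟨_, Finset.mem_insert_self _ _, self_mem_cycleSet⟩⟩
          (fun v hv => hx v (hxx ▸ Multiset.mem_add.2 (Or.inl hv))),
        ih i hi _ _ _
          (isInv_biUnion fun d hd => isInv_of_mem_cyclesIn ((hfacts D hD).2.1 hd))
          ⟨b, Finset.mem_biUnion.2 ⟨_, Finset.mem_insert_self _ _, self_mem_cycleSet⟩⟩
          (fun v hv => hx v (hxx ▸ Multiset.mem_add.2 (Or.inr hv)))⟩)
      (cyclesIn_biUnion (hfacts D hD).1) (cyclesIn_biUnion (hfacts D hD).2.1)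
      (fun hm => hc1 (Finset.mem_insert_of_mem (hD hm)))
      (fun hm => hc2 (Finset.mem_sdiff.1 hm).1)
  have hDE : ∀ D ⊆ E, D.card + (E \ D).card = E.card := fun D hD => by
    rw [add_comm]; exact Finset.card_sdiff_add_card_eq_card hD
  constructor
  · intro hk
    rw [stepCount_cut hO ha hb hab h, hfirst hk.le, zero_add]
    refine Finset.sum_eq_zero fun D hD => splitSum_eq_zero fun x₁ x₂ hxx => ?_
    have hD := Finset.mem_powerset.1 hD
    refine (hparts D hD x₁ x₂ hxx).1 ?_
    have := hDE D hD
    rw [← hxx, Multiset.card_add] at hk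
    omega
  · intro hk hsum
    rw [stepCount_cut hO ha hb hab h, hfirst hk.le, zero_add]
    refine Finset.sum_congr rfl fun D hD => splitSum_congr fun x₁ x₂ hxx => ?_
    have hD := Finset.mem_powerset.1 hD
    have hcardD := hDE D hD
    have hxc : Multiset.card x₁ + Multiset.card x₂ = Multiset.card x := by
      rw [← hxx, Multiset.card_add]
    rw [(hparts D hD x₁ x₂ hxx).2 (by omega)]
    obtain ⟨f1, f2, f3, f4⟩ := hfacts D hD
    have hUcard : ((insert (cycleSet (swap a b * ρ) a) D).biUnion id).card =
        (cycleSet (swap a b * ρ) a).card + ∑ d ∈ D, d.card := by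
      rw [← sum_card_cyclesIn (σ := swap a b * ρ), cyclesIn_biUnion f1, Finset.sum_insert]
      · exact fun hm => hc1 (Finset.mem_insert_of_mem (hD hm))
      · exact isInv_biUnion fun d hd => isInv_of_mem_cyclesIn (f1 hd)
    have hUV := Finset.card_union_of_disjoint f4
    rw [f3] at hUV
    have hxs : x₁.sum + x₂.sum = x.sum := by rw [← hxx, Multiset.sum_add]
    have hprod : (∏ d ∈ D, (d.card : ℚ)) * ∏ d ∈ E \ D, (d.card : ℚ) = ∏ d ∈ E, (d.card : ℚ) := by
      rw [mul_comm]; exact Finset.prod_sdiff hD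
    rw [hprod]
    refine if_congr ?_ rfl rfl
    rw [← hUcard]
    constructor
    · exact fun h => h.1
    · exact fun h => ⟨h, by omega⟩

/-- As the second point runs through the cycle, the length of the cut piece takes each possible
value once, and a splitting of the leaves with two positive branches is compatible with exactly one
of these lengths. So the sum over the second points disappears and all splittings remain. -/
theorem sum_stepCount_cut {k : ℕ} {x : Multiset ℕ}
    (ih : ∀ i ≤ k, ∀ (ρ : Perm α) (O : Finset α) (x : Multiset ℕ), IsInv ρ O → O.Nonempty →
      (∀ v ∈ x, 0 < v) → CountFormula i ρ O x)
    (hO : IsInv ρ O) (hx : ∀ v ∈ x, 0 < v) (ha : a ∈ O)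
    (hk : k + 1 + 2 = Multiset.card x + (cyclesIn ρ O).card) (hsum : x.sum = O.card) :
    ∑ b ∈ (cycleSet ρ a).erase a, stepCount ρ O k x a b =
      2 ^ k * (k.factorial : ℚ) * (∏ d ∈ (cyclesIn ρ O).erase (cycleSet ρ a), (d.card : ℚ)) *
      splitSum (fun A B => posBranch A * posBranch B) (Multiset.map (Nat.cast : ℕ → ℤ) x +
        ((cyclesIn ρ O).erase (cycleSet ρ a)).val.map fun d => -(d.card : ℤ)) := by
  set E := (cyclesIn ρ O).erase (cycleSet ρ a) with hE
  set K : ℚ := 2 ^ k * (k.factorial : ℚ) * (∏ d ∈ E, (d.card : ℚ)) with hK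
  have hOE : O.card = (cycleSet ρ a).card + ∑ d ∈ E, d.card := by
    rw [← sum_card_cyclesIn hO, ← Finset.add_sum_erase _ _ (cycleSet_mem_cyclesIn ha)]
  obtain ⟨f, hf⟩ : ∃ f : ℕ → ℚ, f = fun p => ∑ D ∈ E.powerset, splitSum (fun x₁ x₂ =>
      if x₁.sum = p + ∑ d ∈ D, d.card then K * (cycleBranch x₁ D * cycleBranch x₂ (E \ D))
      else 0) x := ⟨_, rfl⟩
  have e1 : ∀ b ∈ (cycleSet ρ a).erase a, stepCount ρ O k x a b =
      f (cycleSet (swap a b * ρ) a).card := by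
    intro b hb
    obtain ⟨hb1, hb2⟩ := Finset.mem_erase.1 hb
    have hb2 := mem_cycleSet.1 hb2
    rw [hf]
    exact (stepCount_cut_eq ih hO hx ha (hO.mem_of_sameCycle ha hb2) (Ne.symm hb1) hb2).2 hk hsum
  rw [Finset.sum_congr rfl e1, sum_cut_cycle, hf, Finset.sum_comm, splitSum_add, splitSum_map,
    mul_splitSum]
  simp only [splitSum_map_val, Finset.mul_sum]
  rw [splitSum_finset_sum]
  refine Finset.sum_congr rfl fun D hD => ?_
  rw [← splitSum_finset_sum]
  refine splitSum_congr fun x₁ x₂ hxx => ?_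
  have hDE : ∑ d ∈ E \ D, d.card + ∑ d ∈ D, d.card = ∑ d ∈ E, d.card :=
    Finset.sum_sdiff (Finset.mem_powerset.1 hD)
  have hxs : x₁.sum + x₂.sum = x.sum := by rw [← hxx, Multiset.sum_add]
  change _ = K * (cycleBranch x₁ D * cycleBranch x₂ (E \ D))
  by_cases h1 : x₁.sum ≤ ∑ d ∈ D, d.card
  · simp [cycleBranch_eq_zero h1]
  by_cases h2 : x₂.sum ≤ ∑ d ∈ E \ D, d.card
  · simp [cycleBranch_eq_zero h2]
  -- The length of the piece equals the flow of the first branch. It lies in the admissible range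
  -- because both branches have positive flow.
  rw [Finset.sum_eq_single (x₁.sum - ∑ d ∈ D, d.card)]
  · rw [if_pos (by omega)]
  · intro p _ hp
    rw [if_neg (by omega)]
  · intro hp
    rw [Finset.mem_Ico] at hp
    omega

/-- Removing one negative leaf and making it the root edge of a branch multiplies the tree sum by
its flow. At least three leaves are needed: with two leaves the branch is `1` but the tree sum is
`0`, which is why `CountFormula` is stated with branches. -/
theorem cycleBranch_erase {x : Multiset ℕ} {C : Finset (Finset α)} {c : Finset α} (hc : c ∈ C)
    (hcpos : 0 < c.card) (hsum : x.sum = ∑ d ∈ C, d.card) (hcard : 3 ≤ Multiset.card x + C.card) :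
    cycleBranch x (C.erase c) = c.card * intTreeSum (Multiset.map (Nat.cast : ℕ → ℤ) x +
      C.val.map fun d => -(d.card : ℤ)) := by
  have hCsum : (c.card : ℤ) + ∑ d ∈ C.erase c, (d.card : ℤ) = ∑ d ∈ C, (d.card : ℤ) :=
    Finset.add_sum_erase _ (fun d : Finset α => (d.card : ℤ)) hc
  have hBsum : (Multiset.map (Nat.cast : ℕ → ℤ) x +
      (C.erase c).val.map fun d => -(d.card : ℤ)).sum = (c.card : ℤ) := by
    rw [Multiset.sum_add, ← Nat.cast_multiset_sum, hsum, Nat.cast_sum, Finset.sum_map_val, ← hCsum]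
    simp
  rw [cycleBranch, posBranch_of_pos (by rw [hBsum]; exact_mod_cast hcpos), hBsum]
  · congr 2
    rw [← Multiset.add_cons]
    congr 1
    conv_rhs => rw [← Finset.insert_erase hc,
      Finset.insert_val_of_notMem (Finset.notMem_erase _ _), Multiset.map_cons]
  · rw [Multiset.card_add, Multiset.card_map, Multiset.card_map, Finset.card_val]
    have := Finset.card_erase_add_one hc
    omega

/-- Summation over the points of the cycles turns cuts and joins into the two sums of
`mul_intTreeSum`, and the lengths of the cycles from the choices of points complete the product over
all cycles. -/
theorem countFormula (k : ℕ) : ∀ (ρ : Perm α) (O : Finset α) (x : Multiset ℕ), IsInv ρ O →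
    O.Nonempty → (∀ v ∈ x, 0 < v) → CountFormula k ρ O x := by
  induction k using Nat.strong_induction_on with
  | _ k ih =>
  intro ρ O x hO hne hx
  rcases k with _ | k
  · exact countFormula_zero hO hne x hx
  have ih' : ∀ i ≤ k, ∀ (ρ : Perm α) (O : Finset α) (x : Multiset ℕ), IsInv ρ O → O.Nonempty →
      (∀ v ∈ x, 0 < v) → CountFormula i ρ O x := fun i hi => ih i (by omega)
  have hjoin := fun {a b : α} (ha : a ∈ O) (hb : b ∈ O) (h : ¬ ρ.SameCycle a b) =>
    monodromyCount_join (fun ρ hρ => ih' k le_rfl ρ O x hρ hne hx) hO ha hb h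
  have hdis : ∀ c ∈ cyclesIn ρ O, ∀ c' ∈ (cyclesIn ρ O).erase c, ∀ a ∈ c, ∀ b ∈ c',
      c = cycleSet ρ a ∧ c' = cycleSet ρ b ∧ ¬ ρ.SameCycle a b ∧ a ∈ O ∧ b ∈ O := by
    intro c hc c' hc' a ha b hb
    have e1 := eq_cycleSet_of_mem hc ha
    have e2 := eq_cycleSet_of_mem (Finset.mem_of_mem_erase hc') hb
    refine ⟨e1, e2, fun h => Finset.ne_of_mem_erase hc' ?_, mem_of_mem_cyclesIn hO hc ha,
      mem_of_mem_cyclesIn hO (Finset.mem_of_mem_erase hc') hb⟩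
    rw [e1, e2, cycleSet_eq_iff.2 h]
  constructor
  · intro hk
    rw [monodromyCount_succ hO]
    refine Finset.sum_eq_zero fun c hc => Finset.sum_eq_zero fun a ha => ?_
    have hca := eq_cycleSet_of_mem hc ha
    have haO := mem_of_mem_cyclesIn hO hc ha
    rw [Finset.sum_eq_zero, Finset.sum_eq_zero, add_zero]
    · intro c' hc'
      refine Finset.sum_eq_zero fun b hb => ?_
      obtain ⟨_, _, h, _, hbO⟩ := hdis c hc c' hc' a ha b hb
      rw [stepCount_join h, (hjoin haO hbO h).1 hk]
    · intro b hb
      obtain ⟨hb1, hb2⟩ := Finset.mem_erase.1 hb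
      rw [hca] at hb2
      have hb2 := mem_cycleSet.1 hb2
      exact (stepCount_cut_eq ih' hO hx haO (hO.mem_of_sameCycle haO hb2) (Ne.symm hb1) hb2).1 hk
  · intro hk c₀ hc₀
    split_ifs with hsum
    swap
    · exact monodromyCount_eq_zero hO hsum
    set P : Multiset ℤ := Multiset.map (Nat.cast : ℕ → ℤ) x with hP
    set n : Finset α → ℤ := fun d => -(d.card : ℤ) with hn
    set C := cyclesIn ρ O with hC
    have hPsum : P.sum = ∑ d ∈ C, (d.card : ℤ) := by
      rw [hP, ← Nat.cast_multiset_sum, hsum, ← sum_card_cyclesIn hO, Nat.cast_sum]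
    have key := mul_intTreeSum (P := P) (by
        intro v hv
        obtain ⟨w, hw, rfl⟩ := Multiset.mem_map.1 hv
        exact_mod_cast hx w hw) C n
      (fun c hc => by
        have := Finset.card_pos.2 (nonempty_of_mem_cyclesIn hc)
        simp only [hn]
        omega)
      (by
        rw [Multiset.sum_add, hPsum, Finset.sum_map_val]
        simp [hn])
    have hcardS : (Multiset.card (P + C.val.map n) : ℚ) - 2 = k + 1 := by
      have : Multiset.card (P + C.val.map n) = k + 3 := by
        rw [Multiset.card_add, hP, Multiset.card_map, Multiset.card_map]
        exact hk.symm
      rw [this]; push_cast; ring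
    have hmain : monodromyCount ρ O (k + 1) x = 2 ^ k * (k.factorial : ℚ) *
        (∏ d ∈ C, (d.card : ℚ)) * (2 * ((k : ℚ) + 1) * intTreeSum (P + C.val.map n)) := by
      rw [← hcardS, key, monodromyCount_succ hO, ← Finset.sum_add_distrib, Finset.mul_sum]
      refine Finset.sum_congr rfl fun c hc => ?_
      have hterm : ∀ a ∈ c, (∑ b ∈ c.erase a, stepCount ρ O k x a b +
          ∑ c' ∈ C.erase c, ∑ b ∈ c', stepCount ρ O k x a b) =
          2 ^ k * (k.factorial : ℚ) * (∏ d ∈ C.erase c, (d.card : ℚ)) *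
          (splitSum (fun A B => posBranch A * posBranch B) (P + (C.erase c).val.map n) +
          ∑ c' ∈ C.erase c, posBranch (P + ((C.erase c).erase c').val.map n)) := by
        intro a ha
        have hca := eq_cycleSet_of_mem hc ha
        have haO := mem_of_mem_cyclesIn hO hc ha
        rw [mul_add]
        congr 1
        · have := sum_stepCount_cut ih' hO hx haO hk hsum
          rw [← hca] at this
          exact this
        · rw [Finset.mul_sum]
          refine Finset.sum_congr rfl fun c' hc' => ?_
          have : ∀ b ∈ c', stepCount ρ O k x a b = 2 ^ k * (k.factorial : ℚ) *
              (∏ d ∈ (C.erase c).erase c', (d.card : ℚ)) *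
              posBranch (P + ((C.erase c).erase c').val.map n) := by
            intro b hb
            obtain ⟨_, hcb, h, _, hbO⟩ := hdis c hc c' hc' a ha b hb
            rw [stepCount_join h, (hjoin haO hbO h).2 hk hsum, ← hca, ← hcb]
            rfl
          -- The number of choices of `b` is the length of `c'`, the factor missing from the product
          -- after the join.
          rw [Finset.sum_congr rfl this, Finset.sum_const, nsmul_eq_mul,
            ← Finset.mul_prod_erase _ _ hc']
          ring
      rw [Finset.sum_congr rfl hterm, Finset.sum_const, nsmul_eq_mul,
        ← Finset.mul_prod_erase _ _ hc]
      ring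
    have hB : cycleBranch x (C.erase c₀) = c₀.card * intTreeSum (P + C.val.map n) :=
      cycleBranch_erase hc₀ (Finset.card_pos.2 (nonempty_of_mem_cyclesIn hc₀))
        (by rw [hsum, ← sum_card_cyclesIn hO]) (by omega)
    rw [hmain, hB, ← Finset.mul_prod_erase _ _ hc₀, Nat.factorial_succ, pow_succ]
    push_cast
    ring

end CutJoin

/-! ### Labellings of the cycles of a permutation. -/

section Labellings

theorem count_map_univ {D : Type*} [Fintype D] (f : D → ℕ) (n : ℕ) :
    (univ.val.map f).count n = Fintype.card {a // f a = n} := by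
  classical
  rw [Multiset.count_map, Fintype.card_subtype]
  change _ = Multiset.card (Multiset.filter _ _)
  congr 1
  exact Multiset.filter_congr fun x _ => eq_comm

/-- Once one value-preserving bijection exists, the others differ from it by permutations preserving
the values, and these form a product of symmetric groups. -/
theorem card_equiv_eq_matchCount {A B : Type*} [Fintype A] [Fintype B] (h : A → ℕ) (g : B → ℕ) :
    (Nat.card {e : A ≃ B // ∀ a, g (e a) = h a} : ℚ) =
      matchCount (univ.val.map h) (univ.val.map g) := by
  classical
  rw [matchCount]
  split_ifs with heq
  · have hfib : ∀ n, Nonempty ({a // h a = n} ≃ {b // g b = n}) := fun n => by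
      rw [← Fintype.card_eq, ← count_map_univ h n, ← count_map_univ g n, heq]
    let e₀ : A ≃ B := Equiv.ofFiberEquiv fun n => (hfib n).some
    have he₀ : ∀ a, g (e₀ a) = h a := Equiv.ofFiberEquiv_map _
    have e : {e : A ≃ B // ∀ a, g (e a) = h a} ≃ {p : Equiv.Perm A // h ∘ p = h} :=
      { toFun := fun e => ⟨e.1.trans e₀.symm, funext fun a => by
          have := he₀ (e₀.symm (e.1 a))
          simp only [Function.comp_apply, Equiv.trans_apply]
          rw [← this, Equiv.apply_symm_apply, e.2]⟩
        invFun := fun p => ⟨p.1.trans e₀, fun a => by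
          rw [Equiv.trans_apply, he₀]; exact congrFun p.2 a⟩
        left_inv := fun e => by ext; simp
        right_inv := fun p => by ext; simp }
    rw [Nat.card_congr e, Nat.card_eq_fintype_card, DomMulAct.stabilizer_card', ← heq,
      Multiset.toFinset_map]
    simp only [count_map_univ, Finset.val_toFinset]
  · rw [Nat.cast_eq_zero, Nat.card_eq_zero]
    left
    refine ⟨fun e => heq ?_⟩
    have : univ.val.map g = (univ.val.map e.1).map g := by
      congr 1
      have := congrArg Finset.val (Finset.map_univ_equiv e.1)
      rw [← this]; rfl
    rw [this, Multiset.map_map]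
    exact Multiset.map_congr rfl fun a _ => (e.2 a).symm

variable {X ι : Type*} [Fintype X] [DecidableEq X] [Fintype ι]

/-- Such a labelling is a bijection from cycles to labels that respects the lengths; positivity of
`μ` makes every label occur. -/
theorem card_labellings (σ : Equiv.Perm X) (μ : ι → ℕ) (hμ : ∀ i, 0 < μ i) :
    (Nat.card {f : X → ι // (∀ s t, f s = f t ↔ σ.SameCycle s t) ∧
      ∀ i, Nat.card {s // f s = i} = μ i} : ℚ) =
      matchCount (cycleLens σ univ) (univ.val.map μ) := by
  classical
  have hC : cycleLens σ univ = (univ : Finset {c // c ∈ cyclesIn σ univ}).val.map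
      fun c => c.1.card := by
    rw [cycleLens, ← Finset.attach_eq_univ]
    conv_lhs => rw [← Finset.attach_map_val (s := cyclesIn σ univ)]
    rw [Finset.map_val, Multiset.map_map]
    rfl
  rw [hC, ← card_equiv_eq_matchCount]
  congr 1
  symm
  have hmem : ∀ s : X, cycleSet σ s ∈ cyclesIn σ univ := fun s => cycleSet_mem_cyclesIn (mem_univ s)
  have hfib : ∀ (e : {c // c ∈ cyclesIn σ univ} ≃ ι) c,
      Nat.card {s // e ⟨cycleSet σ s, hmem s⟩ = e c} = c.1.card := by
    intro e c
    rw [Nat.card_eq_fintype_card, Fintype.card_subtype]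
    congr 1
    ext s
    simp only [Finset.mem_filter, Finset.mem_univ, true_and, EmbeddingLike.apply_eq_iff_eq]
    constructor
    · rintro rfl; exact self_mem_cycleSet
    · intro hs; exact Subtype.ext (eq_cycleSet_of_mem c.2 hs).symm
  refine Nat.card_eq_of_bijective (fun e => ⟨fun s => e.1 ⟨cycleSet σ s, hmem s⟩, ?_, ?_⟩) ⟨?_, ?_⟩
  · intro s t
    rw [EmbeddingLike.apply_eq_iff_eq, Subtype.mk.injEq, cycleSet_eq_iff]
  · intro i
    obtain ⟨c, rfl⟩ := e.1.surjective i
    rw [hfib, e.2]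
  · intro e e' h
    refine Subtype.ext (Equiv.ext fun c => ?_)
    obtain ⟨s, hs⟩ := nonempty_of_mem_cyclesIn c.2
    have hc : c = ⟨cycleSet σ s, hmem s⟩ := Subtype.ext (eq_cycleSet_of_mem c.2 hs)
    rw [hc]
    exact congrFun (congrArg Subtype.val h) s
  · rintro ⟨f, hf1, hf2⟩
    choose r hr using fun c : {c // c ∈ cyclesIn σ univ} => nonempty_of_mem_cyclesIn c.2
    have hr' : ∀ c, c.1 = cycleSet σ (r c) := fun c => eq_cycleSet_of_mem c.2 (hr c)
    have hfr : ∀ s, f (r ⟨cycleSet σ s, hmem s⟩) = f s := fun s =>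
      (hf1 _ _).2 (cycleSet_eq_iff.1 (hr' ⟨cycleSet σ s, hmem s⟩).symm)
    have hbij : Function.Bijective fun c => f (r c) := by
      constructor
      · intro c c' h
        have := (hf1 _ _).1 h
        exact Subtype.ext (by rw [hr' c, hr' c', cycleSet_eq_iff.2 this])
      · intro i
        have : 0 < Nat.card {s // f s = i} := by rw [hf2]; exact hμ i
        obtain ⟨⟨s, hs⟩⟩ := (Nat.card_pos_iff.1 this).1
        exact ⟨⟨cycleSet σ s, hmem s⟩, by rw [← hs]; exact hfr s⟩
    have hval : ∀ s, Equiv.ofBijective _ hbij ⟨cycleSet σ s, hmem s⟩ = f s := hfr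
    refine ⟨⟨Equiv.ofBijective _ hbij, fun c => ?_⟩, Subtype.ext (funext hval)⟩
    rw [← hf2, ← hfib (Equiv.ofBijective _ hbij) c]
    exact Nat.card_congr (Equiv.subtypeEquivRight fun s => by rw [hval])

/-- The number of pairs of a permutation and a labelling of its cycles. -/
theorem cycleLens_eq_cycleType (σ : Equiv.Perm X) :
    cycleLens σ univ = σ.cycleType + Multiset.replicate (Fintype.card X - σ.cycleType.sum) 1 := by
  have hs : IsInv σ σ.support := fun a => Equiv.Perm.apply_mem_support
  have hs' : IsInv σ σ.supportᶜ := fun a => by simp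
  have e1 : cycleLens σ σ.support = σ.cycleType := by
    have : cyclesIn σ σ.support = σ.cycleFactorsFinset.image Equiv.Perm.support := by
      ext d
      simp only [cyclesIn, Finset.mem_image]
      have key : ∀ a ∈ σ.support, (σ.cycleOf a).support = cycleSet σ a := by
        intro a ha
        ext b
        rw [mem_cycleSet]
        exact Equiv.Perm.mem_support_cycleOf_iff' (Equiv.Perm.mem_support.1 ha)
      constructor
      · rintro ⟨a, ha, rfl⟩
        exact ⟨σ.cycleOf a, Equiv.Perm.cycleOf_mem_cycleFactorsFinset_iff.2 ha, key a ha⟩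
      · rintro ⟨p, hp, rfl⟩
        obtain ⟨a, ha⟩ := ((Equiv.Perm.mem_cycleFactorsFinset_iff.1 hp).1).nonempty_support
        have hpa := Equiv.Perm.cycle_is_cycleOf ha hp
        have ha' := Equiv.Perm.mem_cycleFactorsFinset_support_le hp ha
        exact ⟨a, ha', by rw [hpa, key a ha']⟩
    rw [cycleLens, this, Finset.image_val_of_injOn, Multiset.map_map]
    · rfl
    · intro p hp q hq hpq
      obtain ⟨a, ha⟩ := ((Equiv.Perm.mem_cycleFactorsFinset_iff.1 hp).1).nonempty_support
      rw [Equiv.Perm.cycle_is_cycleOf ha hp]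
      have hpq : p.support = q.support := hpq
      rw [hpq] at ha
      rw [Equiv.Perm.cycle_is_cycleOf ha hq]
  have e2 : cycleLens σ σ.supportᶜ = Multiset.replicate (Fintype.card X - σ.cycleType.sum) 1 := by
    have : cyclesIn σ σ.supportᶜ = σ.supportᶜ.image singleton := by
      refine Finset.image_congr fun a ha => ?_
      have ha : σ a = a := by simpa using ha
      ext b
      rw [mem_cycleSet, Finset.mem_singleton]
      constructor
      · intro h
        obtain ⟨n, rfl⟩ := h.exists_nat_pow_eq
        exact Equiv.Perm.pow_apply_eq_self_of_apply_eq_self ha n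
      · rintro rfl; exact sameCycle_self
    rw [cycleLens, this, Finset.image_val_of_injOn (Finset.singleton_injective.injOn),
      Multiset.map_map, Multiset.eq_replicate]
    refine ⟨?_, ?_⟩
    · rw [Multiset.card_map, Equiv.Perm.sum_cycleType, Finset.card_val, Finset.card_compl]
    · intro b hb
      obtain ⟨c, _, rfl⟩ := Multiset.mem_map.1 hb
      simp
  rw [← Finset.union_compl σ.support, cycleLens_union hs hs' disjoint_compl_right, e1, e2]

/-- This is the class formula: the permutations of the given cycle lengths, times the products of
lengths and of factorials of multiplicities, give the factorial of the degree. The labellings supply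
the multiplicities. -/
theorem sum_matchCount_cycleLens {y : Multiset ℕ} (hy : ∀ v ∈ y, 0 < v)
    (hsum : y.sum = Fintype.card X) :
    (∑ ρ : Equiv.Perm X, matchCount (cycleLens ρ univ) y) * (y.prod : ℚ) =
      (Fintype.card X).factorial := by
  set m := y.filter (2 ≤ ·) with hm
  -- The parts equal to `1` are separated, since `cycleType` leaves out the fixed points.
  have hy1 : y = m + Multiset.replicate (y.count 1) 1 := by
    rw [← Multiset.filter_eq' y 1]
    conv_lhs => rw [← Multiset.filter_add_not (2 ≤ ·) y]
    congr 1
    refine Multiset.filter_congr fun v hv => ?_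
    have := hy v hv
    omega
  have hmsum : m.sum + y.count 1 = Fintype.card X := by
    rw [← hsum]
    conv_rhs => rw [hy1]
    simp
  have hm2 : ∀ a ∈ m, 2 ≤ a := fun a ha => (Multiset.mem_filter.1 ha).2
  have hiff : ∀ ρ : Equiv.Perm X, cycleLens ρ univ = y ↔ ρ.cycleType = m := by
    intro ρ
    rw [cycleLens_eq_cycleType]
    constructor
    · intro h
      rw [hm, ← h, Multiset.filter_add, Multiset.filter_eq_self.2, Multiset.filter_eq_nil.2,
        add_zero]
      · intro a ha
        rw [Multiset.eq_of_mem_replicate ha]; omega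
      · exact fun a ha => Equiv.Perm.two_le_of_mem_cycleType ha
    · intro h
      rw [h]
      conv_rhs => rw [hy1]
      congr 2
      omega
  have hprod : y.prod = m.prod := by
    conv_lhs => rw [hy1]
    simp
  have hfac : ∏ v ∈ y.toFinset, (y.count v).factorial =
      (y.count 1).factorial * ∏ v ∈ m.toFinset, (m.count v).factorial := by
    have e1 : ∏ v ∈ y.toFinset, (y.count v).factorial =
        ∏ v ∈ insert 1 m.toFinset, (y.count v).factorial := by
      refine Finset.prod_subset ?_ ?_
      · intro v hv
        rw [Multiset.mem_toFinset] at hv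
        have := hy v hv
        rw [Finset.mem_insert, Multiset.mem_toFinset, hm, Multiset.mem_filter]
        by_cases h : v = 1
        · exact Or.inl h
        · exact Or.inr ⟨hv, by omega⟩
      · intro v _ hv
        rw [Multiset.mem_toFinset] at hv
        rw [Multiset.count_eq_zero_of_notMem hv, Nat.factorial_zero]
    rw [e1, Finset.prod_insert]
    · congr 1
      refine Finset.prod_congr rfl fun v hv => ?_
      rw [Multiset.mem_toFinset] at hv
      rw [hm, Multiset.count_filter_of_pos (hm2 v hv)]
    · rw [Multiset.mem_toFinset]
      intro h
      have := hm2 1 h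
      omega
  have h := Equiv.Perm.card_of_cycleType_mul_eq X m
  rw [if_pos ⟨by omega, hm2⟩, show Fintype.card X - m.sum = y.count 1 by omega] at h
  rw [← h]
  simp only [matchCount, hiff]
  rw [← Finset.sum_filter, Finset.sum_const, nsmul_eq_mul, hfac, hprod]
  push_cast
  ring

end Labellings

/-! ### From ordered pairs to transpositions, and transitivity. -/

section TransitiveCount

open Equiv

variable {X : Type*} [Fintype X] [DecidableEq X]

theorem swap_mem_pair {x y a b : X} (hab : a ≠ b) :
    swap a b = swap x y ↔ ((a, b) : X × X) = (x, y) ∨ ((a, b) : X × X) = (y, x) := by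
  constructor
  · intro h
    have h1 : swap x y a = b := by rw [← h, swap_apply_left]
    have h2 : a = x ∨ a = y := by
      by_contra hc
      push Not at hc
      rw [swap_apply_of_ne_of_ne hc.1 hc.2] at h1
      exact hab h1
    rcases h2 with rfl | rfl
    · rw [swap_apply_left] at h1; exact Or.inl (by rw [h1])
    · rw [swap_apply_right] at h1; exact Or.inr (by rw [h1])
  · rintro (h | h) <;> obtain ⟨rfl, rfl⟩ := Prod.mk.inj h
    · rfl
    · exact swap_comm _ _

open Classical in
theorem sum_offDiag_swap (H : Perm X → ℚ) :
    ∑ p ∈ (univ : Finset X).offDiag, H (swap p.1 p.2) =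
      2 * ∑ g : Perm X, if g.IsSwap then H g else 0 := by
  rw [← Finset.sum_fiberwise_of_maps_to (t := univ) (g := fun p : X × X => swap p.1 p.2)
    (fun _ _ => Finset.mem_univ _), Finset.mul_sum]
  refine Finset.sum_congr rfl fun g _ => ?_
  have e : ∀ p ∈ ({p ∈ (univ : Finset X).offDiag | swap p.1 p.2 = g}), H (swap p.1 p.2) = H g :=
    fun p hp => by rw [(Finset.mem_filter.1 hp).2]
  rw [Finset.sum_congr rfl e, Finset.sum_const, nsmul_eq_mul]
  split_ifs with hg
  · obtain ⟨x, y, hxy, rfl⟩ := hg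
    have : ({p ∈ (univ : Finset X).offDiag | swap p.1 p.2 = swap x y}) = {(x, y), (y, x)} := by
      ext ⟨a, b⟩
      simp only [Finset.mem_filter, Finset.mem_offDiag, Finset.mem_univ, true_and,
        Finset.mem_insert, Finset.mem_singleton]
      constructor
      · rintro ⟨hab, h⟩
        exact (swap_mem_pair hab).1 h
      · intro h
        have hab : a ≠ b := by
          rcases h with h | h <;> obtain ⟨rfl, rfl⟩ := Prod.mk.inj h
          · exact hxy
          · exact hxy.symm
        exact ⟨hab, (swap_mem_pair hab).2 h⟩
    rw [this, Finset.card_pair]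
    · norm_num
    · intro h
      exact hxy (Prod.mk.inj h).1
  · have : ({p ∈ (univ : Finset X).offDiag | swap p.1 p.2 = g}) = ∅ := by
      refine Finset.filter_eq_empty_iff.2 fun p hp h => hg ?_
      exact ⟨p.1, p.2, (Finset.mem_offDiag.1 hp).2.2, h.symm⟩
    rw [this]; simp

-- Each transposition comes from two ordered pairs. The reversal is needed because the successive
-- factors in `swapProd` are multiplied on the left.
open Classical in
theorem listSum_offDiag_swapList (k : ℕ) (G : List (Perm X) → ℚ) :
    listSum (univ : Finset X).offDiag k (fun l => G (swapList l).reverse) =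
      2 ^ k * ∑ τ : Fin k → Perm X, if ∀ s, (τ s).IsSwap then G (List.ofFn τ) else 0 := by
  induction k generalizing G with
  | zero =>
    have : (Finset.univ : Finset (Fin 0 → Perm X)) = {Fin.elim0} := by
      ext τ; simp only [Finset.mem_univ, Finset.mem_singleton, Subsingleton.elim τ Fin.elim0]
    simp [listSum, swapList, this]
  | succ k ih =>
    obtain ⟨H, hH⟩ : ∃ H : Perm X → ℚ, H = fun g => 2 ^ k * ∑ τ : Fin k → Perm X,
      if ∀ s, (τ s).IsSwap then G (List.ofFn τ ++ [g]) else 0 := ⟨_, rfl⟩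
    have e : ∀ p ∈ (univ : Finset X).offDiag, listSum (univ : Finset X).offDiag k
        (fun l => G (swapList (p :: l)).reverse) = H (swap p.1 p.2) := by
      intro p _
      rw [hH]
      dsimp only
      rw [← ih (fun L => G (L ++ [swap p.1 p.2]))]
      refine listSum_congr fun l _ _ => ?_
      rw [swapList, List.map_cons, List.reverse_cons]
      rfl
    rw [listSum, Finset.sum_congr rfl e, sum_offDiag_swap, hH, pow_succ,
      ← (Fin.snocEquiv fun _ => Perm X).sum_comp, Fintype.sum_prod_type]
    simp only [Finset.mul_sum]
    refine Finset.sum_congr rfl fun g _ => ?_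
    split_ifs with hg
    · rw [Finset.mul_sum]
      refine Finset.sum_congr rfl fun τ _ => ?_
      have : (∀ s, ((Fin.snocEquiv fun _ : Fin (k + 1) => Perm X) (g, τ) s).IsSwap) ↔
          ∀ s, (τ s).IsSwap := by
        rw [Fin.forall_fin_succ']
        simp [Fin.snocEquiv, hg]
      rw [List.ofFn_succ', List.concat_eq_append]
      simp only [this]
      simp [Fin.snocEquiv]
      split_ifs <;> ring
    · rw [mul_zero]
      symm
      refine Finset.sum_eq_zero fun τ _ => ?_
      rw [if_neg, mul_zero]
      intro h
      have := h (Fin.last k)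
      simp [Fin.snocEquiv] at this
      exact hg this

theorem swapProd_eq (ρ : Perm X) (l : List (X × X)) :
    swapProd ρ l = (swapList l).reverse.prod * ρ := by
  induction l generalizing ρ with
  | nil => simp [swapProd, swapList]
  | cons p l ih =>
    have : swapProd ρ (p :: l) = swapProd (swap p.1 p.2 * ρ) l := rfl
    rw [this, ih]
    simp [swapList, mul_assoc]

/-- Orbits of the generated group are invariant under the generators, and invariance under
generators passes to the group. Only the invariant sets enter, so the generators may be replaced by
others with the same invariant sets. -/
theorem isPretransitive_closure_iff [Nonempty X] (T : Set (Perm X)) (gs : List (Perm X))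
    (hT : ∀ V : Finset X, (∀ g ∈ T, IsInv g V) ↔ ∀ g ∈ gs, IsInv g V) :
    MulAction.IsPretransitive (Subgroup.closure T) X ↔ IsComponent gs univ := by
  classical
  constructor
  · intro h
    refine ⟨Finset.univ_nonempty, fun g _ a => by simp, fun V _ ⟨a, ha⟩ hV => ?_⟩
    have hV := (hT V).2 hV
    have key : ∀ g ∈ Subgroup.closure T, IsInv g V := by
      intro g hg
      induction hg using Subgroup.closure_induction with
      | mem x hx => exact hV x hx
      | one => exact fun a => by simp
      | mul x y _ _ hx hy => exact hx.mul hy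
      | inv x _ hx => exact fun a => by rw [← hx (x⁻¹ a), ← Perm.mul_apply, mul_inv_cancel, Perm.one_apply]
    rw [Finset.eq_univ_iff_forall]
    intro b
    obtain ⟨g, rfl⟩ := MulAction.exists_smul_eq (Subgroup.closure T) a b
    exact (key g.1 g.2 a).2 ha
  · intro h
    refine ⟨fun a b => ?_⟩
    have hV : ({b | b ∈ MulAction.orbit (Subgroup.closure T) a} : Finset X) = univ := by
      refine h.2.2 _ (Finset.subset_univ _) ⟨a, by simp⟩ ((hT _).1 fun g hg b => ?_)
      simp only [Finset.mem_filter, Finset.mem_univ, true_and]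
      have h1 : MulAction.orbit (Subgroup.closure T) (g b) =
          MulAction.orbit (Subgroup.closure T) b :=
        MulAction.orbit_eq_iff.2 ⟨⟨g, Subgroup.subset_closure hg⟩, rfl⟩
      rw [← MulAction.orbit_eq_iff, ← MulAction.orbit_eq_iff, h1]
    have := Finset.mem_univ b
    rw [← hV, Finset.mem_filter] at this
    exact this.2

end TransitiveCount

/-! ### Double Hurwitz numbers as tree sums. -/

section HurwitzCount

open Equiv

variable {ι : Type*} {κ : Type*} [Fintype ι] [Fintype κ]

/-- The data of a labelling of the cycles of `σ` with prescribed lengths. -/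
abbrev CycleLabelling {X ι : Type*} (σ : Perm X) (μ : ι → ℕ) : Type _ :=
  {f : X → ι // (∀ s t, f s = f t ↔ σ.SameCycle s t) ∧ ∀ i, Nat.card {s // f s = i} = μ i}

/-- The sequences of transpositions that generate together with `ρ` a transitive group. -/
abbrev TransitiveSwaps {X : Type*} [DecidableEq X] (ρ : Perm X) (k : ℕ) : Type _ :=
  {τ : Fin k → Perm X // (∀ s, (τ s).IsSwap) ∧ MulAction.IsPretransitive
    (Subgroup.closure ({((List.ofFn τ).prod * ρ)⁻¹, ρ} ∪ Set.range τ)) X}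

/-- A monodromy system is determined by the monodromy around the finite branch points. -/
def monodromySystemEquiv (μ : ι → ℕ) (ν : κ → ℕ) : MonodromySystem μ ν ≃
    Σ ρ : Perm (Fin (∑ i, μ i)),
      Σ τ : TransitiveSwaps ρ (Fintype.card ι + Fintype.card κ - 2),
        CycleLabelling ((List.ofFn τ.1).prod * ρ)⁻¹ μ × CycleLabelling ρ ν where
  toFun S := ⟨S.atZero, ⟨S.simple, S.simple_isSwap, by
      have := S.transitive
      rwa [eq_inv_of_mul_eq_one_left ((mul_assoc _ _ _).symm.trans S.prod_eq_one)] at this⟩,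
    ⟨S.poleLabel, by
      rw [← eq_inv_of_mul_eq_one_left ((mul_assoc _ _ _).symm.trans S.prod_eq_one)]
      exact ⟨S.poleLabel_eq_iff, S.card_poleLabel⟩⟩,
    ⟨S.zeroLabel, S.zeroLabel_eq_iff, S.card_zeroLabel⟩⟩
  invFun T :=
    { atInfty := ((List.ofFn T.2.1.1).prod * T.1)⁻¹
      atZero := T.1
      simple := T.2.1.1
      poleLabel := T.2.2.1.1
      zeroLabel := T.2.2.2.1
      simple_isSwap := T.2.1.2.1
      prod_eq_one := by rw [mul_assoc, inv_mul_cancel]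
      transitive := T.2.1.2.2
      poleLabel_eq_iff := T.2.2.1.2.1
      zeroLabel_eq_iff := T.2.2.2.2.1
      card_poleLabel := T.2.2.1.2.2
      card_zeroLabel := T.2.2.2.2.2 }
  left_inv S := by
    have := eq_inv_of_mul_eq_one_left ((mul_assoc _ _ _).symm.trans S.prod_eq_one)
    rcases S with ⟨σ, ρ, τ, f, g, _, _, _, _, _, _, _⟩
    dsimp only at this
    subst this
    rfl
  right_inv T := rfl

theorem cycleLens_inv {X : Type*} [Fintype X] [DecidableEq X] (σ : Perm X) (O : Finset X) :
    cycleLens σ⁻¹ O = cycleLens σ O := by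
  have : cyclesIn σ⁻¹ O = cyclesIn σ O := by
    refine Finset.image_congr fun a _ => ?_
    ext b
    rw [mem_cycleSet, mem_cycleSet, Perm.sameCycle_inv]
  rw [cycleLens, this, cycleLens]

/-- The monodromy around infinity preserves every set that `ρ` and the transpositions preserve, so
it does not affect transitivity; and inversion does not change its cycle lengths. -/
theorem sum_card_transitiveSwaps {X : Type*} [Fintype X] [DecidableEq X] [Nonempty X]
    (ρ : Perm X) (k : ℕ) (μ : ι → ℕ) (hμ : ∀ i, 0 < μ i) :
    2 ^ k * (Nat.card (Σ τ : TransitiveSwaps ρ k,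
      CycleLabelling ((List.ofFn τ.1).prod * ρ)⁻¹ μ) : ℚ) =
      monodromyCount ρ univ k (univ.val.map μ) := by
  classical
  have hfin : ∀ τ : TransitiveSwaps ρ k,
      Finite (CycleLabelling ((List.ofFn τ.1).prod * ρ)⁻¹ μ) := fun τ => inferInstance
  rw [Nat.card_sigma, Nat.cast_sum]
  simp only [card_labellings _ μ hμ, cycleLens_inv]
  have hW : monodromyCount ρ univ k (univ.val.map μ) =
      listSum (univ : Finset X).offDiag k fun l => (fun L : List (Perm X) =>
        (if IsComponent (ρ :: L.reverse) univ then (1 : ℚ) else 0) *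
        matchCount (cycleLens (L.prod * ρ) univ) (univ.val.map μ)) (swapList l).reverse := by
    refine listSum_congr fun l _ _ => ?_
    dsimp only
    rw [List.reverse_reverse, swapProd_eq]
  obtain ⟨G, hG⟩ : ∃ G : List (Perm X) → ℚ, G = fun L =>
    (if IsComponent (ρ :: L.reverse) univ then (1 : ℚ) else 0) *
      matchCount (cycleLens (L.prod * ρ) univ) (univ.val.map μ) := ⟨_, rfl⟩
  rw [hW, ← hG, listSum_offDiag_swapList, hG]
  congr 1
  rw [← Finset.sum_filter]
  simp only [ite_mul, one_mul, zero_mul]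
  rw [← Finset.sum_filter, Finset.filter_filter]
  symm
  refine Finset.sum_subtype _ (fun τ => ?_)
    (fun τ : Fin k → Perm X =>
      matchCount (cycleLens ((List.ofFn τ).prod * ρ) univ) (univ.val.map μ))
  rw [Finset.mem_filter, and_iff_right (Finset.mem_univ _)]
  refine and_congr_right fun _ => (isPretransitive_closure_iff _ _ fun V => ?_).symm
  constructor
  · intro h g hg
    rcases List.mem_cons.1 hg with rfl | hg
    · exact h _ (by simp)
    · rw [List.mem_reverse, List.mem_ofFn] at hg
      exact h g (Or.inr hg)
  · intro h
    have h1 : ∀ g ∈ List.ofFn τ, IsInv g V := fun g hg =>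
      h g (List.mem_cons_of_mem _ (List.mem_reverse.2 hg))
    have h2 : ∀ L : List (Perm X), (∀ g ∈ L, IsInv g V) → IsInv L.prod V := by
      intro L hL
      induction L with
      | nil => exact fun a => by simp
      | cons g L ih =>
        rw [List.prod_cons]
        exact (hL g List.mem_cons_self).mul (ih fun g hg => hL g (List.mem_cons_of_mem _ hg))
    have h3 := (h2 _ h1).mul (h ρ List.mem_cons_self)
    rintro g ((rfl | hg) | ⟨s, rfl⟩)
    · exact fun a => by rw [← h3, ← Perm.mul_apply, mul_inv_cancel, Perm.one_apply]
    · rw [Set.mem_singleton_iff.1 hg]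
      exact h ρ List.mem_cons_self
    · exact h1 _ (List.mem_ofFn.2 ⟨s, rfl⟩)

/-- There are `d! / ∏ ν` labelled permutations around zero, each with the same number `w / 2 ^ k` of
completions, so the factorial cancels. -/
theorem hurwitz_eq_of_const [Nonempty ι] {μ : ι → ℕ} {ν : κ → ℕ} (hμ : ∀ i, 0 < μ i)
    (hν : ∀ j, 0 < ν j) (hsum : ∑ i, μ i = ∑ j, ν j) {w : ℚ}
    (hw : ∀ ρ : Perm (Fin (∑ i, μ i)), cycleLens ρ univ = univ.val.map ν →
      monodromyCount ρ univ (Fintype.card ι + Fintype.card κ - 2) (univ.val.map μ) = w) :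
    hurwitz μ ν = w / (2 ^ (Fintype.card ι + Fintype.card κ - 2) * ∏ j, (ν j : ℚ)) := by
  classical
  set k := Fintype.card ι + Fintype.card κ - 2 with hk
  have hpos : 0 < ∑ i, μ i := Finset.sum_pos (fun i _ => hμ i) Finset.univ_nonempty
  have : Nonempty (Fin (∑ i, μ i)) := ⟨⟨0, hpos⟩⟩
  have hprod : ∏ j, (ν j : ℚ) ≠ 0 := Finset.prod_ne_zero_iff.2 fun j _ => by
    exact_mod_cast (hν j).ne'
  have hcard : 2 ^ k * (Nat.card (MonodromySystem μ ν) : ℚ) =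
      w * ∑ ρ : Perm (Fin (∑ i, μ i)), matchCount (cycleLens ρ univ) (univ.val.map ν) := by
    rw [Nat.card_congr (monodromySystemEquiv μ ν), Nat.card_sigma, Nat.cast_sum, Finset.mul_sum,
      Finset.mul_sum]
    refine Finset.sum_congr rfl fun ρ _ => ?_
    have e : (Σ τ : TransitiveSwaps ρ k,
        CycleLabelling ((List.ofFn τ.1).prod * ρ)⁻¹ μ × CycleLabelling ρ ν) ≃
        (Σ τ : TransitiveSwaps ρ k, CycleLabelling ((List.ofFn τ.1).prod * ρ)⁻¹ μ) ×
          CycleLabelling ρ ν :=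
      { toFun := fun T => ⟨⟨T.1, T.2.1⟩, T.2.2⟩
        invFun := fun T => ⟨T.1.1, T.1.2, T.2⟩
        left_inv := fun T => rfl
        right_inv := fun T => rfl }
    rw [Nat.card_congr e, Nat.card_prod, Nat.cast_mul, ← mul_assoc,
      sum_card_transitiveSwaps ρ k μ hμ, card_labellings ρ ν hν]
    by_cases h : cycleLens ρ univ = univ.val.map ν
    · rw [hw ρ h]
    · rw [matchCount, if_neg h, mul_zero, mul_zero]
  have hfac := sum_matchCount_cycleLens (X := Fin (∑ i, μ i)) (y := univ.val.map ν)
    (by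
      intro v hv
      obtain ⟨j, _, rfl⟩ := Multiset.mem_map.1 hv
      exact hν j)
    (by rw [Fintype.card_fin, hsum]; rfl)
  rw [Fintype.card_fin, Finset.prod_map_val, Nat.cast_prod] at hfac
  have hd : ((∑ i, μ i).factorial : ℚ) ≠ 0 := by exact_mod_cast Nat.factorial_ne_zero _
  rw [hurwitz, div_eq_div_iff hd (by positivity), ← hfac]
  linear_combination (∏ j, (ν j : ℚ)) * hcard

/-- The integer weights of the leaves of the trees for the genus zero covers. -/
def leafWeights (μ : ι → ℕ) (ν : κ → ℕ) : Multiset ℤ :=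
  univ.val.map (fun i => (μ i : ℤ)) + univ.val.map (fun j => -(ν j : ℤ))

/-- A genus zero double Hurwitz number is a sum over trees. -/
theorem hurwitz_eq_intTreeSum [Nonempty ι] [Nonempty κ] {μ : ι → ℕ} {ν : κ → ℕ}
    (hμ : ∀ i, 0 < μ i) (hν : ∀ j, 0 < ν j) (hsum : ∑ i, μ i = ∑ j, ν j)
    (hcard : 3 ≤ Fintype.card ι + Fintype.card κ) :
    hurwitz μ ν = ((Fintype.card ι + Fintype.card κ - 2).factorial : ℚ) *
      intTreeSum (leafWeights μ ν) := by
  classical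
  set k := Fintype.card ι + Fintype.card κ - 2 with hk
  have hd : 0 < ∑ i, μ i := Finset.sum_pos (fun i _ => hμ i) Finset.univ_nonempty
  have : Nonempty (Fin (∑ i, μ i)) := ⟨⟨0, hd⟩⟩
  have hprod : ∏ j, (ν j : ℚ) ≠ 0 := Finset.prod_ne_zero_iff.2 fun j _ => by
    exact_mod_cast (hν j).ne'
  rw [hurwitz_eq_of_const hμ hν hsum
    (w := 2 ^ k * (k.factorial : ℚ) * ((∏ j, (ν j : ℚ)) * intTreeSum (leafWeights μ ν)))]
  · rw [← hk]
    field_simp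
  intro ρ hρ
  have hO : IsInv ρ univ := fun a => by simp
  have hC : (cyclesIn ρ univ).card = Fintype.card κ := by
    have := congrArg Multiset.card hρ
    rwa [cycleLens, Multiset.card_map, Multiset.card_map] at this
  obtain ⟨c, hc⟩ := Finset.card_pos.1 (by rw [hC]; exact Fintype.card_pos : 0 < (cyclesIn ρ univ).card)
  have hxsum : (univ.val.map μ).sum = (univ : Finset (Fin (∑ i, μ i))).card := by
    rw [Finset.card_univ, Fintype.card_fin]; rfl
  have hxcard : Multiset.card (univ.val.map μ) = Fintype.card ι := Multiset.card_map _ _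
  rw [(countFormula k ρ univ _ hO Finset.univ_nonempty (by
      intro v hv
      obtain ⟨i, _, rfl⟩ := Multiset.mem_map.1 hv
      exact hμ i)).2 (by rw [hxcard, hC]; omega) c hc, if_pos hxsum,
    cycleBranch_erase hc (Finset.card_pos.2 (nonempty_of_mem_cyclesIn hc))
      (by rw [hxsum, sum_card_cyclesIn hO]) (by rw [hxcard, hC]; omega)]
  have hleaf : Multiset.map (Nat.cast : ℕ → ℤ) (univ.val.map μ) +
      ((cyclesIn ρ univ).val.map fun d => -(d.card : ℤ)) = leafWeights μ ν := by
    rw [leafWeights, Multiset.map_map]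
    congr 1
    have := congrArg (Multiset.map fun v : ℕ => -(v : ℤ)) hρ
    rwa [cycleLens, Multiset.map_map, Multiset.map_map] at this
  have hCprod : (c.card : ℚ) * ∏ d ∈ (cyclesIn ρ univ).erase c, (d.card : ℚ) = ∏ j, (ν j : ℚ) := by
    have := congrArg (fun s : Multiset ℕ => (s.map (Nat.cast : ℕ → ℚ)).prod) hρ
    simp only [cycleLens, Multiset.map_map] at this
    rw [Finset.mul_prod_erase _ (fun d : Finset _ => (d.card : ℚ)) hc]
    exact this
  rw [hleaf, ← hCprod]
  ring

/-- The case with no transposition and no trivalent tree: only the cyclic cover, with its cyclic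
group of automorphisms. -/
theorem hurwitz_eq_inv [Unique ι] [Unique κ] {μ : ι → ℕ} {ν : κ → ℕ}
    (hμ : ∀ i, 0 < μ i) (hν : ∀ j, 0 < ν j) (hsum : ∑ i, μ i = ∑ j, ν j) :
    hurwitz μ ν = 1 / (μ default : ℚ) := by
  classical
  have hd : 0 < ∑ i, μ i := Finset.sum_pos (fun i _ => hμ i) Finset.univ_nonempty
  have : Nonempty (Fin (∑ i, μ i)) := ⟨⟨0, hd⟩⟩
  have hμν : μ default = ν default := by simpa using hsum
  have hk : Fintype.card ι + Fintype.card κ - 2 = 0 := by simp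
  rw [hurwitz_eq_of_const hμ hν hsum (w := 1)]
  · rw [hk, Fintype.prod_unique, hμν]; simp
  intro ρ hρ
  rw [hk]
  have hO : IsInv ρ univ := fun a => by simp
  have hC : (cyclesIn ρ univ).card = 1 := by
    have := congrArg Multiset.card hρ
    rw [cycleLens, Multiset.card_map, Multiset.card_map] at this
    rw [Finset.card_val] at this
    simpa using this
  obtain ⟨c, hc⟩ := Finset.card_eq_one.1 hC
  have hx : univ.val.map μ = {μ default} := by rw [Finset.univ_unique]; rfl
  have hxsum : (univ.val.map μ).sum = (univ : Finset (Fin (∑ i, μ i))).card := by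
    rw [Finset.card_univ, Fintype.card_fin]; rfl
  rw [(countFormula 0 ρ univ _ hO Finset.univ_nonempty (by
      intro v hv
      obtain ⟨i, _, rfl⟩ := Multiset.mem_map.1 hv
      exact hμ i)).2 (by rw [hC, hx]; rfl) c (by rw [hc]; simp), if_pos hxsum, hc,
    Finset.erase_singleton, hx]
  have : cycleBranch {μ default} (∅ : Finset (Finset (Fin (∑ i, μ i)))) = 1 := by
    unfold cycleBranch
    rw [Multiset.map_singleton, Finset.empty_val, Multiset.map_zero, add_zero]
    exact posBranch_singleton (by exact_mod_cast hμ default)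
  rw [this]
  simp

end HurwitzCount

/-! ### Identities of Hurwitz-Abel and Jensen type. -/

section Abel

variable {S : Multiset ℚ} {a b c v : ℚ}

/-- The sum in the identity of Jensen type. -/
def jensenSum (a b : ℚ) (S : Multiset ℚ) : ℚ :=
  splitSum (fun A B => (a + A.sum) ^ Multiset.card A * (b + B.sum) ^ Multiset.card B) S

/-- The factor `a * (a + A) ^ (|A| - 1)`. -/
def abelFactor (a : ℚ) (A : Multiset ℚ) : ℚ :=
  if A = 0 then 1 else a * (a + A.sum) ^ (Multiset.card A - 1)

theorem abelFactor_cons : abelFactor a (v ::ₘ S) = a * (a + v + S.sum) ^ Multiset.card S := by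
  simp [abelFactor, add_assoc]

theorem mul_abelFactor : abelFactor a S * (a + S.sum) = a * (a + S.sum) ^ Multiset.card S := by
  rw [abelFactor]
  split_ifs with h
  · simp [h]
  · obtain ⟨k, hk⟩ := Nat.exists_eq_add_one_of_ne_zero (mt Multiset.card_eq_zero.1 h)
    rw [hk, Nat.add_sub_cancel, pow_succ]
    ring

theorem pow_card_eq : (a + S.sum) ^ Multiset.card S =
    abelFactor a S + S.sum * (a + S.sum) ^ (Multiset.card S - 1) := by
  rw [abelFactor]
  split_ifs with h
  · simp [h]
  · obtain ⟨k, hk⟩ := Nat.exists_eq_add_one_of_ne_zero (mt Multiset.card_eq_zero.1 h)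
    rw [hk, Nat.add_sub_cancel, pow_succ]
    ring

/-- Write `A.sum` as a sum over the elements of `A` and choose the distinguished element before the
splitting. -/
theorem splitSum_sum_mul (Ψ : Multiset ℚ → Multiset ℚ → ℚ) (S : Multiset ℚ) :
    splitSum (fun A B => A.sum * Ψ A B) S =
      (S.map fun v => v * splitSum (fun A B => Ψ (v ::ₘ A) B) (S.erase v)).sum := by
  induction S using Multiset.induction generalizing Ψ with
  | empty => simp
  | cons w S ih =>
    have e : ∀ v ∈ S, v * splitSum (fun A B => Ψ (v ::ₘ A) B) ((w ::ₘ S).erase v) =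
        v * splitSum (fun A B => Ψ (v ::ₘ A) (w ::ₘ B)) (S.erase v) +
        v * splitSum (fun A B => Ψ (w ::ₘ v ::ₘ A) B) (S.erase v) := by
      intro v hv
      rw [Multiset.erase_cons_tail_of_mem hv, splitSum_cons, mul_add]
      simp only [Multiset.cons_swap w v]
    have e2 : splitSum (fun A B => (w ::ₘ A).sum * Ψ (w ::ₘ A) B) S =
        w * splitSum (fun A B => Ψ (w ::ₘ A) B) S +
        splitSum (fun A B => A.sum * Ψ (w ::ₘ A) B) S := by
      rw [mul_splitSum, ← splitSum_add_fun]
      refine splitSum_congr fun A B _ => ?_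
      rw [Multiset.sum_cons]; ring
    rw [Multiset.map_cons, Multiset.sum_cons, Multiset.erase_cons_head, Multiset.map_congr rfl e,
      Multiset.sum_map_add, ← ih (fun A B => Ψ A (w ::ₘ B)), ← ih (fun A B => Ψ (w ::ₘ A) B),
      splitSum_cons, e2]
    ring

/-- The Hurwitz--Abel identity, and the invariance of the sum of Jensen type. -/
theorem abel_and_jensen (S : Multiset ℚ) :
    (∀ a b, splitSum (fun A B => abelFactor a A * (b + B.sum) ^ Multiset.card B) S =
      (a + b + S.sum) ^ Multiset.card S) ∧
    ∀ a b c, jensenSum (a + c) b S = jensenSum a (b + c) S := by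
  induction hn : Multiset.card S generalizing S with
  | zero =>
    obtain rfl := Multiset.card_eq_zero.1 hn
    simp [jensenSum, abelFactor]
  | succ n ih =>
    have habel : ∀ a b, splitSum (fun A B => abelFactor a A * (b + B.sum) ^ Multiset.card B) S =
        (a + b + S.sum) ^ (n + 1) := by
      intro a b
      obtain ⟨v, T, rfl⟩ : ∃ v T, S = v ::ₘ T := by
        obtain ⟨v, hv⟩ := Multiset.card_pos_iff_exists_mem.1 (by omega : 0 < Multiset.card S)
        exact ⟨v, S.erase v, (Multiset.cons_erase hv).symm⟩
      have hT : Multiset.card T = n := by simpa using hn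
      obtain ⟨h1, h2⟩ := ih T hT
      -- Sort by the side of `v`. Each side produces a Jensen sum of `T`, and the invariance for the
      -- smaller multiset makes them cancel.
      have e1 : splitSum (fun A B => abelFactor a (v ::ₘ A) * (b + B.sum) ^ Multiset.card B) T =
          a * jensenSum (a + v) b T := by
        rw [jensenSum, mul_splitSum]
        refine splitSum_congr fun A B _ => ?_
        rw [abelFactor_cons]; ring
      have e2 : splitSum (fun A B => abelFactor a A *
          (b + (v ::ₘ B).sum) ^ Multiset.card (v ::ₘ B)) T =
          (a + b + v + T.sum) * (a + (b + v) + T.sum) ^ n - a * jensenSum a (b + v) T := by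
        rw [jensenSum, ← h1, mul_splitSum, mul_splitSum, ← splitSum_sub_fun]
        refine splitSum_congr fun A B hAB => ?_
        rw [Multiset.sum_cons, Multiset.card_cons, ← hAB, Multiset.sum_add]
        linear_combination -(b + v + B.sum) ^ Multiset.card B * mul_abelFactor (a := a) (S := A)
      rw [splitSum_cons, e1, e2, h2, Multiset.sum_cons]
      ring
    refine ⟨habel, fun a b c => ?_⟩
    -- Splitting off the Abel part leaves Jensen sums with one element fewer, which by induction
    -- depend only on the sum of the two parameters.
    have key : ∀ a b, jensenSum a b S = (a + b + S.sum) ^ (n + 1) +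
        (S.map fun v => v * jensenSum (a + v) b (S.erase v)).sum := by
      intro a b
      rw [← habel]
      have e : jensenSum a b S = splitSum (fun A B => abelFactor a A *
          (b + B.sum) ^ Multiset.card B) S + splitSum (fun A B => A.sum *
          ((a + A.sum) ^ (Multiset.card A - 1) * (b + B.sum) ^ Multiset.card B)) S := by
        rw [jensenSum, ← splitSum_add_fun]
        refine splitSum_congr fun A B _ => ?_
        rw [pow_card_eq (S := A)]
        ring
      rw [e, splitSum_sum_mul]
      simp [jensenSum, add_assoc]
    rw [key, key]
    congr 1
    · ring
    · congr 1
      refine Multiset.map_congr rfl fun v hv => ?_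
      congr 1
      rw [← (ih (S.erase v) (by rw [Multiset.card_erase_of_mem hv, hn]; rfl)).2]
      congr 1
      ring

/-- The derivative of the Hurwitz--Abel identity. -/
theorem splitSum_pow_card_pred (b : ℚ) (S : Multiset ℚ) :
    splitSum (fun A B => if A = 0 then 0 else
      A.sum ^ (Multiset.card A - 1) * (b + B.sum) ^ Multiset.card B) S =
      Multiset.card S * (b + S.sum) ^ (Multiset.card S - 1) := by
  induction S using Multiset.induction generalizing b with
  | empty => simp
  | cons v T ih =>
    have e1 : splitSum (fun A B => if v ::ₘ A = 0 then 0 else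
        (v ::ₘ A).sum ^ (Multiset.card (v ::ₘ A) - 1) * (b + B.sum) ^ Multiset.card B) T =
        jensenSum v b T := splitSum_congr fun A B _ => by simp
    have e2 : splitSum (fun A B => if A = 0 then 0 else A.sum ^ (Multiset.card A - 1) *
        (b + (v ::ₘ B).sum) ^ Multiset.card (v ::ₘ B)) T =
        (b + v + T.sum) * (Multiset.card T * (b + v + T.sum) ^ (Multiset.card T - 1)) -
        jensenSum 0 (b + v) T + (b + v + T.sum) ^ Multiset.card T := by
      have e3 : (b + v + T.sum) ^ Multiset.card T = splitSum (fun A B => if A = 0 then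
          (b + v + B.sum) ^ Multiset.card B else 0) T := by
        rw [splitSum_eq_of_left_zero]
        · simp
        · intro A B _ hA; rw [if_neg hA]
      rw [← ih (b + v), e3, jensenSum, mul_splitSum, ← splitSum_sub_fun, ← splitSum_add_fun]
      refine splitSum_congr fun A B hAB => ?_
      by_cases hA : A = 0
      · simp [hA]
      · obtain ⟨k, hk⟩ := Nat.exists_eq_add_one_of_ne_zero (mt Multiset.card_eq_zero.1 hA)
        rw [if_neg hA, if_neg hA, if_neg hA, Multiset.sum_cons, Multiset.card_cons, ← hAB,
          Multiset.sum_add, hk, Nat.add_sub_cancel, pow_succ]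
        ring
    -- The Jensen sums from the two positions of `v` cancel by the invariance.
    have hj : jensenSum v b T = jensenSum 0 (b + v) T := by
      have := (abel_and_jensen T).2 0 b v
      rwa [zero_add] at this
    rw [splitSum_cons, e1, e2, hj, Multiset.sum_cons, Multiset.card_cons, Nat.add_sub_cancel]
    rcases Nat.eq_zero_or_pos (Multiset.card T) with h0 | h0
    · simp [h0]
    · obtain ⟨k, hk⟩ := Nat.exists_eq_add_one_of_ne_zero h0.ne'
      rw [hk, Nat.add_sub_cancel]
      push_cast
      ring

end Abel

/-! ### The tree sum when one positive leaf dominates. -/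

section BaseChamber

variable {M G : Type*} [AddCommGroup M] [AddCommGroup G] [LinearOrder G] [IsOrderedAddMonoid G]

theorem map_sum_nonneg {s : M →+ G} {X : Multiset M} (hX : ∀ x ∈ X, 0 ≤ s x) : 0 ≤ s X.sum := by
  rw [map_multiset_sum]
  refine Multiset.sum_nonneg fun v hv => ?_
  obtain ⟨x, hx, rfl⟩ := Multiset.mem_map.1 hv
  exact hX x hx

/-- The leaves are in the position of the chamber in which one positive leaf dominates. -/
structure BaseLeaves (s : M →+ G) (z : M →+ ℚ) (u : M) (X Y : Multiset M) : Prop where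
  pos_of_mem : ∀ x ∈ X, 0 < s x
  neg_of_mem : ∀ y ∈ Y, s y + s X.sum < 0
  sum_eq_zero : u + X.sum + Y.sum = 0
  weight_pos : 0 < z u
  weight_pos_of_mem : ∀ x ∈ X, 0 < z x
  ne_zero : Y ≠ 0

variable {s : M →+ G} {z : M →+ ℚ} {u : M} {X Y : Multiset M}

namespace BaseLeaves

theorem nonneg (h : BaseLeaves s z u X Y) {A : Multiset M} (hA : A ≤ X) : 0 ≤ s A.sum :=
  map_sum_nonneg fun x hx => (h.pos_of_mem x (Multiset.mem_of_le hA hx)).le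

/-- Each negative leaf outweighs all of `X`. Hence a branch without `u` that contains a negative
leaf has negative flow and contributes nothing. -/
theorem sum_neg (h : BaseLeaves s z u X Y) {A A' B : Multiset M} (hA : A + A' = X) (hB : B ≤ Y)
    (hB0 : B ≠ 0) : s A.sum + s B.sum < 0 := by
  obtain ⟨y, hy⟩ := Multiset.exists_mem_of_ne_zero hB0
  obtain ⟨B', rfl⟩ := Multiset.exists_cons_of_mem hy
  have hy := h.neg_of_mem y (Multiset.mem_of_le hB hy)
  have hB' : s B'.sum ≤ 0 := by
    have : 0 ≤ (-s) B'.sum := map_sum_nonneg fun v hv => by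
      have h1 := h.neg_of_mem v (Multiset.mem_of_le hB (Multiset.mem_cons_of_mem hv))
      have h2 := h.nonneg (le_refl X)
      rw [AddMonoidHom.neg_apply, neg_nonneg]
      exact (le_add_of_nonneg_right h2).trans h1.le
    rwa [AddMonoidHom.neg_apply, neg_nonneg] at this
  have hA' : s A.sum ≤ s X.sum := by
    rw [← hA, Multiset.sum_add, map_add]
    exact le_add_of_nonneg_right (h.nonneg (hA ▸ Multiset.le_add_left _ _))
  rw [Multiset.sum_cons, map_add]
  calc s A.sum + (s y + s B'.sum) ≤ s X.sum + (s y + 0) := by gcongr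
    _ = s y + s X.sum := by rw [add_zero, add_comm]
    _ < 0 := hy

/-- The complement contains a negative leaf and not `u`, so its flow is negative and this one is
positive. -/
theorem flow_pos (h : BaseLeaves s z u X Y) {A A' B B' : Multiset M} (hA : A + A' = X)
    (hB : B + B' = Y) (hB0 : B' ≠ 0) : 0 < s (u ::ₘ (A + B)).sum := by
  have h1 := h.sum_neg ((add_comm _ _).trans hA) (hB ▸ Multiset.le_add_left B' B) hB0
  have h2 := congrArg s h.sum_eq_zero
  rw [← hA, ← hB] at h2
  simp only [Multiset.sum_add, map_add, map_zero] at h2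
  rw [Multiset.sum_cons, Multiset.sum_add, map_add, map_add]
  have : s u + (s A.sum + s B.sum) = -(s A'.sum + s B'.sum) := by
    rw [eq_neg_iff_add_eq_zero, ← h2]; abel
  rw [this, neg_pos]
  exact h1

theorem weight_nonneg (h : BaseLeaves s z u X Y) {A : Multiset M} (hA : A ≤ X) : 0 ≤ z A.sum :=
  map_sum_nonneg fun x hx => (h.weight_pos_of_mem x (Multiset.mem_of_le hA hx)).le

theorem weight_add_pos (h : BaseLeaves s z u X Y) {A : Multiset M} (hA : A ≤ X) :
    0 < z u + z A.sum := add_pos_of_pos_of_nonneg h.weight_pos (h.weight_nonneg hA)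

/-- The formula for the tree sum in the base chamber. -/
def Formula (s : M →+ G) (z : M →+ ℚ) (u : M) (X Y : Multiset M) : Prop :=
  (z u + z X.sum) * treeSum (fun v => 0 < s v) z (u ::ₘ (X + Y)) =
    (z u + z X.sum) ^ Multiset.card X * z u ^ (Multiset.card Y - 1)

/-- Any leaf `x` of the branch can play the dominating role: the only negative leaf of the smaller
tree is the root edge, which outweighs the other leaves because `x` is positive. -/
theorem posBranchAt_left (h : BaseLeaves s z u X Y)
    (ih : ∀ u' X' Y', Multiset.card X' + Multiset.card Y' < Multiset.card X + Multiset.card Y →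
      BaseLeaves s z u' X' Y' → 2 ≤ Multiset.card X' + Multiset.card Y' → Formula s z u' X' Y')
    {A : Multiset M} (hA : A ≤ X) (hA0 : A ≠ 0) :
    posBranchAt s z A = z A.sum ^ (Multiset.card A - 1) := by
  obtain ⟨x, hx⟩ := Multiset.exists_mem_of_ne_zero hA0
  obtain ⟨B, rfl⟩ := Multiset.exists_cons_of_mem hx
  have hsx := h.pos_of_mem x (Multiset.mem_of_le hA hx)
  have hBX : B ≤ X := (Multiset.le_cons_self B x).trans hA
  rcases eq_or_ne B 0 with rfl | hB
  · simpa using posBranchAt_singleton s z hsx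
  have hBcard := Multiset.card_pos.2 hB
  have hpos : 0 < s (x ::ₘ B).sum := by
    rw [Multiset.sum_cons, map_add]
    exact add_pos_of_pos_of_nonneg hsx (h.nonneg hBX)
  have hzpos : 0 < z (x ::ₘ B).sum := by
    rw [Multiset.sum_cons, map_add]
    exact add_pos_of_pos_of_nonneg (h.weight_pos_of_mem x (Multiset.mem_of_le hA hx))
      (h.weight_nonneg hBX)
  have hYc := Multiset.card_pos.2 h.ne_zero
  have hAc := Multiset.card_le_card hA
  rw [Multiset.card_cons] at hAc
  have key := ih x B {-(x ::ₘ B).sum} (by rw [Multiset.card_singleton]; omega)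
    { pos_of_mem := fun v hv => h.pos_of_mem v (Multiset.mem_of_le hBX hv)
      neg_of_mem := fun y hy => by
        rw [Multiset.mem_singleton.1 hy, Multiset.sum_cons, map_neg, map_add]
        simpa using hsx
      sum_eq_zero := by simp
      weight_pos := h.weight_pos_of_mem x (Multiset.mem_of_le hA hx)
      weight_pos_of_mem := fun v hv => h.weight_pos_of_mem v (Multiset.mem_of_le hBX hv)
      ne_zero := Multiset.singleton_ne_zero _ } (by rw [Multiset.card_singleton]; omega)
  rw [Formula, ← map_add, ← Multiset.sum_cons] at key
  rw [posBranchAt_of_pos s z hpos (by rw [Multiset.card_cons]; omega)]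
  have e : -(x ::ₘ B).sum ::ₘ x ::ₘ B = x ::ₘ (B + {-(x ::ₘ B).sum}) := by
    rw [Multiset.cons_swap, add_comm, Multiset.singleton_add]
  rw [e, key]
  simp

/-- The root edge becomes one more negative leaf of the smaller tree. It still outweighs `A`, since
its flow is that of `A'` and `B'` together. -/
theorem posBranchAt_right (h : BaseLeaves s z u X Y)
    (ih : ∀ u' X' Y', Multiset.card X' + Multiset.card Y' < Multiset.card X + Multiset.card Y →
      BaseLeaves s z u' X' Y' → 2 ≤ Multiset.card X' + Multiset.card Y' → Formula s z u' X' Y')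
    {A A' B B' : Multiset M} (hA : A + A' = X) (hB : B + B' = Y) (hB0 : B' ≠ 0)
    (hcard : 2 ≤ Multiset.card A' + Multiset.card B') :
    (z u + z A.sum) * posBranchAt s z (u ::ₘ (A + B)) =
      z (u ::ₘ (A + B)).sum * (z u + z A.sum) ^ Multiset.card A * z u ^ Multiset.card B := by
  have hpos := h.flow_pos hA hB hB0
  rcases eq_or_ne (A + B) 0 with h0 | h0
  · obtain ⟨rfl, rfl⟩ := (add_eq_zero.1 h0 : A = 0 ∧ B = 0)
    have : 0 < s u := by simpa using hpos
    simp [posBranchAt_singleton s z this]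
  have hABc := Multiset.card_pos.2 h0
  rw [Multiset.card_add] at hABc
  have hAX : A ≤ X := hA ▸ Multiset.le_add_right _ _
  have hXc := congrArg Multiset.card hA
  have hYc := congrArg Multiset.card hB
  rw [Multiset.card_add] at hXc hYc
  have key := ih u A (-(u ::ₘ (A + B)).sum ::ₘ B) (by rw [Multiset.card_cons]; omega)
    { pos_of_mem := fun v hv => h.pos_of_mem v (Multiset.mem_of_le hAX hv)
      neg_of_mem := fun y hy => by
        rcases Multiset.mem_cons.1 hy with rfl | hy
        · have h1 := h.sum_neg (add_zero X) (hB ▸ Multiset.le_add_left B' B) hB0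
          have h2 := congrArg s h.sum_eq_zero
          rw [← hB] at h2
          rw [map_neg, Multiset.sum_cons, Multiset.sum_add]
          simp only [Multiset.sum_add, map_add, map_zero] at h2 ⊢
          have : -(s u + (s A.sum + s B.sum)) + s A.sum = s X.sum + s B'.sum := by
            rw [← sub_eq_zero, ← neg_eq_zero, ← h2]; abel
          rw [this]
          exact h1
        · have h1 := h.neg_of_mem y (hB ▸ Multiset.mem_add.2 (Or.inl hy))
          refine lt_of_le_of_lt ?_ h1
          rw [← hA, Multiset.sum_add, map_add]
          have := h.nonneg (hA ▸ Multiset.le_add_left A' A)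
          gcongr
          exact le_add_of_nonneg_right this
      sum_eq_zero := by simp only [Multiset.sum_cons, Multiset.sum_add]; abel
      weight_pos := h.weight_pos
      weight_pos_of_mem := fun v hv => h.weight_pos_of_mem v (Multiset.mem_of_le hAX hv)
      ne_zero := Multiset.cons_ne_zero } (by rw [Multiset.card_cons]; omega)
  rw [Formula, Multiset.card_cons, Nat.add_sub_cancel, Multiset.add_cons] at key
  rw [posBranchAt_of_pos s z hpos (by rw [Multiset.card_cons, Multiset.card_add]; omega),
    Multiset.cons_swap, mul_left_comm, key]
  ring

end BaseLeaves

/-- The last factor is `(w + B.sum) - (n - 1) * A.sum`. Its first part is summed by the derivative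
of the Hurwitz-Abel identity, its second part by that identity itself, in both cases without the
term `A = 0`. -/
theorem splitSum_baseLeaves (w : ℚ) (hw : 0 < w) (W : Multiset ℚ) (hW : ∀ v ∈ W, 0 < v) (n : ℚ) :
    w * splitSum (fun A B => if A = 0 then 0 else A.sum ^ (Multiset.card A - 1) *
      ((w + B.sum) ^ Multiset.card B / (w + B.sum)) * (w + W.sum - n * A.sum)) W *
      (w + W.sum) =
    w * Multiset.card W * (w + W.sum) ^ Multiset.card W -
      (n - 1) * ((w + W.sum) ^ (Multiset.card W + 1) - w * (w + W.sum) ^ Multiset.card W) := by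
  have hpos : ∀ A B, A + B = W → 0 < w + B.sum := fun A B h =>
    add_pos_of_pos_of_nonneg hw (Multiset.sum_nonneg fun v hv =>
      (hW v (h ▸ Multiset.mem_add.2 (Or.inr hv))).le)
  have hD := hpos 0 W (zero_add W)
  have h1 := splitSum_pow_card_pred w W
  have h2 := (abel_and_jensen W).1 w 0
  rw [← splitSum_swap, ← sub_eq_zero] at h2
  have e : splitSum (fun A B => if A = 0 then 0 else A.sum ^ (Multiset.card A - 1) *
      ((w + B.sum) ^ Multiset.card B / (w + B.sum)) * (w + W.sum - n * A.sum)) W =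
      splitSum (fun A B => if A = 0 then 0 else
        A.sum ^ (Multiset.card A - 1) * (w + B.sum) ^ Multiset.card B) W -
      (n - 1) * (w⁻¹ * splitSum (fun A B => if A = 0 then 0 else
        abelFactor w B * (0 + A.sum) ^ Multiset.card A) W) := by
    rw [mul_splitSum, mul_splitSum, ← splitSum_sub_fun]
    refine splitSum_congr fun A B hAB => ?_
    split_ifs with hA
    · simp
    have hB := hpos A B hAB
    obtain ⟨k, hk⟩ := Nat.exists_eq_add_one_of_ne_zero (mt Multiset.card_eq_zero.1 hA)
    have h3 := mul_abelFactor (a := w) (S := B)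
    rw [← eq_div_iff hB.ne'] at h3
    rw [h3, ← hAB, Multiset.sum_add, hk, Nat.add_sub_cancel, zero_add, pow_succ]
    field_simp
    ring
  have e2 : splitSum (fun A B => if A = 0 then 0 else
        abelFactor w B * (0 + A.sum) ^ Multiset.card A) W =
      (w + W.sum) ^ Multiset.card W - abelFactor w W := by
    have h4 : abelFactor w W = splitSum (fun A B => if A = 0 then abelFactor w B else 0) W := by
      rw [splitSum_eq_of_left_zero]
      · simp
      · intro A B _ hA; rw [if_neg hA]
    rw [sub_eq_zero, add_zero] at h2
    rw [h4, ← h2, ← splitSum_sub_fun]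
    refine splitSum_congr fun A B _ => ?_
    split_ifs with hA
    · simp [hA]
    · simp
  have h5 := mul_abelFactor (a := w) (S := W)
  rw [e, h1, e2]
  have h6 : (Multiset.card W : ℚ) * (w + W.sum) ^ (Multiset.card W - 1) * (w + W.sum) =
      Multiset.card W * (w + W.sum) ^ Multiset.card W := by
    rcases Nat.eq_zero_or_pos (Multiset.card W) with h0 | h0
    · simp [h0]
    · obtain ⟨k, hk⟩ := Nat.exists_eq_add_one_of_ne_zero h0.ne'
      rw [hk, Nat.add_sub_cancel, pow_succ]; ring
  have hw' : w * w⁻¹ = 1 := mul_inv_cancel₀ hw.ne'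
  rw [pow_succ]
  linear_combination w * h6 + (n - 1) * h5 - (n - 1) * (w + W.sum) *
    ((w + W.sum) ^ Multiset.card W - abelFactor w W) * hw'

/-- Induction through the recursion at the last vertex. With one negative leaf there, one branch
contains `u` and all other negative leaves, the other only leaves of `X`; with two, a single branch
holds everything else. The formula is multiplied by the total weight, so no negative exponent occurs
for `X = 0`. -/
theorem BaseLeaves.treeSum_eq (h : BaseLeaves s z u X Y)
    (hcard : 2 ≤ Multiset.card X + Multiset.card Y) : BaseLeaves.Formula s z u X Y := by
  classical
  induction hN : Multiset.card X + Multiset.card Y using Nat.strong_induction_on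
    generalizing u X Y with
  | _ N ih =>
  have ih' : ∀ u' X' Y', Multiset.card X' + Multiset.card Y' < Multiset.card X + Multiset.card Y →
      BaseLeaves s z u' X' Y' → 2 ≤ Multiset.card X' + Multiset.card Y' →
      BaseLeaves.Formula s z u' X' Y' := fun u' X' Y' hlt h' hc => ih _ (hN ▸ hlt) h' hc rfl
  obtain ⟨γ, _, C, n, hC⟩ : ∃ (γ : Type _) (_ : DecidableEq γ) (C : Finset γ) (n : γ → M),
      Y = C.val.map n := ⟨Y.ToType, inferInstance, univ, _, (Multiset.map_univ_coe Y).symm⟩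
  have hYc : Multiset.card Y = C.card := by rw [hC, Multiset.card_map]; rfl
  have hCpos : 0 < C.card := hYc ▸ Multiset.card_pos.2 h.ne_zero
  set D := z u + z X.sum with hD
  have hDpos : 0 < D := h.weight_add_pos le_rfl
  have hη : ∑ c ∈ C, -z (n c) = D := by
    have h1 := congrArg z h.sum_eq_zero
    rw [hC, Finset.sum_map_val, map_add, map_add, map_sum, map_zero] at h1
    rw [Finset.sum_neg_distrib]
    linarith
  have hsu : 0 < s u := by
    have := h.flow_pos (zero_add X) (zero_add Y) h.ne_zero
    simpa using this
  have hY' : ∀ c ∈ C, Y = (C.erase c).val.map n + {n c} := fun c hc => by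
    rw [hC, add_comm, Multiset.singleton_add, ← Multiset.map_cons,
      ← Finset.insert_val_of_notMem (Finset.notMem_erase c C), Finset.insert_erase hc]
  have hY'' : ∀ c ∈ C, ∀ c' ∈ C.erase c,
      Y = ((C.erase c).erase c').val.map n + {n c, n c'} := fun c hc c' hc' => by
    rw [hY' c hc, Multiset.insert_eq_cons, ← Multiset.singleton_add, add_comm {n c}, ← add_assoc]
    congr 1
    rw [add_comm, Multiset.singleton_add, ← Multiset.map_cons,
      ← Finset.insert_val_of_notMem (Finset.notMem_erase c' _), Finset.insert_erase hc']
  have hrec := mul_treeSum (s := s) (z := z) (P := u ::ₘ X) (by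
      intro v hv
      rcases Multiset.mem_cons.1 hv with rfl | hv
      · exact hsu
      · exact h.pos_of_mem v hv) C n
    (fun c hc => by
      have h1 := h.neg_of_mem (n c) (by rw [hY' c hc]; simp)
      exact lt_of_le_of_lt (le_add_of_nonneg_right (h.nonneg le_rfl)) h1)
    (by rw [← hC, Multiset.cons_add, Multiset.sum_cons, Multiset.sum_add, ← add_assoc]
        exact h.sum_eq_zero)
  have hcut : ∀ c ∈ C, splitSum (fun A B => posBranchAt s z A * posBranchAt s z B)
      (u ::ₘ X + (C.erase c).val.map n) = 2 * splitSum (fun A B => if A = 0 then 0 else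
        z A.sum ^ (Multiset.card A - 1) * ((z u + z B.sum) ^ Multiset.card B / (z u + z B.sum)) *
        (-z (n c) - z A.sum)) X * z u ^ (C.card - 1) := by
    intro c hc
    have hYe := hY' c hc
    have hcc : Multiset.card ((C.erase c).val.map n) = C.card - 1 := by
      rw [Multiset.card_map, Finset.card_val, Finset.card_erase_of_mem hc]
    have hhalf : splitSum (fun A B => posBranchAt s z A * posBranchAt s z (u ::ₘ B))
        (X + (C.erase c).val.map n) = splitSum (fun A B => if A = 0 then 0 else
          z A.sum ^ (Multiset.card A - 1) *
          ((z u + z B.sum) ^ Multiset.card B / (z u + z B.sum)) * (-z (n c) - z A.sum)) X *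
          z u ^ (C.card - 1) := by
      rw [splitSum_add, splitSum_mul]
      refine splitSum_congr fun A B hAB => ?_
      rw [splitSum_eq_of_left_zero, add_zero]
      · split_ifs with hA
        · rw [hA, posBranchAt_zero, zero_mul, zero_mul]
        have hB : B + A = X := (add_comm _ _).trans hAB
        have hBpos := h.weight_add_pos (hB ▸ Multiset.le_add_right B A)
        have hAc := Multiset.card_pos.2 hA
        have h1 := h.posBranchAt_left ih' (hAB ▸ Multiset.le_add_right A B) hA
        have h2 := h.posBranchAt_right ih' hB hYe.symm (Multiset.singleton_ne_zero _)
          (by rw [Multiset.card_singleton]; omega)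
        have h3 : z (u ::ₘ (B + (C.erase c).val.map n)).sum = -z (n c) - z A.sum := by
          have h4 := congrArg z h.sum_eq_zero
          rw [← hB, hYe] at h4
          simp only [Multiset.sum_cons, Multiset.sum_add, map_add, Multiset.sum_singleton,
            map_zero] at h4 ⊢
          linarith
        rw [hcc, h3, mul_comm, ← eq_div_iff hBpos.ne'] at h2
        rw [h1, h2]
        ring
      · intro A' B' hAB' hA'
        have h1 := h.sum_neg hAB (B := A') (by
          rw [hYe, ← hAB', add_assoc]; exact Multiset.le_add_right _ _) hA'
        rw [posBranchAt, if_neg, zero_mul]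
        rw [Multiset.sum_add, map_add]
        exact h1.not_gt
    have hswap : splitSum (fun A B => posBranchAt s z (u ::ₘ A) * posBranchAt s z B)
        (X + (C.erase c).val.map n) =
        splitSum (fun A B => posBranchAt s z A * posBranchAt s z (u ::ₘ B))
        (X + (C.erase c).val.map n) := by
      rw [← splitSum_swap]
      simp only [mul_comm]
    rw [Multiset.cons_add, splitSum_cons, hswap, hhalf]
    ring
  have hjoin : ∀ c ∈ C, ∀ c' ∈ C.erase c,
      posBranchAt s z (u ::ₘ X + ((C.erase c).erase c').val.map n) =
        (-z (n c) - z (n c')) * (D ^ Multiset.card X * z u ^ (C.card - 2) / D) := by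
    intro c hc c' hc'
    have hYe := hY'' c hc c' hc'
    have hcc : Multiset.card (((C.erase c).erase c').val.map n) = C.card - 2 := by
      rw [Multiset.card_map, Finset.card_val, Finset.card_erase_of_mem hc',
        Finset.card_erase_of_mem hc, Nat.sub_sub]
    have h2 := h.posBranchAt_right ih' (add_zero X) hYe.symm (by simp) (by simp)
    have h3 : z (u ::ₘ (X + ((C.erase c).erase c').val.map n)).sum =
        -z (n c) - z (n c') := by
      have h4 := congrArg z h.sum_eq_zero
      rw [hYe] at h4
      simp only [Multiset.sum_cons, Multiset.sum_add, map_add, Multiset.sum_singleton,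
        map_zero, Multiset.insert_eq_cons] at h4 ⊢
      linarith
    rw [hcc, h3, mul_comm, ← hD, ← eq_div_iff hDpos.ne'] at h2
    rw [Multiset.cons_add, h2]
    ring
  have hcuts : ∑ c ∈ C, splitSum (fun A B => posBranchAt s z A * posBranchAt s z B)
      (u ::ₘ X + (C.erase c).val.map n) = 2 * splitSum (fun A B => if A = 0 then 0 else
        A.sum ^ (Multiset.card A - 1) * ((z u + B.sum) ^ Multiset.card B / (z u + B.sum)) *
        (z u + (X.map z).sum - C.card * A.sum)) (X.map z) * z u ^ (C.card - 1) := by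
    rw [Finset.sum_congr rfl hcut, ← Finset.sum_mul, ← Finset.mul_sum, ← splitSum_finset_sum,
      splitSum_map]
    congr 2
    refine splitSum_congr fun A B _ => ?_
    simp only [Multiset.map_eq_zero]
    rw [Multiset.card_map, Multiset.card_map, ← map_multiset_sum,
      ← map_multiset_sum, ← map_multiset_sum, ← hD, ← hη]
    split_ifs with hA
    · simp
    · rw [← Finset.mul_sum, Finset.sum_sub_distrib, Finset.sum_const, nsmul_eq_mul]
  have hjoins : ∑ c ∈ C, ∑ c' ∈ C.erase c,
      posBranchAt s z (u ::ₘ X + ((C.erase c).erase c').val.map n) =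
      2 * (((C.card : ℚ) - 1) * D) * (D ^ Multiset.card X * z u ^ (C.card - 2) / D) := by
    rw [Finset.sum_congr rfl fun c hc => Finset.sum_congr rfl (hjoin c hc)]
    simp only [← Finset.sum_mul]
    congr 1
    have e : ∀ c ∈ C, ∑ c' ∈ C.erase c, (-z (n c) - z (n c')) =
        ((C.card : ℚ) - 1) * -z (n c) + (D - -z (n c)) := by
      intro c hc
      rw [Finset.sum_erase_eq_sub hc, Finset.sum_sub_distrib, Finset.sum_const, nsmul_eq_mul]
      rw [Finset.sum_neg_distrib] at hη
      linarith
    rw [Finset.sum_congr rfl e, Finset.sum_add_distrib, ← Finset.mul_sum, hη,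
      Finset.sum_sub_distrib, hη, Finset.sum_const, nsmul_eq_mul]
    ring
  have hbase := splitSum_baseLeaves (z u) h.weight_pos (X.map z) (by
    intro v hv
    obtain ⟨x, hx, rfl⟩ := Multiset.mem_map.1 hv
    exact h.weight_pos_of_mem x hx) C.card
  have hcardS : (Multiset.card (u ::ₘ X + C.val.map n) : ℚ) - 2 =
      Multiset.card X + C.card - 1 := by
    rw [Multiset.card_add, Multiset.card_cons, Multiset.card_map, Finset.card_val]
    push_cast; ring
  rw [hcuts, hjoins, hcardS, ← hC] at hrec
  rw [Multiset.card_map, ← map_multiset_sum, ← hD] at hbase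
  rw [← map_multiset_sum, ← hD] at hrec
  rw [BaseLeaves.Formula, ← hD, ← Multiset.cons_add, hYc]
  have hNpos : (0 : ℚ) < Multiset.card X + C.card - 1 := by
    have : (2 : ℚ) ≤ Multiset.card X + C.card := by rw [hYc] at hcard; exact_mod_cast hcard
    linarith
  have hzu := h.weight_pos
  generalize splitSum (fun A B => if A = 0 then 0 else
        A.sum ^ (Multiset.card A - 1) * ((z u + B.sum) ^ Multiset.card B / (z u + B.sum)) *
        (D - C.card * A.sum)) (X.map z) = T at hrec hbase
  generalize treeSum (fun v => 0 < s v) z (u ::ₘ X + Y) = F at hrec ⊢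
  have hpow : ((C.card : ℚ) - 1) * z u ^ (C.card - 1) =
      ((C.card : ℚ) - 1) * (z u ^ (C.card - 2) * z u) := by
    rcases Nat.lt_or_ge 1 C.card with h1 | h1
    · rw [← pow_succ, show C.card - 2 + 1 = C.card - 1 by omega]
    · rw [show C.card = 1 by omega]; simp
  have hDD : D ^ Multiset.card X * z u ^ (C.card - 2) / D * D =
      D ^ Multiset.card X * z u ^ (C.card - 2) := div_mul_cancel₀ _ hDpos.ne'
  refine mul_left_cancel₀ (mul_pos (mul_pos two_pos hNpos) hzu).ne' ?_
  rw [pow_succ] at hbase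
  linear_combination D * z u * hrec + 2 * z u ^ (C.card - 1) * hbase +
    2 * (C.card - 1) * D * z u * hDD - 2 * D * D ^ Multiset.card X * hpow

end BaseChamber

/-! ### Chambers and their closures in terms of signs of flows. -/

section Chambers

variable {ι κ : Type*} [Fintype ι] [Fintype κ]

/-- The difference of the sums that are equal on a resonance. -/
def flow (p : (ι → ℝ) × (κ → ℝ)) (I : Finset ι) (J : Finset κ) : ℝ :=
  ∑ i ∈ I, p.1 i - ∑ j ∈ J, p.2 j

theorem continuous_flow (I : Finset ι) (J : Finset κ) :
    Continuous fun p : (ι → ℝ) × (κ → ℝ) => flow p I J := by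
  unfold flow; fun_prop

theorem flow_smul_add (a b : ℝ) (p q : (ι → ℝ) × (κ → ℝ)) (I : Finset ι) (J : Finset κ) :
    flow (a • p + b • q) I J = a * flow p I J + b * flow q I J := by
  simp only [flow, Prod.fst_add, Prod.snd_add, Prod.smul_fst, Prod.smul_snd, Pi.add_apply,
    Pi.smul_apply, smul_eq_mul, Finset.sum_add_distrib, ← Finset.mul_sum]
  ring

theorem flow_compl [DecidableEq ι] [DecidableEq κ] {p : (ι → ℝ) × (κ → ℝ)}
    (h : ∑ i, p.1 i = ∑ j, p.2 j) (I : Finset ι) (J : Finset κ) :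
    flow p Iᶜ Jᶜ = -flow p I J := by
  have h1 := Finset.sum_add_sum_compl I p.1
  have h2 := Finset.sum_add_sum_compl J p.2
  rw [flow, flow]
  linarith

variable [LinearOrder ι] [LinearOrder κ]

theorem isClosed_parameterSpace : IsClosed (parameterSpace ι κ) := by
  have e : parameterSpace ι κ = (⋂ (i : ι) (i' : ι) (_ : i ≤ i'), {p | p.1 i' ≤ p.1 i}) ∩
      (⋂ i, {p | 0 ≤ p.1 i}) ∩ (⋂ (j : κ) (j' : κ) (_ : j ≤ j'), {p | p.2 j' ≤ p.2 j}) ∩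
      (⋂ j, {p | 0 ≤ p.2 j}) ∩ {p | ∑ i, p.1 i = ∑ j, p.2 j} := by
    ext p
    simp only [parameterSpace, Antitone, Set.mem_setOf_eq, Set.mem_inter_iff, Set.mem_iInter]
    tauto
  rw [e]
  refine ((((isClosed_iInter fun i => isClosed_iInter fun i' => isClosed_iInter fun _ => ?_).inter
    (isClosed_iInter fun i => ?_)).inter (isClosed_iInter fun j => isClosed_iInter fun j' =>
    isClosed_iInter fun _ => ?_)).inter (isClosed_iInter fun j => ?_)).inter ?_
  · exact isClosed_le (by fun_prop) (by fun_prop)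
  · exact isClosed_le (by fun_prop) (by fun_prop)
  · exact isClosed_le (by fun_prop) (by fun_prop)
  · exact isClosed_le (by fun_prop) (by fun_prop)
  · exact isClosed_eq (by fun_prop) (by fun_prop)

variable {p q : (ι → ℝ) × (κ → ℝ)}

theorem regular_flow_ne_zero (hq : q ∈ regularPoints ι κ) {I : Finset ι} {J : Finset κ}
    (hI : I.Nonempty) (hI' : I ≠ univ) (hJ : J.Nonempty) (hJ' : J ≠ univ) : flow q I J ≠ 0 :=
  fun h => hq.2 ⟨I, J, hI, hI', hJ, hJ', sub_eq_zero.1 h⟩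

/-- A flow that changed its sign in the connected chamber would vanish at some point of it. -/
theorem flow_pos_of_mem_chamber (hp : p ∈ chamber q) {I : Finset ι} {J : Finset κ}
    (hI : I.Nonempty) (hI' : I ≠ univ) (hJ : J.Nonempty) (hJ' : J ≠ univ) (h : 0 < flow q I J) :
    0 < flow p I J := by
  by_contra hcon
  have hq : q ∈ regularPoints ι κ := by
    by_contra hq
    rw [chamber, connectedComponentIn_eq_empty hq] at hp
    exact hp
  obtain ⟨x, hx, hx0⟩ := isPreconnected_connectedComponentIn.intermediate_value hp
    (mem_connectedComponentIn hq) (continuous_flow I J).continuousOn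
    (show (0 : ℝ) ∈ Set.Icc (flow p I J) (flow q I J) from ⟨not_lt.1 hcon, h.le⟩)
  exact regular_flow_ne_zero (connectedComponentIn_subset _ _ hx) hI hI' hJ hJ' hx0

theorem parameterSpace_of_mem_closure (hp : p ∈ closure (chamber q)) : p ∈ parameterSpace ι κ :=
  closure_minimal (fun _ hx => (connectedComponentIn_subset _ _ hx).1) isClosed_parameterSpace hp

/-- Weak inequalities pass to the closure. Empty and full sets, which define no resonance, are
settled by nonnegativity and the equality of the total sums. -/
theorem flow_nonneg_of_mem_closure (hq : q ∈ parameterSpace ι κ) (hp : p ∈ closure (chamber q))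
    {I : Finset ι} {J : Finset κ} (h : 0 < flow q I J) : 0 ≤ flow p I J := by
  obtain ⟨-, hp1, -, hp2, hp0⟩ := parameterSpace_of_mem_closure hp
  obtain ⟨-, hq1, -, hq2, hq0⟩ := hq
  by_cases hI : I.Nonempty
  · by_cases hJ' : J = univ
    · rw [flow, hJ', ← hq0] at h
      have := Finset.sum_le_sum_of_subset_of_nonneg (Finset.subset_univ I) fun i _ _ => hq1 i
      linarith
    by_cases hJ : J.Nonempty
    · by_cases hI' : I = univ
      · rw [flow, hI', hp0]
        have := Finset.sum_le_sum_of_subset_of_nonneg (Finset.subset_univ J) fun i _ _ => hp2 i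
        linarith
      · exact closure_minimal (fun x hx => (flow_pos_of_mem_chamber hx hI hI' hJ hJ' h).le)
          (isClosed_le continuous_const (continuous_flow I J)) hp
    · rw [Finset.not_nonempty_iff_eq_empty.1 hJ, flow, Finset.sum_empty, sub_zero]
      exact Finset.sum_nonneg fun i _ => hp1 i
  · rw [Finset.not_nonempty_iff_eq_empty.1 hI, flow, Finset.sum_empty, zero_sub] at h
    have := Finset.sum_nonneg fun j (_ : j ∈ J) => hq2 j
    linarith

theorem flow_nonpos_of_mem_closure (hq : q ∈ parameterSpace ι κ) (hp : p ∈ closure (chamber q))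
    {I : Finset ι} {J : Finset κ} (h : flow q I J < 0) : flow p I J ≤ 0 := by
  have h1 := flow_nonneg_of_mem_closure hq hp (I := Iᶜ) (J := Jᶜ) (by
    rw [flow_compl hq.2.2.2.2]; linarith)
  rw [flow_compl (parameterSpace_of_mem_closure hp).2.2.2.2] at h1
  linarith

theorem convex_parameterSpace_combo {a b : ℝ} (ha : 0 ≤ a) (hb : 0 ≤ b)
    (hp : p ∈ parameterSpace ι κ) (hq : q ∈ parameterSpace ι κ) :
    a • p + b • q ∈ parameterSpace ι κ := by
  obtain ⟨p1, p2, p3, p4, p5⟩ := hp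
  obtain ⟨q1, q2, q3, q4, q5⟩ := hq
  refine ⟨fun i i' h => ?_, fun i => ?_, fun j j' h => ?_, fun j => ?_, ?_⟩
  · exact add_le_add (mul_le_mul_of_nonneg_left (p1 h) ha) (mul_le_mul_of_nonneg_left (q1 h) hb)
  · exact add_nonneg (mul_nonneg ha (p2 i)) (mul_nonneg hb (q2 i))
  · exact add_le_add (mul_le_mul_of_nonneg_left (p3 h) ha) (mul_le_mul_of_nonneg_left (q3 h) hb)
  · exact add_nonneg (mul_nonneg ha (p4 j)) (mul_nonneg hb (q4 j))
  · simp only [Prod.fst_add, Prod.snd_add, Prod.smul_fst, Prod.smul_snd, Pi.add_apply,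
      Pi.smul_apply, smul_eq_mul, Finset.sum_add_distrib, ← Finset.mul_sum, p5, q5]

/-- A point at which every nonzero flow has the sign that it has at `q` belongs to the closure of
the chamber of `q`. -/
theorem mem_chamber_of_flow (hq : q ∈ regularPoints ι κ) (hp : p ∈ parameterSpace ι κ)
    (h : ∀ (I : Finset ι) (J : Finset κ), I.Nonempty → I ≠ univ → J.Nonempty → J ≠ univ →
      0 < flow q I J → 0 ≤ flow p I J) {t : ℝ} (ht : 0 < t) (ht1 : t ≤ 1) :
    (1 - t) • p + t • q ∈ chamber q := by
  have hpos : ∀ (I : Finset ι) (J : Finset κ), I.Nonempty → I ≠ univ → J.Nonempty → J ≠ univ →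
      ∀ a b : ℝ, 0 ≤ a → 0 < b → flow (a • p + b • q) I J ≠ 0 := by
    intro I J hI hI' hJ hJ' a b ha hb
    rw [flow_smul_add]
    rcases lt_or_gt_of_ne (regular_flow_ne_zero hq hI hI' hJ hJ') with hlt | hgt
    · have h1 := h Iᶜ Jᶜ (by rwa [← Finset.compl_ne_univ_iff_nonempty, compl_compl])
        (by rwa [Finset.compl_ne_univ_iff_nonempty])
        (by rwa [← Finset.compl_ne_univ_iff_nonempty, compl_compl])
        (by rwa [Finset.compl_ne_univ_iff_nonempty])
        (by rw [flow_compl hq.1.2.2.2.2]; linarith)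
      rw [flow_compl hp.2.2.2.2] at h1
      have h2 := mul_neg_of_pos_of_neg hb hlt
      have h3 := mul_nonneg ha h1
      intro h4
      linarith
    · have h1 := mul_nonneg ha (h I J hI hI' hJ hJ' hgt)
      have h2 := mul_pos hb hgt
      exact (add_pos_of_nonneg_of_pos h1 h2).ne'
  have hsub : segment ℝ ((1 - t) • p + t • q) q ⊆ regularPoints ι κ := by
    rintro x ⟨a, b, ha, hb, hab, rfl⟩
    have e : a • ((1 - t) • p + t • q) + b • q = (a * (1 - t)) • p + (a * t + b) • q := by
      rw [smul_add, smul_smul, smul_smul, add_smul, add_assoc]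
    have ha' : 0 ≤ a * (1 - t) := mul_nonneg ha (by linarith)
    have hb' : 0 < a * t + b := by
      rcases hb.eq_or_lt with hb | hb
      · rw [← hb, add_zero] at hab
        rw [hab, ← hb]; linarith
      · exact add_pos_of_nonneg_of_pos (mul_nonneg ha ht.le) hb
    rw [e]
    refine ⟨convex_parameterSpace_combo ha' hb'.le hp hq.1, ?_⟩
    rintro ⟨I, J, hI, hI', hJ, hJ', hx⟩
    exact hpos I J hI hI' hJ hJ' _ _ ha' hb' (sub_eq_zero.2 hx)
  exact (convex_segment _ _).isPreconnected.subset_connectedComponentIn (right_mem_segment _ _ _)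
    hsub (left_mem_segment _ _ _)

/-- The points of the segment from `p` to `q`, other than `p`, have the strict signs of `q`, so they
lie in the chamber and converge to `p`. -/
theorem mem_closure_chamber_of_flow (hq : q ∈ regularPoints ι κ) (hp : p ∈ parameterSpace ι κ)
    (h : ∀ (I : Finset ι) (J : Finset κ), I.Nonempty → I ≠ univ → J.Nonempty → J ≠ univ →
      0 < flow q I J → 0 ≤ flow p I J) : p ∈ closure (chamber q) := by
  have hlim : Filter.Tendsto (fun t : ℝ => (1 - t) • p + t • q) (nhdsWithin 0 (Set.Ioi 0))
      (nhds p) := by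
    have : Continuous fun t : ℝ => (1 - t) • p + t • q := by fun_prop
    have h1 := this.tendsto 0
    rw [sub_zero, one_smul, zero_smul, add_zero] at h1
    exact h1.mono_left nhdsWithin_le_nhds
  refine mem_closure_of_tendsto hlim ?_
  filter_upwards [Ioc_mem_nhdsGT (zero_lt_one' ℝ)] with t ht
  exact mem_chamber_of_flow hq hp h ht.1 ht.2

end Chambers

/-! ### Integer points strictly inside a chamber. -/

section IntegerPoints

variable {ι κ : Type*} [Fintype ι] [Fintype κ] [LinearOrder ι] [LinearOrder κ]

/-- `p` has strictly decreasing positive coordinates, and all flows at `p` have the same sign as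
at `q`. -/
structure StrictlyInside (q p : (ι → ℝ) × (κ → ℝ)) : Prop where
  fst_lt : ∀ i i', i < i' → p.1 i' < p.1 i
  fst_pos : ∀ i, 0 < p.1 i
  snd_lt : ∀ j j', j < j' → p.2 j' < p.2 j
  snd_pos : ∀ j, 0 < p.2 j
  flow_pos : ∀ I J, 0 < flow q I J → I.Nonempty → I ≠ univ → J.Nonempty → J ≠ univ → 0 < flow p I J

variable {q p : (ι → ℝ) × (κ → ℝ)}

theorem isOpen_strictlyInside (q : (ι → ℝ) × (κ → ℝ)) : IsOpen {p | StrictlyInside q p} := by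
  have e : {p | StrictlyInside q p} = (⋂ (i : ι) (i' : ι) (_ : i < i'), {p | p.1 i' < p.1 i}) ∩
      (⋂ i, {p | 0 < p.1 i}) ∩ (⋂ (j : κ) (j' : κ) (_ : j < j'), {p | p.2 j' < p.2 j}) ∩
      (⋂ j, {p | 0 < p.2 j}) ∩ ⋂ (I : Finset ι) (J : Finset κ) (_ : 0 < flow q I J)
        (_ : I.Nonempty) (_ : I ≠ univ) (_ : J.Nonempty) (_ : J ≠ univ), {p | 0 < flow p I J} := by
    ext p
    simp only [Set.mem_inter_iff, Set.mem_iInter]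
    exact ⟨fun h => ⟨⟨⟨⟨h.1, h.2⟩, h.3⟩, h.4⟩, h.5⟩,
      fun h => ⟨h.1.1.1.1, h.1.1.1.2, h.1.1.2, h.1.2, h.2⟩⟩
  rw [e]
  refine (((IsOpen.inter ?_ ?_).inter ?_).inter ?_).inter ?_
  · exact isOpen_iInter_of_finite fun i => isOpen_iInter_of_finite fun i' =>
      isOpen_iInter_of_finite fun _ => isOpen_lt (by fun_prop) (by fun_prop)
  · exact isOpen_iInter_of_finite fun i => isOpen_lt (by fun_prop) (by fun_prop)
  · exact isOpen_iInter_of_finite fun i => isOpen_iInter_of_finite fun i' =>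
      isOpen_iInter_of_finite fun _ => isOpen_lt (by fun_prop) (by fun_prop)
  · exact isOpen_iInter_of_finite fun i => isOpen_lt (by fun_prop) (by fun_prop)
  · exact isOpen_iInter_of_finite fun I => isOpen_iInter_of_finite fun J =>
      isOpen_iInter_of_finite fun _ => isOpen_iInter_of_finite fun _ =>
      isOpen_iInter_of_finite fun _ => isOpen_iInter_of_finite fun _ =>
      isOpen_iInter_of_finite fun _ => isOpen_lt continuous_const (continuous_flow I J)

theorem flow_smul (c : ℝ) (p : (ι → ℝ) × (κ → ℝ)) (I : Finset ι) (J : Finset κ) :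
    flow (c • p) I J = c * flow p I J := by
  have := flow_smul_add c 0 p p I J
  simpa using this

theorem StrictlyInside.smul (h : StrictlyInside q p) {c : ℝ} (hc : 0 < c) :
    StrictlyInside q (c • p) where
  fst_lt i i' hi := mul_lt_mul_of_pos_left (h.fst_lt i i' hi) hc
  fst_pos i := mul_pos hc (h.fst_pos i)
  snd_lt i i' hi := mul_lt_mul_of_pos_left (h.snd_lt i i' hi) hc
  snd_pos i := mul_pos hc (h.snd_pos i)
  flow_pos I J hIJ h1 h2 h3 h4 := by
    rw [flow_smul]; exact mul_pos hc (h.flow_pos I J hIJ h1 h2 h3 h4)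

theorem exists_strictAnti_pos (ι : Type*) [Fintype ι] [LinearOrder ι] :
    ∃ w : ι → ℝ, (∀ i i', i < i' → w i' < w i) ∧ ∀ i, 0 < w i := by
  refine ⟨fun i => ((univ.filter fun i' => i ≤ i').card : ℝ), fun i i' h => ?_, fun i => ?_⟩
  · refine Nat.cast_lt.2 (Finset.card_lt_card ⟨fun x hx => ?_, fun hsub => ?_⟩)
    · simp only [Finset.mem_filter, Finset.mem_univ, true_and] at hx ⊢
      exact h.le.trans hx
    · have : i ∈ univ.filter fun x => i' ≤ x := hsub (by simp)
      simp only [Finset.mem_filter, Finset.mem_univ, true_and] at this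
      exact absurd h this.not_gt
  · exact Nat.cast_pos.2 (Finset.card_pos.2 ⟨i, by simp⟩)

variable [Nonempty ι] [Nonempty κ]

/-- Add to `q` a small multiple of a balanced, positive, strictly decreasing point; finitely many
strict flow inequalities survive. -/
theorem exists_strictlyInside (hq : q ∈ parameterSpace ι κ) :
    ∃ p, StrictlyInside q p ∧ ∑ i, p.1 i = ∑ j, p.2 j := by
  obtain ⟨w₁, hw₁, hp₁⟩ := exists_strictAnti_pos ι
  obtain ⟨w₂, hw₂, hp₂⟩ := exists_strictAnti_pos κ
  have hS₁ : 0 < ∑ i, w₁ i := Finset.sum_pos (fun i _ => hp₁ i) Finset.univ_nonempty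
  have hS₂ : 0 < ∑ j, w₂ j := Finset.sum_pos (fun i _ => hp₂ i) Finset.univ_nonempty
  set w : (ι → ℝ) × (κ → ℝ) := ((∑ j, w₂ j) • w₁, (∑ i, w₁ i) • w₂) with hw
  have hev : ∀ᶠ t : ℝ in nhdsWithin 0 (Set.Ioi 0), ∀ (I : Finset ι) (J : Finset κ),
      0 < flow q I J → 0 < flow ((1 : ℝ) • q + t • w) I J := by
    rw [Filter.eventually_all]
    intro I
    rw [Filter.eventually_all]
    intro J
    by_cases h : 0 < flow q I J
    · have hc : Continuous fun t : ℝ => flow ((1 : ℝ) • q + t • w) I J :=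
        (continuous_flow I J).comp (by fun_prop)
      have h1 := hc.tendsto 0
      rw [zero_smul, add_zero, one_smul] at h1
      filter_upwards [(h1.mono_left nhdsWithin_le_nhds).eventually_const_lt h] with t ht _
      rwa [one_smul]
    · exact Filter.Eventually.of_forall fun t h' => absurd h' h
  obtain ⟨t, ht, ht0⟩ := (hev.and self_mem_nhdsWithin).exists
  have ht0 : 0 < t := ht0
  obtain ⟨q1, q2, q3, q4, q5⟩ := hq
  refine ⟨(1 : ℝ) • q + t • w, ⟨fun i i' h => ?_, fun i => ?_, fun j j' h => ?_, fun j => ?_,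
    fun I J h _ _ _ _ => ht I J h⟩, ?_⟩
  · have h1 := q1 h.le
    have h2 := mul_lt_mul_of_pos_left (mul_lt_mul_of_pos_left (hw₁ i i' h) hS₂) ht0
    simp only [hw, Prod.fst_add, Prod.smul_fst, Pi.add_apply, Pi.smul_apply, smul_eq_mul]
    linarith
  · have h2 := mul_pos ht0 (mul_pos hS₂ (hp₁ i))
    have := q2 i
    simp only [hw, Prod.fst_add, Prod.smul_fst, Pi.add_apply, Pi.smul_apply, smul_eq_mul]
    linarith
  · have h1 := q3 h.le
    have h2 := mul_lt_mul_of_pos_left (mul_lt_mul_of_pos_left (hw₂ j j' h) hS₁) ht0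
    simp only [hw, Prod.snd_add, Prod.smul_snd, Pi.add_apply, Pi.smul_apply, smul_eq_mul]
    linarith
  · have h2 := mul_pos ht0 (mul_pos hS₁ (hp₂ j))
    have := q4 j
    simp only [hw, Prod.snd_add, Prod.smul_snd, Pi.add_apply, Pi.smul_apply, smul_eq_mul]
    linarith
  · simp only [hw, Prod.fst_add, Prod.smul_fst, Prod.snd_add, Prod.smul_snd, Pi.add_apply,
      Pi.smul_apply, smul_eq_mul, Finset.sum_add_distrib, ← Finset.mul_sum, q5]
    ring

/-- The cone of a chamber contains integer points. -/
theorem exists_nat_strictlyInside (hq : q ∈ parameterSpace ι κ) :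
    ∃ (μ : ι → ℕ) (ν : κ → ℕ), StrictlyInside q (realPoint μ ν) ∧ ∑ i, μ i = ∑ j, ν j := by
  obtain ⟨p, hp, hsum⟩ := exists_strictlyInside hq
  have hS : 0 < ∑ i, p.1 i := Finset.sum_pos (fun i _ => hp.fst_pos i) Finset.univ_nonempty
  -- Rounding a large multiple to integers destroys the balance. Multiplying each side by the total
  -- of the other restores it, and at `p` this is only a positive scaling.
  let L : (ι → ℝ) × (κ → ℝ) → (ι → ℝ) × (κ → ℝ) :=
    fun x => ((∑ j, x.2 j) • x.1, (∑ i, x.1 i) • x.2)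
  have hL : Continuous L := by fun_prop
  have hLp : StrictlyInside q (L p) := by
    have : L p = (∑ i, p.1 i) • p := Prod.ext (by simp [L, hsum]) rfl
    rw [this]
    exact hp.smul hS
  have hlim : Filter.Tendsto (fun x : ℝ => (((fun i => (⌊p.1 i * x⌋₊ : ℝ) / x),
      fun j => (⌊p.2 j * x⌋₊ : ℝ) / x) : (ι → ℝ) × (κ → ℝ))) Filter.atTop (nhds p) := by
    refine Filter.Tendsto.prodMk_nhds (tendsto_pi_nhds.2 fun i => ?_)
      (tendsto_pi_nhds.2 fun j => ?_)
    · exact tendsto_nat_floor_mul_div_atTop (hp.fst_pos i).le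
    · exact tendsto_nat_floor_mul_div_atTop (hp.snd_pos j).le
  have hev := ((hL.tendsto p).comp hlim).eventually ((isOpen_strictlyInside q).mem_nhds hLp)
  obtain ⟨x, hx, hx0⟩ := (hev.and (Filter.eventually_gt_atTop 0)).exists
  refine ⟨fun i => (∑ j, ⌊p.2 j * x⌋₊) * ⌊p.1 i * x⌋₊, fun j => (∑ i, ⌊p.1 i * x⌋₊) * ⌊p.2 j * x⌋₊,
    ?_, by rw [← Finset.mul_sum, ← Finset.mul_sum, mul_comm]⟩
  have h1 : StrictlyInside q ((x * x) • L (((fun i => (⌊p.1 i * x⌋₊ : ℝ) / x),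
      fun j => (⌊p.2 j * x⌋₊ : ℝ) / x))) := StrictlyInside.smul hx (mul_pos hx0 hx0)
  have e : ∀ a b : ℝ, a * b = x * x * (a / x * (b / x)) := fun a b => by field_simp
  convert h1 using 1
  refine Prod.ext (funext fun i => ?_) (funext fun j => ?_)
  · simp only [realPoint, L, Prod.smul_fst, Pi.smul_apply, smul_eq_mul, ← Finset.sum_div]
    push_cast
    exact e _ _
  · simp only [realPoint, L, Prod.smul_snd, Pi.smul_apply, smul_eq_mul, ← Finset.sum_div]
    push_cast
    exact e _ _

end IntegerPoints

/-! ### Splittings of leaves indexed by two finite types. -/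

section LeafSums

variable {M ι κ : Type*} [DecidableEq ι] [DecidableEq κ]

theorem exists_finset_of_add_eq_map {e : ι → M} {s : Finset ι} {A B : Multiset M}
    (h : A + B = s.val.map e) : ∃ t ⊆ s, A = t.val.map e ∧ B = (s \ t).val.map e := by
  induction s using Finset.induction_on generalizing A B with
  | empty =>
    have h0 : A + B = 0 := by simpa using h
    obtain ⟨rfl, rfl⟩ := (add_eq_zero.1 h0 : A = 0 ∧ B = 0)
    exact ⟨∅, subset_rfl, by simp, by simp⟩
  | insert a s ha ih =>
    rw [Finset.insert_val_of_notMem ha, Multiset.map_cons] at h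
    have hm : e a ∈ A + B := h ▸ Multiset.mem_cons_self _ _
    rcases Multiset.mem_add.1 hm with hm | hm
    · obtain ⟨A', rfl⟩ := Multiset.exists_cons_of_mem hm
      rw [Multiset.cons_add, Multiset.cons_inj_right] at h
      obtain ⟨t, ht, rfl, rfl⟩ := ih h
      have hat : a ∉ t := fun h => ha (ht h)
      refine ⟨insert a t, Finset.insert_subset_insert a ht, ?_, ?_⟩
      · rw [Finset.insert_val_of_notMem hat, Multiset.map_cons]
      · congr 2
        ext x
        simp only [Finset.mem_sdiff, Finset.mem_insert]
        constructor
        · rintro ⟨h1, h2⟩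
          exact ⟨Or.inr h1, fun h => h.elim (fun h => ha (h ▸ h1)) h2⟩
        · rintro ⟨h1 | h1, h2⟩
          · exact absurd (Or.inl h1) h2
          · exact ⟨h1, fun h => h2 (Or.inr h)⟩
    · obtain ⟨B', rfl⟩ := Multiset.exists_cons_of_mem hm
      rw [Multiset.add_cons, Multiset.cons_inj_right] at h
      obtain ⟨t, ht, rfl, rfl⟩ := ih h
      refine ⟨t, ht.trans (Finset.subset_insert a s), rfl, ?_⟩
      rw [Finset.insert_sdiff_of_notMem _ fun h => ha (ht h),
        Finset.insert_val_of_notMem fun h => ha (Finset.mem_sdiff.1 h).1, Multiset.map_cons]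

theorem exists_add_eq_add {A B S T : Multiset M} (h : A + B = S + T) :
    ∃ A₁ A₂ B₁ B₂, A = A₁ + A₂ ∧ B = B₁ + B₂ ∧ A₁ + B₁ = S ∧ A₂ + B₂ = T := by
  induction S using Multiset.induction generalizing A B with
  | empty => exact ⟨0, A, 0, B, by simp, by simp, by simp, by simpa using h⟩
  | cons a S ih =>
    rw [Multiset.cons_add] at h
    have hm : a ∈ A + B := h ▸ Multiset.mem_cons_self _ _
    rcases Multiset.mem_add.1 hm with hm | hm
    · obtain ⟨A', rfl⟩ := Multiset.exists_cons_of_mem hm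
      rw [Multiset.cons_add, Multiset.cons_inj_right] at h
      obtain ⟨A₁, A₂, B₁, B₂, rfl, rfl, rfl, rfl⟩ := ih h
      exact ⟨a ::ₘ A₁, A₂, B₁, B₂, by simp, rfl, by simp, rfl⟩
    · obtain ⟨B', rfl⟩ := Multiset.exists_cons_of_mem hm
      rw [Multiset.add_cons, Multiset.cons_inj_right] at h
      obtain ⟨A₁, A₂, B₁, B₂, rfl, rfl, rfl, rfl⟩ := ih h
      exact ⟨A₁, A₂, a ::ₘ B₁, B₂, rfl, by simp, by simp, rfl⟩

variable [Fintype ι] [Fintype κ]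

/-- The splittings of a multiset that is indexed by two finite types. -/
theorem exists_finsets_of_add_eq {e : ι → M} {e' : κ → M} {A B : Multiset M}
    (h : A + B = univ.val.map e + univ.val.map e') :
    ∃ (I : Finset ι) (J : Finset κ), A = I.val.map e + J.val.map e' ∧ B = Iᶜ.val.map e + Jᶜ.val.map e' := by
  obtain ⟨A₁, A₂, B₁, B₂, rfl, rfl, h1, h2⟩ := exists_add_eq_add h
  obtain ⟨I, -, rfl, rfl⟩ := exists_finset_of_add_eq_map h1
  obtain ⟨J, -, rfl, rfl⟩ := exists_finset_of_add_eq_map h2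
  exact ⟨I, J, rfl, rfl⟩

end LeafSums

/-! ### Tree sums with orientations from a reference point. -/

section RefTreeSum

variable {ι κ : Type*} [Fintype ι] [Fintype κ]
variable {R R' : Type*} [CommRing R] [Algebra ℚ R] [CommRing R'] [Algebra ℚ R']

/-- The leaves with the signs of the flows given by a reference point. -/
def refLeaves (q : (ι → ℝ) × (κ → ℝ)) (x : ι → R) (y : κ → R) : Multiset (ℝ × R) :=
  univ.val.map (fun i => (q.1 i, x i)) + univ.val.map (fun j => (-q.2 j, -y j))

/-- The tree sum with the signs of the flows given by a reference point. -/
noncomputable def refTreeSum (q : (ι → ℝ) × (κ → ℝ)) (x : ι → R) (y : κ → R) : R :=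
  treeSum (fun v : ℝ × R => 0 < v.1) (AddMonoidHom.snd ℝ R) (refLeaves q x y)

variable {q q' : (ι → ℝ) × (κ → ℝ)} {x : ι → R} {y : κ → R}

/-- Only the weights are changed, so this evaluates the tree sum in variables at any weights. -/
theorem map_refTreeSum (ψ : R →ₐ[ℚ] R') :
    ψ (refTreeSum q x y) = refTreeSum q (fun i => ψ (x i)) (fun j => ψ (y j)) := by
  rw [refTreeSum, map_treeSum (fun v : ℝ × R => 0 < v.1) _ (fun v : ℝ × R' => 0 < v.1)
    (AddMonoidHom.snd ℝ R') ((AddMonoidHom.id ℝ).prodMap (ψ : R →+ R')) ψ (fun v => Iff.rfl)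
    (fun v => rfl), refTreeSum, refLeaves, refLeaves, Multiset.map_add, Multiset.map_map,
    Multiset.map_map]
  congr 2
  exact Multiset.map_congr rfl fun j _ => Prod.ext rfl (map_neg ψ _)

theorem card_refLeaves : Multiset.card (refLeaves q x y) = Fintype.card ι + Fintype.card κ := by
  rw [refLeaves, Multiset.card_add, Multiset.card_map, Multiset.card_map]
  rfl

theorem refTreeSum_isHomogeneous (q : (ι → ℝ) × (κ → ℝ)) :
    (refTreeSum q (fun i => (MvPolynomial.X (Sum.inl i) : MvPolynomial (ι ⊕ κ) ℚ))
      (fun j => MvPolynomial.X (Sum.inr j))).IsHomogeneous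
      (Fintype.card ι + Fintype.card κ - 3) := by
  rw [← card_refLeaves (q := q) (x := fun i => (MvPolynomial.X (Sum.inl i) : MvPolynomial (ι ⊕ κ) ℚ))
    (y := fun j => MvPolynomial.X (Sum.inr j))]
  refine treeSum_isHomogeneous _ _ _ fun v hv => ?_
  rcases Multiset.mem_add.1 hv with hv | hv
  · obtain ⟨i, _, rfl⟩ := Multiset.mem_map.1 hv
    exact MvPolynomial.isHomogeneous_X _ _
  · obtain ⟨j, _, rfl⟩ := Multiset.mem_map.1 hv
    exact (MvPolynomial.isHomogeneous_X _ _).neg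

/-- The directions need to agree only for inner edges of nonzero weight. This is why one formula is
valid on the whole closure of a chamber. -/
theorem refTreeSum_congr [DecidableEq ι] [DecidableEq κ] (hq : ∑ i, q.1 i = ∑ j, q.2 j) (hq' : ∑ i, q'.1 i = ∑ j, q'.2 j)
    (hxy : ∑ i, x i = ∑ j, y j)
    (h : ∀ I J, 2 ≤ #I + #J → 2 ≤ #Iᶜ + #Jᶜ → ∑ i ∈ I, x i ≠ ∑ j ∈ J, y j →
      (0 < flow q I J ↔ 0 < flow q' I J)) :
    refTreeSum q x y = refTreeSum q' x y := by
  -- Labels that carry both reference points put the two sign functions on one multiset of leaves.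
  set S : Multiset (ℝ × ℝ × R) := univ.val.map (fun i => (q.1 i, q'.1 i, x i)) +
    univ.val.map (fun j => (-q.2 j, -q'.2 j, -y j)) with hS
  set z : ℝ × ℝ × R →+ R := (AddMonoidHom.snd ℝ R).comp (AddMonoidHom.snd ℝ (ℝ × R)) with hz
  have e1 : refTreeSum q x y = treeSum (fun v : ℝ × ℝ × R => 0 < v.1) z S := by
    have := map_treeSum (fun v : ℝ × ℝ × R => 0 < v.1) z (fun v : ℝ × R => 0 < v.1)
      (AddMonoidHom.snd ℝ R) ((AddMonoidHom.id ℝ).prodMap (AddMonoidHom.snd ℝ R)) (AlgHom.id ℚ R)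
      (fun v => Iff.rfl) (fun v => rfl) S
    rw [hS, Multiset.map_add, Multiset.map_map, Multiset.map_map] at this
    exact this.symm
  have e2 : refTreeSum q' x y = treeSum (fun v : ℝ × ℝ × R => 0 < v.2.1) z S := by
    have := map_treeSum (fun v : ℝ × ℝ × R => 0 < v.2.1) z (fun v : ℝ × R => 0 < v.1)
      (AddMonoidHom.snd ℝ R) (AddMonoidHom.snd ℝ (ℝ × R)) (AlgHom.id ℚ R)
      (fun v => Iff.rfl) (fun v => rfl) S
    rw [hS, Multiset.map_add, Multiset.map_map, Multiset.map_map] at this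
    exact this.symm
  have hsum : ∀ (I : Finset ι) (J : Finset κ),
      (I.val.map (fun i => (q.1 i, q'.1 i, x i)) +
        J.val.map (fun j => (-q.2 j, -q'.2 j, -y j))).sum =
      (flow q I J, flow q' I J, ∑ i ∈ I, x i - ∑ j ∈ J, y j) := by
    intro I J
    rw [Multiset.sum_add, Finset.sum_map_val, Finset.sum_map_val]
    refine Prod.ext ?_ (Prod.ext ?_ ?_)
    · simp [Prod.fst_sum, flow, sub_eq_add_neg]
    · simp [Prod.fst_sum, Prod.snd_sum, flow, sub_eq_add_neg]
    · simp [Prod.snd_sum, sub_eq_add_neg]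
  rw [e1, e2]
  refine treeSum_congr _ ?_ fun A B hAB hA hB hzA => ?_
  · rw [hS, hsum]
    simp [flow, hq, hq', hxy]
  · obtain ⟨I, J, rfl, rfl⟩ := exists_finsets_of_add_eq hAB
    rw [hsum] at hzA ⊢
    exact h I J (by simpa using hA) (by simpa using hB) (sub_ne_zero.1 hzA)

theorem intTreeSum_leafWeights (μ : ι → ℕ) (ν : κ → ℕ) :
    intTreeSum (leafWeights μ ν) =
      refTreeSum (realPoint μ ν) (fun i => (μ i : ℚ)) (fun j => (ν j : ℚ)) := by
  have := map_treeSum (fun v : ℤ => 0 < v) (Int.castAddHom ℚ) (fun v : ℝ × ℚ => 0 < v.1)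
    (AddMonoidHom.snd ℝ ℚ) ((Int.castAddHom ℝ).prod (Int.castAddHom ℚ)) (AlgHom.id ℚ ℚ)
    (fun v => by simp) (fun v => rfl) (leafWeights μ ν)
  rw [leafWeights, Multiset.map_add, Multiset.map_map, Multiset.map_map] at this
  refine this.trans ?_
  rw [refTreeSum, refLeaves]
  congr 2
  exact Multiset.map_congr rfl fun i _ => by simp [realPoint]

end RefTreeSum

/-! ### Chamber polynomials as tree sums, and their uniqueness. -/

section ChamberPolynomials

variable {ι κ : Type*} [Fintype ι] [Fintype κ] [LinearOrder ι] [LinearOrder κ]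
variable {q : (ι → ℝ) × (κ → ℝ)}

theorem flow_realPoint_eq_cast (μ : ι → ℕ) (ν : κ → ℕ) (I : Finset ι) (J : Finset κ) :
    flow (realPoint μ ν) I J = ((∑ i ∈ I, (μ i : ℚ) - ∑ j ∈ J, (ν j : ℚ) : ℚ) : ℝ) := by
  simp [flow, realPoint]

/-- At `q` a zero flow is possible only if both sets are empty or both are full, by regularity and
strict positivity; in those cases the flow at `p` vanishes too. -/
theorem flow_pos_iff_of_mem_closure {p : (ι → ℝ) × (κ → ℝ)} (hq : q ∈ regularPoints ι κ)
    (hq1 : ∀ i, 0 < q.1 i) (hq2 : ∀ j, 0 < q.2 j) (hp : p ∈ closure (chamber q))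
    {I : Finset ι} {J : Finset κ} (h : flow p I J ≠ 0) : 0 < flow q I J ↔ 0 < flow p I J := by
  constructor
  · exact fun h1 => lt_of_le_of_ne (flow_nonneg_of_mem_closure hq.1 hp h1) h.symm
  · intro h1
    by_contra h2
    have hp0 := (parameterSpace_of_mem_closure hp).2.2.2.2
    rcases (not_lt.1 h2).lt_or_eq with h3 | h3
    · exact absurd h1 (flow_nonpos_of_mem_closure hq.1 hp h3).not_gt
    · have hq0 := hq.1.2.2.2.2
      refine h ?_
      by_cases hI : I = ∅
      · have hJ : J = ∅ := by
          by_contra hJ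
          have := Finset.sum_pos (fun j _ => hq2 j) (Finset.nonempty_iff_ne_empty.2 hJ)
          rw [hI, flow, Finset.sum_empty] at h3
          linarith
        simp [flow, hI, hJ]
      by_cases hI' : I = univ
      · have hJ : J = univ := by
          by_contra hJ
          obtain ⟨j₀, hj₀⟩ : ∃ j, j ∉ J := by simpa [Finset.eq_univ_iff_forall] using hJ
          have := Finset.sum_lt_sum_of_subset (Finset.subset_univ J) (Finset.mem_univ _) hj₀
            (hq2 _) fun j _ _ => (hq2 j).le
          rw [hI', flow, hq0] at h3
          linarith
        simp [flow, hI', hJ, hp0]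
      by_cases hJ : J = ∅
      · have := Finset.sum_pos (fun j _ => hq1 j) (Finset.nonempty_iff_ne_empty.2 hI)
        rw [hJ, flow, Finset.sum_empty] at h3
        linarith
      by_cases hJ' : J = univ
      · obtain ⟨i₀, hi₀⟩ : ∃ i, i ∉ I := by simpa [Finset.eq_univ_iff_forall] using hI'
        have := Finset.sum_lt_sum_of_subset (Finset.subset_univ I) (Finset.mem_univ _) hi₀
            (hq1 _) fun j _ _ => (hq1 j).le
        rw [hJ', flow, ← hq0] at h3
        linarith
      exact absurd h3 (regular_flow_ne_zero hq (Finset.nonempty_iff_ne_empty.2 hI) hI'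
        (Finset.nonempty_iff_ne_empty.2 hJ) hJ')

variable [Nonempty ι] [Nonempty κ]

/-- The flows that vanish at `(μ, ν)` and may have any sign at `q` are also the weights of their
edges, so their direction does not matter. -/
theorem hurwitz_eq_refTreeSum (hq : q ∈ regularPoints ι κ) (hq1 : ∀ i, 0 < q.1 i)
    (hq2 : ∀ j, 0 < q.2 j) (hN : 3 ≤ Fintype.card ι + Fintype.card κ) {μ : ι → ℕ} {ν : κ → ℕ}
    (hμ : ∀ i, 0 < μ i) (hν : ∀ j, 0 < ν j) (h : realPoint μ ν ∈ closure (chamber q)) :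
    hurwitz μ ν = ((Fintype.card ι + Fintype.card κ - 2).factorial : ℚ) *
      refTreeSum q (fun i => (μ i : ℚ)) (fun j => (ν j : ℚ)) := by
  have hbal := (parameterSpace_of_mem_closure h).2.2.2.2
  have hsum : ∑ i, μ i = ∑ j, ν j := by
    have : (∑ i, (μ i : ℝ)) = ∑ j, (ν j : ℝ) := hbal
    exact_mod_cast this
  rw [hurwitz_eq_intTreeSum hμ hν hsum hN, intTreeSum_leafWeights]
  congr 1
  refine refTreeSum_congr hbal hq.1.2.2.2.2 (by exact_mod_cast hsum) fun I J _ _ hIJ => ?_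
  refine (flow_pos_iff_of_mem_closure hq hq1 hq2 h ?_).symm
  rw [flow_realPoint_eq_cast]
  exact_mod_cast sub_ne_zero.2 hIJ

/-- The chamber polynomial as a tree sum. -/
noncomputable def treePolynomial (q : (ι → ℝ) × (κ → ℝ)) : MvPolynomial (ι ⊕ κ) ℚ :=
  MvPolynomial.C ((Fintype.card ι + Fintype.card κ - 2).factorial : ℚ) *
    refTreeSum q (fun i => MvPolynomial.X (Sum.inl i)) (fun j => MvPolynomial.X (Sum.inr j))

theorem eval_treePolynomial (q : (ι → ℝ) × (κ → ℝ)) (x : ι → ℚ) (y : κ → ℚ) :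
    MvPolynomial.eval (Sum.elim x y) (treePolynomial q) =
      ((Fintype.card ι + Fintype.card κ - 2).factorial : ℚ) * refTreeSum q x y := by
  rw [treePolynomial, map_mul, MvPolynomial.eval_C]
  congr 1
  have := map_refTreeSum (q := q) (x := fun i => (MvPolynomial.X (Sum.inl i) : MvPolynomial (ι ⊕ κ) ℚ))
    (y := fun j => MvPolynomial.X (Sum.inr j)) (MvPolynomial.aeval (Sum.elim x y))
  simp only [MvPolynomial.aeval_X, Sum.elim_inl, Sum.elim_inr] at this
  exact this

theorem isChamberPolynomial_treePolynomial (hq : q ∈ regularPoints ι κ) (hq1 : ∀ i, 0 < q.1 i)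
    (hq2 : ∀ j, 0 < q.2 j) (hN : 3 ≤ Fintype.card ι + Fintype.card κ) :
    IsChamberPolynomial q (treePolynomial q) := by
  refine ⟨hq, ?_, fun μ ν hμ hν h => ?_⟩
  · have := (MvPolynomial.isHomogeneous_C (ι ⊕ κ)
      ((Fintype.card ι + Fintype.card κ - 2).factorial : ℚ)).mul (refTreeSum_isHomogeneous q)
    rwa [zero_add] at this
  · rw [eval_treePolynomial, hurwitz_eq_refTreeSum hq hq1 hq2 hN hμ hν h]

theorem isChamberPolynomial_chamberPolynomial {P : MvPolynomial (ι ⊕ κ) ℚ}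
    (h : IsChamberPolynomial q P) : IsChamberPolynomial q (chamberPolynomial q) := by
  have h' : ∃ P, IsChamberPolynomial q P := ⟨P, h⟩
  rw [chamberPolynomial, dif_pos h']
  exact h'.choose_spec

theorem eval_smul_of_isHomogeneous {σ : Type*} {D : MvPolynomial σ ℚ} {k : ℕ}
    (hD : D.IsHomogeneous k) (c : ℚ) (v : σ → ℚ) :
    MvPolynomial.eval (fun i => c * v i) D = c ^ k * MvPolynomial.eval v D := by
  rw [MvPolynomial.eval_eq, MvPolynomial.eval_eq, Finset.mul_sum]
  refine Finset.sum_congr rfl fun d hd => ?_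
  have hdeg : ∑ i ∈ d.support, d i = k := by
    have := hD (MvPolynomial.mem_support_iff.1 hd)
    rw [Finsupp.weight_apply] at this
    simpa [Finsupp.sum] using this
  simp only [mul_pow, Finset.prod_mul_distrib, Finset.prod_pow_eq_pow_sum, hdeg]
  ring

/-- A chamber polynomial is determined on the hyperplane of balanced points. -/
theorem eval_eq_zero_of_chamber {D : MvPolynomial (ι ⊕ κ) ℚ} {k : ℕ} (hD : D.IsHomogeneous k)
    (hq : q ∈ regularPoints ι κ)
    (h : ∀ (μ : ι → ℕ) (ν : κ → ℕ), (∀ i, 0 < μ i) → (∀ j, 0 < ν j) →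
      realPoint μ ν ∈ closure (chamber q) →
      MvPolynomial.eval (Sum.elim (fun i => (μ i : ℚ)) (fun j => (ν j : ℚ))) D = 0)
    (x : ι → ℚ) (y : κ → ℚ) (hxy : ∑ i, x i = ∑ j, y j) :
    MvPolynomial.eval (Sum.elim x y) D = 0 := by
  obtain ⟨μ, ν, hp, hsum⟩ := exists_nat_strictlyInside hq.1
  -- a common denominator
  obtain ⟨b, hb0, a, hab⟩ : ∃ b : ℕ, 0 < b ∧ ∃ a : ι ⊕ κ → ℤ, ∀ s, (b : ℚ) * Sum.elim x y s = a s := by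
    refine ⟨∏ s, (Sum.elim x y s).den, Finset.prod_pos fun s _ => (Sum.elim x y s).den_pos,
      fun s => (∏ s' ∈ univ.erase s, ((Sum.elim x y s').den : ℤ)) * (Sum.elim x y s).num,
      fun s => ?_⟩
    rw [← Finset.mul_prod_erase _ _ (Finset.mem_univ s)]
    push_cast
    conv_rhs => rw [← Rat.mul_den_eq_num]
    ring
  have hb : (b : ℚ) ≠ 0 := by exact_mod_cast hb0.ne'
  have hasum : ∑ i, a (Sum.inl i) = ∑ j, a (Sum.inr j) := by
    have : (∑ i, (a (Sum.inl i) : ℚ)) = ∑ j, (a (Sum.inr j) : ℚ) := by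
      simp only [← hab, Sum.elim_inl, Sum.elim_inr, ← Finset.mul_sum, hxy]
    exact_mod_cast this
  -- the restriction of `D` to a line
  set g : Polynomial ℚ := MvPolynomial.aeval (fun s => Polynomial.C (a s : ℚ) + Polynomial.X *
    Polynomial.C (Sum.elim (fun i => (μ i : ℚ)) (fun j => (ν j : ℚ)) s)) D with hg
  have hgeval : ∀ t : ℚ, g.eval t = MvPolynomial.eval (fun s => (a s : ℚ) +
      t * Sum.elim (fun i => (μ i : ℚ)) (fun j => (ν j : ℚ)) s) D := by
    intro t
    have e : (Polynomial.aeval t).comp (MvPolynomial.aeval fun s => Polynomial.C (a s : ℚ) +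
        Polynomial.X * Polynomial.C (Sum.elim (fun i => (μ i : ℚ)) (fun j => (ν j : ℚ)) s)) =
        MvPolynomial.aeval (R := ℚ) fun s => (a s : ℚ) +
          t * Sum.elim (fun i => (μ i : ℚ)) (fun j => (ν j : ℚ)) s :=
      MvPolynomial.algHom_ext fun s => by simp; exact mul_comm _ _
    exact congrArg (fun f => f D) e
  -- The direction `(μ, ν)` of the line is strictly inside the cone of the chamber, so all far
  -- integer points of the line are positive and belong to its closure.
  have hzero : ∃ t₀ : ℕ, ∀ t : ℕ, t₀ ≤ t → g.eval (t : ℚ) = 0 := by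
    set A : ℤ := ∑ s, |a s| with hA
    have hA0 : 0 ≤ A := Finset.sum_nonneg fun s _ => abs_nonneg _
    have haA : ∀ s, |a s| ≤ A := fun s =>
      Finset.single_le_sum (f := fun s => |a s|) (fun s _ => abs_nonneg _) (Finset.mem_univ s)
    have hflowA : ∀ (I : Finset ι) (J : Finset κ),
        -A ≤ ∑ i ∈ I, a (Sum.inl i) - ∑ j ∈ J, a (Sum.inr j) := by
      intro I J
      have h1 : |∑ i ∈ I, a (Sum.inl i)| ≤ ∑ i, |a (Sum.inl i)| :=
        (Finset.abs_sum_le_sum_abs _ _).trans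
          (Finset.sum_le_sum_of_subset_of_nonneg (Finset.subset_univ I) fun _ _ _ => abs_nonneg _)
      have h2 : |∑ j ∈ J, a (Sum.inr j)| ≤ ∑ j, |a (Sum.inr j)| :=
        (Finset.abs_sum_le_sum_abs _ _).trans
          (Finset.sum_le_sum_of_subset_of_nonneg (Finset.subset_univ J) fun _ _ _ => abs_nonneg _)
      have h3 : A = ∑ i, |a (Sum.inl i)| + ∑ j, |a (Sum.inr j)| := Fintype.sum_sum_type _
      have h4 := neg_abs_le (∑ i ∈ I, a (Sum.inl i))
      have h5 := le_abs_self (∑ j ∈ J, a (Sum.inr j))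
      linarith
    have hμlt : ∀ i i', i < i' → μ i' < μ i := fun i i' h => Nat.cast_lt.1 (hp.fst_lt i i' h : (μ i' : ℝ) < μ i)
    have hνlt : ∀ j j', j < j' → ν j' < ν j := fun j j' h => Nat.cast_lt.1 (hp.snd_lt j j' h : (ν j' : ℝ) < ν j)
    have hμpos : ∀ i, 0 < μ i := fun i => Nat.cast_pos.1 (hp.fst_pos i : (0 : ℝ) < μ i)
    have hνpos : ∀ j, 0 < ν j := fun j => Nat.cast_pos.1 (hp.snd_pos j : (0 : ℝ) < ν j)
    -- The coordinates of `a`, their differences and its flows are at least `-(2 * A)`, while the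
    -- corresponding strict inequalities between integers at `(μ, ν)` hold with a margin of at least
    -- `1`.
    refine ⟨(2 * A + 1).toNat, fun t ht => ?_⟩
    have ht : 2 * A + 1 ≤ t := Int.toNat_le.1 ht
    have hlin : ∀ c n : ℤ, -(2 * A) ≤ c → 0 < n → 0 < c + t * n := by
      intro c n hc hn
      nlinarith
    have hbound : ∀ s, -(2 * A) ≤ a s := fun s => by
      have := haA s
      have := neg_abs_le (a s)
      linarith
    have hM : ∀ i, 0 < a (Sum.inl i) + t * μ i := fun i =>
      hlin _ _ (hbound _) (by exact_mod_cast hμpos i)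
    have hN : ∀ j, 0 < a (Sum.inr j) + t * ν j := fun j =>
      hlin _ _ (hbound _) (by exact_mod_cast hνpos j)
    obtain ⟨μ', hμ'⟩ : ∃ μ' : ι → ℕ, ∀ i, (μ' i : ℤ) = a (Sum.inl i) + t * μ i :=
      ⟨fun i => (a (Sum.inl i) + t * μ i).toNat, fun i => Int.toNat_of_nonneg (hM i).le⟩
    obtain ⟨ν', hν'⟩ : ∃ ν' : κ → ℕ, ∀ j, (ν' j : ℤ) = a (Sum.inr j) + t * ν j :=
      ⟨fun j => (a (Sum.inr j) + t * ν j).toNat, fun j => Int.toNat_of_nonneg (hN j).le⟩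
    have hsum' : ∑ i, μ' i = ∑ j, ν' j := by
      zify
      simp only [hμ', hν', Finset.sum_add_distrib, ← Finset.mul_sum, hasum]
      congr 2
      exact_mod_cast hsum
    have hmem : realPoint μ' ν' ∈ closure (chamber q) := by
      refine mem_closure_chamber_of_flow hq ⟨fun i i' hi => ?_, fun i => ?_, fun j j' hj => ?_,
        fun j => ?_, ?_⟩ fun I J hI hI' hJ hJ' hIJ => ?_
      · rcases hi.eq_or_lt with rfl | hi
        · exact le_rfl
        · have h1 := hlin (a (Sum.inl i) - a (Sum.inl i')) (μ i - μ i') (by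
            have h1 := haA (Sum.inl i)
            have h2 := haA (Sum.inl i')
            have h3 := neg_abs_le (a (Sum.inl i))
            have h4 := le_abs_self (a (Sum.inl i'))
            linarith) (by have := hμlt i i' hi; omega)
          have h2 : (μ' i' : ℤ) ≤ μ' i := by rw [hμ', hμ']; linarith
          exact Nat.cast_le.2 (by exact_mod_cast h2)
      · exact Nat.cast_nonneg _
      · rcases hj.eq_or_lt with rfl | hj
        · exact le_rfl
        · have h1 := hlin (a (Sum.inr j) - a (Sum.inr j')) (ν j - ν j') (by
            have h1 := haA (Sum.inr j)
            have h2 := haA (Sum.inr j')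
            have h3 := neg_abs_le (a (Sum.inr j))
            have h4 := le_abs_self (a (Sum.inr j'))
            linarith) (by have := hνlt j j' hj; omega)
          have h2 : (ν' j' : ℤ) ≤ ν' j := by rw [hν', hν']; linarith
          exact Nat.cast_le.2 (by exact_mod_cast h2)
      · exact Nat.cast_nonneg _
      · have : (∑ i, (μ' i : ℝ)) = ∑ j, (ν' j : ℝ) := by exact_mod_cast hsum'
        exact this
      · have h1 := hp.flow_pos I J hIJ hI hI' hJ hJ'
        have h2 : 0 < ∑ i ∈ I, (μ i : ℤ) - ∑ j ∈ J, (ν j : ℤ) := by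
          have e : flow (realPoint μ ν) I J =
              ((∑ i ∈ I, (μ i : ℤ) - ∑ j ∈ J, (ν j : ℤ) : ℤ) : ℝ) := by simp [flow, realPoint]
          rw [e] at h1
          exact_mod_cast h1
        have h3 := hlin _ _ ((by linarith : -(2 * A) ≤ -A).trans (hflowA I J)) h2
        have e : flow (realPoint μ' ν') I J =
            ((∑ i ∈ I, (μ' i : ℤ) - ∑ j ∈ J, (ν' j : ℤ) : ℤ) : ℝ) := by simp [flow, realPoint]
        rw [e]
        have h4 : 0 ≤ ∑ i ∈ I, (μ' i : ℤ) - ∑ j ∈ J, (ν' j : ℤ) := by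
          simp only [hμ', hν', Finset.sum_add_distrib, ← Finset.mul_sum]
          linarith
        exact_mod_cast h4
    rw [hgeval, ← h μ' ν' (fun i => ?_) (fun j => ?_) hmem]
    · congr 2
      funext s
      rcases s with i | j
      · simp only [Sum.elim_inl]
        exact_mod_cast (hμ' i).symm
      · simp only [Sum.elim_inr]
        exact_mod_cast (hν' j).symm
    · have := hM i
      rw [← hμ'] at this
      exact_mod_cast this
    · have := hN j
      rw [← hν'] at this
      exact_mod_cast this
  obtain ⟨t₀, ht₀⟩ := hzero
  have hg0 : g = 0 := by
    refine Polynomial.eq_zero_of_infinite_isRoot g ?_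
    refine Set.infinite_of_injective_forall_mem (f := fun n : ℕ => ((t₀ + n : ℕ) : ℚ)) ?_ ?_
    · intro m n hmn
      have : t₀ + m = t₀ + n := Nat.cast_injective (R := ℚ) hmn
      omega
    · exact fun n => ht₀ _ (Nat.le_add_right _ _)
  -- At `t = 0` the line passes through `b` times the given point, and homogeneity removes the
  -- denominator `b`.
  have h0 := hgeval 0
  rw [hg0, Polynomial.eval_zero] at h0
  have h1 := eval_smul_of_isHomogeneous hD b (Sum.elim x y)
  simp only [hab] at h1
  simp only [zero_mul, add_zero] at h0
  rw [← h0, eq_comm, mul_eq_zero] at h1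
  exact h1.resolve_left (pow_ne_zero _ hb)

/-- The values of the chamber polynomial at balanced points. -/
theorem chamberValue_eq (hq : q ∈ regularPoints ι κ) (hq1 : ∀ i, 0 < q.1 i)
    (hq2 : ∀ j, 0 < q.2 j) (hN : 3 ≤ Fintype.card ι + Fintype.card κ) {x : ι → ℚ} {y : κ → ℚ}
    (hxy : ∑ i, x i = ∑ j, y j) :
    chamberValue q x y = ((Fintype.card ι + Fintype.card κ - 2).factorial : ℚ) *
      refTreeSum q x y := by
  have h1 := isChamberPolynomial_treePolynomial hq hq1 hq2 hN
  have h2 := isChamberPolynomial_chamberPolynomial h1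
  rw [← eval_treePolynomial, ← sub_eq_zero, chamberValue, ← map_sub]
  refine eval_eq_zero_of_chamber (h2.2.1.sub h1.2.1) hq (fun μ ν hμ hν h => ?_) x y hxy
  rw [map_sub, h1.2.2 μ ν hμ hν h, h2.2.2 μ ν hμ hν h, sub_self]

end ChamberPolynomials

/-! ### The path of reference points and its stages. -/

section PathData

variable {m n : ℕ} [NeZero m]

/-- A reference point together with the small parameters of the path to the base chamber. -/
structure PathData (α : Fin m → ℕ) (β : Fin n → ℕ) (ε : Fin m → ℝ) (δ : ℝ) : Prop where
  fst : IsPartitionFamily α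
  snd : IsPartitionFamily β
  regular : realPoint α β ∈ regularPoints (Fin m) (Fin n)
  delta_pos : 0 < δ
  delta_lt : δ < 1 / (m : ℝ)
  delta_lt_eps : ∀ i : Fin m, 2 ≤ i.val → δ < ε i
  eps_lt : ∀ i : Fin m, 2 ≤ i.val → ε i < 1 / (m : ℝ)
  eps_anti : ∀ i i' : Fin m, 2 ≤ i.val → i < i' → ε i' < ε i

/-- The final coordinates of the path, except for the first one. -/
def smallPart (ε : Fin m → ℝ) (δ : ℝ) (i : Fin m) : ℝ := if i.val = 1 then δ else ε i

/-- The coordinates, except for the first one, of the path when the coordinates from `K` on have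
been made small. -/
noncomputable def stageCoord (α : Fin m → ℕ) (ε : Fin m → ℝ) (δ : ℝ) (K : ℕ) (i : Fin m) : ℝ :=
  if i.val < K then (α i : ℝ) else smallPart ε δ i

theorem val_ne_zero_of_ne {i : Fin m} (h : i ≠ 0) : i.val ≠ 0 := fun h' =>
  h (Fin.ext (by rw [h']; simp))

variable {α : Fin m → ℕ} {β : Fin n → ℕ} {ε : Fin m → ℝ} {δ : ℝ}

theorem smallPart_eq {i : Fin m} (h : 2 ≤ i.val) : smallPart ε δ i = ε i :=
  if_neg (by omega)

namespace PathData

theorem sum_eq (h : PathData α β ε δ) : ∑ i, α i = ∑ j, β j := by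
  have : (∑ i, (α i : ℝ)) = ∑ j, (β j : ℝ) := h.regular.1.2.2.2.2
  exact_mod_cast this

theorem card_pos (_h : PathData α β ε δ) : (0 : ℝ) < m := Nat.cast_pos.2 (NeZero.pos m)

theorem inv_card_le_one (h : PathData α β ε δ) : 1 / (m : ℝ) ≤ 1 := by
  rw [div_le_one h.card_pos]
  exact_mod_cast NeZero.one_le

theorem delta_lt_one (h : PathData α β ε δ) : δ < 1 := h.delta_lt.trans_le h.inv_card_le_one

theorem smallPart_pos (h : PathData α β ε δ) {i : Fin m} (hi : i ≠ 0) : 0 < smallPart ε δ i := by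
  have := val_ne_zero_of_ne hi
  unfold smallPart
  split_ifs with h1
  · exact h.delta_pos
  · exact h.delta_pos.trans (h.delta_lt_eps i (by omega))

theorem smallPart_lt (h : PathData α β ε δ) {i : Fin m} (hi : i ≠ 0) :
    smallPart ε δ i < 1 / (m : ℝ) := by
  have := val_ne_zero_of_ne hi
  unfold smallPart
  split_ifs with h1
  · exact h.delta_lt
  · exact h.eps_lt i (by omega)

/-- There are at most `m - 1` small coordinates, each below `1 / m`, so one more term below `1 / m`
still keeps the total under `1`. Hence small coordinates never bridge a gap between distinct
integers. -/
theorem sum_smallPart_add_lt (h : PathData α β ε δ) {I : Finset (Fin m)} (hI : (0 : Fin m) ∉ I)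
    {x : ℝ} (hx : x < 1 / (m : ℝ)) : ∑ i ∈ I, smallPart ε δ i + x < 1 := by
  have h1 : ∑ i ∈ I, smallPart ε δ i ≤ #I • (1 / (m : ℝ)) := Finset.sum_le_card_nsmul _ _ _
    fun i hi => (h.smallPart_lt (by rintro rfl; exact hI hi)).le
  have h2 : #I + 1 ≤ m := by
    have := Finset.card_le_univ (insert 0 I)
    rwa [Finset.card_insert_of_notMem hI, Fintype.card_fin] at this
  have h3 : ((#I : ℝ) + 1) * (1 / (m : ℝ)) ≤ 1 := by
    rw [mul_one_div, div_le_one h.card_pos]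
    exact_mod_cast h2
  rw [nsmul_eq_mul] at h1
  linarith

theorem sum_stageCoord (K : ℕ) (I : Finset (Fin m)) : ∑ i ∈ I, stageCoord α ε δ K i =
    ((∑ i ∈ I with i.val < K, α i : ℕ) : ℝ) + ∑ i ∈ I with ¬ i.val < K, smallPart ε δ i := by
  rw [← Finset.sum_filter_add_sum_filter_not I (fun i => i.val < K), Nat.cast_sum]
  congr 1
  · exact Finset.sum_congr rfl fun i hi => if_pos (Finset.mem_filter.1 hi).2
  · exact Finset.sum_congr rfl fun i hi => if_neg (Finset.mem_filter.1 hi).2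

/-- For proper nonempty sets this is regularity; positivity of the parts and the absence of the
index `0` exclude the remaining cases. -/
theorem sum_ne_sum (h : PathData α β ε δ) {I : Finset (Fin m)} {J : Finset (Fin n)}
    (hI : (0 : Fin m) ∉ I) (hne : I.Nonempty ∨ J.Nonempty) : ∑ i ∈ I, α i ≠ ∑ j ∈ J, β j := by
  intro he
  have hI' : I ≠ univ := by rintro rfl; exact hI (Finset.mem_univ _)
  have hIne : I.Nonempty := by
    by_contra hI0
    rw [Finset.not_nonempty_iff_eq_empty] at hI0
    subst hI0
    have := Finset.sum_pos (fun j _ => h.snd.2 j) (hne.resolve_left (by simp))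
    rw [Finset.sum_empty] at he
    omega
  have hJne : J.Nonempty := by
    by_contra hJ0
    rw [Finset.not_nonempty_iff_eq_empty] at hJ0
    subst hJ0
    have := Finset.sum_pos (fun j _ => h.fst.2 j) hIne
    rw [Finset.sum_empty] at he
    omega
  have hJ' : J ≠ univ := by
    rintro rfl
    have := Finset.sum_lt_sum_of_subset (Finset.subset_univ I) (Finset.mem_univ _) hI
      (h.fst.2 _) fun j _ _ => Nat.zero_le _
    rw [he, h.sum_eq] at this
    omega
  refine h.regular.2 ⟨I, J, hIne, hI', hJne, hJ', ?_⟩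
  have : (∑ i ∈ I, (α i : ℝ)) = ∑ j ∈ J, (β j : ℝ) := by exact_mod_cast he
  exact this

/-- The flows on the path are far from zero at the stages. -/
theorem lt_abs_stage (h : PathData α β ε δ) (K : ℕ) {I : Finset (Fin m)} {J : Finset (Fin n)}
    (hI : (0 : Fin m) ∉ I) (hne : I.Nonempty ∨ J.Nonempty) {x : ℝ}
    (hxm : x < 1 / (m : ℝ)) (hxI : ∀ i ∈ I, K ≤ i.val → x < smallPart ε δ i) :
    x < |∑ i ∈ I, stageCoord α ε δ K i - ∑ j ∈ J, (β j : ℝ)| := by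
  have hI0 : ∀ i ∈ I, i ≠ 0 := fun i hi => by rintro rfl; exact hI hi
  have h0 : ∀ i ∈ I.filter fun i => ¬ i.val < K, 0 ≤ smallPart ε δ i := fun i hi =>
    (h.smallPart_pos (hI0 i (Finset.mem_filter.1 hi).1)).le
  have h1 := Finset.sum_nonneg h0
  have h2 := h.sum_smallPart_add_lt (I := I.filter fun i => ¬ i.val < K)
    (fun h => hI (Finset.mem_filter.1 h).1) hxm
  have hx1 := hxm.trans_le h.inv_card_le_one
  rw [sum_stageCoord, ← Nat.cast_sum]
  rcases lt_trichotomy (∑ i ∈ I with i.val < K, α i) (∑ j ∈ J, β j) with h3 | h3 | h3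
  · have h4 : ((∑ i ∈ I with i.val < K, α i : ℕ) : ℝ) + 1 ≤ ((∑ j ∈ J, β j : ℕ) : ℝ) := by
      exact_mod_cast h3
    rw [lt_abs]
    right
    linarith
  -- If the integer parts agree, then some coordinate of `I` has been made small, by regularity of
  -- the original point, and it alone exceeds `x`.
  · have h4 : (I.filter fun i => ¬ i.val < K).Nonempty := by
      by_contra h4
      rw [Finset.not_nonempty_iff_eq_empty, Finset.filter_eq_empty_iff] at h4
      rw [Finset.filter_true_of_mem fun i hi => not_not.1 (h4 hi)] at h3
      exact h.sum_ne_sum hI hne h3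
    obtain ⟨i, hi⟩ := h4
    have h5 := Finset.single_le_sum h0 hi
    have h6 := hxI i (Finset.mem_filter.1 hi).1 (not_lt.1 (Finset.mem_filter.1 hi).2)
    rw [h3, lt_abs]
    left
    linarith
  · have h4 : ((∑ j ∈ J, β j : ℕ) : ℝ) + 1 ≤ ((∑ i ∈ I with i.val < K, α i : ℕ) : ℝ) := by
      exact_mod_cast h3
    rw [lt_abs]
    left
    linarith

theorem stage_ne_zero (h : PathData α β ε δ) (K : ℕ) {I : Finset (Fin m)} {J : Finset (Fin n)}
    (hI : (0 : Fin m) ∉ I) (hne : I.Nonempty ∨ J.Nonempty) :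
    ∑ i ∈ I, stageCoord α ε δ K i - ∑ j ∈ J, (β j : ℝ) ≠ 0 := by
  have := h.lt_abs_stage (x := 0) K hI hne (by have := h.card_pos; positivity)
    fun i hi _ => h.smallPart_pos (by rintro rfl; exact hI hi)
  exact abs_pos.1 this

/-- The integer parts differ by regularity, and the small coordinates are too small to change the
sign. -/
theorem stage_pos_iff (h : PathData α β ε δ) (K : ℕ) {I : Finset (Fin m)} {J : Finset (Fin n)}
    (hI : (0 : Fin m) ∉ I) (hJ : J.Nonempty) :
    0 < ∑ i ∈ I, stageCoord α ε δ K i - ∑ j ∈ J, (β j : ℝ) ↔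
      ∑ j ∈ J, β j < ∑ i ∈ I with i.val < K, α i := by
  have hI0 : ∀ i ∈ I, i ≠ 0 := fun i hi => by rintro rfl; exact hI hi
  have h1 := Finset.sum_nonneg (s := I.filter fun i => ¬ i.val < K) (f := smallPart ε δ)
    fun i hi => (h.smallPart_pos (hI0 i (Finset.mem_filter.1 hi).1)).le
  have h2 := h.sum_smallPart_add_lt (I := I.filter fun i => ¬ i.val < K)
    (fun h => hI (Finset.mem_filter.1 h).1) h.delta_lt
  have hδ := h.delta_pos
  rw [sum_stageCoord, ← Nat.cast_sum]
  rcases lt_trichotomy (∑ i ∈ I with i.val < K, α i) (∑ j ∈ J, β j) with h3 | h3 | h3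
  · have h4 : ((∑ i ∈ I with i.val < K, α i : ℕ) : ℝ) + 1 ≤ ((∑ j ∈ J, β j : ℕ) : ℝ) := by
      exact_mod_cast h3
    exact iff_of_false (by linarith) (by omega)
  · exact absurd h3 (h.sum_ne_sum (fun h => hI (Finset.mem_filter.1 h).1) (Or.inr hJ))
  · have h4 : ((∑ j ∈ J, β j : ℕ) : ℝ) + 1 ≤ ((∑ i ∈ I with i.val < K, α i : ℕ) : ℝ) := by
      exact_mod_cast h3
    exact iff_of_true (by linarith) h3

end PathData

/-- The crossing index is where the partial sums of `α` over `I` pass `β_J`. In this form it can be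
compared with the signs before and after a stage. -/
theorem crossingIndex_eq_coe_iff {I : Finset (Fin m)} {J : Finset (Fin n)} {c : Fin m} :
    crossingIndex α β I J = c ↔ c ∈ I ∧ ∑ j ∈ J, β j < ∑ i ∈ I with i.val < c.val + 1, α i ∧
      ∑ i ∈ I with i.val < c.val, α i ≤ ∑ j ∈ J, β j := by
  have hfilter : ∀ c : Fin m, (I.filter fun i => i.val < c.val + 1) = I.filter fun i => i ≤ c :=
    fun c => Finset.filter_congr fun i _ => by rw [Nat.lt_succ_iff, Fin.le_def]
  rw [hfilter]
  constructor
  · intro h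
    have h1 := Finset.mem_filter.1 (Finset.mem_of_min h)
    refine ⟨h1.1, h1.2, ?_⟩
    by_contra! h2
    have hne : (I.filter fun i => i.val < c.val).Nonempty := by
      by_contra h3
      rw [Finset.not_nonempty_iff_eq_empty] at h3
      rw [h3, Finset.sum_empty] at h2
      omega
    set b := (I.filter fun i => i.val < c.val).max' hne with hb
    have hbm := Finset.mem_filter.1 (Finset.max'_mem _ hne)
    have hle : (b : WithTop (Fin m)) ≥ c := by
      rw [← h]
      refine Finset.min_le (Finset.mem_filter.2 ⟨hbm.1, h2.trans_le ?_⟩)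
      refine Finset.sum_le_sum_of_subset fun i hi => ?_
      exact Finset.mem_filter.2 ⟨(Finset.mem_filter.1 hi).1, Finset.le_max' _ _ hi⟩
    exact absurd hbm.2 (not_lt.2 (Fin.le_def.1 (WithTop.coe_le_coe.1 hle)))
  · rintro ⟨h1, h2, h3⟩
    refine le_antisymm (Finset.min_le (Finset.mem_filter.2 ⟨h1, h2⟩)) (Finset.le_min fun b hb => ?_)
    obtain ⟨-, hb2⟩ := Finset.mem_filter.1 hb
    refine WithTop.coe_le_coe.2 (not_lt.1 fun hlt => ?_)
    refine absurd (hb2.trans_le ?_) h3.not_gt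
    refine Finset.sum_le_sum_of_subset fun i hi => ?_
    exact Finset.mem_filter.2 ⟨(Finset.mem_filter.1 hi).1,
      Fin.lt_def.1 ((Finset.mem_filter.1 hi).2.trans_lt hlt)⟩

theorem exists_crossingIndex_eq_coe {I : Finset (Fin m)} {J : Finset (Fin n)}
    (h : ∑ j ∈ J, β j < ∑ i ∈ I, α i) : ∃ c : Fin m, crossingIndex α β I J = c := by
  have hne : I.Nonempty := by
    by_contra h3
    rw [Finset.not_nonempty_iff_eq_empty] at h3
    rw [h3, Finset.sum_empty] at h
    omega
  refine Finset.min_of_mem (a := I.max' hne) (Finset.mem_filter.2 ⟨Finset.max'_mem _ _, ?_⟩)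
  rwa [Finset.filter_true_of_mem fun i hi => Finset.le_max' I i hi]

end PathData

/-! ### Small changes of a reference point. -/

section Perturbation

variable {ι κ : Type*} [Fintype ι] [Fintype κ] [DecidableEq ι] [DecidableEq κ]
variable {q q' : (ι → ℝ) × (κ → ℝ)} {δ : ℝ}

/-- Each splitting has a side without `i₀`, so these flows determine all directions. Single leaves
are excluded: they are not inner edges, and the cut edge itself may have flow `0` before the
perturbation. -/
theorem refTreeSum_eq_of_perturbation {R : Type*} [CommRing R] [Algebra ℚ R] {x : ι → R}
    {y : κ → R} (hq : ∑ i, q.1 i = ∑ j, q.2 j) (hq' : ∑ i, q'.1 i = ∑ j, q'.2 j) (i₀ : ι)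
    (h : ∀ (I : Finset ι) (J : Finset κ), i₀ ∉ I → 2 ≤ #I + #J →
      δ < |flow q' I J| ∧ |flow q I J - flow q' I J| ≤ δ) (hxy : ∑ i, x i = ∑ j, y j) :
    refTreeSum q x y = refTreeSum q' x y := by
  have key : ∀ (I : Finset ι) (J : Finset κ), i₀ ∉ I → 2 ≤ #I + #J →
      (0 < flow q I J ↔ 0 < flow q' I J) ∧ (flow q I J < 0 ↔ flow q' I J < 0) := by
    intro I J hI hc
    obtain ⟨h1, h2⟩ := h I J hI hc
    rw [abs_le] at h2
    rcases lt_abs.1 h1 with h1 | h1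
    · exact ⟨iff_of_true (by linarith) (by linarith), iff_of_false (by linarith) (by linarith)⟩
    · exact ⟨iff_of_false (by linarith) (by linarith), iff_of_true (by linarith) (by linarith)⟩
  refine refTreeSum_congr hq hq' hxy fun I J hc hc' _ => ?_
  by_cases hI : i₀ ∈ I
  · have h1 := (key Iᶜ Jᶜ (by simpa using hI) hc').2
    rwa [flow_compl hq, flow_compl hq', neg_lt_zero, neg_lt_zero] at h1
  · exact (key I J hI hc).1

theorem notMem_resonances_of_perturbation (hq : ∑ i, q.1 i = ∑ j, q.2 j) (i₀ : ι)
    (h : ∀ (I : Finset ι) (J : Finset κ), i₀ ∉ I → 2 ≤ #I + #J →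
      δ < |flow q' I J| ∧ |flow q I J - flow q' I J| ≤ δ) : q ∉ resonances ι κ := by
  have key : ∀ (I : Finset ι) (J : Finset κ), i₀ ∉ I → I.Nonempty → J.Nonempty →
      flow q I J ≠ 0 := by
    intro I J hI hI' hJ' h0
    obtain ⟨h1, h2⟩ := h I J hI (by have := hI'.card_pos; have := hJ'.card_pos; omega)
    rw [h0, zero_sub, abs_neg] at h2
    linarith
  rintro ⟨I, J, hI, hI', hJ, hJ', h0⟩
  by_cases hI₀ : i₀ ∈ I
  · refine key Iᶜ Jᶜ (by simpa using hI₀) ?_ ?_ ?_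
    · rwa [← Finset.compl_ne_univ_iff_nonempty, compl_compl]
    · rwa [← Finset.compl_ne_univ_iff_nonempty, compl_compl]
    · rw [flow_compl hq, neg_eq_zero]
      exact sub_eq_zero.2 h0
  · exact key I J hI₀ hI hJ (sub_eq_zero.2 h0)

end Perturbation

/-! ### Sums over index types with one more element. -/

section AppendLast

variable {ι : Type*} [Fintype ι] [DecidableEq ι]

theorem sum_appendLast {R : Type*} [AddCommMonoid R] (f : ι → R) (r : R)
    (J : Finset (WithTop ι)) : ∑ j ∈ J, appendLast f r j =
      ∑ j with ((j : ι) : WithTop ι) ∈ J, f j + if ⊤ ∈ J then r else 0 := by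
  have h1 : ∑ j ∈ J, appendLast f r j = ∑ j, if j ∈ J then appendLast f r j else 0 := by
    rw [Finset.sum_ite_mem, Finset.univ_inter]
  rw [h1, Finset.sum_filter, add_comm]
  exact Fintype.sum_option _

theorem sum_univ_appendLast {R : Type*} [AddCommMonoid R] (f : ι → R) (r : R) :
    ∑ j, appendLast f r j = ∑ j, f j + r := by
  rw [sum_appendLast]
  simp

theorem card_eq_card_filter_coe (J : Finset (WithTop ι)) :
    #J = #{j : ι | ((j : ι) : WithTop ι) ∈ J} + if ⊤ ∈ J then 1 else 0 := by
  have := sum_appendLast (fun _ : ι => 1) 1 J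
  rw [Finset.card_eq_sum_ones, Finset.card_eq_sum_ones, ← this]
  refine Finset.sum_congr rfl fun j _ => ?_
  induction j <;> rfl

theorem map_val_univ_withTop {M : Type*} (g : WithTop ι → M) :
    (univ : Finset (WithTop ι)).val.map g = g ⊤ ::ₘ univ.val.map fun j : ι => g j := by
  have : (univ : Finset (WithTop ι)).val = ⊤ ::ₘ (univ : Finset ι).val.map WithTop.some := rfl
  rw [this, Multiset.map_cons, Multiset.map_map]
  rfl

theorem map_val_univ_subtype {ι M : Type*} {p : ι → Prop} {_ : Fintype (Subtype p)} {s : Finset ι}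
    (h : ∀ i, i ∈ s ↔ p i) (f : ι → M) :
    (univ : Finset (Subtype p)).val.map (fun i => f i.1) = s.val.map f := by
  have : s = (univ : Finset (Subtype p)).map (Function.Embedding.subtype p) := by
    ext i
    simp [h]
  rw [this, Finset.map_val, Multiset.map_map]
  rfl

theorem sum_univ_subtype {ι R : Type*} [AddCommMonoid R] {p : ι → Prop} [Fintype (Subtype p)]
    {s : Finset ι} (h : ∀ i, i ∈ s ↔ p i) (f : ι → R) :
    ∑ i : Subtype p, f i.1 = ∑ i ∈ s, f i :=
  congrArg Multiset.sum (map_val_univ_subtype h f)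

end AppendLast

/-! ### The two sides of an edge at a crossing. -/

section Sides

variable {m n : ℕ} [NeZero m]
variable {α : Fin m → ℕ} {β : Fin n → ℕ} {ε : Fin m → ℝ} {δ : ℝ}
variable {I : Finset (Fin m)} {J : Finset (Fin n)} {c : Fin m}

/-- The legs and the edge on one side of an edge with the flow `η`, when `w` are the
coordinates other than the one with the index `i₀`. -/
noncomputable def sideOne (β : Fin n → ℕ) (w : Fin m → ℝ) (I : Finset (Fin m))
    (J : Finset (Fin n)) (η : ℝ) : (WithTop {i // i ∉ I} → ℝ) × ({j // j ∉ J} → ℝ) :=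
  (appendLast (fun i : {i // i ∉ I} => if i.1 = 0 then
    ∑ j ∈ Jᶜ, (β j : ℝ) - ∑ i ∈ Iᶜ.erase 0, w i - η else w i.1) η, fun j => (β j.1 : ℝ))

/-- The legs and the edge on the other side of an edge with the flow `η`. -/
noncomputable def sideTwo (β : Fin n → ℕ) (w : Fin m → ℝ) (c : Fin m) (I : Finset (Fin m))
    (J : Finset (Fin n)) (η : ℝ) : ({i // i ∈ I} → ℝ) × (WithTop {j // j ∈ J} → ℝ) :=
  (fun i => if i.1 = c then ∑ j ∈ J, (β j : ℝ) - ∑ i ∈ I.erase c, w i + η else w i.1,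
    appendLast (fun j : {j // j ∈ J} => (β j.1 : ℝ)) η)

theorem sideOne_balanced (w : Fin m → ℝ) (h0 : (0 : Fin m) ∉ I) (η : ℝ) :
    ∑ i, (sideOne β w I J η).1 i = ∑ j, (sideOne β w I J η).2 j := by
  simp only [sideOne]
  rw [sum_univ_appendLast, sum_univ_subtype (s := Jᶜ) (by simp) fun j => (β j : ℝ),
    sum_univ_subtype (s := Iᶜ) (by simp) fun i => if i = 0 then
      ∑ j ∈ Jᶜ, (β j : ℝ) - ∑ i ∈ Iᶜ.erase 0, w i - η else w i,
    ← Finset.add_sum_erase Iᶜ _ (Finset.mem_compl.2 h0), if_pos rfl,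
    Finset.sum_congr rfl fun i hi => if_neg (Finset.ne_of_mem_erase hi)]
  ring

theorem sideTwo_balanced (w : Fin m → ℝ) (hc : c ∈ I) (η : ℝ) :
    ∑ i, (sideTwo β w c I J η).1 i = ∑ j, (sideTwo β w c I J η).2 j := by
  simp only [sideTwo]
  rw [sum_univ_appendLast, sum_univ_subtype (s := J) (by simp) fun j => (β j : ℝ),
    sum_univ_subtype (s := I) (by simp) fun i => if i = c then
      ∑ j ∈ J, (β j : ℝ) - ∑ i ∈ I.erase c, w i + η else w i,
    ← Finset.add_sum_erase I _ hc, if_pos rfl,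
    Finset.sum_congr rfl fun i hi => if_neg (Finset.ne_of_mem_erase hi)]
  ring

theorem flow_sideOne (w : Fin m → ℝ) (h0 : (0 : Fin m) ∉ I) (η : ℝ)
    {I' : Finset (WithTop {i // i ∉ I})} {J' : Finset {j // j ∉ J}}
    (hI' : ((⟨0, h0⟩ : {i // i ∉ I}) : WithTop {i // i ∉ I}) ∉ I') :
    flow (sideOne β w I J η) I' J' =
      ∑ i ∈ (univ.filter fun i : {i // i ∉ I} => (i : WithTop {i // i ∉ I}) ∈ I').map
        (Function.Embedding.subtype _), w i -
      ∑ j ∈ J'.map (Function.Embedding.subtype _), (β j : ℝ) + if ⊤ ∈ I' then η else 0 := by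
  rw [flow, sideOne, sum_appendLast, Finset.sum_map, Finset.sum_map]
  have : ∀ i ∈ univ.filter fun i : {i // i ∉ I} => (i : WithTop {i // i ∉ I}) ∈ I', i.1 ≠ 0 := by
    rintro ⟨i, hi⟩ hi' rfl
    exact hI' (Finset.mem_filter.1 hi').2
  rw [Finset.sum_congr rfl fun i hi => if_neg (this i hi)]
  simp only [Function.Embedding.coe_subtype]
  ring

theorem flow_sideTwo (w : Fin m → ℝ) (hc : c ∈ I) (η : ℝ)
    {I' : Finset {i // i ∈ I}} {J' : Finset (WithTop {j // j ∈ J})}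
    (hI' : (⟨c, hc⟩ : {i // i ∈ I}) ∉ I') :
    flow (sideTwo β w c I J η) I' J' =
      ∑ i ∈ I'.map (Function.Embedding.subtype _), w i -
      ∑ j ∈ (univ.filter fun j : {j // j ∈ J} => (j : WithTop {j // j ∈ J}) ∈ J').map
        (Function.Embedding.subtype _), (β j : ℝ) - if ⊤ ∈ J' then η else 0 := by
  rw [flow, sideTwo, sum_appendLast, Finset.sum_map, Finset.sum_map]
  have : ∀ i ∈ I', i.1 ≠ c := by
    rintro ⟨i, hi⟩ hi' rfl
    exact hI' hi'
  rw [Finset.sum_congr rfl fun i hi => if_neg (this i hi)]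
  simp only [Function.Embedding.coe_subtype]
  ring

/-- The resonance `x_I = y_J` is crossed when the coordinate with the index `c` is made small. -/
structure IsCrossedAt (α : Fin m → ℕ) (β : Fin n → ℕ) (I : Finset (Fin m)) (J : Finset (Fin n))
    (c : Fin m) : Prop where
  zero_notMem : (0 : Fin m) ∉ I
  nonempty : J.Nonempty
  crossingIndex_eq : crossingIndex α β I J = c

namespace IsCrossedAt

theorem mem (h : IsCrossedAt α β I J c) : c ∈ I :=
  (crossingIndex_eq_coe_iff.1 h.crossingIndex_eq).1

theorem lt (h : IsCrossedAt α β I J c) : ∑ j ∈ J, β j < ∑ i ∈ I with i.val < c.val + 1, α i :=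
  (crossingIndex_eq_coe_iff.1 h.crossingIndex_eq).2.1

theorem le (h : IsCrossedAt α β I J c) : ∑ i ∈ I with i.val < c.val, α i ≤ ∑ j ∈ J, β j :=
  (crossingIndex_eq_coe_iff.1 h.crossingIndex_eq).2.2

theorem sum_lt (h : IsCrossedAt α β I J c) : ∑ j ∈ J, β j < ∑ i ∈ I, α i :=
  h.lt.trans_le (Finset.sum_le_sum_of_subset (Finset.filter_subset _ _))

theorem val_pos (h : IsCrossedAt α β I J c) : 1 ≤ c.val :=
  Nat.one_le_iff_ne_zero.2 (val_ne_zero_of_ne fun h0 => h.zero_notMem (h0 ▸ h.mem))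

theorem stageCoord_of_lt {i : Fin m} (hi : i < c) : stageCoord α ε δ c.val i = α i :=
  if_pos (Fin.lt_def.1 hi)

theorem stageCoord_of_gt (h : IsCrossedAt α β I J c) {i : Fin m} (hi : c < i) :
    stageCoord α ε δ c.val i = ε i := by
  have h1 := Fin.lt_def.1 hi
  have h2 := h.val_pos
  rw [stageCoord, if_neg (by omega), smallPart_eq (by omega)]

theorem xiOne_eq (h : IsCrossedAt α β I J c) : xiOne α β ε δ I J =
    ∑ j ∈ Jᶜ, (β j : ℝ) - ∑ i ∈ Iᶜ.erase 0, stageCoord α ε δ c.val i - δ := by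
  have hne : ∀ i ∈ Iᶜ, i ≠ c := fun i hi hic => Finset.mem_compl.1 hi (hic ▸ h.mem)
  rw [xiOne, h.crossingIndex_eq,
    ← Finset.sum_filter_add_sum_filter_not (Iᶜ.erase 0) (fun i => i < c)]
  have e1 : ∑ i ∈ Iᶜ with i ≠ 0 ∧ WithTop.some i < (c : WithTop (Fin m)), (α i : ℝ) =
      ∑ i ∈ Iᶜ.erase 0 with i < c, stageCoord α ε δ c.val i := by
    refine Finset.sum_congr ?_ fun i hi => ?_
    · ext i
      simp only [Finset.mem_filter, Finset.mem_erase, WithTop.coe_lt_coe]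
      tauto
    · exact (stageCoord_of_lt (Finset.mem_filter.1 hi).2).symm
  have e2 : ∑ i ∈ Iᶜ with i ≠ 0 ∧ (c : WithTop (Fin m)) < WithTop.some i, ε i =
      ∑ i ∈ Iᶜ.erase 0 with ¬ i < c, stageCoord α ε δ c.val i := by
    refine Finset.sum_congr ?_ fun i hi => ?_
    · ext i
      simp only [Finset.mem_filter, Finset.mem_erase, WithTop.coe_lt_coe, not_lt]
      constructor
      · rintro ⟨h1, h2, h3⟩
        exact ⟨⟨h2, h1⟩, h3.le⟩
      · rintro ⟨⟨h2, h1⟩, h3⟩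
        exact ⟨h1, h2, lt_of_le_of_ne h3 (hne i h1).symm⟩
    · obtain ⟨h1, h2⟩ := Finset.mem_filter.1 hi
      exact (h.stageCoord_of_gt (lt_of_le_of_ne (not_lt.1 h2)
        (hne i (Finset.mem_of_mem_erase h1)).symm)).symm
  rw [e1, e2]
  ring

theorem xiTwo_eq (h : IsCrossedAt α β I J c) : xiTwo α β ε δ I J =
    ∑ j ∈ J, (β j : ℝ) - ∑ i ∈ I.erase c, stageCoord α ε δ c.val i + δ := by
  rw [xiTwo, h.crossingIndex_eq,
    ← Finset.sum_filter_add_sum_filter_not (I.erase c) (fun i => i < c)]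
  have e1 : ∑ i ∈ I with WithTop.some i < (c : WithTop (Fin m)), (α i : ℝ) =
      ∑ i ∈ I.erase c with i < c, stageCoord α ε δ c.val i := by
    refine Finset.sum_congr ?_ fun i hi => ?_
    · ext i
      simp only [Finset.mem_filter, Finset.mem_erase, WithTop.coe_lt_coe]
      exact ⟨fun h => ⟨⟨h.2.ne, h.1⟩, h.2⟩, fun h => ⟨h.1.2, h.2⟩⟩
    · exact (stageCoord_of_lt (Finset.mem_filter.1 hi).2).symm
  have e2 : ∑ i ∈ I with (c : WithTop (Fin m)) < WithTop.some i, ε i =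
      ∑ i ∈ I.erase c with ¬ i < c, stageCoord α ε δ c.val i := by
    refine Finset.sum_congr ?_ fun i hi => ?_
    · ext i
      simp only [Finset.mem_filter, Finset.mem_erase, WithTop.coe_lt_coe, not_lt]
      exact ⟨fun h => ⟨⟨h.2.ne', h.1⟩, h.2.le⟩, fun h => ⟨h.1.2, lt_of_le_of_ne h.2 h.1.1.symm⟩⟩
    · obtain ⟨h1, h2⟩ := Finset.mem_filter.1 hi
      exact (h.stageCoord_of_gt (lt_of_le_of_ne (not_lt.1 h2)
        (Finset.ne_of_mem_erase h1).symm)).symm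
  rw [e1, e2]
  ring

/-- The reference points of the theorem are the two sides at the stage `c`, with the flow `δ`
instead of `0` through the cut edge; on each side one coordinate is determined by balance. -/
theorem refOne_eq (h : IsCrossedAt α β I J c) :
    refOne α β ε δ I J = sideOne β (stageCoord α ε δ c.val) I J δ := by
  rw [refOne, sideOne, h.xiOne_eq, h.crossingIndex_eq]
  congr 2
  funext i
  have hne : i.1 ≠ c := fun hic => i.2 (hic ▸ h.mem)
  by_cases hi0 : i.1 = 0
  · rw [if_pos hi0, if_pos hi0]
  · rw [if_neg hi0, if_neg hi0]
    by_cases hlt : i.1 < c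
    · rw [if_pos (WithTop.coe_lt_coe.2 hlt), stageCoord_of_lt hlt]
    · rw [if_neg fun h => hlt (WithTop.coe_lt_coe.1 h),
        h.stageCoord_of_gt (lt_of_le_of_ne (not_lt.1 hlt) hne.symm)]

theorem refTwo_eq (h : IsCrossedAt α β I J c) :
    refTwo α β ε δ I J = sideTwo β (stageCoord α ε δ c.val) c I J δ := by
  rw [refTwo, sideTwo, h.xiTwo_eq, h.crossingIndex_eq]
  congr 2
  funext i
  by_cases hlt : i.1 < c
  · rw [if_pos (WithTop.coe_lt_coe.2 hlt), if_neg hlt.ne, stageCoord_of_lt hlt]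
  · rw [if_neg fun h => hlt (WithTop.coe_lt_coe.1 h)]
    by_cases hic : i.1 = c
    · rw [if_pos hic, if_pos (by rw [hic])]
    · rw [if_neg hic, if_neg fun h => hic (WithTop.coe_inj.1 h),
        h.stageCoord_of_gt (lt_of_le_of_ne (not_lt.1 hlt) (Ne.symm hic))]

/-- It matters that `c` is excluded: the small value of the index `1` is exactly `δ`. The other
small coordinates have an index above `c`, hence at least `2`, and exceed `δ`. -/
theorem delta_lt_abs_stage (hd : PathData α β ε δ) (h : IsCrossedAt α β I J c) {A : Finset (Fin m)} {B : Finset (Fin n)}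
    (h0 : (0 : Fin m) ∉ A) (hcA : c ∉ A) (hne : A.Nonempty ∨ B.Nonempty) :
    δ < |∑ i ∈ A, stageCoord α ε δ c.val i - ∑ j ∈ B, (β j : ℝ)| := by
  refine hd.lt_abs_stage c.val h0 hne hd.delta_lt fun i hi hci => ?_
  have h1 : c.val ≠ i.val := fun h => hcA (Fin.ext h ▸ hi)
  have h2 := h.val_pos
  rw [smallPart_eq (by omega)]
  exact hd.delta_lt_eps i (by omega)

theorem sideOne_perturbation (hd : PathData α β ε δ) (h : IsCrossedAt α β I J c) (I' : Finset (WithTop {i // i ∉ I}))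
    (J' : Finset {j // j ∉ J})
    (hI' : ((⟨0, h.zero_notMem⟩ : {i // i ∉ I}) : WithTop {i // i ∉ I}) ∉ I')
    (hcard : 2 ≤ #I' + #J') :
    δ < |flow (sideOne β (stageCoord α ε δ c.val) I J 0) I' J'| ∧
      |flow (sideOne β (stageCoord α ε δ c.val) I J δ) I' J' -
        flow (sideOne β (stageCoord α ε δ c.val) I J 0) I' J'| ≤ δ := by
  rw [flow_sideOne _ h.zero_notMem _ hI', flow_sideOne _ h.zero_notMem _ hI', ite_self, add_zero,
    add_sub_cancel_left]
  refine ⟨delta_lt_abs_stage hd h ?_ ?_ ?_, ?_⟩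
  · intro h1
    obtain ⟨i, hi, h0⟩ := Finset.mem_map.1 h1
    exact hI' (by
      have : i = ⟨0, h.zero_notMem⟩ := Subtype.ext h0
      rw [← this]
      exact (Finset.mem_filter.1 hi).2)
  · intro h1
    obtain ⟨i, -, h0⟩ := Finset.mem_map.1 h1
    have h0 : i.1 = c := h0
    exact i.2 (h0 ▸ h.mem)
  · rw [Finset.map_nonempty, Finset.map_nonempty]
    rw [card_eq_card_filter_coe] at hcard
    by_contra! h1
    rw [h1.1, h1.2, Finset.card_empty, Finset.card_empty] at hcard
    split_ifs at hcard <;> omega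
  · have := hd.delta_pos
    split_ifs
    · rw [abs_of_pos this]
    · rw [abs_zero]
      exact this.le

theorem sideTwo_perturbation (hd : PathData α β ε δ) (h : IsCrossedAt α β I J c) (I' : Finset {i // i ∈ I})
    (J' : Finset (WithTop {j // j ∈ J}))
    (hI' : (⟨c, h.mem⟩ : {i // i ∈ I}) ∉ I') (hcard : 2 ≤ #I' + #J') :
    δ < |flow (sideTwo β (stageCoord α ε δ c.val) c I J 0) I' J'| ∧
      |flow (sideTwo β (stageCoord α ε δ c.val) c I J δ) I' J' -
        flow (sideTwo β (stageCoord α ε δ c.val) c I J 0) I' J'| ≤ δ := by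
  rw [flow_sideTwo _ h.mem _ hI', flow_sideTwo _ h.mem _ hI', ite_self, sub_zero,
    sub_sub_cancel_left]
  refine ⟨delta_lt_abs_stage hd h ?_ ?_ ?_, ?_⟩
  · intro h1
    obtain ⟨i, -, h0⟩ := Finset.mem_map.1 h1
    exact h.zero_notMem ((h0 : i.1 = 0) ▸ i.2)
  · intro h1
    obtain ⟨i, hi, h0⟩ := Finset.mem_map.1 h1
    exact hI' (by
      have : i = ⟨c, h.mem⟩ := Subtype.ext h0
      rwa [← this])
  · rw [Finset.map_nonempty, Finset.map_nonempty]
    rw [card_eq_card_filter_coe] at hcard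
    by_contra! h1
    rw [h1.1, h1.2, Finset.card_empty, Finset.card_empty] at hcard
    split_ifs at hcard <;> omega
  · have := hd.delta_pos
    split_ifs
    · rw [abs_neg, abs_of_pos this]
    · rw [neg_zero, abs_zero]
      exact this.le

end IsCrossedAt

end Sides

/-! ### The reference points lie in chambers. -/

section References

theorem antitone_appendLast {ι : Type*} [Preorder ι] {f : ι → ℝ} {r : ℝ} (hf : Antitone f)
    (hr : ∀ i, r ≤ f i) : Antitone (appendLast f r) := by
  intro i i' h
  induction i' with
  | top =>
    induction i with
    | top => exact le_rfl
    | coe i => exact hr i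
  | coe i' =>
    induction i with
    | top => exact absurd h (WithTop.not_top_le_coe i')
    | coe i => exact hf (WithTop.coe_le_coe.1 h)

theorem appendLast_pos {ι : Type*} {f : ι → ℝ} {r : ℝ} (hf : ∀ i, 0 < f i) (hr : 0 < r)
    (i : WithTop ι) : 0 < appendLast f r i := by
  induction i with
  | top => exact hr
  | coe i => exact hf i

variable {m n : ℕ} [NeZero m]
variable {α : Fin m → ℕ} {β : Fin n → ℕ} {ε : Fin m → ℝ} {δ : ℝ}
variable {I : Finset (Fin m)} {J : Finset (Fin n)} {c : Fin m}

namespace PathData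

theorem one_le_fst (h : PathData α β ε δ) (i : Fin m) : (1 : ℝ) ≤ α i := by
  exact_mod_cast h.fst.2 i

theorem one_le_snd (h : PathData α β ε δ) (j : Fin n) : (1 : ℝ) ≤ β j := by
  exact_mod_cast h.snd.2 j

theorem stageCoord_le (h : PathData α β ε δ) (K : ℕ) {i : Fin m} (hi : i ≠ 0) :
    stageCoord α ε δ K i ≤ α i := by
  unfold stageCoord
  split_ifs
  · exact le_rfl
  · exact ((h.smallPart_lt hi).le.trans h.inv_card_le_one).trans (h.one_le_fst i)

theorem delta_le_smallPart (h : PathData α β ε δ) {i : Fin m} (hi : i ≠ 0) :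
    δ ≤ smallPart ε δ i := by
  unfold smallPart
  split_ifs
  · exact le_rfl
  · exact (h.delta_lt_eps i (by have := val_ne_zero_of_ne hi; omega)).le

theorem delta_le_stageCoord (h : PathData α β ε δ) (K : ℕ) {i : Fin m} (hi : i ≠ 0) :
    δ ≤ stageCoord α ε δ K i := by
  unfold stageCoord
  split_ifs
  · exact h.delta_lt_one.le.trans (h.one_le_fst i)
  · exact h.delta_le_smallPart hi

theorem smallPart_anti (h : PathData α β ε δ) {i i' : Fin m} (hi : i.val ≠ 1) (hi0 : i ≠ 0)
    (hii : i < i') : smallPart ε δ i' ≤ smallPart ε δ i := by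
  have h1 := val_ne_zero_of_ne hi0
  have h2 := Fin.lt_def.1 hii
  rw [smallPart_eq (by omega), smallPart_eq (by omega)]
  exact (h.eps_anti i i' (by omega) hii).le

end PathData

namespace IsCrossedAt

/-- Two indices are exceptional: `0`, whose coordinate comes from balance, and `c`, which is
replaced by `ξ₂` on its side and may have the small value `δ`. -/
theorem stageCoord_anti (hd : PathData α β ε δ) (h : IsCrossedAt α β I J c) {i i' : Fin m}
    (hi : i ≠ 0) (hic : i ≠ c) (hii : i < i') :
    stageCoord α ε δ c.val i' ≤ stageCoord α ε δ c.val i := by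
  have h1 := Fin.lt_def.1 hii
  have h2 : i.val ≠ c.val := fun h => hic (Fin.ext h)
  have h3 := h.val_pos
  have h4 : i' ≠ 0 := by rintro rfl; simp at h1
  unfold stageCoord
  split_ifs with h5 h6 h6
  · exact_mod_cast hd.fst.1 hii.le
  · omega
  · exact ((hd.smallPart_lt h4).le.trans hd.inv_card_le_one).trans (hd.one_le_fst i)
  · exact hd.smallPart_anti (by omega) hi hii

/-- A crossing requires `α_I ≥ β_J + 1`. By balance the first coordinate on the other side gains at
least `1`, more than the `δ` it gives to the edge, so it remains the largest. -/
theorem fst_zero_lt (hd : PathData α β ε δ) (h : IsCrossedAt α β I J c) :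
    (α 0 : ℝ) < ∑ j ∈ Jᶜ, (β j : ℝ) - ∑ i ∈ Iᶜ.erase 0, stageCoord α ε δ c.val i - δ := by
  have h1 : ∑ i ∈ Iᶜ.erase 0, stageCoord α ε δ c.val i ≤ ∑ i ∈ Iᶜ.erase 0, (α i : ℝ) :=
    Finset.sum_le_sum fun i hi => hd.stageCoord_le _ (Finset.ne_of_mem_erase hi)
  have h2 : (∑ j ∈ J, (β j : ℝ)) + 1 ≤ ∑ i ∈ I, (α i : ℝ) := by exact_mod_cast h.sum_lt
  have h3 : (∑ i, (α i : ℝ)) = ∑ j, (β j : ℝ) := by exact_mod_cast hd.sum_eq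
  have h4 := Finset.sum_add_sum_compl I fun i => (α i : ℝ)
  have h5 := Finset.sum_add_sum_compl J fun j => (β j : ℝ)
  have h6 := Finset.add_sum_erase Iᶜ (fun i => (α i : ℝ)) (Finset.mem_compl.2 h.zero_notMem)
  have h7 := hd.delta_lt_one
  linarith

theorem sum_erase_stageCoord (h : IsCrossedAt α β I J c) :
    ∑ i ∈ I.erase c, stageCoord α ε δ c.val i =
      ((∑ i ∈ I with i.val < c.val, α i : ℕ) : ℝ) +
        ∑ i ∈ I.erase c with ¬ i.val < c.val, smallPart ε δ i := by
  rw [PathData.sum_stageCoord]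
  congr 3
  ext i
  simp only [Finset.mem_filter, Finset.mem_erase]
  constructor
  · rintro ⟨⟨-, h1⟩, h2⟩
    exact ⟨h1, h2⟩
  · rintro ⟨h1, h2⟩
    exact ⟨⟨by rintro rfl; exact lt_irrefl _ h2, h1⟩, h2⟩

/-- The partial sum through `c` exceeds `β_J` by at least `1`, which is more than `δ`. So `ξ₂` fits
below the coordinates before `c`. -/
theorem edge_lt (hd : PathData α β ε δ) (h : IsCrossedAt α β I J c) :
    ∑ j ∈ J, (β j : ℝ) - ∑ i ∈ I.erase c, stageCoord α ε δ c.val i + δ < α c := by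
  have hs : I.filter (fun i => i.val < c.val + 1) =
      insert c (I.filter fun i => i.val < c.val) := by
    ext i
    simp only [Finset.mem_filter, Finset.mem_insert]
    constructor
    · rintro ⟨h1, h2⟩
      rcases (Nat.lt_succ_iff.1 h2).eq_or_lt with h3 | h3
      · exact Or.inl (Fin.ext h3)
      · exact Or.inr ⟨h1, h3⟩
    · rintro (rfl | ⟨h1, h2⟩)
      · exact ⟨h.mem, Nat.lt_succ_self _⟩
      · exact ⟨h1, h2.trans (Nat.lt_succ_self _)⟩
  have h1 := h.lt
  rw [hs, Finset.sum_insert (by simp)] at h1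
  have h2 : (∑ j ∈ J, (β j : ℝ)) + 1 ≤ α c + ((∑ i ∈ I with i.val < c.val, α i : ℕ) : ℝ) := by
    exact_mod_cast h1
  have h3 : 0 ≤ ∑ i ∈ I.erase c with ¬ i.val < c.val, smallPart ε δ i :=
    Finset.sum_nonneg fun i hi => (hd.smallPart_pos fun h0 => h.zero_notMem
      (h0 ▸ Finset.mem_of_mem_erase (Finset.mem_filter.1 hi).1)).le
  have h4 := hd.delta_lt_one
  rw [h.sum_erase_stageCoord]
  linarith

/-- The partial sum before `c` is at least `1` below `β_J`, and the small coordinates together with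
`x` do not use this up. So `ξ₂` exceeds all small coordinates. -/
theorem lt_edge (hd : PathData α β ε δ) (h : IsCrossedAt α β I J c) {x : ℝ}
    (hx : x < 1 / (m : ℝ)) :
    x < ∑ j ∈ J, (β j : ℝ) - ∑ i ∈ I.erase c, stageCoord α ε δ c.val i + δ := by
  have h1 := lt_of_le_of_ne h.le (hd.sum_ne_sum (J := J)
    (fun h0 => h.zero_notMem (Finset.mem_filter.1 h0).1) (Or.inr h.nonempty))
  have h2 : ((∑ i ∈ I with i.val < c.val, α i : ℕ) : ℝ) + 1 ≤ ∑ j ∈ J, (β j : ℝ) := by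
    exact_mod_cast h1
  have h3 := hd.sum_smallPart_add_lt (I := (I.erase c).filter fun i => ¬ i.val < c.val)
    (fun h0 => h.zero_notMem (Finset.mem_of_mem_erase (Finset.mem_filter.1 h0).1)) hx
  have h4 := hd.delta_pos
  rw [h.sum_erase_stageCoord]
  linarith

theorem sideOne_fst_pos (hd : PathData α β ε δ) (h : IsCrossedAt α β I J c) (i) :
    0 < (sideOne β (stageCoord α ε δ c.val) I J δ).1 i := by
  refine appendLast_pos (fun i => ?_) hd.delta_pos i
  split_ifs with h0
  · exact (Nat.cast_nonneg _).trans_lt (fst_zero_lt hd h)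
  · exact hd.delta_pos.trans_le (hd.delta_le_stageCoord _ h0)

theorem sideOne_snd_pos (hd : PathData α β ε δ) (j) :
    0 < (sideOne β (stageCoord α ε δ c.val) I J δ).2 j :=
  one_pos.trans_le (hd.one_le_snd j.1)

theorem sideTwo_fst_pos (hd : PathData α β ε δ) (h : IsCrossedAt α β I J c) (i) :
    0 < (sideTwo β (stageCoord α ε δ c.val) c I J δ).1 i := by
  unfold sideTwo
  dsimp only
  split_ifs with h0
  · exact hd.delta_pos.trans (lt_edge hd h hd.delta_lt)
  · exact hd.delta_pos.trans_le (hd.delta_le_stageCoord _ fun h0 => h.zero_notMem (h0 ▸ i.2))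

theorem sideTwo_snd_pos (hd : PathData α β ε δ) (j) :
    0 < (sideTwo β (stageCoord α ε δ c.val) c I J δ).2 j := by
  refine appendLast_pos (fun j => ?_) hd.delta_pos j
  exact one_pos.trans_le (hd.one_le_snd j.1)

theorem sideOne_mem_regularPoints (hd : PathData α β ε δ) (h : IsCrossedAt α β I J c) :
    sideOne β (stageCoord α ε δ c.val) I J δ ∈
      regularPoints (WithTop {i // i ∉ I}) {j // j ∉ J} := by
  refine ⟨⟨antitone_appendLast (fun i i' hii => ?_) fun i => ?_, fun i => (sideOne_fst_pos hd h i).le,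
    fun j j' hjj => ?_, fun j => (sideOne_snd_pos hd j).le, sideOne_balanced _ h.zero_notMem _⟩,
    notMem_resonances_of_perturbation (sideOne_balanced _ h.zero_notMem _) _
      (sideOne_perturbation hd h)⟩
  · rcases hii.eq_or_lt with rfl | hii
    · exact le_rfl
    have hi' : i'.1 ≠ 0 := fun h0 => not_lt_of_ge (Fin.zero_le i.1) (h0 ▸ hii : i.1 < 0)
    rw [if_neg hi']
    split_ifs with h0
    · exact ((hd.stageCoord_le _ hi').trans (Nat.cast_le.2 (hd.fst.1 (Fin.zero_le i'.1)))).trans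
        (fst_zero_lt hd h).le
    · exact stageCoord_anti hd h h0 (fun hic => i.2 (hic ▸ h.mem)) hii
  · split_ifs with h0
    · exact (hd.delta_lt_one.le.trans (hd.one_le_fst 0)).trans (fst_zero_lt hd h).le
    · exact hd.delta_le_stageCoord _ h0
  · exact Nat.cast_le.2 (hd.snd.1 hjj)

theorem sideTwo_mem_regularPoints (hd : PathData α β ε δ) (h : IsCrossedAt α β I J c) :
    sideTwo β (stageCoord α ε δ c.val) c I J δ ∈
      regularPoints {i // i ∈ I} (WithTop {j // j ∈ J}) := by
  have hI0 : ∀ i : {i // i ∈ I}, i.1 ≠ 0 := fun i h0 => h.zero_notMem (h0 ▸ i.2)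
  refine ⟨⟨fun i i' hii => ?_, fun i => (sideTwo_fst_pos hd h i).le,
    antitone_appendLast (fun j j' hjj => Nat.cast_le.2 (hd.snd.1 hjj)) fun j =>
      hd.delta_lt_one.le.trans (hd.one_le_snd j.1),
    fun j => (sideTwo_snd_pos hd j).le, sideTwo_balanced _ h.mem _⟩,
    notMem_resonances_of_perturbation (sideTwo_balanced _ h.mem _) _
      (sideTwo_perturbation hd h)⟩
  rcases hii.eq_or_lt with rfl | hii
  · exact le_rfl
  have hii : i.1 < i'.1 := hii
  unfold sideTwo
  dsimp only
  split_ifs with h1 h2 h2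
  · exact absurd (h2.trans h1.symm) hii.ne
  · rw [stageCoord_of_lt (h1 ▸ hii)]
    exact (edge_lt hd h).le.trans (Nat.cast_le.2 (hd.fst.1 (h1 ▸ hii).le))
  · have h3 := h.val_pos
    have h4 := Fin.lt_def.1 (h2 ▸ hii)
    rw [stageCoord, if_neg (by omega)]
    exact (lt_edge hd h (hd.smallPart_lt (hI0 i'))).le
  · exact stageCoord_anti hd h (hI0 i) h2 hii

theorem card_sideOne (h : IsCrossedAt α β I J c) :
    Fintype.card (WithTop {i // i ∉ I}) + Fintype.card {j // j ∉ J} = m - #I + 1 + (n - #J) := by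
  rw [show Fintype.card (WithTop {i // i ∉ I}) = Fintype.card {i // i ∉ I} + 1 from
    Fintype.card_option, Fintype.card_subtype_compl, Fintype.card_subtype_compl]
  simp

theorem card_sideTwo :
    Fintype.card {i // i ∈ I} + Fintype.card (WithTop {j // j ∈ J}) = #I + (#J + 1) := by
  rw [show Fintype.card (WithTop {j // j ∈ J}) = Fintype.card {j // j ∈ J} + 1 from
    Fintype.card_option, Fintype.card_coe, Fintype.card_coe]

theorem ne_univ (hd : PathData α β ε δ) (h : IsCrossedAt α β I J c) : J ≠ univ := by
  rintro rfl
  have h1 := h.sum_lt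
  have h2 := Finset.sum_le_sum_of_subset (f := α) (Finset.subset_univ I)
  rw [hd.sum_eq] at h2
  omega

theorem card_snd_lt (hd : PathData α β ε δ) (h : IsCrossedAt α β I J c) : #J < n := by
  have := Finset.card_lt_univ_of_notMem (Finset.mem_compl.1
    ((Finset.compl_ne_univ_iff_nonempty Jᶜ).1 (by rw [compl_compl]; exact ne_univ hd h)).choose_spec)
  rwa [Fintype.card_fin] at this

theorem card_fst_lt (h : IsCrossedAt α β I J c) : #I < m := by
  have := Finset.card_lt_univ_of_notMem h.zero_notMem
  rwa [Fintype.card_fin] at this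

theorem card_fst_pos (h : IsCrossedAt α β I J c) : 0 < #I := Finset.card_pos.2 ⟨c, h.mem⟩

theorem three_le_card_sideOne (hd : PathData α β ε δ) (h : IsCrossedAt α β I J c) :
    3 ≤ Fintype.card (WithTop {i // i ∉ I}) + Fintype.card {j // j ∉ J} := by
  have h1 := card_snd_lt hd h
  have h2 := h.card_fst_lt
  rw [h.card_sideOne]
  omega

theorem three_le_card_sideTwo (h : IsCrossedAt α β I J c) :
    3 ≤ Fintype.card {i // i ∈ I} + Fintype.card (WithTop {j // j ∈ J}) := by
  have h1 := h.nonempty.card_pos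
  have h2 := h.card_fst_pos
  rw [card_sideTwo]
  omega

theorem nonempty_compl (hd : PathData α β ε δ) (h : IsCrossedAt α β I J c) :
    Nonempty {j // j ∉ J} := by
  by_contra h0
  refine ne_univ hd h (Finset.eq_univ_of_forall fun j => ?_)
  by_contra hj
  exact h0 ⟨⟨j, hj⟩⟩

theorem isChamberPolynomial_refOne (hd : PathData α β ε δ) (h : IsCrossedAt α β I J c) :
    IsChamberPolynomial (refOne α β ε δ I J) (chamberPolynomial (refOne α β ε δ I J)) := by
  have := nonempty_compl hd h
  rw [h.refOne_eq]
  exact isChamberPolynomial_chamberPolynomial (isChamberPolynomial_treePolynomial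
    (sideOne_mem_regularPoints hd h) (sideOne_fst_pos hd h) (sideOne_snd_pos hd)
    (three_le_card_sideOne hd h))

theorem isChamberPolynomial_refTwo (hd : PathData α β ε δ) (h : IsCrossedAt α β I J c) :
    IsChamberPolynomial (refTwo α β ε δ I J) (chamberPolynomial (refTwo α β ε δ I J)) := by
  have : Nonempty {i // i ∈ I} := ⟨⟨c, h.mem⟩⟩
  rw [h.refTwo_eq]
  exact isChamberPolynomial_chamberPolynomial (isChamberPolynomial_treePolynomial
    (sideTwo_mem_regularPoints hd h) (sideTwo_fst_pos hd h) (sideTwo_snd_pos hd)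
    h.three_le_card_sideTwo)

/-- The vertices of the tree not lying on the side of `I` and `J` lie here, which gives the
complementary factorial. The edge flow returns from `δ` to `0` without changing any direction. -/
theorem chamberValue_refOne (hd : PathData α β ε δ) (h : IsCrossedAt α β I J c)
    {x : WithTop {i // i ∉ I} → ℚ} {y : {j // j ∉ J} → ℚ} (hxy : ∑ i, x i = ∑ j, y j) :
    chamberValue (refOne α β ε δ I J) x y = ((m + n - 2 - (#I + #J - 1)).factorial : ℚ) *
      refTreeSum (sideOne β (stageCoord α ε δ c.val) I J 0) x y := by
  have := nonempty_compl hd h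
  have h1 := card_snd_lt hd h
  have h2 := h.card_fst_lt
  have h3 := h.card_fst_pos
  rw [h.refOne_eq, chamberValue_eq (sideOne_mem_regularPoints hd h) (sideOne_fst_pos hd h)
    (sideOne_snd_pos hd) (three_le_card_sideOne hd h) hxy, h.card_sideOne,
    refTreeSum_eq_of_perturbation (sideOne_balanced _ h.zero_notMem _)
      (sideOne_balanced _ h.zero_notMem _) _ (sideOne_perturbation hd h) hxy]
  congr 3
  omega

theorem chamberValue_refTwo (hd : PathData α β ε δ) (h : IsCrossedAt α β I J c)
    {x : {i // i ∈ I} → ℚ} {y : WithTop {j // j ∈ J} → ℚ} (hxy : ∑ i, x i = ∑ j, y j) :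
    chamberValue (refTwo α β ε δ I J) x y = ((#I + #J - 1).factorial : ℚ) *
      refTreeSum (sideTwo β (stageCoord α ε δ c.val) c I J 0) x y := by
  have : Nonempty {i // i ∈ I} := ⟨⟨c, h.mem⟩⟩
  rw [h.refTwo_eq, chamberValue_eq (sideTwo_mem_regularPoints hd h) (sideTwo_fst_pos hd h)
    (sideTwo_snd_pos hd) h.three_le_card_sideTwo hxy, card_sideTwo,
    refTreeSum_eq_of_perturbation (sideTwo_balanced _ h.mem _)
      (sideTwo_balanced _ h.mem _) _ (sideTwo_perturbation hd h) hxy]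
  congr 3

end IsCrossedAt

end References

/-! ### The crossings during one stage of the path. -/

section Stages

theorem splitSum_univ_val_map {ι κ M R : Type*} [Fintype ι] [Fintype κ] [DecidableEq ι]
    [DecidableEq κ] [AddCommMonoid R] (Φ : Multiset M → Multiset M → R) (e : ι → M) (e' : κ → M) :
    splitSum Φ (univ.val.map e + univ.val.map e') = ∑ I : Finset ι, ∑ J : Finset κ,
      Φ (I.val.map e + J.val.map e') (Iᶜ.val.map e + Jᶜ.val.map e') := by
  rw [splitSum_add, splitSum_map_val, Finset.powerset_univ]
  refine Finset.sum_congr rfl fun I _ => ?_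
  rw [splitSum_map_val, Finset.powerset_univ]
  rfl

/-- The leaves with the position and the velocity of a path of reference points. -/
theorem treeSum_posAt (t : ℝ) (S : Multiset (ℝ × ℝ × ℚ)) :
    treeSum (PosAt (AddMonoidHom.fst ℝ (ℝ × ℚ))
      ((AddMonoidHom.fst ℝ ℚ).comp (AddMonoidHom.snd ℝ (ℝ × ℚ))) t)
      ((AddMonoidHom.snd ℝ ℚ).comp (AddMonoidHom.snd ℝ (ℝ × ℚ))) S =
    treeSum (fun v : ℝ × ℚ => 0 < v.1) (AddMonoidHom.snd ℝ ℚ)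
      (S.map fun v => (v.1 + t * v.2.1, v.2.2)) := by
  set g : ℝ × ℝ × ℚ →+ ℝ × ℚ :=
    (AddMonoidHom.fst ℝ (ℝ × ℚ) + (AddMonoidHom.mulLeft t).comp
      ((AddMonoidHom.fst ℝ ℚ).comp (AddMonoidHom.snd ℝ (ℝ × ℚ)))).prod
    ((AddMonoidHom.snd ℝ ℚ).comp (AddMonoidHom.snd ℝ (ℝ × ℚ))) with hg
  exact map_treeSum _ _ (fun v : ℝ × ℚ => 0 < v.1) (AddMonoidHom.snd ℝ ℚ) g (AlgHom.id ℚ ℚ) (fun v => Iff.rfl)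
    (fun v => rfl) S

variable {m n : ℕ} [NeZero m]
variable {α : Fin m → ℕ} {β : Fin n → ℕ} {ε : Fin m → ℝ} {δ : ℝ}
variable {I : Finset (Fin m)} {J : Finset (Fin n)} {c : Fin m}

/-- The reference point on the path when the coordinates from `K` on have been made small. -/
noncomputable def stagePoint (α : Fin m → ℕ) (β : Fin n → ℕ) (ε : Fin m → ℝ) (δ : ℝ) (K : ℕ) :
    (Fin m → ℝ) × (Fin n → ℝ) :=
  (fun i => if i = 0 then ∑ j, (β j : ℝ) - ∑ i ∈ univ.erase 0, stageCoord α ε δ K i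
    else stageCoord α ε δ K i, fun j => (β j : ℝ))

theorem stagePoint_balanced (K : ℕ) :
    ∑ i, (stagePoint α β ε δ K).1 i = ∑ j, (stagePoint α β ε δ K).2 j := by
  simp only [stagePoint]
  rw [← Finset.add_sum_erase univ _ (Finset.mem_univ (0 : Fin m)), if_pos rfl,
    Finset.sum_congr rfl fun i hi => if_neg (Finset.ne_of_mem_erase hi)]
  ring

theorem flow_stagePoint (K : ℕ) (hI : (0 : Fin m) ∉ I) : flow (stagePoint α β ε δ K) I J =
    ∑ i ∈ I, stageCoord α ε δ K i - ∑ j ∈ J, (β j : ℝ) := by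
  simp only [flow, stagePoint]
  rw [Finset.sum_congr rfl fun i hi => if_neg fun h0 : i = 0 => hI (h0 ▸ hi)]

theorem stagePoint_succ_eq {i : Fin m} (h0 : i ≠ 0) (hc : i ≠ c) :
    (stagePoint α β ε δ (c.val + 1)).1 i = (stagePoint α β ε δ c.val).1 i := by
  have h1 : i.val ≠ c.val := fun h => hc (Fin.ext h)
  simp only [stagePoint, if_neg h0, stageCoord]
  split_ifs <;> first | rfl | omega

namespace PathData

theorem flow_stagePoint_ne_zero (h : PathData α β ε δ) (K : ℕ) (hne : I.Nonempty ∨ J.Nonempty)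
    (hne' : Iᶜ.Nonempty ∨ Jᶜ.Nonempty) : flow (stagePoint α β ε δ K) I J ≠ 0 := by
  by_cases h0 : (0 : Fin m) ∈ I
  · rw [← neg_ne_zero, ← flow_compl (stagePoint_balanced K),
      flow_stagePoint K (by simpa using h0)]
    exact h.stage_ne_zero K (by simpa using h0) hne'
  · rw [flow_stagePoint K h0]
    exact h.stage_ne_zero K h0 hne

theorem flow_stagePoint_le (h : PathData α β ε δ) (K : ℕ) (h0 : (0 : Fin m) ∉ I) :
    flow (stagePoint α β ε δ K) I J ≤ flow (stagePoint α β ε δ (K + 1)) I J := by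
  rw [flow_stagePoint K h0, flow_stagePoint (K + 1) h0]
  refine sub_le_sub_right (Finset.sum_le_sum fun i hi => ?_) _
  have h1 := h.stageCoord_le K (i := i) (by rintro rfl; exact h0 hi)
  unfold stageCoord at h1 ⊢
  split_ifs at h1 ⊢ <;> first | omega | exact h1 | exact le_rfl

/-- The resonances that are crossed during a stage. -/
theorem isCrossedAt_iff (h : PathData α β ε δ) : IsCrossedAt α β I J c ↔
    0 < flow (stagePoint α β ε δ (c.val + 1)) I J ∧ flow (stagePoint α β ε δ c.val) I J < 0 := by
  constructor
  · intro hc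
    rw [flow_stagePoint _ hc.zero_notMem, flow_stagePoint _ hc.zero_notMem,
      h.stage_pos_iff _ hc.zero_notMem hc.nonempty]
    refine ⟨hc.lt, lt_of_le_of_ne (not_lt.1 ?_)
      (h.stage_ne_zero _ hc.zero_notMem (Or.inr hc.nonempty))⟩
    rw [h.stage_pos_iff _ hc.zero_notMem hc.nonempty]
    exact hc.le.not_gt
  · rintro ⟨h1, h2⟩
    -- Shrinking lowers the flows of sets without the index `0`. By balance those with it do not
    -- decrease, so they cannot pass from positive to negative.
    have h0 : (0 : Fin m) ∉ I := by
      intro h0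
      have h3 := h.flow_stagePoint_le (I := Iᶜ) (J := Jᶜ) c.val (by simpa using h0)
      rw [flow_compl (stagePoint_balanced _), flow_compl (stagePoint_balanced _)] at h3
      linarith
    rw [flow_stagePoint _ h0] at h1 h2
    have hJ : J.Nonempty := by
      by_contra hJ
      rw [Finset.not_nonempty_iff_eq_empty] at hJ
      rw [hJ, Finset.sum_empty, sub_zero] at h2
      refine absurd h2 (Finset.sum_nonneg fun i hi => ?_).not_gt
      exact h.delta_pos.le.trans (h.delta_le_stageCoord _ (by rintro rfl; exact h0 hi))
    rw [h.stage_pos_iff _ h0 hJ] at h1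
    have h2 := mt (h.stage_pos_iff (J := J) c.val h0 hJ).2 (not_lt.2 h2.le)
    refine ⟨h0, hJ, crossingIndex_eq_coe_iff.2 ⟨?_, h1, not_lt.1 h2⟩⟩
    by_contra hc
    have hs : I.filter (fun i => i.val < c.val + 1) = I.filter fun i => i.val < c.val := by
      refine Finset.filter_congr fun i hi => ?_
      have : i.val ≠ c.val := fun h => hc (Fin.ext h ▸ hi)
      omega
    rw [hs] at h1
    exact h2 h1

end PathData

variable (α β ε δ) in
/-- The leaves on the path during a stage, with their positions, velocities and weights. -/
noncomputable def poleLeaf (μ : Fin m → ℕ) (K : ℕ) (i : Fin m) : ℝ × ℝ × ℚ :=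
  ((stagePoint α β ε δ (K + 1)).1 i,
    (stagePoint α β ε δ K).1 i - (stagePoint α β ε δ (K + 1)).1 i, (μ i : ℚ))

/-- The leaves that do not move on the path. -/
noncomputable def zeroLeaf (β ν : Fin n → ℕ) (j : Fin n) : ℝ × ℝ × ℚ := (-(β j : ℝ), 0, -(ν j : ℚ))

theorem sum_leaves (μ : Fin m → ℕ) (ν : Fin n → ℕ) (K : ℕ) (I : Finset (Fin m))
    (J : Finset (Fin n)) :
    (I.val.map (poleLeaf α β ε δ μ K) + J.val.map (zeroLeaf β ν)).sum =
      (flow (stagePoint α β ε δ (K + 1)) I J,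
        flow (stagePoint α β ε δ K) I J - flow (stagePoint α β ε δ (K + 1)) I J,
        gap μ ν I J) := by
  rw [Multiset.sum_add, Finset.sum_map_val, Finset.sum_map_val]
  refine Prod.ext ?_ (Prod.ext ?_ ?_)
  · simp [Prod.fst_sum, flow, poleLeaf, zeroLeaf, stagePoint, sub_eq_add_neg]
  · simp [Prod.fst_sum, Prod.snd_sum, flow, poleLeaf, zeroLeaf, stagePoint]
  · simp [Prod.snd_sum, gap, poleLeaf, zeroLeaf, sub_eq_add_neg]

theorem treeSum_leaves (μ : Fin m → ℕ) (ν : Fin n → ℕ) (K : ℕ) (t : ℝ)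
    {q : (Fin m → ℝ) × (Fin n → ℝ)}
    (h1 : ∀ i, (stagePoint α β ε δ (K + 1)).1 i +
      t * ((stagePoint α β ε δ K).1 i - (stagePoint α β ε δ (K + 1)).1 i) = q.1 i)
    (h2 : ∀ j, (β j : ℝ) = q.2 j) :
    treeSum (PosAt (AddMonoidHom.fst ℝ (ℝ × ℚ))
      ((AddMonoidHom.fst ℝ ℚ).comp (AddMonoidHom.snd ℝ (ℝ × ℚ))) t)
      ((AddMonoidHom.snd ℝ ℚ).comp (AddMonoidHom.snd ℝ (ℝ × ℚ)))
      (univ.val.map (poleLeaf α β ε δ μ K) + univ.val.map (zeroLeaf β ν)) =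
    refTreeSum q (fun i => (μ i : ℚ)) (fun j => (ν j : ℚ)) := by
  rw [treeSum_posAt, refTreeSum, refLeaves, Multiset.map_add, Multiset.map_map, Multiset.map_map]
  congr 2
  · exact Multiset.map_congr rfl fun i _ => Prod.ext (h1 i) rfl
  · exact Multiset.map_congr rfl fun j _ => Prod.ext (by simp [zeroLeaf, h2]) rfl

theorem sum_gap_appendLast (μ : Fin m → ℕ) (ν : Fin n → ℕ) (hμν : ∑ i, μ i = ∑ j, ν j) :
    (∑ i, appendLast (fun i : {i // i ∉ I} => (μ i.1 : ℚ)) (gap μ ν I J) i =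
      ∑ j : {j // j ∉ J}, (ν j.1 : ℚ)) ∧
    (∑ i : {i // i ∈ I}, (μ i.1 : ℚ) =
      ∑ j, appendLast (fun j : {j // j ∈ J} => (ν j.1 : ℚ)) (gap μ ν I J) j) := by
  have h0 : (∑ i, (μ i : ℚ)) = ∑ j, (ν j : ℚ) := by exact_mod_cast hμν
  have h1 := Finset.sum_add_sum_compl I fun i => (μ i : ℚ)
  have h2 := Finset.sum_add_sum_compl J fun j => (ν j : ℚ)
  rw [sum_univ_appendLast, sum_univ_appendLast,
    sum_univ_subtype (s := Iᶜ) (by simp) fun i => (μ i : ℚ),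
    sum_univ_subtype (s := Jᶜ) (by simp) fun j => (ν j : ℚ),
    sum_univ_subtype (s := I) (by simp) fun i => (μ i : ℚ),
    sum_univ_subtype (s := J) (by simp) fun j => (ν j : ℚ), gap]
  constructor <;> linarith

section Cut

variable {μ : Fin m → ℕ} {ν : Fin n → ℕ} {t : ℝ}

/-- At the crossing time all coordinates in `I` other than `c` have their values of the stage, and
`c` has the value that makes the flow vanish. The cut edge becomes the last negative leaf, with flow
`0` and weight `-gap`. -/
theorem cutSum_eq_sideTwo (h : IsCrossedAt α β I J c)
    (ht : flow (stagePoint α β ε δ (c.val + 1)) I J + t * (flow (stagePoint α β ε δ c.val) I J -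
      flow (stagePoint α β ε δ (c.val + 1)) I J) = 0) :
    cutSum (PosAt (AddMonoidHom.fst ℝ (ℝ × ℚ))
      ((AddMonoidHom.fst ℝ ℚ).comp (AddMonoidHom.snd ℝ (ℝ × ℚ))) t)
      ((AddMonoidHom.snd ℝ ℚ).comp (AddMonoidHom.snd ℝ (ℝ × ℚ)))
      (I.val.map (poleLeaf α β ε δ μ c.val) + J.val.map (zeroLeaf β ν)) =
    refTreeSum (sideTwo β (stageCoord α ε δ c.val) c I J 0) (fun i => (μ i.1 : ℚ))
      (appendLast (fun j => (ν j.1 : ℚ)) (gap μ ν I J)) := by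
  have hval : ∀ i ∈ I, (stagePoint α β ε δ (c.val + 1)).1 i + t * ((stagePoint α β ε δ c.val).1 i -
      (stagePoint α β ε δ (c.val + 1)).1 i) = if i = c then
        ∑ j ∈ J, (β j : ℝ) - ∑ i ∈ I.erase c, stageCoord α ε δ c.val i + 0
      else stageCoord α ε δ c.val i := by
    have hI0 : ∀ i ∈ I, i ≠ 0 := fun i hi h0 => h.zero_notMem (h0 ▸ hi)
    have hne : ∀ i ∈ I, i ≠ c → (stagePoint α β ε δ (c.val + 1)).1 i +
        t * ((stagePoint α β ε δ c.val).1 i - (stagePoint α β ε δ (c.val + 1)).1 i) =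
        stageCoord α ε δ c.val i := by
      intro i hi hic
      rw [stagePoint_succ_eq (hI0 i hi) hic, sub_self, mul_zero, add_zero]
      exact if_neg (hI0 i hi)
    intro i hi
    split_ifs with hic
    · subst hic
      have e : ∑ i' ∈ I.erase i, stageCoord α ε δ i.val i' =
          ∑ i' ∈ I.erase i, ((stagePoint α β ε δ (i.val + 1)).1 i' +
            t * ((stagePoint α β ε δ i.val).1 i' - (stagePoint α β ε δ (i.val + 1)).1 i')) :=
        Finset.sum_congr rfl fun i' hi' =>
          (hne i' (Finset.mem_of_mem_erase hi') (Finset.ne_of_mem_erase hi')).symm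
      rw [e, Finset.sum_add_distrib, ← Finset.mul_sum, Finset.sum_sub_distrib]
      simp only [flow] at ht
      rw [← Finset.add_sum_erase I (stagePoint α β ε δ (i.val + 1)).1 hi,
        ← Finset.add_sum_erase I (stagePoint α β ε δ i.val).1 hi] at ht
      simp only [stagePoint] at ht ⊢
      linarith
    · exact hne i hi hic
  rw [cutSum, sum_leaves, treeSum_posAt, refTreeSum, refLeaves, Multiset.map_cons, Multiset.map_add,
    Multiset.map_map, Multiset.map_map]
  congr 1
  rw [map_val_univ_withTop, Multiset.add_cons]
  congr 1
  · refine Prod.ext ?_ rfl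
    simp only [Prod.neg_mk, sideTwo]
    change _ = -(0 : ℝ)
    linarith
  congr 1
  · refine Eq.trans ?_ (map_val_univ_subtype (p := fun i => i ∈ I) (s := I) (fun _ => Iff.rfl) fun i =>
      ((if i = c then ∑ j ∈ J, (β j : ℝ) - ∑ i ∈ I.erase c, stageCoord α ε δ c.val i + 0 else
        stageCoord α ε δ c.val i : ℝ), (μ i : ℚ))).symm
    exact Multiset.map_congr rfl fun i hi => Prod.ext (hval i hi) rfl
  · refine Eq.trans ?_ (map_val_univ_subtype (p := fun j => j ∈ J) (s := J) (fun _ => Iff.rfl) fun j =>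
      (-(β j : ℝ), -(ν j : ℚ))).symm
    refine Multiset.map_congr rfl fun j hj => Prod.ext ?_ rfl
    simp [zeroLeaf]

/-- On the complementary side the compensating coordinate `0` is determined by balance. The cut edge
appears as a positive leaf, since the gap of the complements is the negative of the gap. -/
theorem cutSum_eq_sideOne (hμν : ∑ i, μ i = ∑ j, ν j) (h : IsCrossedAt α β I J c)
    (ht : flow (stagePoint α β ε δ (c.val + 1)) I J + t * (flow (stagePoint α β ε δ c.val) I J -
      flow (stagePoint α β ε δ (c.val + 1)) I J) = 0) :
    cutSum (PosAt (AddMonoidHom.fst ℝ (ℝ × ℚ))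
      ((AddMonoidHom.fst ℝ ℚ).comp (AddMonoidHom.snd ℝ (ℝ × ℚ))) t)
      ((AddMonoidHom.snd ℝ ℚ).comp (AddMonoidHom.snd ℝ (ℝ × ℚ)))
      (Iᶜ.val.map (poleLeaf α β ε δ μ c.val) + Jᶜ.val.map (zeroLeaf β ν)) =
    refTreeSum (sideOne β (stageCoord α ε δ c.val) I J 0)
      (appendLast (fun i => (μ i.1 : ℚ)) (gap μ ν I J)) (fun j => (ν j.1 : ℚ)) := by
  have ht' : flow (stagePoint α β ε δ (c.val + 1)) Iᶜ Jᶜ + t * (flow (stagePoint α β ε δ c.val) Iᶜ Jᶜ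
      - flow (stagePoint α β ε δ (c.val + 1)) Iᶜ Jᶜ) = 0 := by
    rw [flow_compl (stagePoint_balanced _), flow_compl (stagePoint_balanced _)]
    linarith
  have hval : ∀ i ∈ Iᶜ, (stagePoint α β ε δ (c.val + 1)).1 i + t * ((stagePoint α β ε δ c.val).1 i -
      (stagePoint α β ε δ (c.val + 1)).1 i) = if i = 0 then
        ∑ j ∈ Jᶜ, (β j : ℝ) - ∑ i ∈ Iᶜ.erase 0, stageCoord α ε δ c.val i - 0
      else stageCoord α ε δ c.val i := by
    have hne : ∀ i ∈ Iᶜ, i ≠ 0 → (stagePoint α β ε δ (c.val + 1)).1 i +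
        t * ((stagePoint α β ε δ c.val).1 i - (stagePoint α β ε δ (c.val + 1)).1 i) =
        stageCoord α ε δ c.val i := by
      intro i hi hi0
      have hic : i ≠ c := fun hic => Finset.mem_compl.1 hi (hic ▸ h.mem)
      rw [stagePoint_succ_eq hi0 hic, sub_self, mul_zero, add_zero]
      exact if_neg hi0
    intro i hi
    split_ifs with hi0
    · subst hi0
      have e : ∑ i' ∈ Iᶜ.erase 0, stageCoord α ε δ c.val i' =
          ∑ i' ∈ Iᶜ.erase 0, ((stagePoint α β ε δ (c.val + 1)).1 i' +
            t * ((stagePoint α β ε δ c.val).1 i' - (stagePoint α β ε δ (c.val + 1)).1 i')) :=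
        Finset.sum_congr rfl fun i' hi' =>
          (hne i' (Finset.mem_of_mem_erase hi') (Finset.ne_of_mem_erase hi')).symm
      rw [e, Finset.sum_add_distrib, ← Finset.mul_sum, Finset.sum_sub_distrib]
      simp only [flow] at ht'
      rw [← Finset.add_sum_erase Iᶜ (stagePoint α β ε δ (c.val + 1)).1 hi,
        ← Finset.add_sum_erase Iᶜ (stagePoint α β ε δ c.val).1 hi] at ht'
      have e1 : ∀ K, ∑ j ∈ Jᶜ, (stagePoint α β ε δ K).2 j = ∑ j ∈ Jᶜ, (β j : ℝ) := fun K => rfl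
      rw [e1, e1] at ht'
      linarith
    · exact hne i hi hi0
  have hgap : gap μ ν Iᶜ Jᶜ = -gap μ ν I J := by
    have h0 : (∑ i, (μ i : ℚ)) = ∑ j, (ν j : ℚ) := by exact_mod_cast hμν
    have h1 := Finset.sum_add_sum_compl I fun i => (μ i : ℚ)
    have h2 := Finset.sum_add_sum_compl J fun j => (ν j : ℚ)
    simp only [gap]
    linarith
  rw [cutSum, sum_leaves, treeSum_posAt, refTreeSum, refLeaves, Multiset.map_cons, Multiset.map_add,
    Multiset.map_map, Multiset.map_map]
  congr 1
  rw [map_val_univ_withTop, Multiset.cons_add]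
  congr 1
  · refine Prod.ext ?_ ?_
    · simp only [Prod.neg_mk, sideOne]
      change _ = (0 : ℝ)
      linarith
    · exact (neg_eq_iff_eq_neg.2 hgap)
  congr 1
  · refine Eq.trans ?_ (map_val_univ_subtype (p := fun i => i ∉ I) (s := Iᶜ) (fun _ => Finset.mem_compl) fun i =>
      ((if i = 0 then ∑ j ∈ Jᶜ, (β j : ℝ) - ∑ i ∈ Iᶜ.erase 0, stageCoord α ε δ c.val i - 0 else
        stageCoord α ε δ c.val i : ℝ), (μ i : ℚ))).symm
    exact Multiset.map_congr rfl fun i hi => Prod.ext (hval i hi) rfl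
  · refine Eq.trans ?_ (map_val_univ_subtype (p := fun j => j ∉ J) (s := Jᶜ) (fun _ => Finset.mem_compl) fun j =>
      (-(β j : ℝ), -(ν j : ℚ))).symm
    refine Multiset.map_congr rfl fun j hj => Prod.ext ?_ rfl
    simp [zeroLeaf]

end Cut

end Stages

/-! ### The total change along the path and its end point. -/

section PathSum

variable {m n : ℕ} [NeZero m]
variable {α : Fin m → ℕ} {β : Fin n → ℕ} {ε : Fin m → ℝ} {δ : ℝ}
variable {I : Finset (Fin m)} {J : Finset (Fin n)} {c : Fin m}
variable {μ : Fin m → ℕ} {ν : Fin n → ℕ}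

variable (α β ε δ μ ν) in
/-- The contribution of a resonance that is crossed when the coordinate with the index `c` is made
small. -/
noncomputable def resonanceTerm (c : Fin m) (I : Finset (Fin m)) (J : Finset (Fin n)) : ℚ :=
  gap μ ν I J *
    refTreeSum (sideTwo β (stageCoord α ε δ c.val) c I J 0) (fun i => (μ i.1 : ℚ))
      (appendLast (fun j => (ν j.1 : ℚ)) (gap μ ν I J)) *
    refTreeSum (sideOne β (stageCoord α ε δ c.val) I J 0)
      (appendLast (fun i => (μ i.1 : ℚ)) (gap μ ν I J)) (fun j => (ν j.1 : ℚ))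

theorem nonempty_or_of_map_ne_zero {ι κ M : Type*} {I : Finset ι} {J : Finset κ} {e : ι → M}
    {e' : κ → M} (h : I.val.map e + J.val.map e' ≠ 0) : I.Nonempty ∨ J.Nonempty := by
  by_contra! h0
  exact h (by rw [h0.1, h0.2]; rfl)

namespace PathData

open Classical in
/-- The change of the tree sum during a stage. -/
theorem refTreeSum_stagePoint_sub (h : PathData α β ε δ) (hμν : ∑ i, μ i = ∑ j, ν j) :
    refTreeSum (stagePoint α β ε δ (c.val + 1)) (fun i => (μ i : ℚ)) (fun j => (ν j : ℚ)) -
      refTreeSum (stagePoint α β ε δ c.val) (fun i => (μ i : ℚ)) (fun j => (ν j : ℚ)) =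
    ∑ I : Finset (Fin m), ∑ J : Finset (Fin n),
      if IsCrossedAt α β I J c then resonanceTerm α β ε δ μ ν c I J else 0 := by
  set a : ℝ × ℝ × ℚ →+ ℝ := AddMonoidHom.fst ℝ (ℝ × ℚ) with ha
  set b : ℝ × ℝ × ℚ →+ ℝ := (AddMonoidHom.fst ℝ ℚ).comp (AddMonoidHom.snd ℝ (ℝ × ℚ)) with hb
  set z : ℝ × ℝ × ℚ →+ ℚ := (AddMonoidHom.snd ℝ ℚ).comp (AddMonoidHom.snd ℝ (ℝ × ℚ)) with hz
  set S := univ.val.map (poleLeaf α β ε δ μ c.val) + univ.val.map (zeroLeaf β ν) with hS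
  have hsplit : ∀ A B, A + B = S → A ≠ 0 → B ≠ 0 → ∃ (I : Finset (Fin m)) (J : Finset (Fin n)),
      a A.sum = flow (stagePoint α β ε δ (c.val + 1)) I J ∧
      b A.sum = flow (stagePoint α β ε δ c.val) I J -
        flow (stagePoint α β ε δ (c.val + 1)) I J ∧
      flow (stagePoint α β ε δ (c.val + 1)) I J ≠ 0 ∧
      flow (stagePoint α β ε δ c.val) I J ≠ 0 := by
    intro A B hAB hA hB
    obtain ⟨I, J, rfl, rfl⟩ := exists_finsets_of_add_eq hAB
    have h1 := nonempty_or_of_map_ne_zero hA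
    have h2 := nonempty_or_of_map_ne_zero hB
    rw [sum_leaves]
    exact ⟨I, J, rfl, rfl, h.flow_stagePoint_ne_zero _ h1 h2, h.flow_stagePoint_ne_zero _ h1 h2⟩
  have hsum0 : S.sum = 0 := by
    rw [hS, sum_leaves]
    have h0 : ∀ K, flow (stagePoint α β ε δ K) univ univ = 0 := fun K =>
      sub_eq_zero.2 (stagePoint_balanced K)
    have h1 : gap μ ν univ univ = 0 := sub_eq_zero.2 (by exact_mod_cast hμν)
    rw [h0, h0, h1, sub_self]
    rfl
  -- During the stage only the coordinates `0` and `c` move.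
  have hcount : S.countP (fun v => b v ≠ 0) ≤ 2 := by
    rw [hS, Multiset.countP_add, Multiset.countP_map, Multiset.countP_map]
    have h1 : Multiset.card ((univ : Finset (Fin m)).val.filter
        fun i => b (poleLeaf α β ε δ μ c.val i) ≠ 0) ≤ 2 := by
      have h2 : univ.filter (fun i => b (poleLeaf α β ε δ μ c.val i) ≠ 0) ⊆ {0, c} := by
        intro i hi
        by_contra h3
        rw [Finset.mem_insert, Finset.mem_singleton, not_or] at h3
        refine (Finset.mem_filter.1 hi).2 ?_
        change (stagePoint α β ε δ c.val).1 i - (stagePoint α β ε δ (c.val + 1)).1 i = 0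
        rw [stagePoint_succ_eq h3.1 h3.2, sub_self]
      exact (Finset.card_le_card h2).trans Finset.card_le_two
    have h2 : (univ : Finset (Fin n)).val.filter (fun j => b (zeroLeaf β ν j) ≠ 0) = 0 :=
      Multiset.filter_eq_nil.2 fun j _ => not_not.2 rfl
    rw [h2, Multiset.card_zero, add_zero]
    exact h1
  have hpath := treeSum_sub_of_path (z := z) (t₀ := 0) (t₁ := 1) hsum0 hcount
    (fun A B hAB hA hB hb0 => by
      obtain ⟨I, J, h1, -, h3, -⟩ := hsplit A B hAB hA hB
      rw [h1]
      exact h3) zero_le_one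
    (by
      rintro ⟨A, B, hAB, hA, hB, h0⟩
      obtain ⟨I, J, h1, -, h3, -⟩ := hsplit A B hAB hA hB
      rw [zero_mul, add_zero, h1] at h0
      exact h3 h0)
    (by
      rintro ⟨A, B, hAB, hA, hB, h0⟩
      obtain ⟨I, J, h1, h2, -, h4⟩ := hsplit A B hAB hA hB
      rw [one_mul, h1, h2] at h0
      exact h4 (by linarith))
  rw [treeSum_leaves (q := stagePoint α β ε δ (c.val + 1)) μ ν c.val 0 (fun i => by ring)
    fun j => rfl, treeSum_leaves (q := stagePoint α β ε δ c.val) μ ν c.val 1 (fun i => by ring)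
    fun j => rfl] at hpath
  rw [hpath, hS, splitSum_univ_val_map]
  refine Finset.sum_congr rfl fun I _ => Finset.sum_congr rfl fun J _ => ?_
  have ea : a (I.val.map (poleLeaf α β ε δ μ c.val) + J.val.map (zeroLeaf β ν)).sum =
      flow (stagePoint α β ε δ (c.val + 1)) I J := by rw [sum_leaves]; rfl
  have eb : b (I.val.map (poleLeaf α β ε δ μ c.val) + J.val.map (zeroLeaf β ν)).sum =
      flow (stagePoint α β ε δ c.val) I J - flow (stagePoint α β ε δ (c.val + 1)) I J := by
    rw [sum_leaves]; rfl
  have ez : z (I.val.map (poleLeaf α β ε δ μ c.val) + J.val.map (zeroLeaf β ν)).sum =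
      gap μ ν I J := by rw [sum_leaves]; rfl
  have hiff := h.isCrossedAt_iff (I := I) (J := J) (c := c)
  rw [crossingTerm, ea, eb, zero_mul, add_zero, one_mul, add_sub_cancel]
  by_cases hc : IsCrossedAt α β I J c
  · have hflow := hiff.1 hc
    have ht := add_vanishingTime_mul (a := a) (b := b)
      (v := (I.val.map (poleLeaf α β ε δ μ c.val) + J.val.map (zeroLeaf β ν)).sum)
      (by rw [eb]; linarith)
    rw [ea, eb] at ht
    rw [if_pos hflow, if_pos hc, ez, cutSum_eq_sideTwo hc ht, cutSum_eq_sideOne hμν hc ht,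
      resonanceTerm]
  · rw [if_neg hc, if_neg (mt hiff.2 hc)]

/-- The tree sum at the end of the path. -/
theorem sum_mul_refTreeSum_stagePoint_one (h : PathData α β ε δ) (hμ : ∀ i, 0 < μ i)
    (hμν : ∑ i, μ i = ∑ j, ν j) (hn : 0 < n) (hN : 3 ≤ m + n) :
    (∑ i, (μ i : ℚ)) * refTreeSum (stagePoint α β ε δ 1) (fun i => (μ i : ℚ))
      (fun j => (ν j : ℚ)) = (∑ i, (μ i : ℚ)) ^ (m - 1) * (μ 0 : ℚ) ^ (n - 1) := by
  set e : Fin m → ℝ × ℚ := fun i => ((stagePoint α β ε δ 1).1 i, (μ i : ℚ)) with he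
  set X : Multiset (ℝ × ℚ) := (univ.erase (0 : Fin m)).val.map e with hX
  set Y : Multiset (ℝ × ℚ) := (univ : Finset (Fin n)).val.map
    fun j => (-(β j : ℝ), -(ν j : ℚ)) with hY
  have hX0 : ∀ i : Fin m, i ≠ 0 → (stagePoint α β ε δ 1).1 i = smallPart ε δ i := fun i hi => by
    simp only [stagePoint, if_neg hi]
    rw [stageCoord, if_neg (by have := val_ne_zero_of_ne hi; omega)]
  have hleaves : refLeaves (stagePoint α β ε δ 1) (fun i => (μ i : ℚ)) (fun j => (ν j : ℚ)) =
      e 0 ::ₘ (X + Y) := by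
    rw [refLeaves, ← Multiset.cons_add, hX, ← Multiset.map_cons,
      ← Finset.insert_val_of_notMem (Finset.notMem_erase 0 univ),
      Finset.insert_erase (Finset.mem_univ _)]
    rfl
  have hsumX : X.sum = (∑ i ∈ univ.erase 0, smallPart ε δ i, ∑ i ∈ univ.erase 0, (μ i : ℚ)) := by
    rw [hX, Finset.sum_map_val]
    refine Prod.ext ?_ ?_
    · rw [Prod.fst_sum]
      exact Finset.sum_congr rfl fun i hi => hX0 i (Finset.ne_of_mem_erase hi)
    · rw [Prod.snd_sum]
  have hsumμ : (μ 0 : ℚ) + ∑ i ∈ univ.erase 0, (μ i : ℚ) = ∑ i, (μ i : ℚ) :=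
    Finset.add_sum_erase univ (fun i => (μ i : ℚ)) (Finset.mem_univ _)
  -- All coordinates but the first are now small, with total below `1`, and each negative leaf is at
  -- most `-1`: the first coordinate dominates.
  have hbase : BaseLeaves (AddMonoidHom.fst ℝ ℚ) (AddMonoidHom.snd ℝ ℚ) (e 0) X Y :=
    { pos_of_mem := by
        intro x hx
        obtain ⟨i, hi, rfl⟩ := Multiset.mem_map.1 hx
        have hi : i ≠ 0 := Finset.ne_of_mem_erase (s := univ) hi
        change 0 < (stagePoint α β ε δ 1).1 i
        rw [hX0 i hi]
        exact h.smallPart_pos hi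
      neg_of_mem := by
        intro y hy
        obtain ⟨j, -, rfl⟩ := Multiset.mem_map.1 hy
        rw [hsumX]
        change -(β j : ℝ) + ∑ i ∈ univ.erase 0, smallPart ε δ i < 0
        have h1 := h.one_le_snd j
        have h2 := h.sum_smallPart_add_lt (Finset.notMem_erase 0 univ) h.delta_lt
        have h3 := h.delta_pos
        linarith
      sum_eq_zero := by
        rw [add_assoc, ← Multiset.sum_add, ← Multiset.sum_cons, ← hleaves, refLeaves,
          Multiset.sum_add, Finset.sum_map_val, Finset.sum_map_val]
        have h1 := stagePoint_balanced (α := α) (β := β) (ε := ε) (δ := δ) 1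
        have h2 : (∑ i, (μ i : ℚ)) = ∑ j, (ν j : ℚ) := by exact_mod_cast hμν
        refine Prod.ext ?_ ?_
        · simp [Prod.fst_sum, h1]
        · simp [Prod.snd_sum, h2]
      weight_pos := Nat.cast_pos.2 (hμ 0)
      weight_pos_of_mem := by
        intro x hx
        obtain ⟨i, -, rfl⟩ := Multiset.mem_map.1 hx
        exact Nat.cast_pos.2 (hμ i)
      ne_zero := by
        intro h0
        have := congrArg Multiset.card h0
        rw [hY, Multiset.card_map] at this
        simp at this
        omega }
  have hcX : Multiset.card X = m - 1 := by
    rw [hX, Multiset.card_map]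
    simp
  have hcY : Multiset.card Y = n := by
    rw [hY, Multiset.card_map]
    simp
  have := hbase.treeSum_eq (by rw [hcX, hcY]; omega)
  rw [BaseLeaves.Formula, hcX, hcY, hsumX, ← hleaves] at this
  change ((μ 0 : ℚ) + ∑ i ∈ univ.erase 0, (μ i : ℚ)) * _ =
    ((μ 0 : ℚ) + ∑ i ∈ univ.erase 0, (μ i : ℚ)) ^ (m - 1) * (μ 0 : ℚ) ^ (n - 1) at this
  rwa [hsumμ] at this

theorem stagePoint_last (h : PathData α β ε δ) : stagePoint α β ε δ m = realPoint α β := by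
  refine Prod.ext (funext fun i => ?_) rfl
  have h1 : ∀ i, stageCoord α ε δ m i = α i := fun i => if_pos i.isLt
  simp only [stagePoint, h1, realPoint]
  split_ifs with h0
  · have h2 := Finset.add_sum_erase univ (fun i => (α i : ℝ)) (Finset.mem_univ (0 : Fin m))
    have h3 : (∑ i, (α i : ℝ)) = ∑ j, (β j : ℝ) := by exact_mod_cast h.sum_eq
    rw [h0]
    linarith
  · rfl

-- The stages telescope. The last one to be carried out has `c = 1`, since the coordinate `0` is
-- never shrunk, and no resonance is crossed at `c = 0`.
open Classical in
theorem refTreeSum_realPoint (h : PathData α β ε δ) (hμν : ∑ i, μ i = ∑ j, ν j) :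
    refTreeSum (realPoint α β) (fun i => (μ i : ℚ)) (fun j => (ν j : ℚ)) =
      refTreeSum (stagePoint α β ε δ 1) (fun i => (μ i : ℚ)) (fun j => (ν j : ℚ)) +
      ∑ I : Finset (Fin m), ∑ J : Finset (Fin n), ∑ c : Fin m,
        if IsCrossedAt α β I J c then resonanceTerm α β ε δ μ ν c I J else 0 := by
  set F : ℕ → ℚ := fun K =>
    refTreeSum (stagePoint α β ε δ K) (fun i => (μ i : ℚ)) (fun j => (ν j : ℚ)) with hF
  have h1 : ∑ c : Fin m, (F (c.val + 1) - F c.val) = F m - F 0 := by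
    rw [Fin.sum_univ_eq_sum_range (fun K => F (K + 1) - F K) m, Finset.sum_range_sub]
  have h2 : ∀ c : Fin m, c ≠ 0 → F (c.val + 1) - F c.val =
      ∑ I : Finset (Fin m), ∑ J : Finset (Fin n),
        if IsCrossedAt α β I J c then resonanceTerm α β ε δ μ ν c I J else 0 := fun c _ =>
    h.refTreeSum_stagePoint_sub hμν
  have h3 : ∀ I J, ¬ IsCrossedAt α β I J 0 := fun I J h0 => h0.zero_notMem h0.mem
  have h4 : ∑ I : Finset (Fin m), ∑ J : Finset (Fin n), ∑ c : Fin m,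
      (if IsCrossedAt α β I J c then resonanceTerm α β ε δ μ ν c I J else 0) =
      ∑ c ∈ univ.erase (0 : Fin m), (F (c.val + 1) - F c.val) := by
    rw [Finset.sum_congr rfl fun c hc => h2 c (Finset.ne_of_mem_erase hc)]
    refine (Finset.sum_comm.trans (Finset.sum_congr rfl fun I _ => ?_)).symm
    refine Finset.sum_comm.trans (Finset.sum_congr rfl fun J _ => ?_)
    rw [← Finset.add_sum_erase univ _ (Finset.mem_univ (0 : Fin m)), if_neg (h3 I J), zero_add]
  rw [h4, ← h.stagePoint_last]
  rw [← Finset.add_sum_erase univ _ (Finset.mem_univ (0 : Fin m))] at h1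
  have h5 : (0 : Fin m).val = 0 := by simp
  rw [h5, zero_add] at h1
  change F m = F 1 + _
  linarith

end PathData

end PathSum

/-! ### The recurrence. -/

section MainTheorem

variable {m n : ℕ} {μ α : Fin m → ℕ} {ν β : Fin n → ℕ}

/-- Every pair of partitions lies in the closure of a chamber with an integer reference point. -/
theorem exists_isAdjacentReference [NeZero m] (hμ : IsPartitionFamily μ) (hν : IsPartitionFamily ν)
    (hμν : ∑ i, μ i = ∑ j, ν j) (hn : 0 < n) :
    ∃ (α : Fin m → ℕ) (β : Fin n → ℕ), IsAdjacentReference μ ν α β := by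
  obtain ⟨k, rfl⟩ : ∃ k, n = k + 1 := ⟨n - 1, by omega⟩
  -- Modulo `m + 1`, a sum of `α` over `I` is the size of `I`, strictly between `0` and `m` for a
  -- proper nonempty `I`, while a sum of `β` is `0` or `m`. So there is no resonance. Both totals
  -- increase by `m`, which keeps the balance.
  set α : Fin m → ℕ := fun i => (m + 1) * μ i + 1 with hα
  set β : Fin (k + 1) → ℕ := fun j => (m + 1) * ν j + if j = 0 then m else 0 with hβ
  have hsα : ∀ I : Finset (Fin m), ∑ i ∈ I, α i = (m + 1) * ∑ i ∈ I, μ i + #I := fun I => by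
    rw [hα, Finset.sum_add_distrib, Finset.mul_sum, Finset.card_eq_sum_ones]
  have hsβ : ∀ J : Finset (Fin (k + 1)), ∑ j ∈ J, β j =
      (m + 1) * ∑ j ∈ J, ν j + if 0 ∈ J then m else 0 := fun J => by
    rw [hβ, Finset.sum_add_distrib, Finset.mul_sum, Finset.sum_ite_eq']
  have hαp : IsPartitionFamily α := by
    refine ⟨fun i i' h => ?_, fun i => Nat.succ_pos _⟩
    exact Nat.succ_le_succ (Nat.mul_le_mul_left _ (hμ.1 h))
  have hβp : IsPartitionFamily β := by
    refine ⟨fun j j' h => ?_, fun j => Nat.add_pos_left (Nat.mul_pos (Nat.succ_pos _) (hν.2 j)) _⟩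
    refine Nat.add_le_add (Nat.mul_le_mul_left _ (hν.1 h)) ?_
    split_ifs with h1 h2
    · exact le_rfl
    · exact absurd (Fin.le_zero_iff.1 (h1 ▸ h)) h2
    · exact Nat.zero_le _
    · exact le_rfl
  have hsum : ∑ i, α i = ∑ j, β j := by
    rw [hsα, hsβ, hμν, if_pos (Finset.mem_univ _), Finset.card_univ, Fintype.card_fin]
  have hflow : ∀ (a : Fin m → ℕ) (b : Fin (k + 1) → ℕ) (I : Finset (Fin m))
      (J : Finset (Fin (k + 1))), flow (realPoint a b) I J =
      ((∑ i ∈ I, a i : ℕ) : ℝ) - ((∑ j ∈ J, b j : ℕ) : ℝ) := fun a b I J => by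
    simp [flow, realPoint]
  have hmem : ∀ {a : Fin m → ℕ} {b : Fin (k + 1) → ℕ}, IsPartitionFamily a → IsPartitionFamily b →
      ∑ i, a i = ∑ j, b j → realPoint a b ∈ parameterSpace (Fin m) (Fin (k + 1)) := by
    intro a b ha hb hab
    refine ⟨fun i i' h => Nat.cast_le.2 (ha.1 h), fun i => Nat.cast_nonneg _,
      fun j j' h => Nat.cast_le.2 (hb.1 h), fun j => Nat.cast_nonneg _, ?_⟩
    have : (∑ i, (a i : ℝ)) = ∑ j, (b j : ℝ) := by exact_mod_cast hab
    exact this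
  have hcard : ∀ I : Finset (Fin m), I.Nonempty → I ≠ univ → 0 < #I ∧ #I < m := fun I h h' => by
    refine ⟨h.card_pos, lt_of_le_of_ne ?_ fun h0 => h' ?_⟩
    · simpa using Finset.card_le_univ I
    · exact (Finset.card_eq_iff_eq_univ I).1 (by simpa using h0)
  have hreg : realPoint α β ∈ regularPoints (Fin m) (Fin (k + 1)) := by
    refine ⟨hmem hαp hβp hsum, ?_⟩
    rintro ⟨I, J, hI, hI', -, -, h0⟩
    obtain ⟨h1, h2⟩ := hcard I hI hI'
    have h3 := hflow α β I J
    rw [flow, h0, sub_self, eq_comm, sub_eq_zero, Nat.cast_inj, hsα, hsβ] at h3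
    have h4 := congrArg (· % (m + 1)) h3
    simp only [Nat.mul_add_mod] at h4
    rw [Nat.mod_eq_of_lt (by omega)] at h4
    split_ifs at h4
    · rw [Nat.mod_eq_of_lt (by omega)] at h4
      omega
    · rw [Nat.zero_mod] at h4
      omega
  refine ⟨α, β, hαp, hβp, hreg, mem_closure_chamber_of_flow hreg (hmem hμ hν hμν)
    fun I J hI hI' _ _ h => ?_⟩
  obtain ⟨h1, h2⟩ := hcard I hI hI'
  rw [hflow, sub_pos, Nat.cast_lt, hsα, hsβ] at h
  rw [hflow, sub_nonneg, Nat.cast_le]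
  -- A strict inequality at `(μ, ν)` becomes a difference of at least `m + 1`, more than the
  -- perturbation by the size of `I` can compensate.
  by_contra! h3
  have h4 : (m + 1) * (∑ i ∈ I, μ i + 1) ≤ (m + 1) * ∑ j ∈ J, ν j := Nat.mul_le_mul_left _ h3
  rw [mul_add] at h4
  omega

theorem IsAdjacentReference.pos_of_mem (h : IsAdjacentReference μ ν α β) :
    (∀ i, 0 < (realPoint α β).1 i) ∧ ∀ j, 0 < (realPoint α β).2 j :=
  ⟨fun i => Nat.cast_pos.2 (h.1.2 i), fun j => Nat.cast_pos.2 (h.2.1.2 j)⟩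

theorem gap_eq_flow (I : Finset (Fin m)) (J : Finset (Fin n)) :
    (gap μ ν I J : ℝ) = flow (realPoint μ ν) I J := by
  rw [flow_realPoint_eq_cast, gap]

/-- A resonance that separates the point from the base chamber is crossed on the path. -/
theorem IsAdjacentReference.exists_isCrossedAt [NeZero m] (h : IsAdjacentReference μ ν α β)
    {r : Finset (Fin m) × Finset (Fin n)} (hr : r ∈ crossedResonances μ ν) :
    ∃ c, IsCrossedAt α β r.1 r.2 c := by
  obtain ⟨h0, -, h2, -, h4⟩ := (Finset.mem_filter.1 hr).2
  have h5 : 0 < flow (realPoint μ ν) r.1 r.2 := by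
    have : (∑ j ∈ r.2, (ν j : ℝ)) < ∑ i ∈ r.1, (μ i : ℝ) := by exact_mod_cast h4
    exact sub_pos.2 this
  have h6 := (flow_pos_iff_of_mem_closure h.2.2.1 h.pos_of_mem.1 h.pos_of_mem.2 h.2.2.2 h5.ne').2 h5
  have h7 : ∑ j ∈ r.2, β j < ∑ i ∈ r.1, α i := by
    have : (∑ j ∈ r.2, (β j : ℝ)) < ∑ i ∈ r.1, (α i : ℝ) := sub_pos.1 h6
    exact_mod_cast this
  obtain ⟨c, hc⟩ := exists_crossingIndex_eq_coe h7
  exact ⟨c, h0, h2, hc⟩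

/-- The closure of the chamber allows only `μ_I ≥ ν_J` for a crossed resonance. If the inequality is
not strict, the point lies on the wall and the term vanishes with its weight. -/
theorem IsAdjacentReference.gap_eq_zero [NeZero m] (h : IsAdjacentReference μ ν α β)
    {ε : Fin m → ℝ} {δ : ℝ} (hd : PathData α β ε δ)
    {I : Finset (Fin m)} {J : Finset (Fin n)} {c : Fin m} (hc : IsCrossedAt α β I J c)
    (hr : (I, J) ∉ crossedResonances μ ν) : gap μ ν I J = 0 := by
  have h1 : 0 < flow (realPoint α β) I J := by
    have : (∑ j ∈ J, (β j : ℝ)) < ∑ i ∈ I, (α i : ℝ) := by exact_mod_cast hc.sum_lt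
    exact sub_pos.2 this
  have h2 := flow_nonneg_of_mem_closure h.2.2.1.1 h.2.2.2 h1
  rw [← gap_eq_flow] at h2
  have h2 : 0 ≤ gap μ ν I J := by exact_mod_cast h2
  refine le_antisymm (not_lt.1 fun h3 => hr ?_) h2
  refine Finset.mem_filter.2 ⟨Finset.mem_univ _, hc.zero_notMem, ⟨c, hc.mem⟩, hc.nonempty,
    hc.ne_univ hd, ?_⟩
  have : (∑ j ∈ J, (ν j : ℚ)) < ∑ i ∈ I, (μ i : ℚ) := sub_pos.1 h3
  exact_mod_cast this

theorem factorial_mul_eq {N k : ℕ} (h : k ≤ N) (g x y : ℚ) : (N.factorial : ℚ) * (g * x * y) =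
    (N.choose k : ℚ) * g * (((N - k).factorial : ℚ) * y) * ((k.factorial : ℚ) * x) := by
  have : (N.factorial : ℚ) = (N.choose k : ℚ) * k.factorial * (N - k).factorial := by
    exact_mod_cast (Nat.choose_mul_factorial_mul_factorial h).symm
  rw [this]
  ring

theorem theorem2p1 (m n d : ℕ) [NeZero m]
    (μ : Fin m → ℕ) (ν : Fin n → ℕ)
    (hμ : IsPartitionFamily μ) (hν : IsPartitionFamily ν)
    (hμd : ∑ i, μ i = d) (hνd : ∑ j, ν j = d)
    -- `0 < δ < ε_m < ⋯ < ε_3 < 1 / m`; indices start from `0` here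
    (ε : Fin m → ℝ) (δ : ℝ)
    (hδ : 0 < δ) (hδm : δ < 1 / (m : ℝ))
    (hε : ∀ i : Fin m, 2 ≤ i.val → δ < ε i ∧ ε i < 1 / (m : ℝ))
    (hεanti : ∀ i i' : Fin m, 2 ≤ i.val → i < i' → ε i' < ε i) :
    (∃ (α : Fin m → ℕ) (β : Fin n → ℕ), IsAdjacentReference μ ν α β) ∧
    ∀ (α : Fin m → ℕ) (β : Fin n → ℕ), IsAdjacentReference μ ν α β →
      (∀ r ∈ crossedResonances μ ν,
        IsChamberPolynomial (refOne α β ε δ r.1 r.2)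
          (chamberPolynomial (refOne α β ε δ r.1 r.2)) ∧
        IsChamberPolynomial (refTwo α β ε δ r.1 r.2)
          (chamberPolynomial (refTwo α β ε δ r.1 r.2))) ∧
      hurwitz μ ν =
        ((m + n - 2).factorial : ℚ) * (d : ℚ) ^ ((m : ℤ) - 2) * (μ 0 : ℚ) ^ (n - 1) +
        ∑ r ∈ crossedResonances μ ν,
          ((m + n - 2).choose (r.1.card + r.2.card - 1) : ℚ) * gap μ ν r.1 r.2 *
          chamberValue (refOne α β ε δ r.1 r.2)
            (appendLast (fun i : {i // i ∉ r.1} => (μ i.1 : ℚ)) (gap μ ν r.1 r.2))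
            (fun j : {j // j ∉ r.2} => (ν j.1 : ℚ)) *
          chamberValue (refTwo α β ε δ r.1 r.2)
            (fun i : {i // i ∈ r.1} => (μ i.1 : ℚ))
            (appendLast (fun j : {j // j ∈ r.2} => (ν j.1 : ℚ)) (gap μ ν r.1 r.2)) := by
  have hμν : ∑ i, μ i = ∑ j, ν j := hμd.trans hνd.symm
  have hm : 0 < m := NeZero.pos m
  have hdpos : 0 < d := hμd ▸ Finset.sum_pos (fun i _ => hμ.2 i) ⟨0, Finset.mem_univ _⟩
  have hn : 0 < n := by
    by_contra hn
    obtain rfl : n = 0 := by omega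
    rw [Finset.univ_eq_empty, Finset.sum_empty] at hνd
    omega
  refine ⟨exists_isAdjacentReference hμ hν hμν hn, fun α β hαβ => ?_⟩
  have hd : PathData α β ε δ :=
    ⟨hαβ.1, hαβ.2.1, hαβ.2.2.1, hδ, hδm, fun i hi => (hε i hi).1, fun i hi => (hε i hi).2, hεanti⟩
  refine ⟨fun r hr => ?_, ?_⟩
  · obtain ⟨c, hc⟩ := hαβ.exists_isCrossedAt hr
    exact ⟨hc.isChamberPolynomial_refOne hd, hc.isChamberPolynomial_refTwo hd⟩
  have : Nonempty (Fin n) := ⟨⟨0, hn⟩⟩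
  rcases Nat.lt_or_ge (m + n) 3 with hN | hN
  -- With one point over each of `0` and `∞` there is no trivalent tree; the value `1 / d` comes
  -- from the negative exponent `m - 2`.
  · obtain rfl : m = 1 := by omega
    obtain rfl : n = 1 := by omega
    have hempty : crossedResonances μ ν = ∅ := by
      refine Finset.eq_empty_of_forall_notMem fun r hr => ?_
      obtain ⟨h0, ⟨i, hi⟩, -⟩ := (Finset.mem_filter.1 hr).2
      exact h0 (Subsingleton.elim i 0 ▸ hi)
    have hd1 : μ default = d := by rw [← hμd, Fintype.sum_unique]
    rw [hurwitz_eq_inv hμ.2 hν.2 hμν, hempty, Finset.sum_empty, hd1]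
    norm_num
  classical
  have hmain := hurwitz_eq_refTreeSum hαβ.2.2.1 hαβ.pos_of_mem.1 hαβ.pos_of_mem.2
    (by simpa using hN) hμ.2 hν.2 hαβ.2.2.2
  rw [Fintype.card_fin, Fintype.card_fin, hd.refTreeSum_realPoint hμν, mul_add] at hmain
  rw [hmain]
  congr 1
  · have h1 := hd.sum_mul_refTreeSum_stagePoint_one hμ.2 hμν hn hN
    have h2 : (∑ i, (μ i : ℚ)) = d := by exact_mod_cast hμd
    have h3 : (d : ℚ) ≠ 0 := by exact_mod_cast hdpos.ne'
    rw [h2] at h1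
    rw [mul_assoc]
    congr 1
    refine mul_left_cancel₀ h3 (h1.trans ?_)
    rw [← mul_assoc, ← zpow_one_add₀ h3, ← zpow_natCast]
    congr 2
    omega
  · rw [← Finset.sum_product', Finset.univ_product_univ, Finset.mul_sum,
      ← Finset.sum_subset (Finset.subset_univ (crossedResonances μ ν))]
    · refine Finset.sum_congr rfl fun r hr => ?_
      obtain ⟨c, hc⟩ := hαβ.exists_isCrossedAt hr
      -- The crossing index is unique, so each resonance contributes in exactly one stage.
      rw [Finset.sum_eq_single c (fun c' _ hne => if_neg fun hc' => hne ?_) (by simp), if_pos hc,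
        resonanceTerm, hc.chamberValue_refOne hd (sum_gap_appendLast μ ν hμν).1,
        hc.chamberValue_refTwo hd (sum_gap_appendLast μ ν hμν).2]
      · refine factorial_mul_eq ?_ _ _ _
        have h1 := hc.card_snd_lt hd
        have h2 := hc.card_fst_lt
        omega
      · exact WithTop.coe_inj.1 (hc'.crossingIndex_eq.symm.trans hc.crossingIndex_eq)
    · intro r _ hr
      rw [Finset.sum_eq_zero, mul_zero]
      intro c _
      split_ifs with hc
      · rw [resonanceTerm, hαβ.gap_eq_zero hd hc hr, zero_mul, zero_mul]
      · rfl

end MainTheorem
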